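/- Let $n\ge 1$, $G=GL_n(\mathbb C)$, $V=\mathbb C^n$, $\mathfrak g=\mathfrak{gl}_n$; let $B=TN\subset G$ be the upper triangular subgroup, $T$ the diagonal torus, $\mathfrak b\supset\mathfrak n$ the upper and the strictly upper triangular matrices, $\chi_n:B\to\mathbb C^*$ the last diagonal entry, $T_{sc}=\mathbb C^*\times\mathbb C^*$ and $\mathrm{Ad}_g Y=gYg^{-1}$. **Spaces.** The reduced space is $\overline{\mathcal X}_2=\mathfrak b\times G\times\mathfrak n\ni(X,g,Y)$ with potential $\overline W=\mathrm{Tr}(X\,\mathrm{Ad}_gY)$; $B^2$ acts by $(b_1,b_2)\cdot(X,g,Y)=(\mathrm{Ad}_{b_1}X,b_1gb_2^{-1},\mathrm{Ad}_{b_2}Y)$ and $(\lambda,\mu)\in T_{sc}$ by $(\lambda^2X,g,\lambda^{-2}\mu^2Y)$. The non-reduced space is $\mathcal X_2=\mathfrak g\times(G\times\mathfrak n)\times(G\times\mathfrak n)\ni(X,g_1,Y_1,g_2,Y_2)$ with potential $W=\mathrm{Tr}\big(X(\mathrm{Ad}_{g_2}Y_2-\mathrm{Ad}_{g_1}Y_1)\big)$;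 $(h,b_1,b_2)\in G\times B^2$ acts by $(\mathrm{Ad}_hX,hg_1b_1^{-1},\mathrm{Ad}_{b_1}Y_1,hg_2b_2^{-1},\mathrm{Ad}_{b_2}Y_2)$ and $(\lambda,\mu)\in T_{sc}$ by $(\lambda^2X,g_1,\lambda^{-2}\mu^2Y_1,g_2,\lambda^{-2}\mu^2Y_2)$. The framed spaces are the open subsets $$\overline{\mathcal X}_{2,fr}=\{(X,g,Y,u):\ \mathbb C\langle X,\mathrm{Ad}_gY\rangle u=V,\ (g^{-1}u)_n\neq0\}\subset\overline{\mathcal X}_2\times V,$$ $$\mathcal X_{2,fr}=\{(X,g_1,Y_1,g_2,Y_2,u):\ \mathbb C\langle \mathrm{Ad}_{g_1}^{-1}X,Y_1\rangle g_1^{-1}u=V,\ (g_1^{-1}u)_n\neq0\}\subset\mathcal X_2\times V,$$ where $u\mapsto b_1u$ under $B^2$ in the reduced case, $u\mapsto hu$ under $G\times B^2$ in the non-reduced case, and $T_{sc}$ acts trivially on $u$. In both cases $\mathrm{fgt}$ is the map that forgets $u$. **Equivariant matrix factorizations.** Let $\mathfrak h=\mathfrak n\oplus\mathfrak n$, and let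 $L=T^2\times T_{sc}$ for the reduced and $L=G\times T^2\times T_{sc}$ for the non-reduced spaces. For a space $\mathcal Z$ as above with potential $F$, an object is a triple $(M,D,\partial)$: $M=\mathbb C[\mathcal Z]\otimes M_0$ with $M_0$ a finite-dimensional super vector space with compatible even actions of $\mathfrak h$ and (rationally) of $L$; $D\in\mathrm{End}_{\mathbb C[\mathcal Z]}(M)$ with $D^2=F$; $\partial\in\bigoplus_{i>j}\mathrm{Hom}_{\mathbb C[\mathcal Z]}(\Lambda^i\mathfrak h\otimes M,\Lambda^j\mathfrak h\otimes M)$; such that $D_{tot}=D+d_{ce}+\partial$ (this formula on $\Lambda^\bullet\mathfrak h\otimes M$, extended $U(\mathfrak h)$-linearly to the Chevalley–Eilenberg complex $\mathrm{CE}_{\mathfrak h}\otimes^{\Delta}M$, $\mathrm{CE}_{\mathfrak h}=U(\mathfrak h)\otimes\Lambda^\bullet\mathfrak h$) is odd, $\mathbb C[\mathcal Z]$- and $U(\mathfrak h)$-linear, $L$-equivariant of weight $\mu$ (with $\Lambda^p\mathfrak h$ twisted by $\mu^p$), and $D_{tot}^2=F$. Morphisms are the even, $\mathbb C[\mathcal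 Z]$- and $U(\mathfrak h)$-linear, $L$-equivariant maps $\mathrm{CE}_{\mathfrak h}\otimes^\Delta M\to\mathrm{CE}_{\mathfrak h}\otimes^\Delta M'$ that commute with $D_{tot}$, modulo homotopies $D'_{tot}h+hD_{tot}$ with $h$ odd and equivariant in the same sense (of weight $\mu^{-1}$). $\mathcal F\langle\xi,\tau\rangle=\mathcal F\otimes\mathbb C_\xi\otimes\mathbb C_\tau$ is the twist by characters $\xi,\tau$ of the two factors $B$, and $\mathrm{fgt}^*$ is extension of scalars. **Units.** $\overline{\mathds 1}_n$ is the push-forward of the structure sheaf (with zero differential) of $\mathfrak b\times B\times\mathfrak n$ along its inclusion into $\overline{\mathcal X}_2$, and $\mathds 1_n=\Phi(\overline{\mathds 1}_n)=j_*\pi^*\overline{\mathds 1}_n$, with $\pi(X,g_1,Y_1,g_2,Y_2)=(X,g_1^{-1}g_2,Y_2)$ and $j(X,g_1,Y_1,g_2,Y_2)=(\mathrm{Ad}_{g_1}X,g_1,Y_1,g_2,Y_2)$ on $\mathfrak b\times G\times\mathfrak n\times G\times\mathfrak n$. Explicitly, a representative of the pair $(\overline{\mathds 1}_n,\mathds 1_n)$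 consists of Koszul matrix factorizations with $M_0=\Lambda U$ and $D+\partial=\iota_s+A$. Here $\iota_s$ is the Koszul differential of a linear map $s:U\to\mathbb C[\mathcal Z]$, the actions of $\mathfrak h$ and $L$ on $U$ are those for which $s$ is equivariant (of weight $\mu$ under $L$), and $A\in\mathbb C[\mathcal Z]\otimes\Lambda(\mathfrak h^*\oplus U)$, all of whose terms contain a factor from $U$, acts by contraction with $\mathfrak h^*$ and exterior multiplication by $U$. For $\overline{\mathds 1}_n$ one takes $U=\mathfrak n$, $s(P)=\mathrm{Tr}(Pg)$; for $\mathds 1_n$ one takes $U=\mathfrak n\oplus\mathfrak n$, $s(P,Q)=\mathrm{Tr}(Pg_1^{-1}g_2)+\mathrm{Tr}(Q\,\mathrm{Ad}_{g_1}^{-1}X)$, and the correction term $A'$ for $\mathds 1_n$, restricted along $j$ and with the second summand of $U$ set to zero, must equal $\pi^*A$, where $A$ is the correction term for $\overline{\mathds 1}_n$. **Proposition.** Representatives of the pair $(\overline{\mathds 1}_n,\mathds 1_n)$ exist, and for every representative there are isomorphisms, in the homotopy categories of equivariant matrix factorizations on $\mathcal X_{2,fr}$ and on $\overline{\mathcal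 X}_{2,fr}$ respectively, $$\mathrm{fgt}^*(\mathds 1_n\langle\chi_n,0\rangle)\cong\mathrm{fgt}^*(\mathds 1_n),\qquad \mathrm{fgt}^*(\overline{\mathds 1}_n\langle\chi_n,0\rangle)\cong\mathrm{fgt}^*(\overline{\mathds 1}_n).$$ -/

import Mathlib

open scoped TensorProduct

noncomputable section

namespace EquivMF

section Exterior

variable {M : Type} [AddCommGroup M] [Module ℂ M]

/-- The derivation of the exterior algebra `Λ M` that extends a linear endomorphism `φ` of `M`. -/
def extDer (φ : M →ₗ[ℂ] M) : ExteriorAlgebra ℂ M →ₗ[ℂ] ExteriorAlgebra ℂ M :=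
  CliffordAlgebra.foldr' (0 : QuadraticForm ℂ M)
    (LinearMap.mk₂ ℂ
      (fun m (p : ExteriorAlgebra ℂ M × ExteriorAlgebra ℂ M) =>
        ExteriorAlgebra.ι ℂ (φ m) * p.1 + ExteriorAlgebra.ι ℂ m * p.2)
      (by intros; simp only [map_add, add_mul]; abel)
      (by intros; simp only [map_smul, smul_mul_assoc, smul_add])
      (by intros; simp only [Prod.fst_add, Prod.snd_add, mul_add]; abel)
      (by intros; simp only [Prod.smul_fst, Prod.smul_snd, mul_smul_comm, smul_add]))
    (by
      intro m x fx
      have h := ExteriorAlgebra.ι_add_mul_swap (R := ℂ) (φ m) m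
      have h2 := ExteriorAlgebra.ι_sq_zero (R := ℂ) m
      change ExteriorAlgebra.ι ℂ (φ m) * (ExteriorAlgebra.ι ℂ m * x) + ExteriorAlgebra.ι ℂ m *
        (ExteriorAlgebra.ι ℂ (φ m) * x + ExteriorAlgebra.ι ℂ m * fx) = (0 : ℂ) • fx
      rw [mul_add, ← mul_assoc, ← mul_assoc, ← mul_assoc, h2, ← add_assoc, ← add_mul, h]
      simp)
    0

theorem extDer_one (φ : M →ₗ[ℂ] M) : extDer φ 1 = 0 := by
  have := CliffordAlgebra.foldr'_algebraMap (0 : QuadraticForm ℂ M) (N := ExteriorAlgebra ℂ M)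
  rw [← map_one (algebraMap ℂ (ExteriorAlgebra ℂ M))]
  exact (this _ _ _ _).trans (smul_zero _)

theorem extDer_ι_mul (φ : M →ₗ[ℂ] M) (m : M) (w : ExteriorAlgebra ℂ M) :
    extDer φ (ExteriorAlgebra.ι ℂ m * w) =
      ExteriorAlgebra.ι ℂ (φ m) * w + ExteriorAlgebra.ι ℂ m * extDer φ w :=
  CliffordAlgebra.foldr'_ι_mul (0 : QuadraticForm ℂ M) _ _ _ _ _

theorem ext_induction {C : ExteriorAlgebra ℂ M → Prop} (one : C 1)
    (add : ∀ x y, C x → C y → C (x + y)) (smul : ∀ (c : ℂ) x, C x → C (c • x))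
    (ι_mul : ∀ m x, C x → C (ExteriorAlgebra.ι ℂ m * x)) (x : ExteriorAlgebra ℂ M) : C x := by
  induction x using CliffordAlgebra.left_induction with
  | algebraMap r => rw [Algebra.algebraMap_eq_smul_one]; exact smul _ _ one
  | add x y hx hy => exact add _ _ hx hy
  | ι_mul x m hx => exact ι_mul _ _ hx

theorem extDer_add (φ ψ : M →ₗ[ℂ] M) (w : ExteriorAlgebra ℂ M) :
    extDer (φ + ψ) w = extDer φ w + extDer ψ w := by
  induction w using ext_induction with
  | one => simp [extDer_one]
  | add x y hx hy => simp only [map_add, hx, hy]; abel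
  | smul c x hx => simp only [map_smul, hx, smul_add]
  | ι_mul m x hx =>
    simp only [extDer_ι_mul, hx, LinearMap.add_apply, map_add, add_mul, mul_add]; abel

theorem extDer_smul (c : ℂ) (φ : M →ₗ[ℂ] M) (w : ExteriorAlgebra ℂ M) :
    extDer (c • φ) w = c • extDer φ w := by
  induction w using ext_induction with
  | one => simp [extDer_one]
  | add x y hx hy => simp only [map_add, hx, hy, smul_add]
  | smul d x hx => simp only [map_smul, hx, smul_comm c d]
  | ι_mul m x hx =>
    simp only [extDer_ι_mul, hx, LinearMap.smul_apply, map_smul, smul_mul_assoc, mul_smul_comm,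
      smul_add]

/-- Left exterior multiplication `n ⊗ w ↦ n ⊗ (m ∧ w)` on `N ⊗ Λ M`. -/
def wedge (N : Type) [AddCommGroup N] [Module ℂ N] :
    M →ₗ[ℂ] N ⊗[ℂ] ExteriorAlgebra ℂ M →ₗ[ℂ] N ⊗[ℂ] ExteriorAlgebra ℂ M :=
  LinearMap.lTensorHom N ∘ₗ LinearMap.mul ℂ (ExteriorAlgebra ℂ M) ∘ₗ ExteriorAlgebra.ι ℂ

theorem wedge_tmul (N : Type) [AddCommGroup N] [Module ℂ N] (m : M) (n : N)
    (w : ExteriorAlgebra ℂ M) : wedge N m (n ⊗ₜ w) = n ⊗ₜ (ExteriorAlgebra.ι ℂ m * w) := rfl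

theorem wedge_wedge (N : Type) [AddCommGroup N] [Module ℂ N] (m : M)
    (y : N ⊗[ℂ] ExteriorAlgebra ℂ M) : wedge N m (wedge N m y) = 0 := by
  induction y with
  | zero => simp
  | tmul n w => rw [wedge_tmul, wedge_tmul, ← mul_assoc, ExteriorAlgebra.ι_sq_zero, zero_mul,
      TensorProduct.tmul_zero]
  | add x y hx hy => rw [map_add, map_add, hx, hy, add_zero]

/-- Contraction `ι_s : Λ M → R ⊗ Λ M` with an `R`-valued linear form `s` on `M`:
the antiderivation with `ι_s m = s m`, that is
`ι_s (m₁ ∧ … ∧ m_k) = ∑ (-1)^(i+1) s(m_i) m₁ ∧ … m̂_i … ∧ m_k`. -/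
def contract {R : Type} [CommRing R] [Algebra ℂ R] (s : M →ₗ[ℂ] R) :
    ExteriorAlgebra ℂ M →ₗ[ℂ] R ⊗[ℂ] ExteriorAlgebra ℂ M :=
  CliffordAlgebra.foldr' (0 : QuadraticForm ℂ M)
    (LinearMap.mk₂ ℂ
      (fun m (p : ExteriorAlgebra ℂ M × R ⊗[ℂ] ExteriorAlgebra ℂ M) =>
        s m ⊗ₜ p.1 - wedge R m p.2)
      (by intros; simp only [map_add, TensorProduct.add_tmul, LinearMap.add_apply]; abel)
      (by intros; simp only [map_smul, TensorProduct.smul_tmul', LinearMap.smul_apply, smul_sub])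
      (by intros; simp only [Prod.fst_add, Prod.snd_add, map_add, TensorProduct.tmul_add]; abel)
      (by
        intros
        simp only [Prod.smul_fst, Prod.smul_snd, map_smul, TensorProduct.tmul_smul, smul_sub]))
    (by
      intro m x fx
      change s m ⊗ₜ (ExteriorAlgebra.ι ℂ m * x) -
        wedge R m (s m ⊗ₜ x -
          wedge R m fx) = (0 : ℂ) • fx
      rw [map_sub, wedge_wedge, wedge_tmul]
      simp)
    0

theorem contract_one {R : Type} [CommRing R] [Algebra ℂ R] (s : M →ₗ[ℂ] R) :
    contract s 1 = 0 := by
  rw [← map_one (algebraMap ℂ (ExteriorAlgebra ℂ M))]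
  exact (CliffordAlgebra.foldr'_algebraMap (0 : QuadraticForm ℂ M) _ _ _ _).trans (smul_zero _)

theorem contract_ι_mul {R : Type} [CommRing R] [Algebra ℂ R] (s : M →ₗ[ℂ] R) (m : M)
    (w : ExteriorAlgebra ℂ M) :
    contract s (ExteriorAlgebra.ι ℂ m * w) =
      s m ⊗ₜ w - wedge R m (contract s w) :=
  CliffordAlgebra.foldr'_ι_mul (0 : QuadraticForm ℂ M) _ _ _ _ _

end Exterior

section ChevalleyEilenberg

variable (𝔥 : Type) [LieRing 𝔥] [LieAlgebra ℂ 𝔥]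

/-- The Chevalley–Eilenberg complex `U(𝔥) ⊗ Λ 𝔥` (as a vector space). -/
abbrev CE : Type := UniversalEnvelopingAlgebra ℂ 𝔥 ⊗[ℂ] ExteriorAlgebra ℂ 𝔥

variable {𝔥}

/-- The adjoint action of `x` on `Λ 𝔥`. -/
def adExt (x : 𝔥) : ExteriorAlgebra ℂ 𝔥 →ₗ[ℂ] ExteriorAlgebra ℂ 𝔥 :=
  extDer (LieAlgebra.ad ℂ 𝔥 x : 𝔥 →ₗ[ℂ] 𝔥)

/-- The Chevalley–Eilenberg differential on `1 ⊗ Λ 𝔥`: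
`d_ce (1 ⊗ x₁ ∧ … ∧ x_p) = ∑ (-1)^(i+1) x_i ⊗ x₁ ∧ … x̂_i … ∧ x_p
  + ∑_{i<j} (-1)^(i+j) 1 ⊗ [x_i, x_j] ∧ x₁ ∧ … x̂_i … x̂_j … ∧ x_p`,
defined through the equivalent recursion on `p`
`d_ce (1 ⊗ x ∧ w) = x ⊗ w - 1 ⊗ ad_x w - x ∧ d_ce (1 ⊗ w)`, `d_ce (1 ⊗ 1) = 0`. -/
def dCEOne : ExteriorAlgebra ℂ 𝔥 →ₗ[ℂ] CE 𝔥 :=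
  CliffordAlgebra.foldr' (0 : QuadraticForm ℂ 𝔥)
    (LinearMap.mk₂ ℂ
      (fun x (p : ExteriorAlgebra ℂ 𝔥 × CE 𝔥) =>
        UniversalEnvelopingAlgebra.ι ℂ x ⊗ₜ p.1 - 1 ⊗ₜ adExt x p.1 -
          wedge _ x p.2)
      (by
        intros
        simp only [map_add, TensorProduct.add_tmul, adExt, extDer_add, LinearMap.add_apply,
          TensorProduct.tmul_add]
        abel)
      (by
        intros
        simp only [map_smul, TensorProduct.smul_tmul', adExt, extDer_smul, LinearMap.smul_apply,
          smul_sub, TensorProduct.tmul_smul])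
      (by intros; simp only [Prod.fst_add, Prod.snd_add, map_add, TensorProduct.tmul_add]; abel)
      (by
        intros
        simp only [Prod.smul_fst, Prod.smul_snd, map_smul, TensorProduct.tmul_smul, smul_sub]))
    (by
      intro x w y
      change UniversalEnvelopingAlgebra.ι ℂ x ⊗ₜ (ExteriorAlgebra.ι ℂ x * w) -
        1 ⊗ₜ adExt x (ExteriorAlgebra.ι ℂ x * w) -
        wedge (UniversalEnvelopingAlgebra ℂ 𝔥) x
          (UniversalEnvelopingAlgebra.ι ℂ x ⊗ₜ w - 1 ⊗ₜ adExt x w -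
          wedge _ x y) = (0 : ℂ) • y
      rw [map_sub, map_sub, wedge_wedge, wedge_tmul, wedge_tmul]
      simp [adExt, extDer_ι_mul])
    0

theorem dCEOne_one : dCEOne (1 : ExteriorAlgebra ℂ 𝔥) = 0 := by
  rw [← map_one (algebraMap ℂ (ExteriorAlgebra ℂ 𝔥))]
  exact (CliffordAlgebra.foldr'_algebraMap (0 : QuadraticForm ℂ 𝔥) _ _ _ _).trans (smul_zero _)

theorem dCEOne_ι_mul (x : 𝔥) (w : ExteriorAlgebra ℂ 𝔥) :
    dCEOne (ExteriorAlgebra.ι ℂ x * w) =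
      UniversalEnvelopingAlgebra.ι ℂ x ⊗ₜ w - 1 ⊗ₜ adExt x w -
        wedge _ x (dCEOne w) :=
  CliffordAlgebra.foldr'_ι_mul (0 : QuadraticForm ℂ 𝔥) _ _ _ _ _

end ChevalleyEilenberg


section BaseChange

variable {R R' : Type} [CommRing R] [Algebra ℂ R] [CommRing R'] [Algebra ℂ R']
variable {C C' C'' : Type} [AddCommGroup C] [Module ℂ C] [AddCommGroup C'] [Module ℂ C']
  [AddCommGroup C''] [Module ℂ C'']

/-- `a ⊗ c` acting on `R ⊗ C`, for an algebra endomorphism `a` of `R` (semilinear over `a`). -/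
def tensorAct (a : R →ₐ[ℂ] R) (c : C →ₗ[ℂ] C) : R ⊗[ℂ] C →ₗ[ℂ] R ⊗[ℂ] C :=
  TensorProduct.map a.toLinearMap c

/-- `d ⊗ 1 + 1 ⊗ c` acting on `R ⊗ C`, for a derivation `d` of `R`. -/
def tensorDer (d : Derivation ℂ R R) (c : C →ₗ[ℂ] C) : R ⊗[ℂ] C →ₗ[ℂ] R ⊗[ℂ] C :=
  LinearMap.rTensor C (d : R →ₗ[ℂ] R) + LinearMap.lTensor R c

theorem tensorAct_smul (a : R →ₐ[ℂ] R) (c : C →ₗ[ℂ] C) (r : R) (y : R ⊗[ℂ] C) :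
    tensorAct a c (r • y) = a r • tensorAct a c y := by
  induction y with
  | zero => simp
  | tmul s w => simp [tensorAct, TensorProduct.smul_tmul']
  | add x y hx hy => simp only [smul_add, map_add, hx, hy]

theorem tensorDer_smul (d : Derivation ℂ R R) (c : C →ₗ[ℂ] C) (r : R) (y : R ⊗[ℂ] C) :
    tensorDer d c (r • y) = d r • y + r • tensorDer d c y := by
  induction y with
  | zero => simp
  | tmul s w =>
    simp only [tensorDer, TensorProduct.smul_tmul', smul_eq_mul, LinearMap.add_apply,
      LinearMap.rTensor_tmul, LinearMap.lTensor_tmul, Derivation.coeFn_coe, Derivation.leibniz,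
      TensorProduct.add_tmul, smul_add]
    rw [mul_comm s (d r)]; abel
  | add x y hx hy => simp only [smul_add, map_add, hx, hy]; abel

/-- The map `R ⊗ C → R' ⊗ C` induced by an algebra homomorphism `R → R'`. -/
def scalarMap (φ : R →ₐ[ℂ] R') (C : Type) [AddCommGroup C] [Module ℂ C] :
    R ⊗[ℂ] C →ₗ[ℂ] R' ⊗[ℂ] C :=
  LinearMap.rTensor C φ.toLinearMap

theorem scalarMap_smul (φ : R →ₐ[ℂ] R') (r : R) (y : R ⊗[ℂ] C) :
    scalarMap φ C (r • y) = φ r • scalarMap φ C y := by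
  induction y with
  | zero => simp
  | tmul s w => simp [scalarMap, TensorProduct.smul_tmul']
  | add x y hx hy => simp only [smul_add, map_add, hx, hy]

/-- Extension of scalars along `R → R'` of an `R`-linear map between free modules. -/
def extend (φ : R →ₐ[ℂ] R') (f : R ⊗[ℂ] C →ₗ[R] R ⊗[ℂ] C') : R' ⊗[ℂ] C →ₗ[R'] R' ⊗[ℂ] C' :=
  LinearMap.liftBaseChange R'
    (scalarMap φ C' ∘ₗ f.restrictScalars ℂ ∘ₗ TensorProduct.mk ℂ R C 1)

theorem extend_tmul (φ : R →ₐ[ℂ] R') (f : R ⊗[ℂ] C →ₗ[R] R ⊗[ℂ] C') (r : R') (c : C) :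
    extend φ f (r ⊗ₜ c) = r • scalarMap φ C' (f (1 ⊗ₜ c)) := by
  simp [extend]

theorem extend_scalarMap (φ : R →ₐ[ℂ] R') (f : R ⊗[ℂ] C →ₗ[R] R ⊗[ℂ] C') (y : R ⊗[ℂ] C) :
    extend φ f (scalarMap φ C y) = scalarMap φ C' (f y) := by
  induction y with
  | zero => simp
  | tmul s w =>
    have : s ⊗ₜ[ℂ] w = s • ((1 : R) ⊗ₜ[ℂ] w) := by simp [TensorProduct.smul_tmul']
    rw [this, map_smul f, scalarMap_smul, scalarMap_smul, map_smul (extend φ f)]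
    congr 1
    simp [scalarMap, extend_tmul]
  | add x y hx hy => simp only [map_add, hx, hy]

/-- Two maps on `R' ⊗ C` that obey the same semilinearity rule agree if they agree on `1 ⊗ C`. -/
theorem free_induction {P : R ⊗[ℂ] C → Prop} (one : ∀ c, P (1 ⊗ₜ c))
    (add : ∀ x y, P x → P y → P (x + y)) (smul : ∀ (r : R) x, P x → P (r • x)) (y) : P y := by
  induction y with
  | zero => have := smul 0 0; simpa using smul 0 _ (one 0)
  | tmul s w =>
    have : s ⊗ₜ[ℂ] w = s • ((1 : R) ⊗ₜ[ℂ] w) := by simp [TensorProduct.smul_tmul']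
    rw [this]; exact smul _ _ (one w)
  | add x y hx hy => exact add _ _ hx hy

theorem scalarMap_tensorAct (φ : R →ₐ[ℂ] R') (a : R →ₐ[ℂ] R) (a' : R' →ₐ[ℂ] R')
    (h : ∀ r, φ (a r) = a' (φ r)) (c : C →ₗ[ℂ] C) (y : R ⊗[ℂ] C) :
    scalarMap φ C (tensorAct a c y) = tensorAct a' c (scalarMap φ C y) := by
  induction y with
  | zero => simp
  | tmul s w => simp [scalarMap, tensorAct, h]
  | add x y hx hy => simp only [map_add, hx, hy]

theorem scalarMap_tensorDer (φ : R →ₐ[ℂ] R') (d : Derivation ℂ R R) (d' : Derivation ℂ R' R')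
    (h : ∀ r, φ (d r) = d' (φ r)) (c : C →ₗ[ℂ] C) (y : R ⊗[ℂ] C) :
    scalarMap φ C (tensorDer d c y) = tensorDer d' c (scalarMap φ C y) := by
  induction y with
  | zero => simp
  | tmul s w => simp [scalarMap, tensorDer, h]
  | add x y hx hy => simp only [map_add, hx, hy]

theorem scalarMap_lTensor (φ : R →ₐ[ℂ] R') (c : C →ₗ[ℂ] C') (y : R ⊗[ℂ] C) :
    scalarMap φ C' (c.lTensor R y) = c.lTensor R' (scalarMap φ C y) := by
  induction y with
  | zero => simp
  | tmul s w => simp [scalarMap]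
  | add x y hx hy => simp only [map_add, hx, hy]

theorem lTensor_smul' (c : C →ₗ[ℂ] C') (r : R) (y : R ⊗[ℂ] C) :
    c.lTensor R (r • y) = r • c.lTensor R y := by
  induction y with
  | zero => simp
  | tmul s w => simp [TensorProduct.smul_tmul']
  | add x y hx hy => simp only [smul_add, map_add, hx, hy]

end BaseChange

section Category

variable {𝔥 L : Type} [LieRing 𝔥] [LieAlgebra ℂ 𝔥] [Group L]

/-- Symmetry data: a Lie algebra `𝔥`, a group `L` acting on it by automorphisms, a character `κ`
of `L` (the potential will have weight `κ²`, the differentials weight `κ`), and the algebra of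
regular functions on `L`. -/
structure Symmetry (𝔥 L : Type) [LieRing 𝔥] [LieAlgebra ℂ 𝔥] [Group L] where
  Ad : L → 𝔥 →ₗ⁅ℂ⁆ 𝔥
  Ad_one : ∀ x, Ad 1 x = x
  Ad_mul : ∀ l m x, Ad (l * m) x = Ad l (Ad m x)
  κ : L →* ℂˣ
  coord : Subalgebra ℂ (L → ℂ)

/-- The coordinate ring `R = ℂ[𝒵]` of a space with an action of `𝔥` (by derivations) and of `L`
(by automorphisms), with an `𝔥`-invariant potential `W`, of weight `κ²` under `L`
(`l` acts by `(l f)(z) = f (l⁻¹ z)`). -/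
structure EqSpace (S : Symmetry 𝔥 L) where
  R : Type
  [commRing : CommRing R]
  [algebra : Algebra ℂ R]
  der : 𝔥 → Derivation ℂ R R
  der_add : ∀ x y f, der (x + y) f = der x f + der y f
  der_smul : ∀ (c : ℂ) x f, der (c • x) f = c • der x f
  der_lie : ∀ x y f, der ⁅x, y⁆ f = der x (der y f) - der y (der x f)
  act : L → R →ₐ[ℂ] R
  act_one : ∀ f, act 1 f = f
  act_mul : ∀ l m f, act (l * m) f = act l (act m f)
  act_der : ∀ l x f, act l (der x f) = der (S.Ad l x) (act l f)
  W : R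
  der_W : ∀ x, der x W = 0
  act_W : ∀ l, (S.κ l : ℂ) ^ 2 • act l W = W

attribute [instance] EqSpace.commRing EqSpace.algebra

/-- A finite-dimensional `ℤ/2`-graded representation: a super vector space (`par` is `1` on the even
and `-1` on the odd part) with compatible even actions of `𝔥` and of `L`, the latter
rational. -/
structure EqModule (S : Symmetry 𝔥 L) where
  V : Type
  [addCommGroup : AddCommGroup V]
  [module : Module ℂ V]
  [finite : Module.Finite ℂ V]
  lie : 𝔥 →ₗ[ℂ] V →ₗ[ℂ] V
  lie_lie : ∀ x y v, lie ⁅x, y⁆ v = lie x (lie y v) - lie y (lie x v)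
  act : L →* (V →ₗ[ℂ] V)
  act_lie : ∀ l x v, act l (lie x v) = lie (S.Ad l x) (act l v)
  act_coord : ∀ (f : V →ₗ[ℂ] ℂ) (v : V), (fun l => f (act l v)) ∈ S.coord
  par : V →ₗ[ℂ] V
  par_par : ∀ v, par (par v) = v
  par_lie : ∀ x v, par (lie x v) = lie x (par v)
  par_act : ∀ l v, par (act l v) = act l (par v)

attribute [instance] EqModule.addCommGroup EqModule.module EqModule.finite

variable {S : Symmetry 𝔥 L}

/-- The action of `l` on `Λ 𝔥`. It is the adjoint action, twisted by `κ l ^ p` in degree `p`,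
so that the Chevalley–Eilenberg differential has the same weight `κ` as the
differentials of matrix factorizations. -/
def Symmetry.extAct (S : Symmetry 𝔥 L) (l : L) :
    ExteriorAlgebra ℂ 𝔥 →ₗ[ℂ] ExteriorAlgebra ℂ 𝔥 :=
  (ExteriorAlgebra.map ((S.κ l : ℂ) • (S.Ad l : 𝔥 →ₗ[ℂ] 𝔥))).toLinearMap

attribute [local instance 100] LieRing.ofAssociativeRing in
/-- The action of `l` on `U(𝔥) ⊗ Λ 𝔥`. -/
def Symmetry.ceAct (S : Symmetry 𝔥 L) (l : L) : CE 𝔥 →ₗ[ℂ] CE 𝔥 :=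
  TensorProduct.map
    (UniversalEnvelopingAlgebra.lift ℂ
      ((UniversalEnvelopingAlgebra.ι ℂ).comp (S.Ad l))).toLinearMap
    (S.extAct l)

namespace EqModule

variable (V : EqModule S)

/-- The diagonal action (through `Δ`) of `x ∈ 𝔥` on `CE_𝔥 ⊗ V`:
left multiplication on `U(𝔥)` plus the given action on `V`. -/
def ceLie (x : 𝔥) : CE 𝔥 ⊗[ℂ] V.V →ₗ[ℂ] CE 𝔥 ⊗[ℂ] V.V :=
  LinearMap.rTensor V.V (LinearMap.rTensor (ExteriorAlgebra ℂ 𝔥)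
    (LinearMap.mulLeft ℂ (UniversalEnvelopingAlgebra.ι ℂ x))) + LinearMap.lTensor (CE 𝔥) (V.lie x)

/-- The action of `L` on `CE_𝔥 ⊗ V`. -/
def ceAct (l : L) : CE 𝔥 ⊗[ℂ] V.V →ₗ[ℂ] CE 𝔥 ⊗[ℂ] V.V :=
  TensorProduct.map (S.ceAct l) (V.act l)

/-- The total parity of `CE_𝔥 ⊗ V`; `Λ^p 𝔥` has parity `p`. -/
def cePar : CE 𝔥 ⊗[ℂ] V.V →ₗ[ℂ] CE 𝔥 ⊗[ℂ] V.V :=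
  TensorProduct.map (LinearMap.lTensor (UniversalEnvelopingAlgebra ℂ 𝔥)
    (CliffordAlgebra.involute (Q := (0 : QuadraticForm ℂ 𝔥))).toLinearMap) V.par

/-- `m ↦ w ⊗ m` from `M = R ⊗ V` to `Λ 𝔥 ⊗ M`, written as `R ⊗ (Λ 𝔥 ⊗ V)`. -/
def insert (Z : EqSpace S) (w : ExteriorAlgebra ℂ 𝔥) :
    Z.R ⊗[ℂ] V.V →ₗ[ℂ] Z.R ⊗[ℂ] (ExteriorAlgebra ℂ 𝔥 ⊗[ℂ] V.V) :=
  LinearMap.lTensor Z.R (TensorProduct.mk ℂ (ExteriorAlgebra ℂ 𝔥) V.V w)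

/-- The inclusion `Λ 𝔥 ⊗ M → U(𝔥) ⊗ Λ 𝔥 ⊗ M`, `y ↦ 1 ⊗ y`. -/
def incl (Z : EqSpace S) : Z.R ⊗[ℂ] (ExteriorAlgebra ℂ 𝔥 ⊗[ℂ] V.V) →ₗ[ℂ]
    Z.R ⊗[ℂ] (CE 𝔥 ⊗[ℂ] V.V) :=
  LinearMap.lTensor Z.R (LinearMap.rTensor V.V
    (TensorProduct.mk ℂ (UniversalEnvelopingAlgebra ℂ 𝔥) (ExteriorAlgebra ℂ 𝔥) 1))

/-- The submodule `⊕_{q < p} Λ^q 𝔥 ⊗ M` of `Λ 𝔥 ⊗ M`. -/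
def lower (Z : EqSpace S) (p : ℕ) :
    Submodule Z.R (Z.R ⊗[ℂ] (ExteriorAlgebra ℂ 𝔥 ⊗[ℂ] V.V)) :=
  Submodule.span Z.R {y | ∃ q < p, ∃ w ∈ ⋀[ℂ]^q 𝔥, ∃ v : V.V, y = 1 ⊗ₜ (w ⊗ₜ v)}

end EqModule

/-- `CE_𝔥 ⊗^Δ M` for the free module `M = R ⊗ V`, written as `R ⊗ (CE_𝔥 ⊗ V)`. -/
abbrev Total (Z : EqSpace S) (V : EqModule S) : Type := Z.R ⊗[ℂ] (CE 𝔥 ⊗[ℂ] V.V)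

/-- The (diagonal) action of `𝔥` on `CE_𝔥 ⊗^Δ M`. -/
def totLie (Z : EqSpace S) (V : EqModule S) (x : 𝔥) : Total Z V →ₗ[ℂ] Total Z V :=
  tensorDer (Z.der x) (V.ceLie x)

/-- The action of `L` on `CE_𝔥 ⊗^Δ M`. -/
def totAct (Z : EqSpace S) (V : EqModule S) (l : L) : Total Z V →ₗ[ℂ] Total Z V :=
  tensorAct (Z.act l) (V.ceAct l)

/-- The parity operator of `CE_𝔥 ⊗^Δ M`. -/
def totPar (Z : EqSpace S) (V : EqModule S) : Total Z V →ₗ[ℂ] Total Z V :=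
  LinearMap.lTensor Z.R V.cePar

/-- Equivariant matrix factorizations `(M, D, ∂)` of the potential of `Z`, with `M = R ⊗ V`:
`D` is an endomorphism of `M`, `∂` maps `Λ^p 𝔥 ⊗ M` to `⊕_{q < p} Λ^q 𝔥 ⊗ M`, and
`D_tot = D + d_ce + ∂` is an endomorphism of `CE_𝔥 ⊗^Δ M` that is odd, commutes with the
action of `U(𝔥)`, is `L`-equivariant (of weight `κ`) and squares to the potential. As `D`, `∂` need
not commute with `𝔥`, the formula `D_tot = D + d_ce + ∂` is imposed on `1 ⊗ Λ 𝔥 ⊗ M`, which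
generates `CE_𝔥 ⊗^Δ M` over `U(𝔥)`; on `Λ^p 𝔥 ⊗ M` the operator `D` acts with the usual sign
`(-1)^p`. -/
structure MF (Z : EqSpace S) where
  V : EqModule S
  D : Z.R ⊗[ℂ] V.V →ₗ[Z.R] Z.R ⊗[ℂ] V.V
  D_sq : ∀ y, D (D y) = Z.W • y
  del : Z.R ⊗[ℂ] (ExteriorAlgebra ℂ 𝔥 ⊗[ℂ] V.V) →ₗ[Z.R]
    Z.R ⊗[ℂ] (ExteriorAlgebra ℂ 𝔥 ⊗[ℂ] V.V)
  del_lower : ∀ (p : ℕ), ∀ w ∈ ⋀[ℂ]^p 𝔥, ∀ v, del (1 ⊗ₜ (w ⊗ₜ v)) ∈ V.lower Z p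
  Dtot : Total Z V →ₗ[Z.R] Total Z V
  Dtot_one : ∀ w v, Dtot (1 ⊗ₜ ((1 ⊗ₜ w) ⊗ₜ v)) =
    1 ⊗ₜ (dCEOne w ⊗ₜ v) + V.incl Z (V.insert Z
      (CliffordAlgebra.involute (Q := (0 : QuadraticForm ℂ 𝔥)) w) (D (1 ⊗ₜ v)) +
        del (1 ⊗ₜ (w ⊗ₜ v)))
  Dtot_lie : ∀ x y, Dtot (totLie Z V x y) = totLie Z V x (Dtot y)
  Dtot_par : ∀ y, Dtot (totPar Z V y) = - totPar Z V (Dtot y)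
  Dtot_act : ∀ l y, Dtot (totAct Z V l y) = (S.κ l : ℂ) • totAct Z V l (Dtot y)
  Dtot_sq : ∀ y, Dtot (Dtot y) = Z.W • y

/-- Morphisms of equivariant matrix factorizations (before passing to homotopy classes):
even, `R`-linear, `U(𝔥)`-linear and `L`-equivariant chain maps `CE_𝔥 ⊗^Δ M → CE_𝔥 ⊗^Δ M'`. -/
structure MF.Hom {Z : EqSpace S} (E F : MF Z) where
  f : Total Z E.V →ₗ[Z.R] Total Z F.V
  lie : ∀ x y, f (totLie Z E.V x y) = totLie Z F.V x (f y)
  par : ∀ y, f (totPar Z E.V y) = totPar Z F.V (f y)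
  act : ∀ l y, f (totAct Z E.V l y) = totAct Z F.V l (f y)
  comm : ∀ y, f (E.Dtot y) = F.Dtot (f y)

/-- Homotopy of morphisms: `f - g = D'_tot h + h D_tot` for an odd, `R`-linear, `U(𝔥)`-linear and
`L`-equivariant (of weight `κ⁻¹`) map `h`. -/
def MF.Hom.Homotopic {Z : EqSpace S} {E F : MF Z} (f g : MF.Hom E F) : Prop :=
  ∃ h : Total Z E.V →ₗ[Z.R] Total Z F.V,
    (∀ x y, h (totLie Z E.V x y) = totLie Z F.V x (h y)) ∧
    (∀ y, h (totPar Z E.V y) = - totPar Z F.V (h y)) ∧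
    (∀ l y, (S.κ l : ℂ) • h (totAct Z E.V l y) = totAct Z F.V l (h y)) ∧
    ∀ y, f.f y - g.f y = F.Dtot (h y) + h (E.Dtot y)

/-- The identity morphism. -/
def MF.Hom.id {Z : EqSpace S} (E : MF Z) : MF.Hom E E where
  f := LinearMap.id
  lie _ _ := rfl
  par _ := rfl
  act _ _ := rfl
  comm _ := rfl

/-- Composition of morphisms. -/
def MF.Hom.comp {Z : EqSpace S} {E F G : MF Z} (g : MF.Hom F G) (f : MF.Hom E F) :
    MF.Hom E G where
  f := g.f ∘ₗ f.f
  lie x y := by simp [f.lie, g.lie]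
  par y := by simp [f.par, g.par]
  act l y := by simp [f.act, g.act]
  comm y := by simp [f.comm, g.comm]

/-- Two equivariant matrix factorizations are isomorphic in the homotopy category. -/
def MF.Isomorphic {Z : EqSpace S} (E F : MF Z) : Prop :=
  ∃ (f : MF.Hom E F) (g : MF.Hom F E),
    (g.comp f).Homotopic (MF.Hom.id E) ∧ (f.comp g).Homotopic (MF.Hom.id F)

/-- The twist `V ⊗ ℂ_χ` of a representation by a character `χ` of `L` (trivial on `𝔥`). -/
def EqModule.twist (V : EqModule S) (χ : L →* ℂˣ) (hχ : (fun l => (χ l : ℂ)) ∈ S.coord) :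
    EqModule S where
  V := V.V
  lie := V.lie
  lie_lie := V.lie_lie
  act :=
    { toFun := fun l => (χ l : ℂ) • V.act l
      map_one' := by simp
      map_mul' := by
        intro l m
        ext v
        simp [smul_smul, mul_comm (χ m : ℂ)] }
  act_lie := by
    intro l x v
    simp [V.act_lie]
  act_coord := by
    intro f v
    have := S.coord.mul_mem hχ (V.act_coord f v)
    convert this using 1
    ext l
    simp
  par := V.par
  par_par := V.par_par
  par_lie := V.par_lie
  par_act := by
    intro l v
    simp [V.par_act]

/-- The twisted matrix factorization `E ⊗ ℂ_χ`. -/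
def MF.twist {Z : EqSpace S} (E : MF Z) (χ : L →* ℂˣ) (hχ : (fun l => (χ l : ℂ)) ∈ S.coord) :
    MF Z where
  V := E.V.twist χ hχ
  D := E.D
  D_sq := E.D_sq
  del := E.del
  del_lower := E.del_lower
  Dtot := E.Dtot
  Dtot_one := E.Dtot_one
  Dtot_lie := E.Dtot_lie
  Dtot_par := E.Dtot_par
  Dtot_act := by
    intro l y
    have h : ∀ y, totAct Z (E.V.twist χ hχ) l y = (χ l : ℂ) • totAct Z E.V l y := by
      intro y
      have : totAct Z (E.V.twist χ hχ) l = (χ l : ℂ) • totAct Z E.V l := by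
        simp only [totAct, tensorAct, EqModule.ceAct]
        change TensorProduct.map _ (TensorProduct.map _ ((χ l : ℂ) • E.V.act l)) = _
        rw [TensorProduct.map_smul_right, TensorProduct.map_smul_right]
      rw [this]; rfl
    rw [h, h]
    refine (LinearMap.map_smul_of_tower E.Dtot (χ l : ℂ) (totAct Z E.V l y)).trans ?_
    exact (congrArg (fun t => (χ l : ℂ) • t) (E.Dtot_act l y)).trans (smul_comm _ _ _)
  Dtot_sq := E.Dtot_sq

/-- An equivariant map of spaces `𝒵' → 𝒵` compatible with the potentials, given by the pull-back of
functions. -/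
structure EqSpace.Hom (Z Z' : EqSpace S) where
  φ : Z.R →ₐ[ℂ] Z'.R
  der : ∀ x f, φ (Z.der x f) = Z'.der x (φ f)
  act : ∀ l f, φ (Z.act l f) = Z'.act l (φ f)
  W : φ Z.W = Z'.W

/-- The pull-back of an equivariant matrix factorization `(M, D, ∂)`: extension of scalars of
`M = R ⊗ V`, `D`, `∂` and `D_tot` along `R → R'`. -/
def MF.pullback {Z Z' : EqSpace S} (h : EqSpace.Hom Z Z') (E : MF Z) : MF Z' where
  V := E.V
  D := extend h.φ E.D
  D_sq := by
    intro y
    induction y using free_induction with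
    | one c =>
      rw [extend_tmul, one_smul, extend_scalarMap, E.D_sq, scalarMap_smul, h.W]
      simp [scalarMap]
    | add x y hx hy => simp only [map_add, hx, hy, smul_add]
    | smul r y hy => simp only [map_smul, hy, smul_comm r]
  del := extend h.φ E.del
  del_lower := by
    intro p w hw v
    rw [extend_tmul, one_smul]
    have := E.del_lower p w hw v
    revert this
    generalize E.del (1 ⊗ₜ (w ⊗ₜ v)) = y
    intro hy
    induction hy using Submodule.span_induction with
    | mem y hy =>
      obtain ⟨q, hq, w, hw, v, rfl⟩ := hy
      exact Submodule.subset_span ⟨q, hq, w, hw, v, by simp [scalarMap]⟩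
    | zero => simp
    | add x y _ _ hx hy => rw [map_add]; exact Submodule.add_mem _ hx hy
    | smul r x _ hx => rw [scalarMap_smul]; exact Submodule.smul_mem _ _ hx
  Dtot := extend h.φ E.Dtot
  Dtot_one := by
    intro w v
    rw [extend_tmul, one_smul, E.Dtot_one, extend_tmul, one_smul, extend_tmul, one_smul]
    simp only [map_add, EqModule.incl, EqModule.insert, scalarMap_lTensor]
    simp [scalarMap]
  Dtot_lie := by
    intro x y
    induction y using free_induction with
    | one c =>
      have h1 : ((1 : Z'.R) ⊗ₜ[ℂ] c) = scalarMap h.φ _ ((1 : Z.R) ⊗ₜ[ℂ] c) := by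
        simp [scalarMap]
      have h2 := scalarMap_tensorDer h.φ (Z.der x) (Z'.der x) (h.der x) (E.V.ceLie x)
      rw [h1]
      simp only [totLie]
      rw [← h2, extend_scalarMap, extend_scalarMap, ← h2]
      congr 1
      exact E.Dtot_lie x _
    | add x y hx hy => simp only [map_add, hx, hy]
    | smul r y hy =>
      simp only [totLie] at hy ⊢
      rw [tensorDer_smul, map_add, map_smul, map_smul, map_smul, tensorDer_smul, hy]
  Dtot_par := by
    intro y
    induction y using free_induction with
    | one c =>
      have h1 : ((1 : Z'.R) ⊗ₜ[ℂ] c) = scalarMap h.φ _ ((1 : Z.R) ⊗ₜ[ℂ] c) := by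
        simp [scalarMap]
      rw [h1]
      simp only [totPar]
      rw [← scalarMap_lTensor, extend_scalarMap, extend_scalarMap, ← scalarMap_lTensor, ← map_neg]
      congr 1
      exact E.Dtot_par _
    | add x y hx hy => simp only [map_add, hx, hy, neg_add]
    | smul r y hy =>
      simp only [totPar] at hy ⊢
      rw [lTensor_smul', map_smul, map_smul, lTensor_smul', hy, smul_neg]
  Dtot_act := by
    intro l y
    induction y using free_induction with
    | one c =>
      have h1 : ((1 : Z'.R) ⊗ₜ[ℂ] c) = scalarMap h.φ _ ((1 : Z.R) ⊗ₜ[ℂ] c) := by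
        simp [scalarMap]
      have h2 := scalarMap_tensorAct h.φ (Z.act l) (Z'.act l) (h.act l) (E.V.ceAct l)
      rw [h1]
      simp only [totAct]
      rw [← h2, extend_scalarMap, extend_scalarMap, ← h2, ← map_smul]
      congr 1
      exact E.Dtot_act l _
    | add x y hx hy => simp only [map_add, hx, hy, smul_add]
    | smul r y hy =>
      simp only [totAct] at hy ⊢
      rw [tensorAct_smul, map_smul, map_smul, tensorAct_smul, hy, smul_comm]
  Dtot_sq := by
    intro y
    induction y using free_induction with
    | one c =>
      rw [extend_tmul, one_smul, extend_scalarMap, E.Dtot_sq, scalarMap_smul, h.W]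
      simp [scalarMap]
    | add x y hx hy => simp only [map_add, hx, hy, smul_add]
    | smul r y hy => simp only [map_smul, hy, smul_comm r]

/-- The operators by which `Λ(𝔥* ⊕ U)` acts on `Λ 𝔥 ⊗ Λ U`: a form `α ∈ 𝔥*` acts by contraction of
`Λ 𝔥`, an element `θ ∈ U` by `w ⊗ m ↦ (-1)^p w ⊗ (θ ∧ m)` for `w ∈ Λ^p 𝔥`. -/
def koszulGen (𝔥 U : Type) [AddCommGroup 𝔥] [Module ℂ 𝔥] [AddCommGroup U] [Module ℂ U] :
    Module.Dual ℂ 𝔥 × U →ₗ[ℂ] Module.End ℂ (ExteriorAlgebra ℂ 𝔥 ⊗[ℂ] ExteriorAlgebra ℂ U) :=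
  LinearMap.coprod
    (LinearMap.rTensorHom (ExteriorAlgebra ℂ U) ∘ₗ
      CliffordAlgebra.contractLeft (Q := (0 : QuadraticForm ℂ 𝔥)))
    (LinearMap.mulLeft ℂ (LinearMap.rTensor (ExteriorAlgebra ℂ U)
        (CliffordAlgebra.involute (Q := (0 : QuadraticForm ℂ 𝔥))).toLinearMap :
          Module.End ℂ (ExteriorAlgebra ℂ 𝔥 ⊗[ℂ] ExteriorAlgebra ℂ U)) ∘ₗ
      LinearMap.lTensorHom (ExteriorAlgebra ℂ 𝔥) ∘ₗ
      LinearMap.mul ℂ (ExteriorAlgebra ℂ U) ∘ₗ ExteriorAlgebra.ι ℂ)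

theorem koszulGen_tmul (𝔥 U : Type) [AddCommGroup 𝔥] [Module ℂ 𝔥] [AddCommGroup U] [Module ℂ U]
    (α : Module.Dual ℂ 𝔥) (θ : U) (w : ExteriorAlgebra ℂ 𝔥) (m : ExteriorAlgebra ℂ U) :
    koszulGen 𝔥 U (α, θ) (w ⊗ₜ m) =
      CliffordAlgebra.contractLeft (Q := (0 : QuadraticForm ℂ 𝔥)) α w ⊗ₜ m +
      CliffordAlgebra.involute (Q := (0 : QuadraticForm ℂ 𝔥)) w ⊗ₜ (ExteriorAlgebra.ι ℂ θ * m) :=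
  rfl

theorem involute_contractLeft {M : Type} [AddCommGroup M] [Module ℂ M]
    (α : Module.Dual ℂ M) (w : ExteriorAlgebra ℂ M) :
    CliffordAlgebra.contractLeft (Q := (0 : QuadraticForm ℂ M)) α
      (CliffordAlgebra.involute (Q := (0 : QuadraticForm ℂ M)) w) +
    CliffordAlgebra.involute (Q := (0 : QuadraticForm ℂ M))
      (CliffordAlgebra.contractLeft (Q := (0 : QuadraticForm ℂ M)) α w) = 0 := by
  induction w using CliffordAlgebra.left_induction with
  | algebraMap r => simp
  | add x y hx hy =>
    simp only [map_add]
    rw [add_add_add_comm, hx, hy, add_zero]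
  | ι_mul w m hw =>
    rw [map_mul, CliffordAlgebra.involute_ι, neg_mul, map_neg, CliffordAlgebra.contractLeft_ι_mul,
      CliffordAlgebra.contractLeft_ι_mul, map_sub, map_mul, CliffordAlgebra.involute_ι,
      eq_neg_of_add_eq_zero_left hw]
    simp

/-- The action of `Λ(𝔥* ⊕ U)` on `Λ 𝔥 ⊗ Λ U`. -/
def koszulRep (𝔥 U : Type) [AddCommGroup 𝔥] [Module ℂ 𝔥] [AddCommGroup U] [Module ℂ U] :
    ExteriorAlgebra ℂ (Module.Dual ℂ 𝔥 × U) →ₐ[ℂ]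
      Module.End ℂ (ExteriorAlgebra ℂ 𝔥 ⊗[ℂ] ExteriorAlgebra ℂ U) :=
  ExteriorAlgebra.lift ℂ ⟨koszulGen 𝔥 U, by
    rintro ⟨α, θ⟩
    refine TensorProduct.ext' fun w m => ?_
    change koszulGen 𝔥 U (α, θ) (koszulGen 𝔥 U (α, θ) (w ⊗ₜ m)) = 0
    rw [koszulGen_tmul, map_add, koszulGen_tmul, koszulGen_tmul,
      CliffordAlgebra.contractLeft_contractLeft, ← mul_assoc, ExteriorAlgebra.ι_sq_zero]
    simp only [TensorProduct.zero_tmul, zero_add, zero_mul, TensorProduct.tmul_zero, add_zero]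
    rw [← TensorProduct.add_tmul, add_comm, involute_contractLeft, TensorProduct.zero_tmul]⟩

/-- The action of `A ∈ R ⊗ Λ(𝔥* ⊕ U)` on `R ⊗ (Λ 𝔥 ⊗ Λ U)`, on elements `1 ⊗ y`. -/
def koszulMul {R : Type} [CommRing R] [Algebra ℂ R]
    {𝔥 U : Type} [AddCommGroup 𝔥] [Module ℂ 𝔥] [AddCommGroup U] [Module ℂ U]
    (A : R ⊗[ℂ] ExteriorAlgebra ℂ (Module.Dual ℂ 𝔥 × U))
    (y : ExteriorAlgebra ℂ 𝔥 ⊗[ℂ] ExteriorAlgebra ℂ U) :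
    R ⊗[ℂ] (ExteriorAlgebra ℂ 𝔥 ⊗[ℂ] ExteriorAlgebra ℂ U) :=
  LinearMap.lTensor R ((koszulRep 𝔥 U).toLinearMap.flip y) A

end Category

section RegularFunctions

set_option linter.unusedSectionVars false

open Filter Topology

variable {E E' : Type} [AddCommGroup E] [Module ℂ E] [AddCommGroup E'] [Module ℂ E']

/-- The algebra of polynomial functions on a complex vector space. -/
def polyFun (E : Type) [AddCommGroup E] [Module ℂ E] : Subalgebra ℂ (E → ℂ) :=
  Algebra.adjoin ℂ (Set.range fun φ : E →ₗ[ℂ] ℂ => (φ : E → ℂ))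

/-- The algebra `ℂ[Z]` of regular functions on a quasi-affine (locally closed) subset `Z` of a
vector space: the functions that are locally fractions `a / s` of polynomial functions. -/
def regular (Z : Set E) : Subalgebra ℂ (Z → ℂ) where
  carrier := {f | ∀ p : Z, ∃ a ∈ polyFun E, ∃ s ∈ polyFun E, s p ≠ 0 ∧ ∀ q : Z, s q * f q = a q}
  mul_mem' := by
    intro f g hf hg p
    obtain ⟨a, ha, s, hs, h1, h2⟩ := hf p
    obtain ⟨b, hb, t, ht, h3, h4⟩ := hg p
    refine ⟨a * b, mul_mem ha hb, s * t, mul_mem hs ht, mul_ne_zero h1 h3, fun q => ?_⟩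
    simp only [Pi.mul_apply, ← h2, ← h4]; ring
  add_mem' := by
    intro f g hf hg p
    obtain ⟨a, ha, s, hs, h1, h2⟩ := hf p
    obtain ⟨b, hb, t, ht, h3, h4⟩ := hg p
    refine ⟨a * t + b * s, add_mem (mul_mem ha ht) (mul_mem hb hs), s * t, mul_mem hs ht,
      mul_ne_zero h1 h3, fun q => ?_⟩
    simp only [Pi.mul_apply, Pi.add_apply, ← h2, ← h4]; ring
  algebraMap_mem' := by
    intro c p
    exact ⟨algebraMap ℂ _ c, Subalgebra.algebraMap_mem _ c, 1, one_mem _, one_ne_zero,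
      fun q => one_mul _⟩

theorem polyFun_regular (Z : Set E) {a : E → ℂ} (ha : a ∈ polyFun E) :
    (fun p : Z => a p) ∈ regular Z :=
  fun _ => ⟨a, ha, 1, one_mem _, one_ne_zero, fun _ => one_mul _⟩

theorem linear_polyFun (φ : E →ₗ[ℂ] ℂ) : (φ : E → ℂ) ∈ polyFun E :=
  Algebra.subset_adjoin ⟨φ, rfl⟩

/-- Polynomials in regular functions are regular. -/
theorem polyFun_comp {Z : Set E} (m : Z → E')
    (hm : ∀ φ : E' →ₗ[ℂ] ℂ, (fun p => φ (m p)) ∈ regular Z) {a : E' → ℂ} (ha : a ∈ polyFun E') :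
    (fun p => a (m p)) ∈ regular Z := by
  induction ha using Algebra.adjoin_induction with
  | mem a h => obtain ⟨φ, rfl⟩ := h; exact hm φ
  | algebraMap c => exact (regular Z).algebraMap_mem c
  | add a b _ _ ha hb => exact (regular Z).add_mem ha hb
  | mul a b _ _ ha hb => exact (regular Z).mul_mem ha hb

/-- Pull-back of regular functions along a map with regular coordinates. -/
theorem regular_comp {Z : Set E} {Z' : Set E'} (m : Z → Z')
    (hm : ∀ φ : E' →ₗ[ℂ] ℂ, (fun p => φ (m p)) ∈ regular Z) {f : Z' → ℂ} (hf : f ∈ regular Z') :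
    (fun p => f (m p)) ∈ regular Z := by
  intro p
  obtain ⟨a, ha, s, hs, h1, h2⟩ := hf (m p)
  obtain ⟨b, hb, t, ht, h3, h4⟩ := polyFun_comp (fun p => (m p : E')) hm ha p
  obtain ⟨c, hc, r, hr, h5, h6⟩ := polyFun_comp (fun p => (m p : E')) hm hs p
  refine ⟨r * b, mul_mem hr hb, t * c, mul_mem ht hc, mul_ne_zero h3 ?_, fun q => ?_⟩
  · rw [← h6]; exact mul_ne_zero h5 h1
  · have e2 := h2 (m q)
    have e4 := h4 q
    have e6 := h6 q
    simp only [Pi.mul_apply] at e4 e6 ⊢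
    rw [← e6, ← e4, ← e2]; ring

/-- The pull-back homomorphism `m^* : ℂ[Z'] → ℂ[Z]` of a morphism `m : Z → Z'`. -/
def pullFun {Z : Set E} {Z' : Set E'} (m : Z → Z')
    (hm : ∀ φ : E' →ₗ[ℂ] ℂ, (fun p => φ (m p)) ∈ regular Z) : regular Z' →ₐ[ℂ] regular Z where
  toFun f := ⟨fun p => (f : Z' → ℂ) (m p), regular_comp m hm f.2⟩
  map_one' := rfl
  map_mul' _ _ := rfl
  map_zero' := rfl
  map_add' _ _ := rfl
  commutes' _ := rfl

/-- The extension of a function by zero outside of `Z`. -/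
def extZero {Z : Set E} (f : Z → ℂ) : E → ℂ := Function.extend Subtype.val f 0

theorem extZero_coe {Z : Set E} (f : Z → ℂ) (p : Z) : extZero f p = f p :=
  Subtype.val_injective.extend_apply f 0 p

theorem extZero_mem {Z : Set E} (f : Z → ℂ) {p : E} (hp : p ∈ Z) : extZero f p = f ⟨p, hp⟩ :=
  extZero_coe f ⟨p, hp⟩

theorem extZero_not_mem {Z : Set E} (f : Z → ℂ) {p : E} (hp : p ∉ Z) : extZero f p = 0 :=
  Function.extend_apply' f (0 : E → ℂ) p (by rintro ⟨q, rfl⟩; exact hp q.2)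

theorem extZero_add {Z : Set E} (f g : Z → ℂ) : extZero (f + g) = extZero f + extZero g := by
  ext p
  by_cases hp : p ∈ Z
  · simp [extZero_mem _ hp]
  · simp [extZero_not_mem _ hp]

theorem extZero_mul {Z : Set E} (f g : Z → ℂ) : extZero (f * g) = extZero f * extZero g := by
  ext p
  by_cases hp : p ∈ Z
  · simp [extZero_mem _ hp]
  · simp [extZero_not_mem _ hp]

theorem extZero_smul {Z : Set E} (c : ℂ) (f : Z → ℂ) : extZero (c • f) = c • extZero f := by
  ext p
  by_cases hp : p ∈ Z
  · simp [extZero_mem _ hp]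
  · simp [extZero_not_mem _ hp]

theorem polyFun_lineDeriv {a : E → ℂ} (ha : a ∈ polyFun E) (p : E) :
    ∃ D : E →ₗ[ℂ] ℂ, ∀ v, HasLineDerivAt ℂ a (D v) p v := by
  induction ha using Algebra.adjoin_induction with
  | mem a h =>
    obtain ⟨φ, rfl⟩ := h
    refine ⟨φ, fun v => ?_⟩
    have : (fun t : ℂ => φ (p + t • v)) = fun t => φ p + t * φ v := by ext; simp
    simp only [HasLineDerivAt, this]
    simpa using ((hasDerivAt_id (0 : ℂ)).mul_const (φ v)).const_add (φ p)
  | algebraMap c => exact ⟨0, fun v => hasDerivAt_const _ _⟩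
  | add a b _ _ ha hb =>
    obtain ⟨D, hD⟩ := ha
    obtain ⟨D', hD'⟩ := hb
    exact ⟨D + D', fun v => (hD v).add (hD' v)⟩
  | mul a b _ _ ha hb =>
    obtain ⟨D, hD⟩ := ha
    obtain ⟨D', hD'⟩ := hb
    refine ⟨b p • D + a p • D', fun v => ?_⟩
    have := HasDerivAt.mul (hD v) (hD' v)
    have e : (b p • D + a p • D') v = D v * b (p + (0 : ℂ) • v) + a (p + (0 : ℂ) • v) * D' v := by
      simp; ring
    rw [e]
    exact this

theorem polyFun_vectorField {a : E → ℂ} (ha : a ∈ polyFun E) (ξ : E →ₗ[ℂ] E) :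
    ∃ a' ∈ polyFun E, ∀ p, HasLineDerivAt ℂ a (a' p) p (ξ p) := by
  induction ha using Algebra.adjoin_induction with
  | mem a h =>
    obtain ⟨φ, rfl⟩ := h
    refine ⟨_, linear_polyFun (φ ∘ₗ ξ), fun p => ?_⟩
    have : (fun t : ℂ => φ (p + t • ξ p)) = fun t => φ p + t * φ (ξ p) := by ext; simp
    simp only [HasLineDerivAt, this]
    simpa using ((hasDerivAt_id (0 : ℂ)).mul_const (φ (ξ p))).const_add (φ p)
  | algebraMap c => exact ⟨0, zero_mem _, fun v => hasDerivAt_const _ _⟩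
  | add a b _ _ ha hb =>
    obtain ⟨D, h, hD⟩ := ha
    obtain ⟨D', h', hD'⟩ := hb
    exact ⟨D + D', add_mem h h', fun v => (hD v).add (hD' v)⟩
  | mul a b ha0 hb0 ha hb =>
    obtain ⟨D, h, hD⟩ := ha
    obtain ⟨D', h', hD'⟩ := hb
    refine ⟨D * b + a * D', add_mem (mul_mem h hb0) (mul_mem ha0 h'), fun v => ?_⟩
    have := HasDerivAt.mul (hD v) (hD' v)
    have e : (D * b + a * D') v =
        D v * b (v + (0 : ℂ) • ξ v) + a (v + (0 : ℂ) • ξ v) * D' v := by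
      simp
    rw [e]
    exact this

theorem extZero_lineDeriv {Z : Set E} {f : Z → ℂ} {a s : E → ℂ}
    (h : ∀ q : Z, s q * f q = a q) (p : Z) (hs : s p ≠ 0) {v : E} {a' s' : ℂ}
    (hv : ∀ᶠ t : ℂ in 𝓝 0, (p : E) + t • v ∈ Z)
    (ha' : HasLineDerivAt ℂ a a' (p : E) v) (hs' : HasLineDerivAt ℂ s s' (p : E) v) :
    HasLineDerivAt ℂ (extZero f) ((a' - f p * s') / s p) (p : E) v := by
  have h0 : s ((p : E) + (0 : ℂ) • v) ≠ 0 := by simpa using hs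
  have h1 : HasDerivAt (fun t : ℂ => a ((p : E) + t • v) / s ((p : E) + t • v))
      ((a' * s ((p : E) + (0 : ℂ) • v) - a ((p : E) + (0 : ℂ) • v) * s') /
        s ((p : E) + (0 : ℂ) • v) ^ 2) 0 := HasDerivAt.div ha' hs' h0
  have h2 : (a' * s ((p : E) + (0 : ℂ) • v) - a ((p : E) + (0 : ℂ) • v) * s') /
        s ((p : E) + (0 : ℂ) • v) ^ 2 = (a' - f p * s') / s p := by
    simp only [zero_smul, add_zero]
    rw [← h p]
    field_simp
  rw [h2] at h1
  refine h1.congr_of_eventuallyEq ?_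
  have h3 : ∀ᶠ t : ℂ in 𝓝 0, s ((p : E) + t • v) ≠ 0 :=
    (HasDerivAt.continuousAt hs').eventually_ne h0
  filter_upwards [hv, h3] with t ht ht'
  rw [extZero_mem f ht, eq_div_iff ht', mul_comm]
  exact h ⟨_, ht⟩

theorem regular_lineDeriv {Z : Set E} {f : Z → ℂ} (hf : f ∈ regular Z) (p : Z) :
    ∃ D : E →ₗ[ℂ] ℂ, ∀ v, (∀ᶠ t : ℂ in 𝓝 0, (p : E) + t • v ∈ Z) →
      HasLineDerivAt ℂ (extZero f) (D v) (p : E) v := by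
  obtain ⟨a, ha, s, hs, h1, h2⟩ := hf p
  obtain ⟨A, hA⟩ := polyFun_lineDeriv ha (p : E)
  obtain ⟨B, hB⟩ := polyFun_lineDeriv hs (p : E)
  refine ⟨(s p)⁻¹ • (A - f p • B), fun v hv => ?_⟩
  have := extZero_lineDeriv h2 p h1 hv (hA v) (hB v)
  convert this using 1
  simp [div_eq_inv_mul]

/-- A linear vector field that is tangent to `Z` (a quasi-affine set). -/
def Tangent (Z : Set E) (ξ : E →ₗ[ℂ] E) : Prop :=
  ∀ p ∈ Z, ∀ᶠ t : ℂ in 𝓝 0, p + t • ξ p ∈ Z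

theorem tangent_neg {Z : Set E} {ξ : E →ₗ[ℂ] E} (h : Tangent Z ξ) (p : Z) :
    ∀ᶠ t : ℂ in 𝓝 0, (p : E) + t • (-ξ p) ∈ Z := by
  have h1 : Tendsto (fun t : ℂ => -t) (𝓝 0) (𝓝 0) := by
    simpa using (continuous_neg (G := ℂ)).tendsto 0
  filter_upwards [h1.eventually (h p p.2)] with t ht
  simpa using ht

/-- The derivative of a function at `p` along the vector field `-ξ`: this is the infinitesimal form
of the action `(b f)(z) = f (b⁻¹ z)`. -/
def lieFun {Z : Set E} (ξ : E →ₗ[ℂ] E) (f : Z → ℂ) : Z → ℂ :=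
  fun p => lineDeriv ℂ (extZero f) (p : E) (-ξ p)

theorem lieFun_hasLineDerivAt {Z : Set E} {ξ : E →ₗ[ℂ] E} (h : Tangent Z ξ) {f : Z → ℂ}
    (hf : f ∈ regular Z) (p : Z) :
    HasLineDerivAt ℂ (extZero f) (lieFun ξ f p) (p : E) (-ξ p) := by
  obtain ⟨D, hD⟩ := regular_lineDeriv hf p
  exact (hD _ (tangent_neg h p)).lineDifferentiableAt.hasLineDerivAt

theorem lieFun_regular {Z : Set E} {ξ : E →ₗ[ℂ] E} (h : Tangent Z ξ) {f : Z → ℂ}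
    (hf : f ∈ regular Z) : lieFun ξ f ∈ regular Z := by
  intro p
  obtain ⟨a, ha, s, hs, h1, h2⟩ := hf p
  obtain ⟨a', ha', hA⟩ := polyFun_vectorField ha (-ξ)
  obtain ⟨s', hs', hB⟩ := polyFun_vectorField hs (-ξ)
  refine ⟨s * a' - a * s', sub_mem (mul_mem hs ha') (mul_mem ha hs'), s * s, mul_mem hs hs,
    mul_ne_zero h1 h1, fun q => ?_⟩
  simp only [Pi.mul_apply, Pi.sub_apply]
  by_cases hq : s q = 0
  · have := h2 q
    rw [hq, zero_mul] at this
    rw [← this, hq]; ring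
  · have h3 := extZero_lineDeriv h2 q hq (tangent_neg h q) (hA q) (hB q)
    have h4 : lieFun ξ f q = (a' q - f q * s' q) / s q := h3.lineDeriv
    rw [h4, ← h2 q]
    field_simp

/-- The derivation of `ℂ[Z]` defined by a vector field tangent to `Z`. -/
def lieDer {Z : Set E} (ξ : E →ₗ[ℂ] E) (h : Tangent Z ξ) : Derivation ℂ (regular Z) (regular Z) :=
  Derivation.mk'
    { toFun := fun f => ⟨lieFun ξ f, lieFun_regular h f.2⟩
      map_add' := by
        intro f g
        ext p
        have h1 := HasDerivAt.add (lieFun_hasLineDerivAt h f.2 p) (lieFun_hasLineDerivAt h g.2 p)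
        have h2 : HasLineDerivAt ℂ (extZero ((f : Z → ℂ) + (g : Z → ℂ)))
            (lieFun ξ f p + lieFun ξ g p) (p : E) (-ξ p) := by
          rw [extZero_add]; exact h1
        exact h2.lineDeriv
      map_smul' := by
        intro c f
        ext p
        have h1 := HasDerivAt.const_mul c (lieFun_hasLineDerivAt h f.2 p)
        have h2 : HasLineDerivAt ℂ (extZero (c • (f : Z → ℂ))) (c * lieFun ξ f p)
            (p : E) (-ξ p) := by
          rw [extZero_smul]; exact h1
        exact h2.lineDeriv }
    (by
      intro f g
      ext p
      have h1 := HasDerivAt.mul (lieFun_hasLineDerivAt h f.2 p) (lieFun_hasLineDerivAt h g.2 p)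
      have h2 : HasLineDerivAt ℂ (extZero ((f : Z → ℂ) * (g : Z → ℂ)))
          (lieFun ξ f p * extZero (g : Z → ℂ) ((p : E) + (0 : ℂ) • (-ξ p)) +
            extZero (f : Z → ℂ) ((p : E) + (0 : ℂ) • (-ξ p)) * lieFun ξ g p) (p : E) (-ξ p) := by
        rw [extZero_mul]; exact h1
      refine h2.lineDeriv.trans ?_
      simp only [zero_smul, add_zero, extZero_coe]
      change _ = (f : Z → ℂ) p * lieFun ξ g p + (g : Z → ℂ) p * lieFun ξ f p
      ring)

theorem lieDer_apply {Z : Set E} (ξ : E →ₗ[ℂ] E) (h : Tangent Z ξ) (f : regular Z) (p : Z) :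
    (lieDer ξ h f : Z → ℂ) p = lieFun ξ f p := rfl

theorem lieFun_linear {Z : Set E} (ξ : E →ₗ[ℂ] E) (h : Tangent Z ξ) (φ : E →ₗ[ℂ] ℂ) (p : Z) :
    lieFun ξ (fun q : Z => φ q) p = - φ (ξ p) := by
  obtain ⟨a', -, hA⟩ := polyFun_vectorField (linear_polyFun φ) (-ξ)
  have h0 : HasLineDerivAt ℂ (φ : E → ℂ) (-φ (ξ p)) (p : E) (-ξ p) := by
    have : (fun t : ℂ => φ ((p : E) + t • (-ξ p))) = fun t => φ p + t * (-φ (ξ p)) := by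
      ext; simp
    simp only [HasLineDerivAt, this]
    simpa using ((hasDerivAt_id (0 : ℂ)).mul_const (-φ (ξ p))).const_add (φ p)
  have h1 : HasLineDerivAt ℂ (1 : E → ℂ) 0 (p : E) (-ξ p) := hasDerivAt_const _ _
  have := extZero_lineDeriv (f := fun q : Z => φ q) (a := φ) (s := 1) (fun q => one_mul _) p
    one_ne_zero (tangent_neg h p) h0 h1
  refine this.lineDeriv.trans ?_
  simp

/-- A derivation of `ℂ[Z]` is determined by its values on linear functions. -/
theorem derivation_ext {Z : Set E} {d d' : Derivation ℂ (regular Z) (regular Z)}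
    (h : ∀ φ : E →ₗ[ℂ] ℂ, d ⟨fun q => φ q, polyFun_regular Z (linear_polyFun φ)⟩ =
      d' ⟨fun q => φ q, polyFun_regular Z (linear_polyFun φ)⟩) (f : regular Z) : d f = d' f := by
  have hp : ∀ a (ha : a ∈ polyFun E), d ⟨fun q => a q, polyFun_regular Z ha⟩ =
      d' ⟨fun q => a q, polyFun_regular Z ha⟩ := by
    intro a ha
    induction ha using Algebra.adjoin_induction with
    | mem a h' => obtain ⟨φ, rfl⟩ := h'; exact h φ
    | algebraMap c => exact (d.map_algebraMap c).trans (d'.map_algebraMap c).symm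
    | add a b ha0 hb0 ha hb =>
      have : (⟨fun q => (a + b) q, polyFun_regular Z (add_mem ha0 hb0)⟩ : regular Z) =
        ⟨fun q => a q, polyFun_regular Z ha0⟩ + ⟨fun q => b q, polyFun_regular Z hb0⟩ := rfl
      rw [this, map_add, map_add, ha, hb]
    | mul a b ha0 hb0 ha hb =>
      have : (⟨fun q => (a * b) q, polyFun_regular Z (mul_mem ha0 hb0)⟩ : regular Z) =
        ⟨fun q => a q, polyFun_regular Z ha0⟩ * ⟨fun q => b q, polyFun_regular Z hb0⟩ := rfl
      rw [this, Derivation.leibniz, Derivation.leibniz, ha, hb]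
  ext p
  obtain ⟨a, ha, s, hs, h1, h2⟩ := f.2 p
  have h3 : (⟨fun q => s q, polyFun_regular Z hs⟩ : regular Z) * f =
      ⟨fun q => a q, polyFun_regular Z ha⟩ := by
    ext q; exact h2 q
  have h4 : d (⟨fun q => s q, polyFun_regular Z hs⟩ * f) =
      d' (⟨fun q => s q, polyFun_regular Z hs⟩ * f) := by rw [h3]; exact hp a ha
  rw [Derivation.leibniz, Derivation.leibniz, hp s hs, add_left_inj] at h4
  have h5 := congrFun (congrArg Subtype.val h4) p
  exact mul_left_cancel₀ h1 h5

end RegularFunctions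

section Geometry

variable {𝔥 L : Type} [LieRing 𝔥] [LieAlgebra ℂ 𝔥] [Group L]

/-- A quasi-affine set `Z` in a vector space `E`, with linear actions of `L` and of `𝔥` on `E` that
preserve `Z`, and an invariant (of weight `κ²` under `L`) potential `W` on `Z`. -/
structure Geometry (S : Symmetry 𝔥 L) where
  E : Type
  [addCommGroup : AddCommGroup E]
  [module : Module ℂ E]
  Z : Set E
  ξ : 𝔥 →ₗ[ℂ] E →ₗ[ℂ] E
  ξ_lie : ∀ x y p, ξ ⁅x, y⁆ p = ξ x (ξ y p) - ξ y (ξ x p)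
  tangent : ∀ x, Tangent Z (ξ x)
  σ : L →* (E →ₗ[ℂ] E)
  σ_mem : ∀ l, ∀ p ∈ Z, σ l p ∈ Z
  σ_ξ : ∀ l x p, σ l (ξ x p) = ξ (S.Ad l x) (σ l p)
  W : regular Z
  W_ξ : ∀ x, lieDer (ξ x) (tangent x) W = 0
  W_σ : ∀ l (p : Z), (W : Z → ℂ) ⟨σ l p, σ_mem l p p.2⟩ = (S.κ l : ℂ) ^ 2 * (W : Z → ℂ) p

attribute [instance] Geometry.addCommGroup Geometry.module

variable {S : Symmetry 𝔥 L}

theorem Geometry.σ_inv (G : Geometry S) (l : L) (p : G.E) : G.σ l (G.σ l⁻¹ p) = p := by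
  rw [← Module.End.mul_apply, ← map_mul, mul_inv_cancel, map_one, Module.End.one_apply]

theorem Geometry.inv_σ (G : Geometry S) (l : L) (p : G.E) : G.σ l⁻¹ (G.σ l p) = p := by
  rw [← Module.End.mul_apply, ← map_mul, inv_mul_cancel, map_one, Module.End.one_apply]

/-- The action of `l` on `Z`. -/
def Geometry.move (G : Geometry S) (l : L) (p : G.Z) : G.Z := ⟨G.σ l p, G.σ_mem l p p.2⟩

theorem Geometry.move_coord (G : Geometry S) (l : L) (φ : G.E →ₗ[ℂ] ℂ) :
    (fun p : G.Z => φ (G.move l p)) ∈ regular G.Z :=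
  polyFun_regular G.Z (linear_polyFun (φ ∘ₗ G.σ l))

theorem Geometry.extZero_move (G : Geometry S) (l : L) (f : G.Z → ℂ) (p : G.E) :
    extZero (fun q => f (G.move l q)) p = extZero f (G.σ l p) := by
  by_cases hp : p ∈ G.Z
  · rw [extZero_mem _ hp, extZero_mem _ (G.σ_mem l p hp)]; rfl
  · rw [extZero_not_mem _ hp, extZero_not_mem]
    intro h
    have := G.σ_mem l⁻¹ _ h
    rw [G.inv_σ] at this
    exact hp this

/-- The coordinate ring of a geometric space with its actions and its potential. -/
def Geometry.toSpace (G : Geometry S) : EqSpace S where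
  R := regular G.Z
  der x := lieDer (G.ξ x) (G.tangent x)
  der_add := by
    intro x y f
    ext p
    obtain ⟨D, hD⟩ := regular_lineDeriv f.2 p
    have key : ∀ z, lieFun (G.ξ z) f p = D (-G.ξ z p) := fun z =>
      (hD _ (tangent_neg (G.tangent z) p)).lineDeriv
    change lieFun _ _ _ = lieFun _ _ _ + lieFun _ _ _
    rw [key, key, key]
    simp; ring
  der_smul := by
    intro c x f
    ext p
    obtain ⟨D, hD⟩ := regular_lineDeriv f.2 p
    have key : ∀ z, lieFun (G.ξ z) f p = D (-G.ξ z p) := fun z =>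
      (hD _ (tangent_neg (G.tangent z) p)).lineDeriv
    change lieFun _ _ _ = c * lieFun _ _ _
    rw [key, key]
    simp
  der_lie := by
    intro x y f
    rw [← Derivation.commutator_apply]
    refine derivation_ext (fun φ => ?_) f
    have key : ∀ z (ψ : G.E →ₗ[ℂ] ℂ), lieDer (G.ξ z) (G.tangent z)
        ⟨fun q => ψ q, polyFun_regular G.Z (linear_polyFun ψ)⟩ =
        ⟨fun q => (-(ψ ∘ₗ G.ξ z)) q, polyFun_regular G.Z (linear_polyFun _)⟩ := by
      intro z ψ
      ext p
      exact lieFun_linear (G.ξ z) (G.tangent z) ψ p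
    rw [Derivation.commutator_apply, key, key, key, key, key]
    ext p
    change -φ (G.ξ ⁅x, y⁆ p) = - -φ (G.ξ y (G.ξ x p)) - - -φ (G.ξ x (G.ξ y p))
    rw [G.ξ_lie, map_sub]; ring
  act l := pullFun (G.move l⁻¹) (G.move_coord l⁻¹)
  act_one := by
    intro f
    ext p
    refine congrArg (f : G.Z → ℂ) (Subtype.ext ?_)
    simp [Geometry.move]
  act_mul := by
    intro l m f
    ext p
    refine congrArg (f : G.Z → ℂ) (Subtype.ext ?_)
    simp [Geometry.move]
  act_der := by
    intro l x f
    ext p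
    change lineDeriv ℂ (extZero (f : G.Z → ℂ)) (G.σ l⁻¹ p) (-G.ξ x (G.σ l⁻¹ p)) =
      lineDeriv ℂ (extZero fun q => (f : G.Z → ℂ) (G.move l⁻¹ q)) p (-G.ξ (S.Ad l x) p)
    have h1 : G.σ l⁻¹ (G.ξ (S.Ad l x) p) = G.ξ x (G.σ l⁻¹ p) := by
      have := G.σ_ξ l x (G.σ l⁻¹ p)
      rw [G.σ_inv] at this
      rw [← this, G.inv_σ]
    simp only [lineDeriv, G.extZero_move, map_add, map_smul, map_neg, h1]
  W := G.W
  der_W := G.W_ξ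
  act_W := by
    intro l
    ext p
    change (S.κ l : ℂ) ^ 2 * (G.W : G.Z → ℂ) (G.move l⁻¹ p) = (G.W : G.Z → ℂ) p
    rw [← G.W_σ]
    exact congrArg (G.W : G.Z → ℂ) (Subtype.ext (G.σ_inv l p))

/-- A linear equivariant map that sends `Z'` to `Z` and is compatible with potentials induces a
morphism of equivariant spaces. -/
def Geometry.homOfLinear (G G' : Geometry S) (π : G'.E →ₗ[ℂ] G.E)
    (hZ : ∀ p ∈ G'.Z, π p ∈ G.Z) (hξ : ∀ x p, π (G'.ξ x p) = G.ξ x (π p))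
    (hσ : ∀ l p, π (G'.σ l p) = G.σ l (π p))
    (hW : ∀ p : G'.Z, (G.W : G.Z → ℂ) ⟨π p, hZ p p.2⟩ = (G'.W : G'.Z → ℂ) p) :
    EqSpace.Hom G.toSpace G'.toSpace where
  φ := pullFun (fun p : G'.Z => (⟨π p, hZ p p.2⟩ : G.Z))
    (fun ψ => polyFun_regular G'.Z (linear_polyFun (ψ ∘ₗ π)))
  der := by
    intro x (f : regular G.Z)
    refine Subtype.ext (funext fun p => ?_)
    have h1 := lieFun_hasLineDerivAt (G.tangent x) f.2 ⟨π p, hZ p p.2⟩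
    change lieFun (G.ξ x) f ⟨π p, hZ p p.2⟩ = lieFun (G'.ξ x) _ p
    symm
    refine HasLineDerivAt.lineDeriv (HasDerivAt.congr_of_eventuallyEq h1 ?_)
    filter_upwards [tangent_neg (G'.tangent x) p] with t ht
    have h2 := hZ _ ht
    rw [extZero_mem _ ht]
    have h3 : π ((p : G'.E) + t • (-G'.ξ x p)) = π p + t • (-G.ξ x (π p)) := by
      simp [hξ]
    change (f : G.Z → ℂ) ⟨π ((p : G'.E) + t • (-G'.ξ x p)), h2⟩ = _
    rw [← extZero_mem (f : G.Z → ℂ) h2, h3]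
  act := by
    intro l (f : regular G.Z)
    refine Subtype.ext (funext fun p => ?_)
    exact congrArg (f : G.Z → ℂ) (Subtype.ext (hσ l⁻¹ p).symm)
  W := Subtype.ext (funext fun p => hW p)

end Geometry

section Matrices

open Filter Topology

/-- Square matrices of size `n`. -/
abbrev Mat (n : ℕ) : Type := Matrix (Fin n) (Fin n) ℂ

/-- The vector space `𝔫` of strictly upper triangular matrices. -/
def nil (n : ℕ) : Submodule ℂ (Mat n) where
  carrier := {x | ∀ i j, j ≤ i → x i j = 0}
  add_mem' := by
    intro x y hx hy i j h
    rw [Matrix.add_apply, hx i j h, hy i j h, add_zero]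
  zero_mem' := fun _ _ _ => rfl
  smul_mem' := by
    intro c x hx i j h
    rw [Matrix.smul_apply, hx i j h, smul_zero]

/-- The space `𝔟` of upper triangular matrices. -/
def upper (n : ℕ) : Submodule ℂ (Mat n) where
  carrier := {x | ∀ i j, j < i → x i j = 0}
  add_mem' := by
    intro x y hx hy i j h
    rw [Matrix.add_apply, hx i j h, hy i j h, add_zero]
  zero_mem' := fun _ _ _ => rfl
  smul_mem' := by
    intro c x hx i j h
    rw [Matrix.smul_apply, hx i j h, smul_zero]

variable {n : ℕ}

theorem upper_mul {x y : Mat n} (hx : x ∈ upper n) (hy : y ∈ upper n) : x * y ∈ upper n := by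
  intro i j h
  rw [Matrix.mul_apply]
  refine Finset.sum_eq_zero fun k _ => ?_
  rcases lt_or_ge k i with hk | hk
  · rw [hx i k hk, zero_mul]
  · rw [hy k j (lt_of_lt_of_le h hk), mul_zero]

theorem nil_mul_upper {x y : Mat n} (hx : x ∈ nil n) (hy : y ∈ upper n) : x * y ∈ nil n := by
  intro i j h
  rw [Matrix.mul_apply]
  refine Finset.sum_eq_zero fun k _ => ?_
  rcases le_or_gt k i with hk | hk
  · rw [hx i k hk, zero_mul]
  · rw [hy k j (lt_of_le_of_lt h hk), mul_zero]

theorem upper_mul_nil {x y : Mat n} (hx : x ∈ upper n) (hy : y ∈ nil n) : x * y ∈ nil n := by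
  intro i j h
  rw [Matrix.mul_apply]
  refine Finset.sum_eq_zero fun k _ => ?_
  rcases lt_or_ge k i with hk | hk
  · rw [hx i k hk, zero_mul]
  · rw [hy k j (le_trans h hk), mul_zero]

theorem nil_le_upper : nil n ≤ upper n := fun _ hx i j h => hx i j h.le

theorem nil_mul {x y : Mat n} (hx : x ∈ nil n) (hy : y ∈ nil n) : x * y ∈ nil n :=
  nil_mul_upper hx (nil_le_upper hy)

/-- The commutator bracket on `𝔫`. -/
instance : LieRing (nil n) where
  bracket x y := ⟨x.1 * y.1 - y.1 * x.1, sub_mem (nil_mul x.2 y.2) (nil_mul y.2 x.2)⟩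
  add_lie x y z := Subtype.ext (by
    change (x.1 + y.1) * z.1 - z.1 * (x.1 + y.1) =
      (x.1 * z.1 - z.1 * x.1) + (y.1 * z.1 - z.1 * y.1)
    noncomm_ring)
  lie_add x y z := Subtype.ext (by
    change x.1 * (y.1 + z.1) - (y.1 + z.1) * x.1 =
      (x.1 * y.1 - y.1 * x.1) + (x.1 * z.1 - z.1 * x.1)
    noncomm_ring)
  lie_self x := Subtype.ext (sub_self _)
  leibniz_lie x y z := Subtype.ext (by
    change x.1 * (y.1 * z.1 - z.1 * y.1) - (y.1 * z.1 - z.1 * y.1) * x.1 =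
      ((x.1 * y.1 - y.1 * x.1) * z.1 - z.1 * (x.1 * y.1 - y.1 * x.1)) +
      (y.1 * (x.1 * z.1 - z.1 * x.1) - (x.1 * z.1 - z.1 * x.1) * y.1)
    noncomm_ring)

instance : LieAlgebra ℂ (nil n) where
  lie_smul c x y := Subtype.ext (by
    change x.1 * (c • y.1) - (c • y.1) * x.1 = c • (x.1 * y.1 - y.1 * x.1)
    rw [mul_smul_comm, smul_mul_assoc, smul_sub])

theorem nil_lie (x y : nil n) : (⁅x, y⁆ : nil n).1 = x.1 * y.1 - y.1 * x.1 := rfl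

/-- The diagonal matrix with diagonal `t`. -/
def dg (t : Fin n → ℂˣ) : Mat n := Matrix.diagonal fun i => (t i : ℂ)

@[simp] theorem dg_one : dg (1 : Fin n → ℂˣ) = 1 := by simp [dg]

@[simp] theorem dg_mul (t s : Fin n → ℂˣ) : dg (t * s) = dg t * dg s := by
  simp [dg, Matrix.diagonal_mul_diagonal]

@[simp] theorem dg_mul_inv (t : Fin n → ℂˣ) : dg t * dg t⁻¹ = 1 := by rw [← dg_mul]; simp

@[simp] theorem dg_inv_mul (t : Fin n → ℂˣ) : dg t⁻¹ * dg t = 1 := by rw [← dg_mul]; simp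

theorem dg_upper (t : Fin n → ℂˣ) : dg t ∈ upper n :=
  fun _ _ h => Matrix.diagonal_apply_ne _ h.ne'

theorem dg_last (t : Fin n → ℂˣ) (v : Fin n → ℂ) (i : Fin n) :
    (dg t).mulVec v i = t i * v i := by
  simp [dg, Matrix.mulVec_diagonal]

theorem conj_nil (t s : Fin n → ℂˣ) {x : Mat n} (hx : x ∈ nil n) : dg t * x * dg s ∈ nil n :=
  nil_mul_upper (upper_mul_nil (dg_upper t) hx) (dg_upper s)

theorem conj_upper (t s : Fin n → ℂˣ) {x : Mat n} (hx : x ∈ upper n) :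
    dg t * x * dg s ∈ upper n :=
  upper_mul (upper_mul (dg_upper t) hx) (dg_upper s)

theorem det_dg_ne (t : Fin n → ℂˣ) : (dg t).det ≠ 0 := by
  simp [dg, Matrix.det_diagonal, Finset.prod_eq_zero_iff]

/-- `v` is a cyclic vector for the algebra `ℂ⟨a, b⟩`: `ℂ⟨a, b⟩ v = V`. -/
def Cyclic (a b : Mat n) (v : Fin n → ℂ) : Prop :=
  ∀ w, ∃ P ∈ Algebra.adjoin ℂ ({a, b} : Set (Mat n)), P.mulVec v = w

theorem Cyclic.conj {a b : Mat n} {v : Fin n → ℂ} (h : Cyclic a b v) (p q : Mat n)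
    (hpq : p * q = 1) (c d : ℂ) (hc : c ≠ 0) (hd : d ≠ 0) :
    Cyclic (c • (p * a * q)) (d • (p * b * q)) (p.mulVec v) := by
  have hqp : q * p = 1 := mul_eq_one_comm.mp hpq
  intro w
  obtain ⟨P, hP, hw⟩ := h (q.mulVec w)
  refine ⟨p * P * q, ?_, ?_⟩
  · clear hw
    induction hP using Algebra.adjoin_induction with
    | mem x hx =>
      have key : ∀ (e : ℂ) (y : Mat n), e ≠ 0 →
          e • (p * y * q) ∈ Algebra.adjoin ℂ
            ({c • (p * a * q), d • (p * b * q)} : Set (Mat n)) →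
          p * y * q ∈ Algebra.adjoin ℂ
            ({c • (p * a * q), d • (p * b * q)} : Set (Mat n)) := by
        intro e y he hy
        have := Subalgebra.smul_mem _ hy e⁻¹
        rwa [smul_smul, inv_mul_cancel₀ he, one_smul] at this
      rcases hx with rfl | hx
      · exact key c _ hc (Algebra.subset_adjoin (Set.mem_insert _ _))
      · rw [Set.mem_singleton_iff] at hx
        subst hx
        exact key d _ hd (Algebra.subset_adjoin (Set.mem_insert_of_mem _ rfl))
    | algebraMap r =>
      rw [Algebra.algebraMap_eq_smul_one, mul_smul_comm, mul_one, smul_mul_assoc, hpq]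
      exact Subalgebra.smul_mem _ (one_mem _) r
    | add x y _ _ hx hy => rw [mul_add, add_mul]; exact add_mem hx hy
    | mul x y _ _ hx hy =>
      have : p * (x * y) * q = (p * x * q) * (p * y * q) := by
        have e : (p * x * q) * (p * y * q) = p * x * (q * p) * y * q := by noncomm_ring
        rw [e, hqp]; noncomm_ring
      rw [this]; exact mul_mem hx hy
  · rw [Matrix.mulVec_mulVec, mul_assoc, hqp, mul_one, ← Matrix.mulVec_mulVec, hw,
      Matrix.mulVec_mulVec, hpq, Matrix.one_mulVec]

theorem Cyclic.eventually {a b : ℂ → Mat n} {v : ℂ → Fin n → ℂ} (ha : ContinuousAt a 0)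
    (hb : ContinuousAt b 0) (hv : ContinuousAt v 0) (h : Cyclic (a 0) (b 0) (v 0)) :
    ∀ᶠ t in 𝓝 0, Cyclic (a t) (b t) (v t) := by
  have key : ∀ P ∈ Algebra.adjoin ℂ ({a 0, b 0} : Set (Mat n)), ∃ Q : ℂ → Mat n,
      ContinuousAt Q 0 ∧ (∀ t, Q t ∈ Algebra.adjoin ℂ ({a t, b t} : Set (Mat n))) ∧ Q 0 = P := by
    intro P hP
    induction hP using Algebra.adjoin_induction with
    | mem x hx =>
      rcases hx with rfl | hx
      · exact ⟨a, ha, fun t => Algebra.subset_adjoin (Set.mem_insert _ _), rfl⟩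
      · rw [Set.mem_singleton_iff] at hx
        subst hx
        exact ⟨b, hb, fun t => Algebra.subset_adjoin (Set.mem_insert_of_mem _ rfl), rfl⟩
    | algebraMap r =>
      exact ⟨fun _ => algebraMap ℂ _ r, continuousAt_const,
        fun t => Subalgebra.algebraMap_mem _ _, rfl⟩
    | add x y _ _ hx hy =>
      obtain ⟨Q, h1, h2, rfl⟩ := hx
      obtain ⟨Q', h1', h2', rfl⟩ := hy
      exact ⟨fun t => Q t + Q' t, h1.add h1', fun t => add_mem (h2 t) (h2' t), rfl⟩
    | mul x y _ _ hx hy =>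
      obtain ⟨Q, h1, h2, rfl⟩ := hx
      obtain ⟨Q', h1', h2', rfl⟩ := hy
      exact ⟨fun t => Q t * Q' t, h1.mul h1', fun t => mul_mem (h2 t) (h2' t), rfl⟩
  choose P hP hPw using h
  choose Q hQ hQm hQ0 using fun j : Fin n => key _ (hP (Pi.single j 1))
  have hN : ContinuousAt (fun t => (Matrix.of fun i j => (Q j t).mulVec (v t) i : Mat n).det) 0 := by
    have h1 : ContinuousAt (fun t => (Matrix.of fun i j => (Q j t).mulVec (v t) i : Mat n)) 0 := by
      refine continuousAt_pi.2 fun i => continuousAt_pi.2 fun j => ?_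
      have h2 : ContinuousAt (fun t => (Q j t).mulVec (v t)) 0 := by
        have h3 : Continuous fun x : Mat n × (Fin n → ℂ) => x.1.mulVec x.2 := by fun_prop
        exact h3.continuousAt.comp ((hQ j).prodMk hv)
      exact continuousAt_pi.1 h2 i
    exact (continuous_id.matrix_det).continuousAt.comp h1
  have h0 : (Matrix.of fun i j => (Q j 0).mulVec (v 0) i : Mat n).det ≠ 0 := by
    have : (Matrix.of fun i j => (Q j 0).mulVec (v 0) i : Mat n) = 1 := by
      ext i j
      rw [Matrix.of_apply, hQ0, hPw, Matrix.one_apply, Pi.single_apply]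
    rw [this, Matrix.det_one]
    exact one_ne_zero
  filter_upwards [hN.eventually_ne h0] with t ht w
  set N : Mat n := Matrix.of fun i j => (Q j t).mulVec (v t) i with hNdef
  have hu : IsUnit N.det := isUnit_iff_ne_zero.2 ht
  refine ⟨∑ j, (N⁻¹.mulVec w) j • Q j t,
    sum_mem fun j _ => Subalgebra.smul_mem _ (hQm j t) _, ?_⟩
  have h1 : N.mulVec (N⁻¹.mulVec w) = w := by
    rw [Matrix.mulVec_mulVec, Matrix.mul_nonsing_inv _ hu, Matrix.one_mulVec]
  rw [← h1]
  ext i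
  rw [Matrix.sum_mulVec, Finset.sum_apply]
  simp only [Matrix.smul_mulVec, Pi.smul_apply, smul_eq_mul]
  rw [Matrix.mulVec, dotProduct]
  refine Finset.sum_congr rfl fun j _ => ?_
  rw [h1, mul_comm, hNdef, Matrix.of_apply]

theorem line_continuous {E : Type} [AddCommGroup E] [Module ℂ E] (f : E →ₗ[ℂ] Mat n) (p v : E) :
    Continuous fun t : ℂ => f (p + t • v) := by
  simp only [map_add, map_smul]
  fun_prop

theorem line_continuous_vec {E : Type} [AddCommGroup E] [Module ℂ E] (f : E →ₗ[ℂ] (Fin n → ℂ))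
    (p v : E) : Continuous fun t : ℂ => f (p + t • v) := by
  simp only [map_add, map_smul]
  fun_prop

theorem inv_continuousAt {f : ℂ → Mat n} (hf : ContinuousAt f 0) (h0 : (f 0).det ≠ 0) :
    ContinuousAt (fun t => (f t)⁻¹) 0 := by
  have h1 : ContinuousAt (fun t => (f t).det) 0 :=
    (continuous_id.matrix_det).continuousAt.comp hf
  have h2 : ContinuousAt (fun t => (f t).adjugate) 0 :=
    (continuous_id.matrix_adjugate).continuousAt.comp hf
  have : (fun t => (f t)⁻¹) = fun t => ((f t).det)⁻¹ • (f t).adjugate := by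
    ext1 t
    rw [Matrix.inv_def, Ring.inverse_eq_inv']
  rw [this]
  exact (h1.inv₀ h0).smul h2

theorem mulVec_continuousAt {f : ℂ → Mat n} {v : ℂ → Fin n → ℂ} (hf : ContinuousAt f 0)
    (hv : ContinuousAt v 0) : ContinuousAt (fun t => (f t).mulVec (v t)) 0 := by
  have h3 : Continuous fun x : Mat n × (Fin n → ℂ) => x.1.mulVec x.2 := by fun_prop
  exact h3.continuousAt.comp (hf.prodMk hv)

theorem det_eventually {f : ℂ → Mat n} (hf : ContinuousAt f 0) (h0 : (f 0).det ≠ 0) :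
    ∀ᶠ t in 𝓝 0, (f t).det ≠ 0 :=
  ContinuousAt.eventually_ne ((continuous_id.matrix_det).continuousAt.comp hf) h0


section RegularMatrices

variable {E : Type} [AddCommGroup E] [Module ℂ E] {Z : Set E}

/-- A matrix-valued function with regular entries. -/
def RegularMat (f : Z → Mat n) : Prop := ∀ i j, (fun p => f p i j) ∈ regular Z

theorem RegularMat.linear (f : E →ₗ[ℂ] Mat n) : RegularMat fun p : Z => f p := fun i j =>
  polyFun_regular Z (linear_polyFun ((LinearMap.proj j ∘ₗ LinearMap.proj i) ∘ₗ f))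

theorem RegularMat.mul {f g : Z → Mat n} (hf : RegularMat f) (hg : RegularMat g) :
    RegularMat fun p => f p * g p := by
  intro i j
  have : (fun p => (f p * g p) i j) = ∑ k, (fun p => f p i k) * fun p => g p k j := by
    ext p
    simp [Matrix.mul_apply]
  rw [this]
  exact sum_mem fun k _ => mul_mem (hf i k) (hg k j)

theorem RegularMat.sub {f g : Z → Mat n} (hf : RegularMat f) (hg : RegularMat g) :
    RegularMat fun p => f p - g p := fun i j => sub_mem (hf i j) (hg i j)

theorem RegularMat.det {f : Z → Mat n} (hf : RegularMat f) :
    (fun p => (f p).det) ∈ regular Z := by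
  have : (fun p => (f p).det) =
      ∑ τ : Equiv.Perm (Fin n), (Equiv.Perm.sign τ : ℤ) • ∏ i, fun p => f p (τ i) i := by
    ext p
    rw [Matrix.det_apply]
    simp [Finset.sum_apply, Finset.prod_apply, Units.smul_def]
  rw [this]
  exact sum_mem fun τ _ => zsmul_mem (prod_mem fun i _ => hf _ _) _

theorem regular_inv {f : Z → ℂ} (hf : f ∈ regular Z) (h0 : ∀ p, f p ≠ 0) :
    (fun p => (f p)⁻¹) ∈ regular Z := by
  intro p
  obtain ⟨a, ha, s, hs, h1, h2⟩ := hf p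
  refine ⟨s, hs, a, ha, ?_, fun q => ?_⟩
  · rw [← h2]; exact mul_ne_zero h1 (h0 p)
  · rw [← h2, mul_assoc, mul_inv_cancel₀ (h0 q), mul_one]

theorem RegularMat.inv {f : Z → Mat n} (hf : RegularMat f) (h0 : ∀ p, (f p).det ≠ 0) :
    RegularMat fun p => (f p)⁻¹ := by
  intro i j
  have : (fun p => (f p)⁻¹ i j) = (fun p => ((f p).det)⁻¹) * fun p => (f p).adjugate i j := by
    ext p
    rw [Matrix.inv_def, Ring.inverse_eq_inv']
    rfl
  rw [this]
  refine mul_mem (regular_inv hf.det h0) ?_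
  have h1 : RegularMat fun p => (f p).updateRow j (Pi.single i 1) := by
    intro k l
    by_cases hk : k = j
    · subst hk
      simp only [Matrix.updateRow_self]
      exact (regular Z).algebraMap_mem _
    · simp only [Matrix.updateRow_ne hk]
      exact hf k l
  simpa only [Matrix.adjugate_apply] using h1.det

theorem RegularMat.apply {f : Z → Mat n} (hf : RegularMat f) (φ : Mat n →ₗ[ℂ] ℂ) :
    (fun p => φ (f p)) ∈ regular Z := by
  have : (fun p => φ (f p)) = ∑ i, ∑ j, φ (Matrix.single i j 1) • fun p => f p i j := by
    ext p
    conv_lhs => rw [Matrix.matrix_eq_sum_single (f p)]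
    simp only [map_sum, Finset.sum_apply, Pi.smul_apply, smul_eq_mul]
    refine Finset.sum_congr rfl fun i _ => Finset.sum_congr rfl fun j _ => ?_
    have : Matrix.single i j (f p i j) = f p i j • (Matrix.single i j 1 : Mat n) := by
      rw [Matrix.smul_single, smul_eq_mul, mul_one]
    rw [this, map_smul, smul_eq_mul, mul_comm]
  rw [this]
  exact sum_mem fun i _ => sum_mem fun j _ => Subalgebra.smul_mem _ (hf i j) _

theorem RegularMat.trace {f : Z → Mat n} (hf : RegularMat f) :
    (fun p => (f p).trace) ∈ regular Z := hf.apply (Matrix.traceLinearMap (Fin n) ℂ ℂ)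

/-- The matrix over `ℂ[Z]` given by a matrix-valued regular function. -/
def RegularMat.toMatrix {f : Z → Mat n} (hf : RegularMat f) :
    Matrix (Fin n) (Fin n) (regular Z) := fun i j => ⟨fun p => f p i j, hf i j⟩

theorem RegularMat.toMatrix_mul {f g : Z → Mat n} (hf : RegularMat f) (hg : RegularMat g) :
    (hf.mul hg).toMatrix = hf.toMatrix * hg.toMatrix := by
  ext i j p
  simp [RegularMat.toMatrix, Matrix.mul_apply, Finset.sum_apply]

theorem RegularMat.toMatrix_sub {f g : Z → Mat n} (hf : RegularMat f) (hg : RegularMat g) :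
    (hf.sub hg).toMatrix = hf.toMatrix - hg.toMatrix := rfl

theorem RegularMat.toMatrix_trace {f : Z → Mat n} (hf : RegularMat f) :
    (⟨fun p => (f p).trace, hf.trace⟩ : regular Z) = hf.toMatrix.trace := by
  ext p
  simp [RegularMat.toMatrix, Matrix.trace, Finset.sum_apply]

theorem RegularMat.toMatrix_inv {f : Z → Mat n} (hf : RegularMat f) (h0 : ∀ p, (f p).det ≠ 0) :
    hf.toMatrix * (hf.inv h0).toMatrix = 1 := by
  rw [← RegularMat.toMatrix_mul]
  ext i j p
  simp only [RegularMat.toMatrix]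
  rw [Matrix.mul_nonsing_inv _ (isUnit_iff_ne_zero.2 (h0 p)), Matrix.one_apply, Matrix.one_apply]
  split_ifs <;> rfl

/-- Constant matrices. -/
def constMat (x : Mat n) : Matrix (Fin n) (Fin n) (regular Z) := x.map (algebraMap ℂ _)

theorem derMat_mul {R : Type} [CommRing R] [Algebra ℂ R] (d : Derivation ℂ R R)
    (A B : Matrix (Fin n) (Fin n) R) : (A * B).map d = A.map d * B + A * B.map d := by
  ext i j
  simp only [Matrix.map_apply, Matrix.mul_apply, Matrix.add_apply, map_sum, Derivation.leibniz,
    smul_eq_mul, ← Finset.sum_add_distrib]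
  refine Finset.sum_congr rfl fun k _ => ?_
  ring

theorem derMat_sub {R : Type} [CommRing R] [Algebra ℂ R] (d : Derivation ℂ R R)
    (A B : Matrix (Fin n) (Fin n) R) : (A - B).map d = A.map d - B.map d := by
  ext i j
  simp

theorem derMat_trace {R : Type} [CommRing R] [Algebra ℂ R] (d : Derivation ℂ R R)
    (A : Matrix (Fin n) (Fin n) R) : d A.trace = (A.map d).trace := by
  simp [Matrix.trace]

theorem derMat_inv {R : Type} [CommRing R] [Algebra ℂ R] (d : Derivation ℂ R R)
    (A B : Matrix (Fin n) (Fin n) R) (h : A * B = 1) : B.map d = -(B * A.map d * B) := by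
  have h2 : B * A = 1 := mul_eq_one_comm.mp h
  have h1 : (A * B).map d = 0 := by
    rw [h]
    ext i j
    rw [Matrix.map_apply, Matrix.one_apply]
    split_ifs <;> simp
  rw [derMat_mul] at h1
  have h3 : B * (A.map d * B + A * B.map d) = 0 := by rw [h1, mul_zero]
  rw [mul_add, ← mul_assoc, ← mul_assoc, h2, one_mul] at h3
  exact eq_neg_of_add_eq_zero_right h3

theorem derMat_linear (f : E →ₗ[ℂ] Mat n) (ξ : E →ₗ[ℂ] E) (h : Tangent Z ξ) :
    (RegularMat.linear f : RegularMat fun p : Z => f p).toMatrix.map (lieDer ξ h) =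
      -(RegularMat.linear (f ∘ₗ ξ) : RegularMat fun p : Z => (f ∘ₗ ξ) p).toMatrix := by
  ext i j p
  exact lieFun_linear ξ h ((LinearMap.proj j ∘ₗ LinearMap.proj i) ∘ₗ f) p

theorem constMat_comm (x y : Mat n) {f : Z → Mat n} (hf : RegularMat f)
    (h : RegularMat fun p => x * f p - f p * y) :
    h.toMatrix = constMat x * hf.toMatrix - hf.toMatrix * constMat y := by
  ext i j p
  simp [RegularMat.toMatrix, Matrix.mul_apply, Finset.sum_apply, constMat]

end RegularMatrices

end Matrices

section Framing

open Filter Topology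

variable {𝔥 L : Type} [LieRing 𝔥] [LieAlgebra ℂ 𝔥] [Group L] {S : Symmetry 𝔥 L}

/-- Given a space `Z ⊂ E` and a representation `V`, an invariant subset `O` of `E × V` defines the
framed space `{(p, u) ∈ Z × V : (p, u) ∈ O}`, with the potential pulled back from `Z`. -/
def Geometry.framed (G : Geometry S) {V : Type} [AddCommGroup V] [Module ℂ V]
    (ρ : 𝔥 →ₗ[ℂ] V →ₗ[ℂ] V) (ρ_lie : ∀ x y u, ρ ⁅x, y⁆ u = ρ x (ρ y u) - ρ y (ρ x u))
    (τ : L →* (V →ₗ[ℂ] V)) (τ_ρ : ∀ l x u, τ l (ρ x u) = ρ (S.Ad l x) (τ l u))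
    (O : Set (G.E × V))
    (O_tangent : ∀ x, ∀ p ∈ G.Z, ∀ u, (p, u) ∈ O →
      ∀ᶠ t : ℂ in 𝓝 0, (p + t • G.ξ x p, u + t • ρ x u) ∈ O)
    (O_σ : ∀ l, ∀ p ∈ G.Z, ∀ u, (p, u) ∈ O → (G.σ l p, τ l u) ∈ O) : Geometry S where
  E := G.E × V
  Z := {p | p.1 ∈ G.Z ∧ p ∈ O}
  ξ := LinearMap.mk₂ ℂ (fun x p => (G.ξ x p.1, ρ x p.2))
    (by intros; simp) (by intros; simp) (by intros; simp) (by intros; simp)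
  ξ_lie x y p := Prod.ext (G.ξ_lie x y p.1) (ρ_lie x y p.2)
  tangent := by
    rintro x ⟨p, u⟩ ⟨h1, h2⟩
    filter_upwards [G.tangent x p h1, O_tangent x p h1 u h2] with t h3 h4
    exact ⟨h3, h4⟩
  σ :=
    { toFun := fun l => LinearMap.prodMap (G.σ l) (τ l)
      map_one' := by ext <;> simp
      map_mul' := by intros; ext <;> simp }
  σ_mem l p h := ⟨G.σ_mem l _ h.1, O_σ l _ h.1 _ h.2⟩
  σ_ξ l x p := Prod.ext (G.σ_ξ l x p.1) (τ_ρ l x p.2)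
  W := ⟨fun p => (G.W : G.Z → ℂ) ⟨p.1.1, p.2.1⟩,
    regular_comp (fun p : {p : G.E × V | p.1 ∈ G.Z ∧ p ∈ O} => (⟨p.1.1, p.2.1⟩ : G.Z))
      (fun φ => polyFun_regular _ (linear_polyFun (φ ∘ₗ LinearMap.fst ℂ G.E V))) G.W.2⟩
  W_ξ := by
    rintro x
    refine Subtype.ext (funext fun p => ?_)
    have h1 := lieFun_hasLineDerivAt (G.tangent x) G.W.2 ⟨p.1.1, p.2.1⟩
    have h0 : lieFun (G.ξ x) (G.W : G.Z → ℂ) ⟨p.1.1, p.2.1⟩ = 0 :=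
      congrFun (congrArg Subtype.val (G.W_ξ x)) ⟨p.1.1, p.2.1⟩
    rw [h0] at h1
    refine HasLineDerivAt.lineDeriv (HasDerivAt.congr_of_eventuallyEq h1 ?_)
    rcases p with ⟨⟨p, u⟩, hp, hu⟩
    have hneg : Tendsto (fun t : ℂ => -t) (𝓝 0) (𝓝 0) := by
      simpa using (continuous_neg (G := ℂ)).tendsto 0
    filter_upwards [hneg.eventually (G.tangent x p hp), hneg.eventually (O_tangent x p hp u hu)]
      with t h3 h4
    have h3' : p + t • (-G.ξ x p) ∈ G.Z := by simpa using h3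
    have h5 : (p, u) + t • (-(G.ξ x p, ρ x u)) ∈ {p : G.E × V | p.1 ∈ G.Z ∧ p ∈ O} := by
      constructor
      · exact h3'
      · have : (p, u) + t • (-(G.ξ x p, ρ x u)) = (p + -t • G.ξ x p, u + -t • ρ x u) := by
          simp
        rw [this]; exact h4
    exact (extZero_mem _ h5).trans (extZero_mem _ h3').symm
  W_σ l p := G.W_σ l ⟨p.1.1, p.2.1⟩

end Framing

section Spaces

open Filter Topology

/-- The torus `T × T × T_sc`, where `T` is the group of invertible diagonal matrices and
`T_sc = ℂ* × ℂ*`; its elements are written `(t₁, t₂, λ, μ)`. -/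
abbrev Torus (n : ℕ) : Type := (Fin n → ℂˣ) × (Fin n → ℂˣ) × ℂˣ × ℂˣ

/-- The Lie algebra `𝔫 × 𝔫` of the unipotent radical of `B × B`. -/
abbrev nilSq (n : ℕ) : Type := nil n × nil n

/-- The character `∏ t₁ᵢ ^ ξᵢ ∏ t₂ᵢ ^ τᵢ λ ^ a μ ^ b` of `T × T × T_sc`. -/
def weight {n : ℕ} (ξ τ : Fin n → ℤ) (a b : ℤ) : Torus n →* ℂˣ where
  toFun l := (∏ i, l.1 i ^ ξ i) * (∏ i, l.2.1 i ^ τ i) * l.2.2.1 ^ a * l.2.2.2 ^ b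
  map_one' := by simp
  map_mul' l m := by
    simp only [Prod.fst_mul, Prod.snd_mul, Pi.mul_apply, mul_zpow, Finset.prod_mul_distrib]
    ac_rfl

variable {n : ℕ}

/-- Conjugation of a strictly upper triangular matrix by a diagonal one. -/
def nilConj (t : Fin n → ℂˣ) : nil n →ₗ[ℂ] nil n where
  toFun x := ⟨dg t * x.1 * dg t⁻¹, conj_nil t t⁻¹ x.2⟩
  map_add' x y := Subtype.ext (by
    change dg t * (x.1 + y.1) * dg t⁻¹ = dg t * x.1 * dg t⁻¹ + dg t * y.1 * dg t⁻¹
    noncomm_ring)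
  map_smul' c x := Subtype.ext (by
    change dg t * (c • x.1) * dg t⁻¹ = c • (dg t * x.1 * dg t⁻¹)
    simp)

theorem conj_mul (p q x y : Mat n) (h : q * p = 1) : p * (x * y) * q = (p * x * q) * (p * y * q) := by
  have e : (p * x * q) * (p * y * q) = p * x * (q * p) * y * q := by noncomm_ring
  rw [e, h]; noncomm_ring

/-- The adjoint action of `T × T × T_sc` on `𝔫 × 𝔫` (trivial on `T_sc`). -/
def torusAd (l : Torus n) : nilSq n →ₗ⁅ℂ⁆ nilSq n :=
  { LinearMap.prodMap (nilConj l.1) (nilConj l.2.1) with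
    map_lie' := by
      rintro ⟨x1, x2⟩ ⟨y1, y2⟩
      have key : ∀ (t : Fin n → ℂˣ) (x y : nil n),
          nilConj t ⁅x, y⁆ = ⁅nilConj t x, nilConj t y⁆ := by
        intro t x y
        apply Subtype.ext
        change dg t * (x.1 * y.1 - y.1 * x.1) * dg t⁻¹ =
          (dg t * x.1 * dg t⁻¹) * (dg t * y.1 * dg t⁻¹) -
            (dg t * y.1 * dg t⁻¹) * (dg t * x.1 * dg t⁻¹)
        rw [← conj_mul _ _ _ _ (dg_inv_mul t), ← conj_mul _ _ _ _ (dg_inv_mul t)]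
        noncomm_ring
      exact Prod.ext (key _ _ _) (key _ _ _) }

theorem torusAd_one (x : nilSq n) : torusAd 1 x = x :=
  have key : ∀ y : nil n, nilConj 1 y = y := fun y => Subtype.ext (by simp [nilConj])
  Prod.ext (key _) (key _)

theorem nilConj_mul (t s : Fin n → ℂˣ) (y : nil n) :
    nilConj (t * s) y = nilConj t (nilConj s y) := Subtype.ext (by
  change dg (t * s) * y.1 * dg (t * s)⁻¹ = dg t * (dg s * y.1 * dg s⁻¹) * dg t⁻¹
  rw [mul_inv_rev, dg_mul, dg_mul]
  noncomm_ring)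

theorem torusAd_mul (l m : Torus n) (x : nilSq n) : torusAd (l * m) x = torusAd l (torusAd m x) :=
  Prod.ext (nilConj_mul _ _ _) (nilConj_mul _ _ _)

/-- The symmetries of the reduced spaces: `B × B`-equivariance is equivariance with respect to
`𝔫 × 𝔫` and `T × T`; in addition there is the action of `T_sc`. The regular functions on the torus are
the Laurent polynomials. -/
def symRed (n : ℕ) : Symmetry (nilSq n) (Torus n) where
  Ad := torusAd
  Ad_one := torusAd_one
  Ad_mul := torusAd_mul
  κ := weight 0 0 0 1
  coord := Algebra.adjoin ℂ {f | ∃ ξ τ a b, f = fun l => (weight ξ τ a b l : ℂ)}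

/-- The symmetries of the non-reduced spaces: those of the reduced ones and the group `G = GL_n`. -/
def symNon (n : ℕ) : Symmetry (nilSq n) (Matrix.GeneralLinearGroup (Fin n) ℂ × Torus n) where
  Ad l := torusAd l.2
  Ad_one := torusAd_one
  Ad_mul l m := torusAd_mul l.2 m.2
  κ := (weight 0 0 0 1).comp (MonoidHom.snd _ _)
  coord := Algebra.adjoin ℂ
    ({f | ∃ ξ τ a b, f = fun l => (weight ξ τ a b l.2 : ℂ)} ∪
      {f | ∃ i j, f = fun l => (l.1 : Mat n) i j} ∪
      {f | ∃ i j, f = fun l => ((l.1⁻¹ : Matrix.GeneralLinearGroup (Fin n) ℂ) : Mat n) i j})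

theorem weight_coord (ξ τ : Fin n → ℤ) (a b : ℤ) :
    (fun l => (weight ξ τ a b l : ℂ)) ∈ (symRed n).coord :=
  Algebra.subset_adjoin ⟨ξ, τ, a, b, rfl⟩

theorem weight_coord_snd (ξ τ : Fin n → ℤ) (a b : ℤ) :
    (fun l => ((weight ξ τ a b).comp (MonoidHom.snd _ _) l : ℂ)) ∈ (symNon n).coord :=
  Algebra.subset_adjoin (Or.inl (Or.inl ⟨ξ, τ, a, b, rfl⟩))

theorem derMat_conj {R : Type} [CommRing R] [Algebra ℂ R] (d : Derivation ℂ R R)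
    (a b g Y h : Matrix (Fin n) (Fin n) R) (hgh : g * h = 1)
    (hg : g.map d = -(a * g - g * b)) (hY : Y.map d = -(b * Y - Y * b)) :
    (g * Y * h).map d = -(a * (g * Y * h) - (g * Y * h) * a) := by
  have hhg := mul_eq_one_comm.mp hgh
  have hh : h.map d = h * a - b * h := by
    rw [derMat_inv d g h hgh, hg]
    have : -(h * -(a * g - g * b) * h) = h * a * (g * h) - (h * g) * b * h := by noncomm_ring
    rw [this, hgh, hhg, mul_one, one_mul]
  rw [derMat_mul, derMat_mul, hg, hY, hh]
  noncomm_ring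

theorem derMat_trace_comm {R : Type} [CommRing R] [Algebra ℂ R] (d : Derivation ℂ R R)
    (a X C : Matrix (Fin n) (Fin n) R) (hX : X.map d = -(a * X - X * a))
    (hC : C.map d = -(a * C - C * a)) : d (X * C).trace = 0 := by
  rw [derMat_trace, derMat_mul, hX, hC]
  have : -(a * X - X * a) * C + X * -(a * C - C * a) = X * C * a - a * (X * C) := by noncomm_ring
  rw [this, Matrix.trace_sub, Matrix.trace_mul_comm, sub_self]

theorem inv_sandwich (p q s t g : Mat n) (hp : p * q = 1) (hs : s * t = 1) (hg : g.det ≠ 0) :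
    (p * g * t)⁻¹ = s * g⁻¹ * q := by
  apply Matrix.inv_eq_right_inv
  have hts := mul_eq_one_comm.mp hs
  have : p * g * t * (s * g⁻¹ * q) = p * g * (t * s) * g⁻¹ * q := by noncomm_ring
  rw [this, hts, mul_one, mul_assoc p g, Matrix.mul_nonsing_inv _ (isUnit_iff_ne_zero.2 hg),
    mul_one, hp]

/-- `Ad_{pgt} (c s Y t) = c p (Ad_g Y) q`, where `q = p⁻¹`, `t = s⁻¹`. -/
theorem conj_sandwich (p q s t g Y : Mat n) (c : ℂ) (hp : p * q = 1) (hs : s * t = 1)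
    (hg : g.det ≠ 0) :
    (p * g * t) * (c • (s * Y * t)) * (p * g * t)⁻¹ = c • (p * (g * Y * g⁻¹) * q) := by
  rw [inv_sandwich p q s t g hp hs hg, mul_smul_comm, smul_mul_assoc]
  have hts := mul_eq_one_comm.mp hs
  have : p * g * t * (s * Y * t) * (s * g⁻¹ * q) =
      p * g * (t * s) * Y * (t * s) * g⁻¹ * q := by noncomm_ring
  rw [this, hts]
  congr 1
  noncomm_ring

theorem trace_sandwich (p q X C : Mat n) (b c : ℂ) (hp : p * q = 1) :
    ((b • (p * X * q)) * (c • (p * C * q))).trace = b * c * (X * C).trace := by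
  have hqp := mul_eq_one_comm.mp hp
  rw [smul_mul_smul_comm, Matrix.trace_smul, smul_eq_mul]
  have : p * X * q * (p * C * q) = p * X * (q * p) * C * q := by noncomm_ring
  rw [this, hqp, mul_one, Matrix.trace_mul_comm]
  have : q * (p * X * C) = (q * p) * (X * C) := by noncomm_ring
  rw [this, hqp, one_mul]

/-- `X ↦ c a X b` as a linear map. -/
def sandwich (c : ℂ) (a b : Mat n) : Mat n →ₗ[ℂ] Mat n where
  toFun X := c • (a * X * b)
  map_add' X Y := by rw [mul_add, add_mul, smul_add]
  map_smul' d X := by simp [smul_comm c d]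

theorem sandwich_one : sandwich 1 (1 : Mat n) 1 = 1 := by
  ext1 X; simp [sandwich]

theorem sandwich_mul (c d : ℂ) (a b a' b' : Mat n) :
    sandwich (c * d) (a * a') (b' * b) = sandwich c a b * sandwich d a' b' := by
  refine LinearMap.ext fun X => ?_
  simp [sandwich, mul_smul, mul_assoc, smul_comm c d]

/-- The underlying set of the reduced space `𝔟 × G × 𝔫`, with points `(X, g, Y)`. -/
def redSet (n : ℕ) : Set (Mat n × Mat n × Mat n) :=
  {p | p.1 ∈ upper n ∧ p.2.1.det ≠ 0 ∧ p.2.2 ∈ nil n}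

/-- The action of `𝔫 × 𝔫` on the reduced space. -/
def redXi (n : ℕ) : nilSq n →ₗ[ℂ] Mat n × Mat n × Mat n →ₗ[ℂ] Mat n × Mat n × Mat n :=
  LinearMap.mk₂ ℂ (fun x p => (x.1.1 * p.1 - p.1 * x.1.1, x.1.1 * p.2.1 - p.2.1 * x.2.1,
      x.2.1 * p.2.2 - p.2.2 * x.2.1))
    (by
      intros
      simp only [Prod.fst_add, Prod.snd_add, Submodule.coe_add, Prod.mk_add_mk]
      congr 1; · noncomm_ring
      congr 1 <;> noncomm_ring)
    (by intros; simp [smul_sub])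
    (by
      intros
      simp only [Prod.fst_add, Prod.snd_add, Prod.mk_add_mk]
      congr 1; · noncomm_ring
      congr 1 <;> noncomm_ring)
    (by intros; simp [smul_sub])

/-- The action of `T × T × T_sc` on the reduced space:
`(t₁, t₂, λ, μ) · (X, g, Y) = (λ² t₁ X t₁⁻¹, t₁ g t₂⁻¹, λ⁻² μ² t₂ Y t₂⁻¹)`. -/
def redSigma (n : ℕ) : Torus n →* (Mat n × Mat n × Mat n →ₗ[ℂ] Mat n × Mat n × Mat n) where
  toFun l := LinearMap.prodMap (sandwich (l.2.2.1 ^ 2 : ℂ) (dg l.1) (dg l.1⁻¹))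
    (LinearMap.prodMap (sandwich 1 (dg l.1) (dg l.2.1⁻¹))
      (sandwich ((l.2.2.1 : ℂ)⁻¹ ^ 2 * (l.2.2.2 : ℂ) ^ 2) (dg l.2.1) (dg l.2.1⁻¹)))
  map_one' := by
    have h : sandwich 1 (1 : Mat n) 1 = LinearMap.id := sandwich_one
    simp [h]
    rfl
  map_mul' l m := by
    have h1 := sandwich_mul ((l.2.2.1 : ℂ) ^ 2) ((m.2.2.1 : ℂ) ^ 2) (dg l.1) (dg l.1⁻¹)
      (dg m.1) (dg m.1⁻¹)
    have h2 := sandwich_mul 1 1 (dg l.1) (dg l.2.1⁻¹) (dg m.1) (dg m.2.1⁻¹)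
    have h3 := sandwich_mul ((l.2.2.1 : ℂ)⁻¹ ^ 2 * (l.2.2.2 : ℂ) ^ 2)
      ((m.2.2.1 : ℂ)⁻¹ ^ 2 * (m.2.2.2 : ℂ) ^ 2) (dg l.2.1) (dg l.2.1⁻¹) (dg m.2.1) (dg m.2.1⁻¹)
    rw [one_mul] at h2
    have e1 : ((l * m).2.2.1 : ℂ) ^ 2 = (l.2.2.1 : ℂ) ^ 2 * (m.2.2.1 : ℂ) ^ 2 := by
      simp [mul_pow]
    have e3 : ((l * m).2.2.1 : ℂ)⁻¹ ^ 2 * ((l * m).2.2.2 : ℂ) ^ 2 =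
        (l.2.2.1 : ℂ)⁻¹ ^ 2 * (l.2.2.2 : ℂ) ^ 2 * ((m.2.2.1 : ℂ)⁻¹ ^ 2 * (m.2.2.2 : ℂ) ^ 2) := by
      simp [mul_pow]; ring
    rw [e1, e3]
    simp only [Prod.fst_mul, Prod.snd_mul, mul_inv_rev, dg_mul]
    rw [h1, h2, h3]
    rfl

theorem redSet_det (p : redSet n) : (p : Mat n × Mat n × Mat n).2.1.det ≠ 0 := p.2.2.1

theorem redX_regular : RegularMat fun p : redSet n => (p : Mat n × Mat n × Mat n).1 :=
  RegularMat.linear (LinearMap.fst ℂ (Mat n) (Mat n × Mat n))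

theorem redg_regular : RegularMat fun p : redSet n => (p : Mat n × Mat n × Mat n).2.1 :=
  RegularMat.linear (LinearMap.fst ℂ (Mat n) (Mat n) ∘ₗ LinearMap.snd ℂ (Mat n) (Mat n × Mat n))

theorem redY_regular : RegularMat fun p : redSet n => (p : Mat n × Mat n × Mat n).2.2 :=
  RegularMat.linear (LinearMap.snd ℂ (Mat n) (Mat n) ∘ₗ LinearMap.snd ℂ (Mat n) (Mat n × Mat n))

theorem redW_regular : RegularMat fun p : redSet n =>
    p.1.1 * (p.1.2.1 * p.1.2.2 * p.1.2.1⁻¹) :=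
  redX_regular.mul ((redg_regular.mul redY_regular).mul (redg_regular.inv redSet_det))

theorem redTangent (x : nilSq n) : Tangent (redSet n) (redXi n x) := by
  rintro p ⟨h1, h2, h3⟩
  have hc := line_continuous (LinearMap.fst ℂ (Mat n) (Mat n) ∘ₗ
    LinearMap.snd ℂ (Mat n) (Mat n × Mat n)) p (redXi n x p)
  filter_upwards [det_eventually hc.continuousAt (by simpa using h2)] with t ht
  have hx := nil_le_upper x.1.2
  refine ⟨add_mem h1 (Submodule.smul_mem _ _ (sub_mem (upper_mul hx h1) (upper_mul h1 hx))), ht,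
    add_mem h3 (Submodule.smul_mem _ _ (sub_mem (nil_mul x.2.2 h3) (nil_mul h3 x.2.2)))⟩

/-- The reduced space `𝔟 × G × 𝔫` with its potential `Tr (X Ad_g Y)`. -/
def redGeom (n : ℕ) : Geometry (symRed n) where
  E := Mat n × Mat n × Mat n
  Z := redSet n
  ξ := redXi n
  ξ_lie x y p := by
    refine Prod.ext ?_ (Prod.ext ?_ ?_)
    · change (x.1.1 * y.1.1 - y.1.1 * x.1.1) * p.1 - p.1 * (x.1.1 * y.1.1 - y.1.1 * x.1.1) =
        (x.1.1 * (y.1.1 * p.1 - p.1 * y.1.1) - (y.1.1 * p.1 - p.1 * y.1.1) * x.1.1) -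
        (y.1.1 * (x.1.1 * p.1 - p.1 * x.1.1) - (x.1.1 * p.1 - p.1 * x.1.1) * y.1.1)
      noncomm_ring
    · change (x.1.1 * y.1.1 - y.1.1 * x.1.1) * p.2.1 - p.2.1 * (x.2.1 * y.2.1 - y.2.1 * x.2.1) =
        (x.1.1 * (y.1.1 * p.2.1 - p.2.1 * y.2.1) - (y.1.1 * p.2.1 - p.2.1 * y.2.1) * x.2.1) -
        (y.1.1 * (x.1.1 * p.2.1 - p.2.1 * x.2.1) - (x.1.1 * p.2.1 - p.2.1 * x.2.1) * y.2.1)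
      noncomm_ring
    · change (x.2.1 * y.2.1 - y.2.1 * x.2.1) * p.2.2 - p.2.2 * (x.2.1 * y.2.1 - y.2.1 * x.2.1) =
        (x.2.1 * (y.2.1 * p.2.2 - p.2.2 * y.2.1) - (y.2.1 * p.2.2 - p.2.2 * y.2.1) * x.2.1) -
        (y.2.1 * (x.2.1 * p.2.2 - p.2.2 * x.2.1) - (x.2.1 * p.2.2 - p.2.2 * x.2.1) * y.2.1)
      noncomm_ring
  tangent := redTangent
  σ := redSigma n
  σ_mem := by
    rintro l p ⟨h1, h2, h3⟩
    refine ⟨Submodule.smul_mem _ _ (conj_upper _ _ h1), ?_,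
      Submodule.smul_mem _ _ (conj_nil _ _ h3)⟩
    change ((1 : ℂ) • (dg l.1 * p.2.1 * dg l.2.1⁻¹)).det ≠ 0
    rw [one_smul, Matrix.det_mul, Matrix.det_mul]
    exact mul_ne_zero (mul_ne_zero (det_dg_ne _) h2) (det_dg_ne _)
  σ_ξ l x p := by
    have key : ∀ (c : ℂ) (t s : Fin n → ℂˣ) (y z : nil n) (A : Mat n),
        c • (dg t * (y.1 * A - A * z.1) * dg s⁻¹) =
          (nilConj t y).1 * (c • (dg t * A * dg s⁻¹)) -
            (c • (dg t * A * dg s⁻¹)) * (nilConj s z).1 := by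
      intro c t s y z A
      change _ = (dg t * y.1 * dg t⁻¹) * (c • (dg t * A * dg s⁻¹)) -
            (c • (dg t * A * dg s⁻¹)) * (dg s * z.1 * dg s⁻¹)
      rw [mul_smul_comm, smul_mul_assoc, ← smul_sub]
      have e1 : (dg t * y.1 * dg t⁻¹) * (dg t * A * dg s⁻¹) =
          dg t * y.1 * (dg t⁻¹ * dg t) * A * dg s⁻¹ := by noncomm_ring
      have e2 : (dg t * A * dg s⁻¹) * (dg s * z.1 * dg s⁻¹) =
          dg t * A * (dg s⁻¹ * dg s) * z.1 * dg s⁻¹ := by noncomm_ring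
      rw [e1, e2, dg_inv_mul, dg_inv_mul]
      congr 1
      noncomm_ring
    exact Prod.ext (key _ _ _ _ _ _) (Prod.ext (key _ _ _ _ _ _) (key _ _ _ _ _ _))
  W := ⟨fun p => (p.1.1 * (p.1.2.1 * p.1.2.2 * p.1.2.1⁻¹)).trace, redW_regular.trace⟩
  W_ξ x := by
    have hd := redTangent x
    set d := lieDer (redXi n x) hd with hdef
    have hX : redX_regular.toMatrix.map d =
        -(constMat x.1.1 * redX_regular.toMatrix - redX_regular.toMatrix * constMat x.1.1) := by
      rw [← constMat_comm x.1.1 x.1.1 redX_regular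
        ((RegularMat.linear (LinearMap.fst ℂ (Mat n) (Mat n × Mat n) ∘ₗ redXi n x) :))]
      exact derMat_linear (LinearMap.fst ℂ (Mat n) (Mat n × Mat n)) (redXi n x) hd
    have hg : redg_regular.toMatrix.map d =
        -(constMat x.1.1 * redg_regular.toMatrix - redg_regular.toMatrix * constMat x.2.1) := by
      rw [← constMat_comm x.1.1 x.2.1 redg_regular
        ((RegularMat.linear ((LinearMap.fst ℂ (Mat n) (Mat n) ∘ₗ
          LinearMap.snd ℂ (Mat n) (Mat n × Mat n)) ∘ₗ redXi n x) :))]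
      exact derMat_linear (LinearMap.fst ℂ (Mat n) (Mat n) ∘ₗ
          LinearMap.snd ℂ (Mat n) (Mat n × Mat n)) (redXi n x) hd
    have hY : redY_regular.toMatrix.map d =
        -(constMat x.2.1 * redY_regular.toMatrix - redY_regular.toMatrix * constMat x.2.1) := by
      rw [← constMat_comm x.2.1 x.2.1 redY_regular
        ((RegularMat.linear ((LinearMap.snd ℂ (Mat n) (Mat n) ∘ₗ
          LinearMap.snd ℂ (Mat n) (Mat n × Mat n)) ∘ₗ redXi n x) :))]
      exact derMat_linear (LinearMap.snd ℂ (Mat n) (Mat n) ∘ₗ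
          LinearMap.snd ℂ (Mat n) (Mat n × Mat n)) (redXi n x) hd
    have hW : (⟨fun p : redSet n => (p.1.1 * (p.1.2.1 * p.1.2.2 * p.1.2.1⁻¹)).trace,
        redW_regular.trace⟩ : regular (redSet n)) =
        (redX_regular.toMatrix * (redg_regular.toMatrix * redY_regular.toMatrix *
          (redg_regular.inv redSet_det).toMatrix)).trace := by
      rw [redW_regular.toMatrix_trace, ← RegularMat.toMatrix_mul, ← RegularMat.toMatrix_mul,
        ← RegularMat.toMatrix_mul]
    rw [hW]
    exact derMat_trace_comm d _ _ _ hX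
      (derMat_conj d _ _ _ _ _ (redg_regular.toMatrix_inv redSet_det) hg hY)
  W_σ l p := by
    have h : (l.2.2.1 : ℂ) ≠ 0 := Units.ne_zero _
    have hk : ((symRed n).κ l : ℂ) = l.2.2.2 := by simp [symRed, weight]
    change (((l.2.2.1 : ℂ) ^ 2 • (dg l.1 * p.1.1 * dg l.1⁻¹)) *
      (((1 : ℂ) • (dg l.1 * p.1.2.1 * dg l.2.1⁻¹)) *
        (((l.2.2.1 : ℂ)⁻¹ ^ 2 * (l.2.2.2 : ℂ) ^ 2) • (dg l.2.1 * p.1.2.2 * dg l.2.1⁻¹)) *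
        ((1 : ℂ) • (dg l.1 * p.1.2.1 * dg l.2.1⁻¹))⁻¹)).trace =
      _ * (p.1.1 * (p.1.2.1 * p.1.2.2 * p.1.2.1⁻¹)).trace
    rw [one_smul, conj_sandwich _ _ _ _ _ _ _ (dg_mul_inv _) (dg_mul_inv _) p.2.2.1,
      trace_sandwich _ _ _ _ _ _ (dg_mul_inv _), hk]
    congr 1
    field_simp

end Spaces

section NonReduced

open Filter Topology

variable {n : ℕ}

/-- The ambient vector space of the non-reduced space, with points
`(X, (g₁, Y₁), (g₂, Y₂))`. -/
abbrev NonAmb (n : ℕ) : Type := Mat n × (Mat n × Mat n) × (Mat n × Mat n)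

/-- The underlying set of the non-reduced space `𝔤 × (G × 𝔫) × (G × 𝔫)`. -/
def nonSet (n : ℕ) : Set (NonAmb n) :=
  {p | (p.2.1.1.det ≠ 0 ∧ p.2.1.2 ∈ nil n) ∧ (p.2.2.1.det ≠ 0 ∧ p.2.2.2 ∈ nil n)}

/-- The coordinate `X`. -/
def nonX (n : ℕ) : NonAmb n →ₗ[ℂ] Mat n := LinearMap.fst ℂ _ _

/-- The coordinate `g₁`. -/
def nong1 (n : ℕ) : NonAmb n →ₗ[ℂ] Mat n :=
  LinearMap.fst ℂ _ _ ∘ₗ LinearMap.fst ℂ _ _ ∘ₗ LinearMap.snd ℂ _ _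

/-- The coordinate `Y₁`. -/
def nonY1 (n : ℕ) : NonAmb n →ₗ[ℂ] Mat n :=
  LinearMap.snd ℂ _ _ ∘ₗ LinearMap.fst ℂ _ _ ∘ₗ LinearMap.snd ℂ _ _

/-- The coordinate `g₂`. -/
def nong2 (n : ℕ) : NonAmb n →ₗ[ℂ] Mat n :=
  LinearMap.fst ℂ _ _ ∘ₗ LinearMap.snd ℂ _ _ ∘ₗ LinearMap.snd ℂ _ _

/-- The coordinate `Y₂`. -/
def nonY2 (n : ℕ) : NonAmb n →ₗ[ℂ] Mat n :=
  LinearMap.snd ℂ _ _ ∘ₗ LinearMap.snd ℂ _ _ ∘ₗ LinearMap.snd ℂ _ _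

/-- The action of `𝔫` on the pairs `(g, Y)`: `x · (g, Y) = (- g x, [x, Y])`. -/
def pairXi (n : ℕ) : nil n →ₗ[ℂ] Mat n × Mat n →ₗ[ℂ] Mat n × Mat n :=
  LinearMap.mk₂ ℂ (fun x p => (-(p.1 * x.1), x.1 * p.2 - p.2 * x.1))
    (by
      intros
      simp only [Submodule.coe_add, Prod.mk_add_mk]
      congr 1 <;> noncomm_ring)
    (by intros; simp [smul_sub])
    (by
      intros
      simp only [Prod.fst_add, Prod.snd_add, Prod.mk_add_mk]
      congr 1 <;> noncomm_ring)
    (by intros; simp [smul_sub])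

theorem pairXi_lie (x y : nil n) (p : Mat n × Mat n) :
    pairXi n ⁅x, y⁆ p = pairXi n x (pairXi n y p) - pairXi n y (pairXi n x p) := by
  refine Prod.ext ?_ ?_
  · change -(p.1 * (x.1 * y.1 - y.1 * x.1)) = -(-(p.1 * y.1) * x.1) - -(-(p.1 * x.1) * y.1)
    noncomm_ring
  · change (x.1 * y.1 - y.1 * x.1) * p.2 - p.2 * (x.1 * y.1 - y.1 * x.1) =
      (x.1 * (y.1 * p.2 - p.2 * y.1) - (y.1 * p.2 - p.2 * y.1) * x.1) -
      (y.1 * (x.1 * p.2 - p.2 * x.1) - (x.1 * p.2 - p.2 * x.1) * y.1)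
    noncomm_ring

/-- The action of `𝔫 × 𝔫` on the non-reduced space. -/
def nonXi (n : ℕ) : nilSq n →ₗ[ℂ] NonAmb n →ₗ[ℂ] NonAmb n :=
  LinearMap.mk₂ ℂ (fun x p => (0, pairXi n x.1 p.2.1, pairXi n x.2 p.2.2))
    (by intros; simp) (by intros; simp) (by intros; simp) (by intros; simp)

/-- The action of `G × T × T × T_sc` on the non-reduced space: `(h, t₁, t₂, λ, μ)` maps
`(X, g₁, Y₁, g₂, Y₂)` to
`(λ² h X h⁻¹, h g₁ t₁⁻¹, λ⁻² μ² t₁ Y₁ t₁⁻¹, h g₂ t₂⁻¹, λ⁻² μ² t₂ Y₂ t₂⁻¹)`. -/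
def nonSigma (n : ℕ) : Matrix.GeneralLinearGroup (Fin n) ℂ × Torus n →*
    (NonAmb n →ₗ[ℂ] NonAmb n) where
  toFun l := LinearMap.prodMap
    (sandwich (l.2.2.2.1 ^ 2 : ℂ) (l.1 : Mat n) (↑(l.1⁻¹) : Mat n))
    (LinearMap.prodMap
      (LinearMap.prodMap (sandwich 1 (l.1 : Mat n) (dg l.2.1⁻¹))
        (sandwich ((l.2.2.2.1 : ℂ)⁻¹ ^ 2 * (l.2.2.2.2 : ℂ) ^ 2) (dg l.2.1) (dg l.2.1⁻¹)))
      (LinearMap.prodMap (sandwich 1 (l.1 : Mat n) (dg l.2.2.1⁻¹))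
        (sandwich ((l.2.2.2.1 : ℂ)⁻¹ ^ 2 * (l.2.2.2.2 : ℂ) ^ 2) (dg l.2.2.1) (dg l.2.2.1⁻¹))))
  map_one' := by
    have h : sandwich 1 (1 : Mat n) 1 = LinearMap.id := sandwich_one
    simp [h]
    rfl
  map_mul' l m := by
    have h1 := sandwich_mul ((l.2.2.2.1 : ℂ) ^ 2) ((m.2.2.2.1 : ℂ) ^ 2) (l.1 : Mat n)
      (↑(l.1⁻¹) : Mat n) (m.1 : Mat n) (↑(m.1⁻¹) : Mat n)
    have h2 : ∀ t s : Fin n → ℂˣ, _ := fun t s =>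
      sandwich_mul 1 1 (l.1 : Mat n) (dg t⁻¹) (m.1 : Mat n) (dg s⁻¹)
    have h3 : ∀ t s : Fin n → ℂˣ, _ := fun t s =>
      sandwich_mul ((l.2.2.2.1 : ℂ)⁻¹ ^ 2 * (l.2.2.2.2 : ℂ) ^ 2)
      ((m.2.2.2.1 : ℂ)⁻¹ ^ 2 * (m.2.2.2.2 : ℂ) ^ 2) (dg t) (dg t⁻¹) (dg s) (dg s⁻¹)
    rw [one_mul] at h2
    have e1 : ((l * m).2.2.2.1 : ℂ) ^ 2 = (l.2.2.2.1 : ℂ) ^ 2 * (m.2.2.2.1 : ℂ) ^ 2 := by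
      simp [mul_pow]
    have e3 : ((l * m).2.2.2.1 : ℂ)⁻¹ ^ 2 * ((l * m).2.2.2.2 : ℂ) ^ 2 =
        (l.2.2.2.1 : ℂ)⁻¹ ^ 2 * (l.2.2.2.2 : ℂ) ^ 2 *
          ((m.2.2.2.1 : ℂ)⁻¹ ^ 2 * (m.2.2.2.2 : ℂ) ^ 2) := by
      simp [mul_pow]; ring
    rw [e1, e3]
    simp only [Prod.fst_mul, Prod.snd_mul, mul_inv_rev, dg_mul, Units.val_mul]
    rw [h1, h2, h2, h3, h3]
    rfl

theorem nonX_regular : RegularMat fun p : nonSet n => nonX n p := RegularMat.linear _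
theorem nong1_regular : RegularMat fun p : nonSet n => nong1 n p := RegularMat.linear _
theorem nonY1_regular : RegularMat fun p : nonSet n => nonY1 n p := RegularMat.linear _
theorem nong2_regular : RegularMat fun p : nonSet n => nong2 n p := RegularMat.linear _
theorem nonY2_regular : RegularMat fun p : nonSet n => nonY2 n p := RegularMat.linear _

theorem nonSet_det1 (p : nonSet n) : (nong1 n p).det ≠ 0 := p.2.1.1
theorem nonSet_det2 (p : nonSet n) : (nong2 n p).det ≠ 0 := p.2.2.1

theorem nonW_regular : RegularMat fun p : nonSet n => nonX n p *
    (nong2 n p * nonY2 n p * (nong2 n p)⁻¹ - nong1 n p * nonY1 n p * (nong1 n p)⁻¹) :=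
  nonX_regular.mul (((nong2_regular.mul nonY2_regular).mul (nong2_regular.inv nonSet_det2)).sub
    ((nong1_regular.mul nonY1_regular).mul (nong1_regular.inv nonSet_det1)))

theorem nonTangent (x : nilSq n) : Tangent (nonSet n) (nonXi n x) := by
  rintro p ⟨⟨h1, h2⟩, h3, h4⟩
  have hc1 := line_continuous (nong1 n) p (nonXi n x p)
  have hc2 := line_continuous (nong2 n) p (nonXi n x p)
  filter_upwards [det_eventually hc1.continuousAt (by rw [zero_smul, add_zero]; exact h1),
    det_eventually hc2.continuousAt (by rw [zero_smul, add_zero]; exact h3)] with t ht ht'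
  exact ⟨⟨ht, add_mem h2 (Submodule.smul_mem _ _ (sub_mem (nil_mul x.1.2 h2) (nil_mul h2 x.1.2)))⟩,
    ht', add_mem h4 (Submodule.smul_mem _ _ (sub_mem (nil_mul x.2.2 h4) (nil_mul h4 x.2.2)))⟩

theorem gl_mul_inv (h : Matrix.GeneralLinearGroup (Fin n) ℂ) :
    (h : Mat n) * (↑(h⁻¹) : Mat n) = 1 := Units.mul_inv h

theorem gl_inv_mul (h : Matrix.GeneralLinearGroup (Fin n) ℂ) :
    (↑(h⁻¹) : Mat n) * (h : Mat n) = 1 := Units.inv_mul h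

theorem gl_det (h : Matrix.GeneralLinearGroup (Fin n) ℂ) : (h : Mat n).det ≠ 0 := by
  intro h0
  have := congrArg Matrix.det (gl_mul_inv h)
  rw [Matrix.det_mul, h0, zero_mul, Matrix.det_one] at this
  exact zero_ne_one this

theorem pair_equivariant (h : Mat n) (t : Fin n → ℂˣ) (c : ℂ) (x : nil n) (g Y : Mat n) :
    ((1 : ℂ) • (h * (-(g * x.1)) * dg t⁻¹) =
      -(((1 : ℂ) • (h * g * dg t⁻¹)) * (nilConj t x).1)) ∧
    c • (dg t * (x.1 * Y - Y * x.1) * dg t⁻¹) =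
      (nilConj t x).1 * (c • (dg t * Y * dg t⁻¹)) -
        (c • (dg t * Y * dg t⁻¹)) * (nilConj t x).1 := by
  change ((1 : ℂ) • (h * (-(g * x.1)) * dg t⁻¹) =
      -(((1 : ℂ) • (h * g * dg t⁻¹)) * (dg t * x.1 * dg t⁻¹))) ∧
    c • (dg t * (x.1 * Y - Y * x.1) * dg t⁻¹) =
      (dg t * x.1 * dg t⁻¹) * (c • (dg t * Y * dg t⁻¹)) -
        (c • (dg t * Y * dg t⁻¹)) * (dg t * x.1 * dg t⁻¹)
  constructor
  · have e : (h * g * dg t⁻¹) * (dg t * x.1 * dg t⁻¹) =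
        h * g * (dg t⁻¹ * dg t) * x.1 * dg t⁻¹ := by noncomm_ring
    rw [one_smul, one_smul, e, dg_inv_mul]
    noncomm_ring
  · rw [mul_smul_comm, smul_mul_assoc, ← smul_sub, ← conj_mul _ _ _ _ (dg_inv_mul t),
      ← conj_mul _ _ _ _ (dg_inv_mul t)]
    congr 1
    noncomm_ring

theorem constMat_right (y : Mat n) {E : Type} [AddCommGroup E] [Module ℂ E] {Z : Set E}
    {f : Z → Mat n} (hf : RegularMat f) (h : RegularMat fun p => -(f p * y)) :
    -h.toMatrix = hf.toMatrix * constMat y := by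
  ext i j p
  simp [RegularMat.toMatrix, Matrix.mul_apply, Finset.sum_apply, constMat]

theorem derMat_conj_right {R : Type} [CommRing R] [Algebra ℂ R] (d : Derivation ℂ R R)
    (b g Y h : Matrix (Fin n) (Fin n) R) (hgh : g * h = 1)
    (hg : g.map d = g * b) (hY : Y.map d = -(b * Y - Y * b)) : (g * Y * h).map d = 0 := by
  have := derMat_conj d 0 b g Y h hgh (by rw [hg]; noncomm_ring) hY
  simpa using this

/-- The non-reduced space `𝔤 × (G × 𝔫) × (G × 𝔫)` with its potential
`Tr (X (Ad_{g₂} Y₂ - Ad_{g₁} Y₁))`. -/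
def nonGeom (n : ℕ) : Geometry (symNon n) where
  E := NonAmb n
  Z := nonSet n
  ξ := nonXi n
  ξ_lie x y p := Prod.ext (sub_zero (0 : Mat n)).symm
    (Prod.ext (pairXi_lie _ _ _) (pairXi_lie _ _ _))
  tangent := nonTangent
  σ := nonSigma n
  σ_mem := by
    rintro l p ⟨⟨h1, h2⟩, h3, h4⟩
    have key : ∀ (g : Mat n) (t : Fin n → ℂˣ), g.det ≠ 0 →
        ((1 : ℂ) • ((l.1 : Mat n) * g * dg t)).det ≠ 0 := by
      intro g t hg
      rw [one_smul, Matrix.det_mul, Matrix.det_mul]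
      exact mul_ne_zero (mul_ne_zero (gl_det _) hg) (det_dg_ne _)
    exact ⟨⟨key _ _ h1, Submodule.smul_mem _ _ (conj_nil _ _ h2)⟩, key _ _ h3,
      Submodule.smul_mem _ _ (conj_nil _ _ h4)⟩
  σ_ξ l x p := by
    have e1 := pair_equivariant (l.1 : Mat n) l.2.1 ((l.2.2.2.1 : ℂ)⁻¹ ^ 2 * (l.2.2.2.2 : ℂ) ^ 2)
      x.1 p.2.1.1 p.2.1.2
    have e2 := pair_equivariant (l.1 : Mat n) l.2.2.1 ((l.2.2.2.1 : ℂ)⁻¹ ^ 2 * (l.2.2.2.2 : ℂ) ^ 2)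
      x.2 p.2.2.1 p.2.2.2
    refine Prod.ext ?_ (Prod.ext (Prod.ext e1.1 e1.2) (Prod.ext e2.1 e2.2))
    exact map_zero (sandwich _ _ _)
  W := ⟨fun p => (nonX n p * (nong2 n p * nonY2 n p * (nong2 n p)⁻¹ -
    nong1 n p * nonY1 n p * (nong1 n p)⁻¹)).trace, nonW_regular.trace⟩
  W_ξ x := by
    have hd := nonTangent x
    set d := lieDer (nonXi n x) hd with hdef
    have hX : nonX_regular.toMatrix.map d = 0 := by
      refine (derMat_linear (nonX n) (nonXi n x) hd).trans ?_
      ext i j p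
      exact neg_zero
    have hg1 : nong1_regular.toMatrix.map d = nong1_regular.toMatrix * constMat x.1.1 := by
      rw [← constMat_right x.1.1 nong1_regular
        ((RegularMat.linear (nong1 n ∘ₗ nonXi n x) :))]
      exact derMat_linear (nong1 n) (nonXi n x) hd
    have hg2 : nong2_regular.toMatrix.map d = nong2_regular.toMatrix * constMat x.2.1 := by
      rw [← constMat_right x.2.1 nong2_regular
        ((RegularMat.linear (nong2 n ∘ₗ nonXi n x) :))]
      exact derMat_linear (nong2 n) (nonXi n x) hd
    have hY1 : nonY1_regular.toMatrix.map d =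
        -(constMat x.1.1 * nonY1_regular.toMatrix - nonY1_regular.toMatrix * constMat x.1.1) := by
      rw [← constMat_comm x.1.1 x.1.1 nonY1_regular
        ((RegularMat.linear (nonY1 n ∘ₗ nonXi n x) :))]
      exact derMat_linear (nonY1 n) (nonXi n x) hd
    have hY2 : nonY2_regular.toMatrix.map d =
        -(constMat x.2.1 * nonY2_regular.toMatrix - nonY2_regular.toMatrix * constMat x.2.1) := by
      rw [← constMat_comm x.2.1 x.2.1 nonY2_regular
        ((RegularMat.linear (nonY2 n ∘ₗ nonXi n x) :))]
      exact derMat_linear (nonY2 n) (nonXi n x) hd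
    have hW : (⟨fun p : nonSet n => (nonX n p * (nong2 n p * nonY2 n p * (nong2 n p)⁻¹ -
        nong1 n p * nonY1 n p * (nong1 n p)⁻¹)).trace, nonW_regular.trace⟩ : regular (nonSet n)) =
        (nonX_regular.toMatrix * (nong2_regular.toMatrix * nonY2_regular.toMatrix *
          (nong2_regular.inv nonSet_det2).toMatrix - nong1_regular.toMatrix *
          nonY1_regular.toMatrix * (nong1_regular.inv nonSet_det1).toMatrix)).trace := by
      rw [nonW_regular.toMatrix_trace, ← RegularMat.toMatrix_mul, ← RegularMat.toMatrix_mul,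
        ← RegularMat.toMatrix_mul, ← RegularMat.toMatrix_mul, ← RegularMat.toMatrix_sub,
        ← RegularMat.toMatrix_mul]
    rw [hW, derMat_trace, derMat_mul, derMat_sub, hX,
      derMat_conj_right d _ _ _ _ (nong1_regular.toMatrix_inv nonSet_det1) hg1 hY1,
      derMat_conj_right d _ _ _ _ (nong2_regular.toMatrix_inv nonSet_det2) hg2 hY2]
    simp
  W_σ l p := by
    have h : (l.2.2.2.1 : ℂ) ≠ 0 := Units.ne_zero _
    have hk : ((symNon n).κ l : ℂ) = l.2.2.2.2 := by simp [symNon, weight]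
    change (((l.2.2.2.1 : ℂ) ^ 2 • ((l.1 : Mat n) * nonX n p * (↑(l.1⁻¹) : Mat n))) *
      (((1 : ℂ) • ((l.1 : Mat n) * nong2 n p * dg l.2.2.1⁻¹)) *
        (((l.2.2.2.1 : ℂ)⁻¹ ^ 2 * (l.2.2.2.2 : ℂ) ^ 2) •
          (dg l.2.2.1 * nonY2 n p * dg l.2.2.1⁻¹)) *
        ((1 : ℂ) • ((l.1 : Mat n) * nong2 n p * dg l.2.2.1⁻¹))⁻¹ -
      ((1 : ℂ) • ((l.1 : Mat n) * nong1 n p * dg l.2.1⁻¹)) *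
        (((l.2.2.2.1 : ℂ)⁻¹ ^ 2 * (l.2.2.2.2 : ℂ) ^ 2) •
          (dg l.2.1 * nonY1 n p * dg l.2.1⁻¹)) *
        ((1 : ℂ) • ((l.1 : Mat n) * nong1 n p * dg l.2.1⁻¹))⁻¹)).trace =
      _ * (nonX n p * (nong2 n p * nonY2 n p * (nong2 n p)⁻¹ -
        nong1 n p * nonY1 n p * (nong1 n p)⁻¹)).trace
    rw [one_smul, one_smul,
      conj_sandwich _ _ _ _ _ _ _ (gl_mul_inv l.1) (dg_mul_inv _) (nonSet_det1 p),
      conj_sandwich _ _ _ _ _ _ _ (gl_mul_inv l.1) (dg_mul_inv _) (nonSet_det2 p),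
      ← smul_sub, ← sub_mul, ← mul_sub,
      trace_sandwich _ _ _ _ _ _ (gl_mul_inv l.1), hk]
    congr 1
    field_simp

end NonReduced

section Framed

open Filter Topology

variable {n : ℕ}

/-- The last index. -/
def last (n : ℕ) [NeZero n] : Fin n := ⟨n - 1, Nat.pred_lt (NeZero.ne n)⟩

/-- The action of `𝔫 × 𝔫` on the framing of the reduced space, through the first factor. -/
def redRho (n : ℕ) : nilSq n →ₗ[ℂ] (Fin n → ℂ) →ₗ[ℂ] (Fin n → ℂ) :=
  LinearMap.mk₂ ℂ (fun x u => x.1.1.mulVec u)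
    (by intros; simp [Matrix.add_mulVec]) (by intros; simp [Matrix.smul_mulVec])
    (by intros; simp [Matrix.mulVec_add]) (by intros; simp [Matrix.mulVec_smul])

/-- The action of `T × T × T_sc` on the framing of the reduced space:
`(t₁, t₂, λ, μ) · u = t₁ u`. -/
def redTau (n : ℕ) : Torus n →* ((Fin n → ℂ) →ₗ[ℂ] (Fin n → ℂ)) where
  toFun l := Matrix.mulVecLin (dg l.1)
  map_one' := by
    refine LinearMap.ext fun u => ?_
    simp
  map_mul' l m := by
    refine LinearMap.ext fun u => ?_
    change (dg (l.1 * m.1)).mulVec u = (dg l.1).mulVec ((dg m.1).mulVec u)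
    rw [dg_mul, Matrix.mulVec_mulVec]

/-- The stability condition of the reduced framed space:
`ℂ⟨X, Ad_g Y⟩ u = V` and `(g⁻¹ u)_n ≠ 0`. -/
def redStable (n : ℕ) [NeZero n] : Set ((Mat n × Mat n × Mat n) × (Fin n → ℂ)) :=
  {p | Cyclic p.1.1 (p.1.2.1 * p.1.2.2 * p.1.2.1⁻¹) p.2 ∧ (p.1.2.1⁻¹.mulVec p.2) (last n) ≠ 0}

theorem redStable_tangent [NeZero n] (x : nilSq n) : ∀ p ∈ redSet n, ∀ u, (p, u) ∈ redStable n →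
    ∀ᶠ t : ℂ in 𝓝 0, (p + t • redXi n x p, u + t • redRho n x u) ∈ redStable n := by
  rintro p ⟨h1, h2, h3⟩ u ⟨h4, h5⟩
  have c1 := (line_continuous (LinearMap.fst ℂ (Mat n) (Mat n × Mat n)) p
    (redXi n x p)).continuousAt (x := 0)
  have c2 := (line_continuous (LinearMap.fst ℂ (Mat n) (Mat n) ∘ₗ
    LinearMap.snd ℂ (Mat n) (Mat n × Mat n)) p (redXi n x p)).continuousAt (x := 0)
  have c3 := (line_continuous (LinearMap.snd ℂ (Mat n) (Mat n) ∘ₗ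
    LinearMap.snd ℂ (Mat n) (Mat n × Mat n)) p (redXi n x p)).continuousAt (x := 0)
  have c4 := (line_continuous_vec (LinearMap.id : (Fin n → ℂ) →ₗ[ℂ] (Fin n → ℂ)) u
    (redRho n x u)).continuousAt (x := 0)
  have c5 := inv_continuousAt c2 (by rw [zero_smul, add_zero]; exact h2)
  have c6 := (mulVec_continuousAt c5 c4)
  have c7 := continuousAt_pi.1 c6 (last n)
  have e1 := Cyclic.eventually c1 ((c2.mul c3).mul c5) c4
    (by
      simp only [Pi.mul_apply, zero_smul, add_zero]
      exact h4)
  have e2 := c7.eventually_ne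
    (y := 0) (by
      simp only [zero_smul, add_zero]
      exact h5)
  filter_upwards [e1, e2] with t ht ht'
  exact ⟨ht, ht'⟩

theorem redStable_act [NeZero n] (l : Torus n) : ∀ p ∈ redSet n, ∀ u, (p, u) ∈ redStable n →
    (redSigma n l p, redTau n l u) ∈ redStable n := by
  rintro p ⟨h1, h2, h3⟩ u ⟨h4, h5⟩
  have h : (l.2.2.1 : ℂ) ≠ 0 := Units.ne_zero _
  have hm : (l.2.2.2 : ℂ) ≠ 0 := Units.ne_zero _
  constructor
  · change Cyclic ((l.2.2.1 : ℂ) ^ 2 • (dg l.1 * p.1 * dg l.1⁻¹))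
      (((1 : ℂ) • (dg l.1 * p.2.1 * dg l.2.1⁻¹)) *
        (((l.2.2.1 : ℂ)⁻¹ ^ 2 * (l.2.2.2 : ℂ) ^ 2) • (dg l.2.1 * p.2.2 * dg l.2.1⁻¹)) *
      ((1 : ℂ) • (dg l.1 * p.2.1 * dg l.2.1⁻¹))⁻¹) ((dg l.1).mulVec u)
    rw [one_smul, conj_sandwich _ _ _ _ _ _ _ (dg_mul_inv _) (dg_mul_inv _) h2]
    exact h4.conj _ _ (dg_mul_inv _) _ _ (by positivity) (by positivity)
  · change (((1 : ℂ) • (dg l.1 * p.2.1 * dg l.2.1⁻¹))⁻¹.mulVec ((dg l.1).mulVec u)) (last n) ≠ 0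
    rw [one_smul, inv_sandwich _ _ _ _ _ (dg_mul_inv _) (dg_mul_inv _) h2,
      Matrix.mulVec_mulVec, mul_assoc, dg_inv_mul, mul_one, ← Matrix.mulVec_mulVec, dg_last]
    exact mul_ne_zero (Units.ne_zero _) h5

/-- The framed reduced space. -/
def redFr (n : ℕ) [NeZero n] : Geometry (symRed n) :=
  (redGeom n).framed (V := Fin n → ℂ) (redRho n)
    (by
      intro x y u
      change (x.1.1 * y.1.1 - y.1.1 * x.1.1).mulVec u =
        x.1.1.mulVec (y.1.1.mulVec u) - y.1.1.mulVec (x.1.1.mulVec u)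
      rw [Matrix.sub_mulVec, Matrix.mulVec_mulVec, Matrix.mulVec_mulVec])
    (redTau n)
    (by
      intro l x u
      change (dg l.1).mulVec (x.1.1.mulVec u) =
        (dg l.1 * x.1.1 * dg l.1⁻¹).mulVec ((dg l.1).mulVec u)
      rw [Matrix.mulVec_mulVec, Matrix.mulVec_mulVec, mul_assoc _ _ (dg l.1), dg_inv_mul, mul_one])
    (redStable n)
    redStable_tangent redStable_act

/-- The map that forgets the framing, on reduced spaces. -/
def redFgt (n : ℕ) [NeZero n] : EqSpace.Hom (redGeom n).toSpace (redFr n).toSpace :=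
  (redGeom n).homOfLinear (redFr n) (LinearMap.fst ℂ (Mat n × Mat n × Mat n) (Fin n → ℂ))
    (fun _ hp => hp.1) (fun _ _ => rfl) (fun _ _ => rfl) (fun _ => rfl)

/-- The action of `G × T × T × T_sc` on the framing of the non-reduced space:
`(h, t₁, t₂, λ, μ) · u = h u`. -/
def nonTau (n : ℕ) : Matrix.GeneralLinearGroup (Fin n) ℂ × Torus n →*
    ((Fin n → ℂ) →ₗ[ℂ] (Fin n → ℂ)) where
  toFun l := Matrix.mulVecLin (l.1 : Mat n)
  map_one' := by
    refine LinearMap.ext fun u => ?_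
    simp
  map_mul' l m := by
    refine LinearMap.ext fun u => ?_
    change ((l.1 : Mat n) * (m.1 : Mat n)).mulVec u =
      (l.1 : Mat n).mulVec ((m.1 : Mat n).mulVec u)
    rw [Matrix.mulVec_mulVec]

/-- The stability condition of the non-reduced framed space:
`ℂ⟨Ad_{g₁}⁻¹ X, Y₁⟩ g₁⁻¹ u = V` and `(g₁⁻¹ u)_n ≠ 0`. -/
def nonStable (n : ℕ) [NeZero n] : Set (NonAmb n × (Fin n → ℂ)) :=
  {p | Cyclic ((nong1 n p.1)⁻¹ * nonX n p.1 * nong1 n p.1) (nonY1 n p.1)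
      ((nong1 n p.1)⁻¹.mulVec p.2) ∧ ((nong1 n p.1)⁻¹.mulVec p.2) (last n) ≠ 0}

theorem nonStable_tangent [NeZero n] (x : nilSq n) : ∀ p ∈ nonSet n, ∀ u, (p, u) ∈ nonStable n →
    ∀ᶠ t : ℂ in 𝓝 0, (p + t • nonXi n x p,
      u + t • (0 : nilSq n →ₗ[ℂ] (Fin n → ℂ) →ₗ[ℂ] (Fin n → ℂ)) x u) ∈ nonStable n := by
  rintro p ⟨⟨h1, h2⟩, h3⟩ u ⟨h4, h5⟩
  have c1 := (line_continuous (nonX n) p (nonXi n x p)).continuousAt (x := 0)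
  have c2 := (line_continuous (nong1 n) p (nonXi n x p)).continuousAt (x := 0)
  have c3 := (line_continuous (nonY1 n) p (nonXi n x p)).continuousAt (x := 0)
  have c4 := (line_continuous_vec (LinearMap.id : (Fin n → ℂ) →ₗ[ℂ] (Fin n → ℂ)) u
    0).continuousAt (x := 0)
  have c5 := inv_continuousAt c2 (by rw [zero_smul, add_zero]; exact h1)
  have c6 := (mulVec_continuousAt c5 c4)
  have c7 := continuousAt_pi.1 c6 (last n)
  have e1 := Cyclic.eventually ((c5.mul c1).mul c2) c3 c6
    (by
      simp only [Pi.mul_apply, zero_smul, add_zero]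
      exact h4)
  have e2 := c7.eventually_ne
    (y := 0) (by
      simp only [zero_smul, add_zero]
      exact h5)
  filter_upwards [e1, e2] with t ht ht'
  exact ⟨ht, ht'⟩

theorem nonStable_act [NeZero n] (l : Matrix.GeneralLinearGroup (Fin n) ℂ × Torus n) :
    ∀ p ∈ nonSet n, ∀ u, (p, u) ∈ nonStable n → (nonSigma n l p, nonTau n l u) ∈ nonStable n := by
  rintro p ⟨⟨h1, h2⟩, h3⟩ u ⟨h4, h5⟩
  have h : (l.2.2.2.1 : ℂ) ≠ 0 := Units.ne_zero _
  have hm : (l.2.2.2.2 : ℂ) ≠ 0 := Units.ne_zero _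
  have hinv : ((1 : ℂ) • ((l.1 : Mat n) * nong1 n p * dg l.2.1⁻¹))⁻¹ =
      dg l.2.1 * (nong1 n p)⁻¹ * (↑(l.1⁻¹) : Mat n) := by
    rw [one_smul]
    exact inv_sandwich _ _ _ _ _ (gl_mul_inv l.1) (dg_mul_inv _) h1
  have hu : ((1 : ℂ) • ((l.1 : Mat n) * nong1 n p * dg l.2.1⁻¹))⁻¹.mulVec
      ((l.1 : Mat n).mulVec u) = (dg l.2.1).mulVec ((nong1 n p)⁻¹.mulVec u) := by
    rw [hinv, Matrix.mulVec_mulVec, Matrix.mulVec_mulVec, mul_assoc, gl_inv_mul, mul_one]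
  constructor
  · change Cyclic (((1 : ℂ) • ((l.1 : Mat n) * nong1 n p * dg l.2.1⁻¹))⁻¹ *
        ((l.2.2.2.1 : ℂ) ^ 2 • ((l.1 : Mat n) * nonX n p * (↑(l.1⁻¹) : Mat n))) *
        ((1 : ℂ) • ((l.1 : Mat n) * nong1 n p * dg l.2.1⁻¹)))
      (((l.2.2.2.1 : ℂ)⁻¹ ^ 2 * (l.2.2.2.2 : ℂ) ^ 2) •
        (dg l.2.1 * nonY1 n p * dg l.2.1⁻¹))
      (((1 : ℂ) • ((l.1 : Mat n) * nong1 n p * dg l.2.1⁻¹))⁻¹.mulVec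
        ((l.1 : Mat n).mulVec u))
    have hX : ((1 : ℂ) • ((l.1 : Mat n) * nong1 n p * dg l.2.1⁻¹))⁻¹ *
        ((l.2.2.2.1 : ℂ) ^ 2 • ((l.1 : Mat n) * nonX n p * (↑(l.1⁻¹) : Mat n))) *
        ((1 : ℂ) • ((l.1 : Mat n) * nong1 n p * dg l.2.1⁻¹)) =
        (l.2.2.2.1 : ℂ) ^ 2 • (dg l.2.1 * ((nong1 n p)⁻¹ * nonX n p * nong1 n p) *
          dg l.2.1⁻¹) := by
      rw [hinv, one_smul, mul_smul_comm, smul_mul_assoc]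
      have : dg l.2.1 * (nong1 n p)⁻¹ * (↑(l.1⁻¹) : Mat n) *
          ((l.1 : Mat n) * nonX n p * (↑(l.1⁻¹) : Mat n)) *
          ((l.1 : Mat n) * nong1 n p * dg l.2.1⁻¹) =
          dg l.2.1 * (nong1 n p)⁻¹ * ((↑(l.1⁻¹) : Mat n) * (l.1 : Mat n)) * nonX n p *
          ((↑(l.1⁻¹) : Mat n) * (l.1 : Mat n)) * nong1 n p * dg l.2.1⁻¹ := by noncomm_ring
      rw [this, gl_inv_mul]
      congr 1
      noncomm_ring
    rw [hu, hX]
    exact h4.conj _ _ (dg_mul_inv _) _ _ (by positivity) (by positivity)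
  · change (((1 : ℂ) • ((l.1 : Mat n) * nong1 n p * dg l.2.1⁻¹))⁻¹.mulVec
        ((l.1 : Mat n).mulVec u)) (last n) ≠ 0
    rw [hu, dg_last]
    exact mul_ne_zero (Units.ne_zero _) h5

/-- The framed non-reduced space. -/
def nonFr (n : ℕ) [NeZero n] : Geometry (symNon n) :=
  (nonGeom n).framed (V := Fin n → ℂ) 0 (by intros; simp) (nonTau n) (by intros; simp)
    (nonStable n)
    nonStable_tangent nonStable_act

/-- The map that forgets the framing, on non-reduced spaces. -/
def nonFgt (n : ℕ) [NeZero n] : EqSpace.Hom (nonGeom n).toSpace (nonFr n).toSpace :=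
  (nonGeom n).homOfLinear (nonFr n) (LinearMap.fst ℂ (NonAmb n) (Fin n → ℂ))
    (fun _ hp => hp.1) (fun _ _ => rfl) (fun _ _ => rfl) (fun _ => rfl)

end Framed

section Units

/-- `E` is a Koszul matrix factorization `(R ⊗ Λ U, ι_s + …)`: as a super representation it is `Λ U`,
where `U` is a representation of `𝔥` and `L`, and `D + ∂` (that is, `D_tot - d_ce`) is the sum of the
Koszul differential `ι_s` and of the multiplication by an element `A` of `R ⊗ Λ (𝔥* ⊕ U)` all terms
of which contain a factor from `U`. -/
def IsKoszul {𝔥 L : Type} [LieRing 𝔥] [LieAlgebra ℂ 𝔥] [Group L] {S : Symmetry 𝔥 L}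
    (Z : EqSpace S) {U : Type} [AddCommGroup U] [Module ℂ U] (lieU : 𝔥 → U →ₗ[ℂ] U)
    (actU : L → U →ₗ[ℂ] U) (s : U →ₗ[ℂ] Z.R)
    (A : Z.R ⊗[ℂ] ExteriorAlgebra ℂ (Module.Dual ℂ 𝔥 × U)) (E : MF Z) : Prop :=
  A ∈ Submodule.span Z.R
    {y | ∃ (a : ExteriorAlgebra ℂ (Module.Dual ℂ 𝔥 × U)) (θ : U),
      y = 1 ⊗ₜ (a * ExteriorAlgebra.ι ℂ (0, θ))} ∧
  ∃ e : E.V.V ≃ₗ[ℂ] ExteriorAlgebra ℂ U,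
    (∀ x v, e (E.V.lie x v) = extDer (lieU x) (e v)) ∧
    (∀ l v, e (E.V.act l v) = ExteriorAlgebra.map (actU l) (e v)) ∧
    (∀ v, e (E.V.par v) = CliffordAlgebra.involute (Q := (0 : QuadraticForm ℂ U)) (e v)) ∧
    ∀ (w : ExteriorAlgebra ℂ 𝔥) (v : E.V.V),
      LinearMap.lTensor Z.R (LinearMap.lTensor (ExteriorAlgebra ℂ 𝔥) e.toLinearMap)
        (E.V.insert Z (CliffordAlgebra.involute (Q := (0 : QuadraticForm ℂ 𝔥)) w)
          (E.D (1 ⊗ₜ v)) + E.del (1 ⊗ₜ (w ⊗ₜ v))) =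
      LinearMap.lTensor Z.R (TensorProduct.mk ℂ (ExteriorAlgebra ℂ 𝔥) (ExteriorAlgebra ℂ U)
        (CliffordAlgebra.involute (Q := (0 : QuadraticForm ℂ 𝔥)) w)) (contract s (e v)) +
      koszulMul A (w ⊗ₜ e v)

variable {n : ℕ}

/-- The linear forms `P ↦ Tr (P F)` on `𝔫` defined by a matrix `F` of functions; they vanish where
`F` is upper triangular. -/
def lowerEntries {E : Type} [AddCommGroup E] [Module ℂ E] {Z : Set E} {F : Z → Mat n}
    (hF : RegularMat F) : nil n →ₗ[ℂ] regular Z where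
  toFun P := ⟨fun p => (P.1 * F p).trace,
    hF.apply (Matrix.traceLinearMap (Fin n) ℂ ℂ ∘ₗ LinearMap.mulLeft ℂ P.1)⟩
  map_add' P Q := Subtype.ext (funext fun p => by
    change ((P.1 + Q.1) * F p).trace = (P.1 * F p).trace + (Q.1 * F p).trace
    rw [add_mul, Matrix.trace_add])
  map_smul' c P := Subtype.ext (funext fun p => by
    change ((c • P.1) * F p).trace = c • (P.1 * F p).trace
    rw [smul_mul_assoc, Matrix.trace_smul])

/-- The action `P ↦ x₂ P - P x₁` of `𝔫 × 𝔫` on the space `𝔫` of equations for the lower triangular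
part of `g`. -/
def eqLie (x : nilSq n) : nil n →ₗ[ℂ] nil n where
  toFun P := ⟨x.2.1 * P.1 - P.1 * x.1.1, sub_mem (nil_mul x.2.2 P.2) (nil_mul P.2 x.1.2)⟩
  map_add' P Q := Subtype.ext (by
    change x.2.1 * (P.1 + Q.1) - (P.1 + Q.1) * x.1.1 =
      (x.2.1 * P.1 - P.1 * x.1.1) + (x.2.1 * Q.1 - Q.1 * x.1.1)
    noncomm_ring)
  map_smul' c P := Subtype.ext (by
    change x.2.1 * (c • P.1) - (c • P.1) * x.1.1 = c • (x.2.1 * P.1 - P.1 * x.1.1)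
    rw [mul_smul_comm, smul_mul_assoc, smul_sub])

/-- The action `P ↦ c t P s⁻¹` of the torus on `𝔫`. -/
def eqAct (c : ℂ) (t s : Fin n → ℂˣ) : nil n →ₗ[ℂ] nil n where
  toFun P := ⟨c • (dg t * P.1 * dg s⁻¹), Submodule.smul_mem _ _ (conj_nil _ _ P.2)⟩
  map_add' P Q := Subtype.ext ((sandwich c (dg t) (dg s⁻¹)).map_add P.1 Q.1)
  map_smul' d P := Subtype.ext ((sandwich c (dg t) (dg s⁻¹)).map_smul d P.1)

/-- `E` is the push-forward, along the inclusion of `𝔟 × B × 𝔫` into `𝔟 × G × 𝔫`, of the structure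
sheaf (with zero differential), realized as a Koszul matrix factorization with correction term `A`. -/
def IsUnitRed (n : ℕ)
    (A : regular (redSet n) ⊗[ℂ] ExteriorAlgebra ℂ (Module.Dual ℂ (nilSq n) × nil n))
    (E : MF (redGeom n).toSpace) : Prop :=
  IsKoszul (redGeom n).toSpace (U := nil n) eqLie
    (fun l => eqAct (l.2.2.2 : ℂ) l.2.1 l.1)
    (lowerEntries redg_regular) A E

/-- The image of `𝔟 × (G × 𝔫) × (G × 𝔫)`, with points `(X, (g₁, Y₁), (g₂, Y₂))`. -/
def tildeSet (n : ℕ) : Set (NonAmb n) := {p | p.1 ∈ upper n ∧ p ∈ nonSet n}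

theorem tilde_regular (f : NonAmb n →ₗ[ℂ] Mat n) : RegularMat fun p : tildeSet n => f p :=
  RegularMat.linear f

theorem tilde_inv1 : RegularMat fun p : tildeSet n => (nong1 n p)⁻¹ :=
  (tilde_regular (nong1 n)).inv fun p => p.2.2.1.1

/-- The embedding `j(X, g₁, Y₁, g₂, Y₂) = (Ad_{g₁} X, g₁, Y₁, g₂, Y₂)` into the non-reduced space,
through the pull-back of functions. -/
def tildeJ (n : ℕ) : regular (nonSet n) →ₐ[ℂ] regular (tildeSet n) :=
  pullFun (fun p : tildeSet n =>
    (⟨(nong1 n p * nonX n p * (nong1 n p)⁻¹, p.1.2), p.2.2⟩ : nonSet n))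
    (by
      intro φ
      have h1 := ((((tilde_regular (nong1 n)).mul (tilde_regular (nonX n))).mul
        tilde_inv1).apply (φ ∘ₗ LinearMap.inl ℂ _ _))
      have h2 := polyFun_regular (tildeSet n)
        (linear_polyFun (φ ∘ₗ LinearMap.inr ℂ _ _ ∘ₗ LinearMap.snd ℂ _ _))
      convert (regular (tildeSet n)).add_mem h1 h2 using 1
      ext p
      change _ = φ (_, 0) + φ (0, p.1.2)
      rw [← map_add]
      simp)

/-- The projection `π(X, g₁, Y₁, g₂, Y₂) = (X, g₁⁻¹ g₂, Y₂)` to the reduced space, through the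
pull-back of functions. -/
def tildePi (n : ℕ) : regular (redSet n) →ₐ[ℂ] regular (tildeSet n) :=
  pullFun (fun p : tildeSet n =>
    (⟨(nonX n p, (nong1 n p)⁻¹ * nong2 n p, nonY2 n p), p.2.1, by
      rw [Matrix.det_mul, Matrix.det_nonsing_inv, Ring.inverse_eq_inv']
      exact mul_ne_zero (inv_ne_zero p.2.2.1.1) p.2.2.2.1, p.2.2.2.2⟩ : redSet n))
    (by
      intro φ
      have h1 := ((tilde_regular (nonX n)).apply (φ ∘ₗ LinearMap.inl ℂ _ _))
      have h2 := ((tilde_inv1.mul (tilde_regular (nong2 n))).apply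
        (φ ∘ₗ LinearMap.inr ℂ _ _ ∘ₗ LinearMap.inl ℂ _ _))
      have h3 := ((tilde_regular (nonY2 n)).apply
        (φ ∘ₗ LinearMap.inr ℂ _ _ ∘ₗ LinearMap.inr ℂ _ _))
      convert (regular (tildeSet n)).add_mem h1 ((regular (tildeSet n)).add_mem h2 h3) using 1
      ext p
      change _ = φ (_, 0, 0) + (φ (0, _, 0) + φ (0, 0, _))
      rw [← map_add, ← map_add]
      simp)

theorem nong12_regular : RegularMat fun p : nonSet n => (nong1 n p)⁻¹ * nong2 n p :=
  (nong1_regular.inv nonSet_det1).mul nong2_regular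

theorem nonAdX_regular : RegularMat fun p : nonSet n => (nong1 n p)⁻¹ * nonX n p * nong1 n p :=
  ((nong1_regular.inv nonSet_det1).mul nonX_regular).mul nong1_regular

/-- The bracket action of `x₁` on the space `𝔫` of equations for the lower triangular part of
`Ad_{g₁}⁻¹ X`. -/
def eqLieX (x : nilSq n) : nil n →ₗ[ℂ] nil n := eqLie (x.1, x.1)

/-- `E` is the push-forward, along the embedding `j`, of the pull-back along the projection `π` of the
reduced unit with correction term `A`. The equations are those of the lower triangular parts of
`g₁⁻¹ g₂` (pulled back from the reduced space) and of `Ad_{g₁}⁻¹ X` (which define the image of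
`j`); the correction term `A'` restricts to the pull-back of `A` along `j`. -/
def IsUnitNon (n : ℕ)
    (A : regular (redSet n) ⊗[ℂ] ExteriorAlgebra ℂ (Module.Dual ℂ (nilSq n) × nil n))
    (E : MF (nonGeom n).toSpace) : Prop :=
  ∃ A' : regular (nonSet n) ⊗[ℂ]
      ExteriorAlgebra ℂ (Module.Dual ℂ (nilSq n) × (nil n × nil n)),
    IsKoszul (nonGeom n).toSpace (U := nil n × nil n)
      (fun x => LinearMap.prodMap (eqLie x) (eqLieX x))
      (fun l => LinearMap.prodMap (eqAct (l.2.2.2.2 : ℂ) l.2.2.1 l.2.1)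
        (eqAct ((l.2.2.2.2 : ℂ) * (l.2.2.2.1 : ℂ)⁻¹ ^ 2) l.2.1 l.2.1))
      (LinearMap.coprod (lowerEntries nong12_regular) (lowerEntries nonAdX_regular)) A' E ∧
    TensorProduct.map (tildeJ n).toLinearMap
      (ExteriorAlgebra.map (LinearMap.prodMap LinearMap.id (LinearMap.fst ℂ (nil n) (nil n)))
        ).toLinearMap A' =
    TensorProduct.map (tildePi n).toLinearMap LinearMap.id A

/-- `E` and `E'` are the unit `1̄_n` of the reduced and the unit `1_n = Φ(1̄_n)` of the
non-reduced convolution category. -/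
def IsUnitPair (n : ℕ) (E : MF (redGeom n).toSpace) (E' : MF (nonGeom n).toSpace) : Prop :=
  ∃ A, IsUnitRed n A E ∧ IsUnitNon n A E'

/-- The twist `⟨ξ, τ⟩` of matrix factorizations on the reduced space by a pair of characters of `B`,
given by their exponents. -/
def twistRed (E : MF (redGeom n).toSpace) (ξ τ : Fin n → ℤ) : MF (redGeom n).toSpace :=
  E.twist (weight ξ τ 0 0) (weight_coord ξ τ 0 0)

/-- The twist `⟨ξ, τ⟩` of matrix factorizations on the non-reduced space. -/
def twistNon (E : MF (nonGeom n).toSpace) (ξ τ : Fin n → ℤ) : MF (nonGeom n).toSpace :=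
  E.twist ((weight ξ τ 0 0).comp (MonoidHom.snd _ _)) (weight_coord_snd ξ τ 0 0)

/-- The exponents of the last character `χ_n` of `B` (the last diagonal entry). -/
def chiLast (n : ℕ) [NeZero n] : Fin n → ℤ := Pi.single (last n) 1

end Units

end EquivMF

end

/-!
The two halves of the statement have separate proofs.

**The isomorphisms.** Let `c` be an invariant function of weight `χ`. Multiplication by `c` is a
morphism from a matrix factorization to its twist by `χ`, and it is an isomorphism in the homotopy
category as soon as there are equivariant operators `e` (odd, of weight `μ⁻¹`) and `v` (even, of weight
`χ⁻¹`) such that `ω = [D_tot, e] + c v` is invertible: with `φ = ω⁻¹` and `h = e φ` the operator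
`ψ = v φ - h [D_tot, v] φ` is closed and `[D_tot, h] = 1 - c ψ` (`homotopy_inverse`,
`isomorphic_twist`).

* On the framed non-reduced space `c = (g₁⁻¹ u)_n` is itself invertible, so that every equivariant
  matrix factorization is isomorphic to its twist (`isomorphic_twist_non`).
* On the framed reduced space take `c = u_n`. The matrix `G'` that is obtained from `g` by replacing
  the last column by `u` has determinant `det g ⬝ (g⁻¹ u)_n`, hence is invertible. Reading off the
  entry `(n, n)` of `G' G'⁻¹ = 1` gives `1` as a combination of `u_n` and of the entries `g_{nj}` with
  `j < n`, which are among the equations of the unit. If `e` is the exterior multiplication by the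
  corresponding element of `ℂ[𝒵] ⊗ U`, then `[ι_s, e] + c v = 1`, and the other terms of
  `[D_tot, e]` raise the exterior degree in `Λ U`. So `ω` is unipotent, whatever the correction term is
  (`IsKoszul.isomorphic_twist`, `isomorphic_twist_red`).

**Existence of the representatives.** The operators on the Koszul model that are defined by
`ℂ[𝒵] ⊗ Λ(𝔥* ⊕ U)` form a supercommutative algebra, on which `∂ = [d_ce + ι_s, -]` is a differential. In
this algebra there are matrices `g`, `k = g⁻¹`, `X`, `Y`, a matrix `Θ` of odd elements with
`∂Θ = g + …` below the diagonal, a similar matrix `Ξ` for `X`, and the matrices `η₁`, `η₂` of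
linear forms on the two summands of `𝔥`, which are flat connections. With these data
(`SuperDG.UnitData`) the correction term is written down explicitly. Let `D` be the covariant
derivative. The matrices `ĝ = g - DΘ` and `X̂ = X - DΞ` are closed and upper triangular, so that
`Z = X̂ ĝ Y` is closed and strictly upper triangular, and `Tr (X g Y k)` differs from
`T = Tr (Z k)` by the derivative of an explicit element. The argument of the first part, applied to
`c = det ĝ`, `v = det k` and the element `e` obtained from the Leibniz formula for `det g ⬝ det k = 1` by
replacing one entry below the diagonal by an entry of `Θ` in each term, gives elements `h`, `ψ` with
`∂h = 1 - c ψ`, `∂ψ = 0`. Finally `c Tr (Z k)` is exact: it is `Tr (Z C' ĝ k)` for a closed upper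
triangular matrix `C'` with `C' ĝ = c`, where `ĝ` may be replaced by `g`, and `Tr (Z C') = 0`. Hence
`Tr (X g Y k) = ∂A` for an element `A` all of whose terms contain an entry of `Θ` or `Ξ`
(`SuperDG.UnitData.d_A`), and `ι_s + A` is the differential of the unit (`UnitModel.exists_koszul`).

The reduced space, where `Ξ = 0`, and the non-reduced space, where `g₁⁻¹ g₂`, `Ad_{g₁}⁻¹ X` and `Y₂` play
the roles of `g`, `X` and `Y`, both carry such data (`redModel`, `nonModel`). The construction is
carried out in the product of the two algebras (`exists_correction_pair`): the two correction terms
are the same universal expression, hence agree after restriction along `j` and pull-back along `π`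
(`restrict_agree`). The remaining summand `-Tr (Ad_{g₁}⁻¹ X ⬝ Y₁)` of the non-reduced potential is
corrected by `-Tr (Ξ Y₁)`, which vanishes when the second summand of `U` is set to zero.
-/

open scoped TensorProduct

noncomputable section

namespace EquivMF

/-! ### Induced modules over the enveloping algebra -/

section Induction

variable {𝔥 L : Type} [LieRing 𝔥] [LieAlgebra ℂ 𝔥] [Group L] {S : Symmetry 𝔥 L}

theorem uea_adjoin : Algebra.adjoin ℂ
    (Set.range (UniversalEnvelopingAlgebra.ι ℂ : 𝔥 → UniversalEnvelopingAlgebra ℂ 𝔥)) = ⊤ := by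
  let _ : LieRing (UniversalEnvelopingAlgebra ℂ 𝔥) := LieRing.ofAssociativeRing
  set A := Algebra.adjoin ℂ
    (Set.range (UniversalEnvelopingAlgebra.ι ℂ : 𝔥 → UniversalEnvelopingAlgebra ℂ 𝔥))
  let _ : LieRing A := LieRing.ofAssociativeRing
  let f : 𝔥 →ₗ⁅ℂ⁆ A :=
    { toFun := fun x => ⟨UniversalEnvelopingAlgebra.ι ℂ x, Algebra.subset_adjoin ⟨x, rfl⟩⟩
      map_add' := fun x y => Subtype.ext (map_add _ _ _)
      map_smul' := fun c x => Subtype.ext (map_smul (UniversalEnvelopingAlgebra.ι ℂ) c x)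
      map_lie' := fun {x y} => Subtype.ext (LieHom.map_lie _ _ _) }
  have h : A.val.comp (UniversalEnvelopingAlgebra.lift ℂ f) = AlgHom.id ℂ _ := by
    apply UniversalEnvelopingAlgebra.hom_ext
    ext x
    change ((UniversalEnvelopingAlgebra.lift ℂ f (UniversalEnvelopingAlgebra.ι ℂ x) : A) :
      UniversalEnvelopingAlgebra ℂ 𝔥) = UniversalEnvelopingAlgebra.ι ℂ x
    rw [UniversalEnvelopingAlgebra.lift_ι_apply]
    rfl
  rw [eq_top_iff]
  intro u _
  have := congrArg (fun g => g u) h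
  change ((UniversalEnvelopingAlgebra.lift ℂ f u : A) : UniversalEnvelopingAlgebra ℂ 𝔥) = u at this
  rw [← this]
  exact (UniversalEnvelopingAlgebra.lift ℂ f u).2

/-- A linear condition on `U(𝔥)` that holds for `1` and is stable under left multiplication by `𝔥`
always holds. -/
theorem uea_induction {P : UniversalEnvelopingAlgebra ℂ 𝔥 → Prop} (one : P 1)
    (add : ∀ u v, P u → P v → P (u + v)) (smul : ∀ (c : ℂ) u, P u → P (c • u))
    (ι_mul : ∀ x u, P u → P (UniversalEnvelopingAlgebra.ι ℂ x * u)) (u) : P u := by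
  have key : ∀ a ∈ Algebra.adjoin ℂ
      (Set.range (UniversalEnvelopingAlgebra.ι ℂ : 𝔥 → UniversalEnvelopingAlgebra ℂ 𝔥)),
      ∀ v, P v → P (a * v) := by
    intro a ha
    induction ha using Algebra.adjoin_induction with
    | mem a h => obtain ⟨x, rfl⟩ := h; exact ι_mul x
    | algebraMap c => intro v hv; rw [← Algebra.smul_def]; exact smul c v hv
    | add a b _ _ ha hb => intro v hv; rw [add_mul]; exact add _ _ (ha v hv) (hb v hv)
    | mul a b _ _ ha hb => intro v hv; rw [mul_assoc]; exact ha _ (hb v hv)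
  have := key u (by rw [uea_adjoin]; trivial) 1 one
  rwa [mul_one] at this

variable (Z : EqSpace S) (V : EqModule S)

/-- The generating subspace `Λ 𝔥 ⊗ M` of `CE_𝔥 ⊗^Δ M`. -/
abbrev Base : Type := Z.R ⊗[ℂ] (ExteriorAlgebra ℂ 𝔥 ⊗[ℂ] V.V)

/-- The action of `𝔥` on `Λ 𝔥 ⊗ M` through `M`. -/
def baseLie (x : 𝔥) : Base Z V →ₗ[ℂ] Base Z V :=
  tensorDer (Z.der x) (LinearMap.lTensor (ExteriorAlgebra ℂ 𝔥) (V.lie x))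

/-- The inclusion of `Λ 𝔥 ⊗ M` into `CE_𝔥 ⊗^Δ M` as an `R`-linear map. -/
def baseIncl : Base Z V →ₗ[Z.R] Total Z V :=
  { V.incl Z with map_smul' := fun r y => lTensor_smul' _ r y }

variable {Z V}

theorem baseIncl_tmul (r : Z.R) (w : ExteriorAlgebra ℂ 𝔥) (v : V.V) :
    baseIncl Z V (r ⊗ₜ (w ⊗ₜ v)) = r ⊗ₜ ((1 ⊗ₜ w) ⊗ₜ v) := rfl

theorem baseIncl_eq (y : Base Z V) : baseIncl Z V y = V.incl Z y := rfl

theorem totLie_tmul (x : 𝔥) (r : Z.R) (u : UniversalEnvelopingAlgebra ℂ 𝔥)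
    (w : ExteriorAlgebra ℂ 𝔥) (v : V.V) :
    totLie Z V x (r ⊗ₜ ((u ⊗ₜ w) ⊗ₜ v)) = Z.der x r ⊗ₜ ((u ⊗ₜ w) ⊗ₜ v) +
      (r ⊗ₜ (((UniversalEnvelopingAlgebra.ι ℂ x * u) ⊗ₜ w) ⊗ₜ v) +
        r ⊗ₜ ((u ⊗ₜ w) ⊗ₜ V.lie x v)) := by
  simp [totLie, tensorDer, EqModule.ceLie]

theorem totLie_smul (x : 𝔥) (r : Z.R) (y : Total Z V) :
    totLie Z V x (r • y) = Z.der x r • y + r • totLie Z V x y := tensorDer_smul _ _ _ _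

theorem baseLie_smul (x : 𝔥) (r : Z.R) (y : Base Z V) :
    baseLie Z V x (r • y) = Z.der x r • y + r • baseLie Z V x y := tensorDer_smul _ _ _ _

theorem baseLie_tmul (x : 𝔥) (r : Z.R) (w : ExteriorAlgebra ℂ 𝔥) (v : V.V) :
    baseLie Z V x (r ⊗ₜ (w ⊗ₜ v)) = Z.der x r ⊗ₜ (w ⊗ₜ v) + r ⊗ₜ (w ⊗ₜ V.lie x v) := by
  simp [baseLie, tensorDer]

theorem total_tmul_induction {P : Total Z V → Prop} (add : ∀ x y, P x → P y → P (x + y))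
    (tmul : ∀ r u w v, P (r ⊗ₜ ((u ⊗ₜ w) ⊗ₜ v))) (y) : P y := by
  have zero : P 0 := by simpa using tmul 0 0 0 0
  refine TensorProduct.induction_on y zero (fun r c => ?_) add
  refine TensorProduct.induction_on c (by simpa using zero) (fun z v => ?_)
    (fun a b ha hb => by rw [TensorProduct.tmul_add]; exact add _ _ ha hb)
  refine TensorProduct.induction_on z (by simpa using zero) (fun u w => tmul r u w v)
    (fun a b ha hb => by
      rw [TensorProduct.add_tmul, TensorProduct.tmul_add]; exact add _ _ ha hb)

theorem base_tmul_induction {P : Base Z V → Prop} (add : ∀ x y, P x → P y → P (x + y))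
    (tmul : ∀ r w v, P (r ⊗ₜ (w ⊗ₜ v))) (y) : P y := by
  have zero : P 0 := by simpa using tmul 0 0 0
  refine TensorProduct.induction_on y zero (fun r c => ?_) add
  refine TensorProduct.induction_on c (by simpa using zero) (fun w v => tmul r w v)
    (fun a b ha hb => by rw [TensorProduct.tmul_add]; exact add _ _ ha hb)

/-- The submodule of `CE_𝔥 ⊗^Δ M` spanned by a subspace of `V`. -/
def totalSpan (Z : EqSpace S) (V' : Submodule ℂ V.V) : Submodule Z.R (Total Z V) :=
  Submodule.span Z.R {y | ∃ (z : CE 𝔥), ∃ v ∈ V', y = 1 ⊗ₜ (z ⊗ₜ v)}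

/-- If `V'` is stable under `𝔥`, then `CE_𝔥 ⊗^Δ (R ⊗ V')` is generated over `R` and `U(𝔥)` by
`1 ⊗ Λ 𝔥 ⊗ V'`. -/
theorem totalSpan_induction {V' : Submodule ℂ V.V} (hV' : ∀ x, ∀ v ∈ V', V.lie x v ∈ V')
    {P : Total Z V → Prop} (add : ∀ x y, P x → P y → P (x + y))
    (smul : ∀ (r : Z.R) y, P y → P (r • y)) (lie : ∀ x y, P y → P (totLie Z V x y))
    (gen : ∀ w, ∀ v ∈ V', P (1 ⊗ₜ ((1 ⊗ₜ w) ⊗ₜ v))) {y} (hy : y ∈ totalSpan Z V') : P y := by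
  have key : ∀ (u : UniversalEnvelopingAlgebra ℂ 𝔥) (w : ExteriorAlgebra ℂ 𝔥), ∀ v ∈ V',
      P (1 ⊗ₜ ((u ⊗ₜ w) ⊗ₜ v)) := by
    intro u
    induction u using uea_induction with
    | one => exact gen
    | add u u' hu hu' =>
      intro w v hv
      rw [TensorProduct.add_tmul, TensorProduct.add_tmul, TensorProduct.tmul_add]
      exact add _ _ (hu w v hv) (hu' w v hv)
    | smul c u hu =>
      intro w v hv
      rw [← TensorProduct.smul_tmul', ← TensorProduct.smul_tmul', TensorProduct.tmul_smul,
        ← algebraMap_smul Z.R c]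
      exact smul _ _ (hu w v hv)
    | ι_mul x u hu =>
      intro w v hv
      have h : (1 : Z.R) ⊗ₜ[ℂ] (((UniversalEnvelopingAlgebra.ι ℂ x * u) ⊗ₜ[ℂ] w) ⊗ₜ[ℂ] v) =
          totLie Z V x (1 ⊗ₜ ((u ⊗ₜ w) ⊗ₜ v)) +
            (-1 : Z.R) • (1 ⊗ₜ ((u ⊗ₜ w) ⊗ₜ V.lie x v)) := by
        rw [totLie_tmul, Derivation.map_one_eq_zero, TensorProduct.zero_tmul, zero_add,
          neg_smul (1 : Z.R) ((1 : Z.R) ⊗ₜ[ℂ] ((u ⊗ₜ[ℂ] w) ⊗ₜ[ℂ] V.lie x v)),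
          one_smul, add_neg_cancel_right]
      rw [h]
      exact add _ _ (lie _ _ (hu w v hv)) (smul _ _ (hu w _ (hV' x v hv)))
  have zero : P 0 := by simpa using key 0 0 0 V'.zero_mem
  refine Submodule.span_induction ?_ zero (fun x y _ _ => add x y) (fun r y _ => smul r y) hy
  rintro y ⟨z, v, hv, rfl⟩
  refine TensorProduct.induction_on z (by simpa using zero) (fun u w => key u w v hv)
    (fun a b ha hb => by
      rw [TensorProduct.add_tmul, TensorProduct.tmul_add]; exact add _ _ ha hb)

theorem mem_totalSpan_top (y : Total Z V) : y ∈ totalSpan Z (⊤ : Submodule ℂ V.V) := by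
  refine total_tmul_induction (fun x y hx hy => Submodule.add_mem _ hx hy) (fun r u w v => ?_) y
  have : r ⊗ₜ[ℂ] ((u ⊗ₜ[ℂ] w) ⊗ₜ[ℂ] v) = r • ((1 : Z.R) ⊗ₜ[ℂ] ((u ⊗ₜ[ℂ] w) ⊗ₜ[ℂ] v)) := by
    rw [TensorProduct.smul_tmul', smul_eq_mul, mul_one]
  rw [this]
  exact Submodule.smul_mem _ _ (Submodule.subset_span ⟨_, v, trivial, rfl⟩)

/-- `CE_𝔥 ⊗^Δ M` is generated over `R` and `U(𝔥)` by `1 ⊗ Λ 𝔥 ⊗ M`. -/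
theorem total_induction {P : Total Z V → Prop} (add : ∀ x y, P x → P y → P (x + y))
    (smul : ∀ (r : Z.R) y, P y → P (r • y)) (lie : ∀ x y, P y → P (totLie Z V x y))
    (gen : ∀ w v, P (1 ⊗ₜ ((1 ⊗ₜ w) ⊗ₜ v))) (y) : P y :=
  totalSpan_induction (V' := ⊤) (fun _ _ _ => trivial) add smul lie (fun w v _ => gen w v)
    (mem_totalSpan_top y)

theorem totalSpan_lie {V' : Submodule ℂ V.V} (hV' : ∀ x, ∀ v ∈ V', V.lie x v ∈ V') (x : 𝔥)
    {y : Total Z V} (hy : y ∈ totalSpan Z V') : totLie Z V x y ∈ totalSpan Z V' := by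
  refine Submodule.span_induction ?_ ?_ (fun y z _ _ hy hz => ?_) (fun r y hy h => ?_) hy
  · rintro y ⟨z, v, hv, rfl⟩
    refine TensorProduct.induction_on z (by simp) (fun u w => ?_) (fun a b ha hb => ?_)
    · rw [totLie_tmul, Derivation.map_one_eq_zero, TensorProduct.zero_tmul, zero_add]
      exact Submodule.add_mem _ (Submodule.subset_span ⟨_, v, hv, rfl⟩)
        (Submodule.subset_span ⟨_, _, hV' x v hv, rfl⟩)
    · rw [TensorProduct.add_tmul, TensorProduct.tmul_add, map_add]
      exact Submodule.add_mem _ ha hb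
  · rw [map_zero]; exact Submodule.zero_mem _
  · rw [map_add]; exact Submodule.add_mem _ hy hz
  · rw [totLie_smul]
    exact Submodule.add_mem _ (Submodule.smul_mem _ _ hy) (Submodule.smul_mem _ _ h)

/-- An operator that commutes with `𝔥` respects the submodules `totalSpan` if it does so on
generators. -/
theorem totalSpan_map {V₁ V₂ : Submodule ℂ V.V} (h₁ : ∀ x, ∀ v ∈ V₁, V.lie x v ∈ V₁)
    (h₂ : ∀ x, ∀ v ∈ V₂, V.lie x v ∈ V₂) {T : Total Z V →ₗ[Z.R] Total Z V}
    (hT : ∀ x y, T (totLie Z V x y) = totLie Z V x (T y))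
    (gen : ∀ w, ∀ v ∈ V₁, T (1 ⊗ₜ ((1 ⊗ₜ w) ⊗ₜ v)) ∈ totalSpan Z V₂) {y}
    (hy : y ∈ totalSpan Z V₁) : T y ∈ totalSpan Z V₂ :=
  totalSpan_induction (P := fun y => T y ∈ totalSpan Z V₂) h₁
    (fun x y hx hy => by rw [map_add]; exact Submodule.add_mem _ hx hy)
    (fun r y hy => by rw [map_smul]; exact Submodule.smul_mem _ _ hy)
    (fun x y hy => by rw [hT]; exact totalSpan_lie h₂ x hy) gen hy

theorem totLie_add_left (x y : 𝔥) (z : Total Z V) :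
    totLie Z V (x + y) z = totLie Z V x z + totLie Z V y z := by
  induction z using total_tmul_induction with
  | add a b ha hb => simp only [map_add, ha, hb]; abel
  | tmul r u w v =>
    simp only [totLie_tmul, Z.der_add, map_add, LinearMap.add_apply, add_mul,
      TensorProduct.add_tmul, TensorProduct.tmul_add]
    abel

theorem totLie_smul_left (c : ℂ) (x : 𝔥) (z : Total Z V) :
    totLie Z V (c • x) z = c • totLie Z V x z := by
  induction z using total_tmul_induction with
  | add a b ha hb => simp only [map_add, ha, hb, smul_add]
  | tmul r u w v =>
    simp only [totLie_tmul, Z.der_smul, map_smul, LinearMap.smul_apply, smul_mul_assoc,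
      ← TensorProduct.smul_tmul', TensorProduct.tmul_smul, smul_add]

theorem totLie_lie (x y : 𝔥) (z : Total Z V) :
    totLie Z V ⁅x, y⁆ z = totLie Z V x (totLie Z V y z) - totLie Z V y (totLie Z V x z) := by
  induction z using total_tmul_induction with
  | add a b ha hb => simp only [map_add, ha, hb]; abel
  | tmul r u w v =>
    let _ : LieRing (UniversalEnvelopingAlgebra ℂ 𝔥) := LieRing.ofAssociativeRing
    have h : UniversalEnvelopingAlgebra.ι ℂ ⁅x, y⁆ =
        UniversalEnvelopingAlgebra.ι ℂ x * UniversalEnvelopingAlgebra.ι ℂ y -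
        UniversalEnvelopingAlgebra.ι ℂ y * UniversalEnvelopingAlgebra.ι ℂ x :=
      LieHom.map_lie _ _ _
    simp only [totLie_tmul, Z.der_lie, V.lie_lie, h, map_add, sub_mul, mul_assoc,
      TensorProduct.sub_tmul, TensorProduct.tmul_sub]
    abel

theorem baseLie_add_left (x y : 𝔥) (z : Base Z V) :
    baseLie Z V (x + y) z = baseLie Z V x z + baseLie Z V y z := by
  induction z using base_tmul_induction with
  | add a b ha hb => simp only [map_add, ha, hb]; abel
  | tmul r w v =>
    simp only [baseLie_tmul, Z.der_add, map_add, LinearMap.add_apply,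
      TensorProduct.add_tmul, TensorProduct.tmul_add]
    abel

theorem baseLie_smul_left (c : ℂ) (x : 𝔥) (z : Base Z V) :
    baseLie Z V (c • x) z = c • baseLie Z V x z := by
  induction z using base_tmul_induction with
  | add a b ha hb => simp only [map_add, ha, hb, smul_add]
  | tmul r w v =>
    simp only [baseLie_tmul, Z.der_smul, map_smul, LinearMap.smul_apply,
      ← TensorProduct.smul_tmul', TensorProduct.tmul_smul, smul_add]

theorem baseLie_lie (x y : 𝔥) (z : Base Z V) :
    baseLie Z V ⁅x, y⁆ z = baseLie Z V x (baseLie Z V y z) - baseLie Z V y (baseLie Z V x z) := by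
  induction z using base_tmul_induction with
  | add a b ha hb => simp only [map_add, ha, hb]; abel
  | tmul r w v =>
    simp only [baseLie_tmul, Z.der_lie, V.lie_lie, map_add,
      TensorProduct.sub_tmul, TensorProduct.tmul_sub]
    abel

end Induction

section HomRep

variable {𝔥 X Y : Type} [LieRing 𝔥] [LieAlgebra ℂ 𝔥] [AddCommGroup X] [Module ℂ X]
  [AddCommGroup Y] [Module ℂ Y]

attribute [local instance 100] LieRing.ofAssociativeRing in
/-- The action `x · F = ρ' x ∘ F - F ∘ ρ x` of a Lie algebra on the space of linear maps between two
representations. -/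
def homLieHom (ρ : 𝔥 →ₗ[ℂ] X →ₗ[ℂ] X) (ρ' : 𝔥 →ₗ[ℂ] Y →ₗ[ℂ] Y)
    (h : ∀ x y z, ρ ⁅x, y⁆ z = ρ x (ρ y z) - ρ y (ρ x z))
    (h' : ∀ x y z, ρ' ⁅x, y⁆ z = ρ' x (ρ' y z) - ρ' y (ρ' x z)) :
    𝔥 →ₗ⁅ℂ⁆ Module.End ℂ (X →ₗ[ℂ] Y) where
  toFun x :=
    { toFun := fun F => ρ' x ∘ₗ F - F ∘ₗ ρ x
      map_add' := fun F G => LinearMap.ext fun y => by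
        simp only [LinearMap.sub_apply, LinearMap.add_apply, LinearMap.comp_apply, map_add]; abel
      map_smul' := fun c F => LinearMap.ext fun y => by
        simp only [LinearMap.sub_apply, LinearMap.smul_apply, LinearMap.comp_apply, map_smul,
          RingHom.id_apply, smul_sub] }
  map_add' x y := LinearMap.ext fun F => LinearMap.ext fun z => by
    simp only [LinearMap.coe_mk, AddHom.coe_mk, LinearMap.sub_apply, LinearMap.add_apply,
      LinearMap.comp_apply, map_add]
    abel
  map_smul' c x := LinearMap.ext fun F => LinearMap.ext fun z => by
    simp only [LinearMap.coe_mk, AddHom.coe_mk, LinearMap.sub_apply, LinearMap.smul_apply,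
      LinearMap.comp_apply, map_smul, RingHom.id_apply, smul_sub]
  map_lie' {x y} := LinearMap.ext fun F => LinearMap.ext fun z => by
    simp only [LinearMap.coe_mk, AddHom.coe_mk, Ring.lie_def, LinearMap.sub_apply,
      Module.End.mul_apply, LinearMap.comp_apply, h, h', map_sub]
    abel

attribute [local instance 100] LieRing.ofAssociativeRing in
/-- The action of `U(𝔥)` on the space of linear maps between two representations. -/
def homAct (ρ : 𝔥 →ₗ[ℂ] X →ₗ[ℂ] X) (ρ' : 𝔥 →ₗ[ℂ] Y →ₗ[ℂ] Y)
    (h : ∀ x y z, ρ ⁅x, y⁆ z = ρ x (ρ y z) - ρ y (ρ x z))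
    (h' : ∀ x y z, ρ' ⁅x, y⁆ z = ρ' x (ρ' y z) - ρ' y (ρ' x z)) :
    UniversalEnvelopingAlgebra ℂ 𝔥 →ₗ[ℂ] (X →ₗ[ℂ] Y) →ₗ[ℂ] X →ₗ[ℂ] Y :=
  (UniversalEnvelopingAlgebra.lift ℂ (homLieHom ρ ρ' h h')).toLinearMap

variable (ρ : 𝔥 →ₗ[ℂ] X →ₗ[ℂ] X) (ρ' : 𝔥 →ₗ[ℂ] Y →ₗ[ℂ] Y)
  (h : ∀ x y z, ρ ⁅x, y⁆ z = ρ x (ρ y z) - ρ y (ρ x z))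
  (h' : ∀ x y z, ρ' ⁅x, y⁆ z = ρ' x (ρ' y z) - ρ' y (ρ' x z))

theorem homAct_one (F : X →ₗ[ℂ] Y) : homAct ρ ρ' h h' 1 F = F := by
  let _ : LieRing (Module.End ℂ (X →ₗ[ℂ] Y)) := LieRing.ofAssociativeRing
  change UniversalEnvelopingAlgebra.lift ℂ (homLieHom ρ ρ' h h') 1 F = F
  rw [map_one, Module.End.one_apply]

theorem homAct_ι_mul (x : 𝔥) (u : UniversalEnvelopingAlgebra ℂ 𝔥) (F : X →ₗ[ℂ] Y) (z : X) :
    homAct ρ ρ' h h' (UniversalEnvelopingAlgebra.ι ℂ x * u) F z =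
      ρ' x (homAct ρ ρ' h h' u F z) - homAct ρ ρ' h h' u F (ρ x z) := by
  let _ : LieRing (Module.End ℂ (X →ₗ[ℂ] Y)) := LieRing.ofAssociativeRing
  change UniversalEnvelopingAlgebra.lift ℂ (homLieHom ρ ρ' h h')
    (UniversalEnvelopingAlgebra.ι ℂ x * u) F z = _
  rw [map_mul, UniversalEnvelopingAlgebra.lift_ι_apply]
  rfl

end HomRep

section Extension

variable {𝔥 L : Type} [LieRing 𝔥] [LieAlgebra ℂ 𝔥] [Group L] {S : Symmetry 𝔥 L}
variable {Z : EqSpace S} {V : EqModule S}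

variable (Z V) in
/-- The action of `U(𝔥)` on the space of linear maps `Λ 𝔥 ⊗ M → CE_𝔥 ⊗^Δ M`. -/
def genAct : UniversalEnvelopingAlgebra ℂ 𝔥 →ₗ[ℂ]
    (Base Z V →ₗ[ℂ] Total Z V) →ₗ[ℂ] Base Z V →ₗ[ℂ] Total Z V :=
  homAct
    { toFun := baseLie Z V
      map_add' := fun x y => LinearMap.ext (baseLie_add_left x y)
      map_smul' := fun c x => LinearMap.ext (baseLie_smul_left c x) }
    { toFun := totLie Z V
      map_add' := fun x y => LinearMap.ext (totLie_add_left x y)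
      map_smul' := fun c x => LinearMap.ext (totLie_smul_left c x) }
    baseLie_lie totLie_lie

theorem genAct_one (F : Base Z V →ₗ[ℂ] Total Z V) : genAct Z V 1 F = F := homAct_one _ _ _ _ F

theorem genAct_ι_mul (x : 𝔥) (u : UniversalEnvelopingAlgebra ℂ 𝔥)
    (F : Base Z V →ₗ[ℂ] Total Z V) (y : Base Z V) :
    genAct Z V (UniversalEnvelopingAlgebra.ι ℂ x * u) F y =
      totLie Z V x (genAct Z V u F y) - genAct Z V u F (baseLie Z V x y) :=
  homAct_ι_mul _ _ _ _ x u F y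

/-- The `U(𝔥)`-linear extension to `CE_𝔥 ⊗^Δ M` of an `R`-linear map defined on `Λ 𝔥 ⊗ M`. It is given
by `u ⊗ y ↦ (u · F) y`, where `u · F` is the action of `u ∈ U(𝔥)` on the space of linear maps. -/
def indExt (F : Base Z V →ₗ[Z.R] Total Z V) : Total Z V →ₗ[Z.R] Total Z V :=
  LinearMap.liftBaseChange Z.R
    (TensorProduct.lift (TensorProduct.lift
      (LinearMap.mk₂ ℂ
        (fun u w => (genAct Z V u (F.restrictScalars ℂ)) ∘ₗ TensorProduct.mk ℂ _ _ 1 ∘ₗ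
          TensorProduct.mk ℂ _ _ w)
        (by intros; simp only [map_add, LinearMap.add_apply, LinearMap.add_comp])
        (by intros; simp only [map_smul, LinearMap.smul_apply, LinearMap.smul_comp])
        (by intros; simp only [map_add, LinearMap.comp_add])
        (by intros; simp only [map_smul, LinearMap.comp_smul]))))

theorem indExt_tmul (F : Base Z V →ₗ[Z.R] Total Z V) (r : Z.R)
    (u : UniversalEnvelopingAlgebra ℂ 𝔥) (w : ExteriorAlgebra ℂ 𝔥) (v : V.V) :
    indExt F (r ⊗ₜ ((u ⊗ₜ w) ⊗ₜ v)) = r • genAct Z V u (F.restrictScalars ℂ) (1 ⊗ₜ (w ⊗ₜ v)) := by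
  simp [indExt]

theorem indExt_incl (F : Base Z V →ₗ[Z.R] Total Z V) (y : Base Z V) :
    indExt F (baseIncl Z V y) = F y := by
  induction y using base_tmul_induction with
  | add a b ha hb => simp only [map_add, ha, hb]
  | tmul r w v =>
    rw [baseIncl_tmul, indExt_tmul, genAct_one, LinearMap.restrictScalars_apply,
      ← map_smul,
      TensorProduct.smul_tmul', smul_eq_mul, mul_one]

theorem indExt_lie (F : Base Z V →ₗ[Z.R] Total Z V) (x : 𝔥) (y : Total Z V) :
    indExt F (totLie Z V x y) = totLie Z V x (indExt F y) := by
  induction y using total_tmul_induction with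
  | add a b ha hb => simp only [map_add, ha, hb]
  | tmul r u w v =>
    rw [totLie_tmul, map_add, map_add, indExt_tmul, indExt_tmul, indExt_tmul, indExt_tmul,
      totLie_smul, genAct_ι_mul, baseLie_tmul, Derivation.map_one_eq_zero,
      TensorProduct.zero_tmul, zero_add, smul_sub, sub_add_cancel]

end Extension

/-! ### Operators that commute with the Lie algebra -/

section Operators

variable {𝔥 L : Type} [LieRing 𝔥] [LieAlgebra ℂ 𝔥] [Group L] {S : Symmetry 𝔥 L}
variable {Z : EqSpace S} {V : EqModule S}

/-- `R`-linear operators on `CE_𝔥 ⊗^Δ M` that commute with `𝔥` are determined by their restriction to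
`Λ 𝔥 ⊗ M`. -/
theorem total_ext {f g : Total Z V →ₗ[Z.R] Total Z V}
    (hf : ∀ x y, f (totLie Z V x y) = totLie Z V x (f y))
    (hg : ∀ x y, g (totLie Z V x y) = totLie Z V x (g y))
    (h : ∀ w v, f (1 ⊗ₜ ((1 ⊗ₜ w) ⊗ₜ v)) = g (1 ⊗ₜ ((1 ⊗ₜ w) ⊗ₜ v))) : f = g := by
  refine LinearMap.ext fun y => ?_
  induction y using total_induction with
  | add x y hx hy => rw [map_add, map_add, hx, hy]
  | smul r y hy => rw [map_smul, map_smul, hy]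
  | lie x y hy => rw [hf, hg, hy]
  | gen w v => exact h w v

/-- The `U(𝔥)`-linear extension of an operator on `Λ 𝔥 ⊗ M` to `CE_𝔥 ⊗^Δ M`, as a linear map. -/
def opLin : Module.End Z.R (Base Z V) →ₗ[ℂ] Module.End Z.R (Total Z V) where
  toFun f := indExt (baseIncl Z V ∘ₗ f)
  map_add' f g := by
    refine total_ext (indExt_lie _)
      (fun x y => by rw [LinearMap.add_apply, LinearMap.add_apply, indExt_lie, indExt_lie,
        map_add]) fun w v => ?_
    rw [← baseIncl_tmul, LinearMap.add_apply, indExt_incl, indExt_incl, indExt_incl,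
      LinearMap.comp_add, LinearMap.add_apply]
  map_smul' c f := by
    refine total_ext (indExt_lie _)
      (fun x y => by rw [LinearMap.smul_apply, LinearMap.smul_apply, indExt_lie,
        map_smul, RingHom.id_apply]) fun w v => ?_
    rw [← baseIncl_tmul, LinearMap.smul_apply, indExt_incl, indExt_incl,
      LinearMap.comp_apply, LinearMap.comp_apply, LinearMap.smul_apply,
      LinearMap.map_smul_of_tower, RingHom.id_apply]

theorem opLin_incl (f : Module.End Z.R (Base Z V)) (y : Base Z V) :
    opLin f (baseIncl Z V y) = baseIncl Z V (f y) := indExt_incl _ _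

theorem opLin_lie (f : Module.End Z.R (Base Z V)) (x : 𝔥) (y : Total Z V) :
    opLin f (totLie Z V x y) = totLie Z V x (opLin f y) := indExt_lie _ _ _

theorem opLin_one : opLin (1 : Module.End Z.R (Base Z V)) = 1 := by
  refine total_ext (opLin_lie _) (fun x y => rfl) fun w v => ?_
  rw [← baseIncl_tmul, opLin_incl]
  rfl

theorem opLin_mul (f g : Module.End Z.R (Base Z V)) : opLin (f * g) = opLin f * opLin g := by
  refine total_ext (opLin_lie _)
    (fun x y => by rw [Module.End.mul_apply, Module.End.mul_apply, opLin_lie, opLin_lie])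
    fun w v => ?_
  rw [← baseIncl_tmul, opLin_incl, Module.End.mul_apply, Module.End.mul_apply, opLin_incl,
    opLin_incl]

/-- The `U(𝔥)`-linear extension of operators on `Λ 𝔥 ⊗ M` to `CE_𝔥 ⊗^Δ M`. -/
def op : Module.End Z.R (Base Z V) →ₐ[ℂ] Module.End Z.R (Total Z V) :=
  AlgHom.ofLinearMap opLin opLin_one opLin_mul

theorem op_incl (f : Module.End Z.R (Base Z V)) (y : Base Z V) :
    op f (baseIncl Z V y) = baseIncl Z V (f y) := indExt_incl _ _

theorem op_lie (f : Module.End Z.R (Base Z V)) (x : 𝔥) (y : Total Z V) :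
    op f (totLie Z V x y) = totLie Z V x (op f y) := indExt_lie _ _ _

variable (Z V) in
/-- The action of `L` on `Λ 𝔥 ⊗ M`. -/
def baseAct (l : L) : Base Z V →ₗ[ℂ] Base Z V :=
  tensorAct (Z.act l) (TensorProduct.map (S.extAct l) (V.act l))

variable (Z V) in
/-- The parity of `Λ 𝔥 ⊗ M`. -/
def basePar : Base Z V →ₗ[ℂ] Base Z V :=
  LinearMap.lTensor Z.R (TensorProduct.map
    (CliffordAlgebra.involute (Q := (0 : QuadraticForm ℂ 𝔥))).toLinearMap V.par)

theorem baseAct_tmul (l : L) (r : Z.R) (w : ExteriorAlgebra ℂ 𝔥) (v : V.V) :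
    baseAct Z V l (r ⊗ₜ (w ⊗ₜ v)) = Z.act l r ⊗ₜ (S.extAct l w ⊗ₜ V.act l v) := rfl

theorem basePar_tmul (r : Z.R) (w : ExteriorAlgebra ℂ 𝔥) (v : V.V) :
    basePar Z V (r ⊗ₜ (w ⊗ₜ v)) =
      r ⊗ₜ (CliffordAlgebra.involute (Q := (0 : QuadraticForm ℂ 𝔥)) w ⊗ₜ V.par v) := rfl

theorem totAct_tmul (l : L) (r : Z.R) (u : UniversalEnvelopingAlgebra ℂ 𝔥)
    (w : ExteriorAlgebra ℂ 𝔥) (v : V.V) :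
    totAct Z V l (r ⊗ₜ ((u ⊗ₜ w) ⊗ₜ v)) =
      Z.act l r ⊗ₜ (S.ceAct l (u ⊗ₜ w) ⊗ₜ V.act l v) := rfl

attribute [local instance 100] LieRing.ofAssociativeRing in
theorem ceAct_tmul (l : L) (u : UniversalEnvelopingAlgebra ℂ 𝔥) (w : ExteriorAlgebra ℂ 𝔥) :
    S.ceAct l (u ⊗ₜ w) = UniversalEnvelopingAlgebra.lift ℂ
      ((UniversalEnvelopingAlgebra.ι ℂ).comp (S.Ad l)) u ⊗ₜ S.extAct l w := rfl

theorem totPar_tmul (r : Z.R) (u : UniversalEnvelopingAlgebra ℂ 𝔥)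
    (w : ExteriorAlgebra ℂ 𝔥) (v : V.V) :
    totPar Z V (r ⊗ₜ ((u ⊗ₜ w) ⊗ₜ v)) =
      r ⊗ₜ ((u ⊗ₜ CliffordAlgebra.involute (Q := (0 : QuadraticForm ℂ 𝔥)) w) ⊗ₜ V.par v) := rfl

theorem totAct_incl (l : L) (y : Base Z V) :
    totAct Z V l (baseIncl Z V y) = baseIncl Z V (baseAct Z V l y) := by
  induction y using base_tmul_induction with
  | add a b ha hb => simp only [map_add, ha, hb]
  | tmul r w v =>
    rw [baseIncl_tmul, totAct_tmul, ceAct_tmul, map_one, baseAct_tmul, baseIncl_tmul]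

theorem totPar_incl (y : Base Z V) :
    totPar Z V (baseIncl Z V y) = baseIncl Z V (basePar Z V y) := by
  induction y using base_tmul_induction with
  | add a b ha hb => simp only [map_add, ha, hb]
  | tmul r w v => rw [baseIncl_tmul, totPar_tmul, basePar_tmul, baseIncl_tmul]

theorem totAct_lie (l : L) (x : 𝔥) (y : Total Z V) :
    totAct Z V l (totLie Z V x y) = totLie Z V (S.Ad l x) (totAct Z V l y) := by
  induction y using total_tmul_induction with
  | add a b ha hb => simp only [map_add, ha, hb]
  | tmul r u w v =>
    let _ : LieRing (UniversalEnvelopingAlgebra ℂ 𝔥) := LieRing.ofAssociativeRing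
    rw [totLie_tmul, map_add, map_add, totAct_tmul, totAct_tmul, totAct_tmul, totAct_tmul,
      ceAct_tmul, ceAct_tmul, totLie_tmul, Z.act_der, V.act_lie, map_mul,
      UniversalEnvelopingAlgebra.lift_ι_apply]
    rfl

theorem totPar_lie (x : 𝔥) (y : Total Z V) :
    totPar Z V (totLie Z V x y) = totLie Z V x (totPar Z V y) := by
  induction y using total_tmul_induction with
  | add a b ha hb => simp only [map_add, ha, hb]
  | tmul r u w v =>
    rw [totLie_tmul, map_add, map_add, totPar_tmul, totPar_tmul, totPar_tmul, totPar_tmul,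
      totLie_tmul, V.par_lie]

theorem totAct_smul (l : L) (r : Z.R) (y : Total Z V) :
    totAct Z V l (r • y) = Z.act l r • totAct Z V l y := tensorAct_smul _ _ _ _

theorem totPar_smul (r : Z.R) (y : Total Z V) :
    totPar Z V (r • y) = r • totPar Z V y := lTensor_smul' _ _ _

/-- An operator with the equivariance properties of a morphism of matrix factorizations, of weight
`χ` (a function on `L`) and of parity `ε = ±1`. -/
structure Covariant (χ : L → ℂ) (ε : ℂ) (T : Module.End Z.R (Total Z V)) : Prop where
  lie : ∀ x y, T (totLie Z V x y) = totLie Z V x (T y)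
  par : ∀ y, T (totPar Z V y) = ε • totPar Z V (T y)
  act : ∀ l y, T (totAct Z V l y) = χ l • totAct Z V l (T y)

namespace Covariant

variable {χ χ' : L → ℂ} {ε ε' : ℂ} {T T' : Module.End Z.R (Total Z V)}

theorem mul (h : Covariant χ ε T) (h' : Covariant χ' ε' T') :
    Covariant (χ * χ') (ε * ε') (T * T') where
  lie x y := by rw [Module.End.mul_apply, h'.lie, h.lie, Module.End.mul_apply]
  par y := by
    rw [Module.End.mul_apply, h'.par, LinearMap.map_smul_of_tower, h.par, smul_smul, mul_comm ε,
      Module.End.mul_apply]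
  act l y := by
    rw [Module.End.mul_apply, h'.act, LinearMap.map_smul_of_tower, h.act, smul_smul, mul_comm,
      Module.End.mul_apply, Pi.mul_apply]

theorem add (h : Covariant χ ε T) (h' : Covariant χ ε T') : Covariant χ ε (T + T') where
  lie x y := by rw [LinearMap.add_apply, LinearMap.add_apply, h'.lie, h.lie, map_add]
  par y := by rw [LinearMap.add_apply, LinearMap.add_apply, h'.par, h.par, map_add, smul_add]
  act l y := by rw [LinearMap.add_apply, LinearMap.add_apply, h'.act, h.act, map_add, smul_add]

theorem neg (h : Covariant χ ε T) : Covariant χ ε (-T) where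
  lie x y := by rw [LinearMap.neg_apply, LinearMap.neg_apply, h.lie, map_neg]
  par y := by rw [LinearMap.neg_apply, LinearMap.neg_apply, h.par, map_neg, smul_neg]
  act l y := by rw [LinearMap.neg_apply, LinearMap.neg_apply, h.act, map_neg, smul_neg]

theorem sub (h : Covariant χ ε T) (h' : Covariant χ ε T') : Covariant χ ε (T - T') :=
  sub_eq_add_neg T T' ▸ h.add h'.neg

/-- The inverse of an equivariant operator is equivariant. -/
theorem inv (h : Covariant (1 : L → ℂ) 1 T) (h1 : T * T' = 1) (h2 : T' * T = 1) :
    Covariant (1 : L → ℂ) 1 T' := by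
  have e1 : ∀ y, T (T' y) = y := fun y => congrArg (fun f : Module.End Z.R (Total Z V) => f y) h1
  have e2 : ∀ y, T' (T y) = y := fun y => congrArg (fun f : Module.End Z.R (Total Z V) => f y) h2
  refine ⟨fun x y => ?_, fun y => ?_, fun l y => ?_⟩
  · conv_lhs => rw [← e1 y, ← h.lie, e2]
  · have := h.par (T' y)
    rw [one_smul, e1] at this
    rw [← this, e2, one_smul]
  · have := h.act l (T' y)
    rw [Pi.one_apply, one_smul, e1] at this
    rw [← this, e2, Pi.one_apply, one_smul]

end Covariant

theorem covariant_op {χ : L → ℂ} {ε : ℂ} {f : Module.End Z.R (Base Z V)}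
    (par : ∀ y, f (basePar Z V y) = ε • basePar Z V (f y))
    (act : ∀ l y, f (baseAct Z V l y) = χ l • baseAct Z V l (f y)) : Covariant χ ε (op f) where
  lie := op_lie f
  par y := by
    induction y using total_induction with
    | add x y hx hy => simp only [map_add, hx, hy, smul_add]
    | smul r y hy => rw [totPar_smul, map_smul, map_smul, hy, totPar_smul, smul_comm]
    | lie x y hy => rw [totPar_lie, op_lie, op_lie, hy, totPar_lie, map_smul]
    | gen w v =>
      rw [← baseIncl_tmul, totPar_incl, op_incl, op_incl, par, totPar_incl,
        LinearMap.map_smul_of_tower]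
  act l y := by
    induction y using total_induction with
    | add x y hx hy => simp only [map_add, hx, hy, smul_add]
    | smul r y hy => rw [totAct_smul, map_smul, map_smul, hy, totAct_smul, smul_comm]
    | lie x y hy => rw [totAct_lie, op_lie, op_lie, hy, totAct_lie, map_smul]
    | gen w v =>
      rw [← baseIncl_tmul, totAct_incl, op_incl, op_incl, act, totAct_incl,
        LinearMap.map_smul_of_tower]

theorem MF.covariant_Dtot (E : MF Z) :
    Covariant (fun l => (S.κ l : ℂ)) (-1) (E.Dtot : Module.End Z.R (Total Z E.V)) :=
  ⟨E.Dtot_lie, fun y => (E.Dtot_par y).trans (neg_one_smul ℂ _).symm, E.Dtot_act⟩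

theorem covariant_smul {c : Z.R} {χ : L → ℂ} (hc : ∀ x, Z.der x c = 0)
    (hχ : ∀ l, χ l • Z.act l c = c) :
    Covariant χ 1 (c • (1 : Module.End Z.R (Total Z V))) where
  lie x y := by
    rw [LinearMap.smul_apply, LinearMap.smul_apply, Module.End.one_apply, Module.End.one_apply,
      totLie_smul, hc, zero_smul, zero_add]
  par y := by
    rw [LinearMap.smul_apply, LinearMap.smul_apply, Module.End.one_apply, Module.End.one_apply,
      totPar_smul, one_smul]
  act l y := by
    rw [LinearMap.smul_apply, LinearMap.smul_apply, Module.End.one_apply, Module.End.one_apply,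
      totAct_smul, ← smul_assoc, hχ]

end Operators

/-! ### Inverting a function up to homotopy -/

section Inverse

variable {A : Type} [Ring A] {D e v c φ : A}

/-- The commutator of `D` with the inverse `φ` of `ω = [D, e] + c v`: as `D²` is central, `[D, ω]`
is `c [D, v]`. -/
theorem commutator_inverse (hc : ∀ a, c * a = a * c) (hD : ∀ a, D * D * a = a * (D * D))
    (h1 : (D * e + e * D + c * v) * φ = 1) (h2 : φ * (D * e + e * D + c * v) = 1) :
    D * φ = φ * D - c * (φ * (D * v - v * D) * φ) := by
  have h : D * (D * e + e * D + c * v) - (D * e + e * D + c * v) * D =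
      c * (D * v - v * D) := by
    have e1 := hD e
    have e2 := hc D
    have : D * (D * e + e * D + c * v) - (D * e + e * D + c * v) * D =
      (D * D * e - e * (D * D)) + (D * c * v - c * v * D) := by noncomm_ring
    rw [this, e1, sub_self, zero_add, ← e2]
    noncomm_ring
  calc D * φ = (φ * (D * e + e * D + c * v)) * (D * φ) := by rw [h2, one_mul]
    _ = φ * (D * (D * e + e * D + c * v)
        - (D * (D * e + e * D + c * v) - (D * e + e * D + c * v) * D)) * φ := by noncomm_ring
    _ = φ * D * ((D * e + e * D + c * v) * φ) - φ * c * (D * v - v * D) * φ := by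
        rw [h]; noncomm_ring
    _ = φ * D - c * (φ * (D * v - v * D) * φ) := by rw [h1, ← hc]; noncomm_ring

/-- If `ω = [D, e] + c v` is invertible then `c` is invertible up to the homotopy `e ω⁻¹`. -/
theorem homotopy_inverse (hc : ∀ a, c * a = a * c) (hD : ∀ a, D * D * a = a * (D * D))
    (h1 : (D * e + e * D + c * v) * φ = 1) (h2 : φ * (D * e + e * D + c * v) = 1) :
    D * (e * φ) + e * φ * D = 1 - c * (v * φ - e * φ * (D * v - v * D) * φ) := by
  have h := commutator_inverse hc hD h1 h2
  have h' : φ * D = D * φ + c * (φ * (D * v - v * D) * φ) := by rw [h]; abel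
  calc D * (e * φ) + e * φ * D = D * e * φ + e * (φ * D) := by noncomm_ring
    _ = (D * e + e * D + c * v) * φ - c * v * φ + e * c * (φ * (D * v - v * D) * φ) := by
        rw [h']; noncomm_ring
    _ = _ := by rw [h1, ← hc e]; noncomm_ring

/-- The inverse up to homotopy of `homotopy_inverse` is closed. -/
theorem homotopy_inverse_closed (hc : ∀ a, c * a = a * c) (hD : ∀ a, D * D * a = a * (D * D))
    (h1 : (D * e + e * D + c * v) * φ = 1) (h2 : φ * (D * e + e * D + c * v) = 1) :
    D * (v * φ - e * φ * (D * v - v * D) * φ) = (v * φ - e * φ * (D * v - v * D) * φ) * D := by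
  have h := commutator_inverse hc hD h1 h2
  have h3 := homotopy_inverse hc hD h1 h2
  obtain ⟨b, hb⟩ : ∃ b, b = D * v - v * D := ⟨_, rfl⟩
  rw [← hb] at h h3 ⊢
  have h4 : D * b = -(b * D) := by
    have := hD v
    rw [hb]
    have e : D * (D * v - v * D) = D * D * v - D * v * D := by noncomm_ring
    rw [e, this]; noncomm_ring
  -- `D (e φ b φ) = (D e φ + e φ D) b φ - e φ D b φ`
  have e1 : D * (e * φ * b * φ) = (D * (e * φ) + e * φ * D) * (b * φ) - e * φ * (D * b) * φ := by
    noncomm_ring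
  have e2 : e * φ * (D * b) * φ = -(e * φ * b * (D * φ)) := by rw [h4]; noncomm_ring
  have e3 : D * (v * φ) = b * φ + v * (D * φ) := by rw [hb]; noncomm_ring
  rw [mul_sub, e1, e2, h3, e3, h]
  have e4 : v * (c * (φ * b * φ)) = c * (v * φ * b * φ) := by
    rw [← mul_assoc, ← hc v]; noncomm_ring
  have e5 : e * φ * b * (c * (φ * b * φ)) = c * (e * φ * b * φ * b * φ) := by
    rw [← mul_assoc, ← hc (e * φ * b)]; noncomm_ring
  rw [mul_sub v, mul_sub (e * φ * b), e4, e5]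
  noncomm_ring

end Inverse

/-! ### Twists by characters -/

section Twist

variable {𝔥 L : Type} [LieRing 𝔥] [LieAlgebra ℂ 𝔥] [Group L] {S : Symmetry 𝔥 L} {Z : EqSpace S}

theorem totAct_twist (V : EqModule S) (χ : L →* ℂˣ) (hχ : (fun l => (χ l : ℂ)) ∈ S.coord)
    (l : L) (y : Total Z V) :
    totAct Z (V.twist χ hχ) l y = (χ l : ℂ) • totAct Z V l y := by
  have : totAct Z (V.twist χ hχ) l = (χ l : ℂ) • totAct Z V l := by
    simp only [totAct, tensorAct, EqModule.ceAct]
    change TensorProduct.map _ (TensorProduct.map _ ((χ l : ℂ) • V.act l)) = _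
    rw [TensorProduct.map_smul_right, TensorProduct.map_smul_right]
  rw [this]; rfl

/-- If an invariant function `c` of weight `χ` is invertible up to homotopy, then multiplication by `c`
is an isomorphism from `E` to its twist by `χ`. -/
theorem isomorphic_twist (E : MF Z) (χ : L →* ℂˣ) (hχ : (fun l => (χ l : ℂ)) ∈ S.coord)
    {c : Z.R} (hc : ∀ x, Z.der x c = 0) (hcχ : ∀ l, (χ l : ℂ) • Z.act l c = c)
    {e v φ : Module.End Z.R (Total Z E.V)}
    (he : Covariant (fun l => (S.κ l : ℂ)⁻¹) (-1) e) (hv : Covariant (fun l => (χ l : ℂ)⁻¹) 1 v)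
    {D : Module.End Z.R (Total Z E.V)} (hDE : D = E.Dtot)
    (h1 : (D * e + e * D + c • 1 * v) * φ = 1) (h2 : φ * (D * e + e * D + c • 1 * v) = 1) :
    MF.Isomorphic (E.twist χ hχ) E := by
  have hDy : ∀ y, E.Dtot y = D y := fun y => (LinearMap.congr_fun hDE y).symm
  have hD : Covariant (fun l => (S.κ l : ℂ)) (-1) D := hDE ▸ E.covariant_Dtot
  set C : Module.End Z.R (Total Z E.V) := c • 1 with hCdef
  have hC : Covariant (fun l => (χ l : ℂ)) 1 C := covariant_smul hc hcχ
  have hcen : ∀ a, C * a = a * C := fun a => by rw [hCdef, smul_mul_assoc, mul_smul_comm,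
    one_mul, mul_one]
  have hDD : D * D = Z.W • 1 := hDE ▸ LinearMap.ext E.Dtot_sq
  have hDcen : ∀ a, D * D * a = a * (D * D) := fun a => by
    rw [hDD, smul_mul_assoc, mul_smul_comm, one_mul, mul_one]
  have k1 : (fun l => (S.κ l : ℂ)) * (fun l => (S.κ l : ℂ)⁻¹) = (1 : L → ℂ) :=
    funext fun l => mul_inv_cancel₀ (Units.ne_zero _)
  have k2 : (fun l => (χ l : ℂ)) * (fun l => (χ l : ℂ)⁻¹) = (1 : L → ℂ) :=
    funext fun l => mul_inv_cancel₀ (Units.ne_zero _)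
  have hω : Covariant (1 : L → ℂ) 1 (D * e + e * D + C * v) := by
    have a1 := hD.mul he
    have a2 := he.mul hD
    have a3 := hC.mul hv
    rw [k1] at a1
    rw [mul_comm, k1] at a2
    rw [k2] at a3
    norm_num at a1 a2 a3
    exact (a1.add a2).add a3
  -- the weights of `D`, `e` and of `c`, `v` cancel, so that `φ` is equivariant
  have hφ := hω.inv h1 h2
  have hh : Covariant (fun l => (S.κ l : ℂ)⁻¹) (-1) (e * φ) := by
    have := he.mul hφ
    rwa [mul_one, mul_one] at this
  set ψ := v * φ - e * φ * (D * v - v * D) * φ with hψdef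
  have hψ : Covariant (fun l => (χ l : ℂ)⁻¹) 1 ψ := by
    have a1 := hv.mul hφ
    have a2 := hD.mul hv
    have a3 := hv.mul hD
    rw [mul_comm, mul_comm (1 : ℂ)] at a3
    have a4 := (hh.mul (a2.sub a3)).mul hφ
    rw [← mul_assoc, mul_comm (fun l => (S.κ l : ℂ)⁻¹), k1] at a4
    norm_num at a1 a4
    exact a1.sub a4
  have hom := homotopy_inverse (A := Module.End Z.R (Total Z E.V)) hcen hDcen h1 h2
  have hcl := homotopy_inverse_closed (A := Module.End Z.R (Total Z E.V)) hcen hDcen h1 h2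
  -- the mutually inverse morphisms are `ψ` and the multiplication by `c`
  let f : MF.Hom (E.twist χ hχ) E :=
    { f := ψ
      lie := hψ.lie
      par := fun y => (hψ.par y).trans (one_smul ℂ _)
      act := fun l y => by
        refine (congrArg ψ (totAct_twist E.V χ hχ l y)).trans ?_
        rw [LinearMap.map_smul_of_tower]
        refine (congrArg (fun t => (χ l : ℂ) • t) (hψ.act l y)).trans ?_
        rw [smul_smul, mul_inv_cancel₀ (Units.ne_zero _), one_smul]
        rfl
      comm := fun y => (congrArg ψ (hDy y)).trans
        ((LinearMap.congr_fun hcl y).symm.trans (hDy (ψ y)).symm) }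
  let g : MF.Hom E (E.twist χ hχ) :=
    { f := C
      lie := hC.lie
      par := fun y => (hC.par y).trans (one_smul ℂ _)
      act := fun l y => (hC.act l y).trans (totAct_twist E.V χ hχ l _).symm
      comm := fun y => (congrArg C (hDy y)).trans
        ((LinearMap.congr_fun (hcen D) y).trans (hDy (C y)).symm) }
  have hhom : ∀ y, C (ψ y) - y = E.Dtot ((-(e * φ)) y) + (-(e * φ)) (E.Dtot y) := fun y => by
    rw [hDy, hDy]
    have := LinearMap.congr_fun hom y
    simp only [LinearMap.sub_apply, LinearMap.add_apply, Module.End.mul_apply,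
      Module.End.one_apply] at this
    rw [LinearMap.neg_apply, LinearMap.neg_apply, map_neg, ← neg_add, Module.End.mul_apply,
      Module.End.mul_apply, this, hψdef]
    simp only [LinearMap.sub_apply, Module.End.mul_apply]
    abel
  have hcomm : ∀ y, C (ψ y) = ψ (C y) := fun y => LinearMap.congr_fun (hcen ψ) y
  have hp : ∀ y, (-(e * φ)) (totPar Z E.V y) = -totPar Z E.V ((-(e * φ)) y) := fun y =>
    (hh.neg.par y).trans (neg_one_smul ℂ (totPar Z E.V ((-(e * φ)) y)))
  have ha : ∀ l y, (S.κ l : ℂ) • (-(e * φ)) (totAct Z E.V l y) =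
      totAct Z E.V l ((-(e * φ)) y) := fun l y => by
    rw [hh.neg.act l y, smul_smul, mul_inv_cancel₀ (Units.ne_zero _), one_smul]
  have ha' : ∀ l y, (S.κ l : ℂ) • (-(e * φ)) ((χ l : ℂ) • totAct Z E.V l y) =
      (χ l : ℂ) • totAct Z E.V l ((-(e * φ)) y) := fun l y => by
    rw [LinearMap.map_smul_of_tower, smul_comm, ha]
  refine ⟨f, g, ⟨-(e * φ), hh.neg.lie, hp, fun l y => ?_, hhom⟩,
    ⟨-(e * φ), hh.neg.lie, hp, ha, fun y => ?_⟩⟩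
  · exact (congrArg (fun t => (S.κ l : ℂ) • (-(e * φ)) t) (totAct_twist E.V χ hχ l y)).trans
      ((ha' l y).trans (totAct_twist E.V χ hχ l _).symm)
  · exact (congrArg (fun t => t - y) (hcomm y).symm).trans (hhom y)

end Twist

/-! ### Koszul operators -/

section Koszul

variable {𝔥 L : Type} [LieRing 𝔥] [LieAlgebra ℂ 𝔥] [Group L] {S : Symmetry 𝔥 L}
variable {Z : EqSpace S} {V : EqModule S} {U : Type} [AddCommGroup U] [Module ℂ U]

/-- The action of `R ⊗ End C` on `R ⊗ C`. -/
def scalarEnd (R C : Type) [CommRing R] [Algebra ℂ R] [AddCommGroup C] [Module ℂ C] :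
    R ⊗[ℂ] Module.End ℂ C →ₐ[ℂ] Module.End R (R ⊗[ℂ] C) :=
  (LinearMap.tensorProductEnd ℂ R C).restrictScalars ℂ

theorem scalarEnd_tmul (R C : Type) [CommRing R] [Algebra ℂ R] [AddCommGroup C] [Module ℂ C]
    (r s : R) (f : Module.End ℂ C) (c : C) :
    scalarEnd R C (r ⊗ₜ f) (s ⊗ₜ c) = (r * s) ⊗ₜ f c := by
  change r • (s ⊗ₜ[ℂ] f c) = _
  rw [TensorProduct.smul_tmul', smul_eq_mul]

/-- The algebra `R ⊗ Λ (𝔥* ⊕ U)` of correction terms of Koszul matrix factorizations. -/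
abbrev KAlg (Z : EqSpace S) (U : Type) [AddCommGroup U] [Module ℂ U] : Type :=
  Z.R ⊗[ℂ] ExteriorAlgebra ℂ (Module.Dual ℂ 𝔥 × U)

/-- The action of `Λ (𝔥* ⊕ U)` on `Λ 𝔥 ⊗ V`, for a space `V` that is identified with `Λ U`. -/
def koszulConj (e : V.V ≃ₗ[ℂ] ExteriorAlgebra ℂ U) :
    ExteriorAlgebra ℂ (Module.Dual ℂ 𝔥 × U) →ₐ[ℂ]
      Module.End ℂ (ExteriorAlgebra ℂ 𝔥 ⊗[ℂ] V.V) :=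
  (LinearEquiv.conjAlgEquiv ℂ
    (LinearEquiv.lTensor (ExteriorAlgebra ℂ 𝔥) e).symm).toAlgHom.comp (koszulRep 𝔥 U)

variable (Z) in
/-- The action of `R ⊗ Λ (𝔥* ⊕ U)` on `Λ 𝔥 ⊗ M`, for `M = R ⊗ V` with `V` identified with `Λ U`. -/
def baseMul (e : V.V ≃ₗ[ℂ] ExteriorAlgebra ℂ U) :
    KAlg Z U →ₐ[ℂ] Module.End Z.R (Base Z V) :=
  (scalarEnd Z.R (ExteriorAlgebra ℂ 𝔥 ⊗[ℂ] V.V)).comp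
    (Algebra.TensorProduct.map (AlgHom.id ℂ Z.R) (koszulConj e))

variable (e : V.V ≃ₗ[ℂ] ExteriorAlgebra ℂ U)

theorem baseMul_tmul (r s : Z.R) (a : ExteriorAlgebra ℂ (Module.Dual ℂ 𝔥 × U))
    (y : ExteriorAlgebra ℂ 𝔥 ⊗[ℂ] V.V) :
    baseMul Z e (r ⊗ₜ a) (s ⊗ₜ y) = (r * s) ⊗ₜ (LinearMap.lTensor _ e.symm.toLinearMap
      (koszulRep 𝔥 U a (LinearMap.lTensor _ e.toLinearMap y))) := by
  rw [baseMul, AlgHom.comp_apply, Algebra.TensorProduct.map_tmul, scalarEnd_tmul]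
  rfl

theorem baseMul_scalar (r : Z.R) (y : Base Z V) : baseMul Z e (r ⊗ₜ 1) y = r • y := by
  induction y using base_tmul_induction with
  | add a b ha hb => rw [map_add, ha, hb, smul_add]
  | tmul s w v =>
    rw [baseMul_tmul, map_one, Module.End.one_apply, TensorProduct.smul_tmul', smul_eq_mul]
    congr 1
    simp

theorem baseMul_gen (α : Module.Dual ℂ 𝔥) (θ : U) (r : Z.R) (w : ExteriorAlgebra ℂ 𝔥) (v : V.V) :
    baseMul Z e (1 ⊗ₜ ExteriorAlgebra.ι ℂ (α, θ)) (r ⊗ₜ (w ⊗ₜ v)) =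
      r ⊗ₜ (CliffordAlgebra.contractLeft (Q := (0 : QuadraticForm ℂ 𝔥)) α w ⊗ₜ v) +
      r ⊗ₜ (CliffordAlgebra.involute (Q := (0 : QuadraticForm ℂ 𝔥)) w ⊗ₜ
        e.symm (ExteriorAlgebra.ι ℂ θ * e v)) := by
  rw [baseMul_tmul, koszulRep, ExteriorAlgebra.lift_ι_apply, LinearMap.lTensor_tmul]
  change (1 * r) ⊗ₜ[ℂ] LinearMap.lTensor _ e.symm.toLinearMap
    (koszulGen 𝔥 U (α, θ) (w ⊗ₜ[ℂ] e v)) = _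
  rw [koszulGen_tmul, one_mul, map_add, TensorProduct.tmul_add, LinearMap.lTensor_tmul,
    LinearMap.lTensor_tmul]
  simp

/-- The operator `baseMul` in terms of `koszulMul`. -/
theorem lTensor_baseMul (A : KAlg Z U) (w : ExteriorAlgebra ℂ 𝔥) (v : V.V) :
    LinearMap.lTensor Z.R (LinearMap.lTensor (ExteriorAlgebra ℂ 𝔥) e.toLinearMap)
      (baseMul Z e A (1 ⊗ₜ (w ⊗ₜ v))) = koszulMul A (w ⊗ₜ e v) := by
  refine TensorProduct.induction_on A (by simp [koszulMul]) (fun r a => ?_) (fun a b ha hb => ?_)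
  · rw [baseMul_tmul, mul_one, LinearMap.lTensor_tmul, koszulMul, LinearMap.lTensor_tmul,
      ← LinearMap.comp_apply, ← LinearMap.lTensor_comp]
    simp
  · rw [map_add, LinearMap.add_apply, map_add, ha, hb, koszulMul, koszulMul, koszulMul, map_add]

/-- The algebra `R ⊗ Λ (𝔥* ⊕ U)` is generated by `R`, `𝔥*` and `U`. -/
theorem kalg_induction {P : KAlg Z U → Prop} (scalar : ∀ r, P (r ⊗ₜ 1))
    (gen : ∀ α θ, P (1 ⊗ₜ ExteriorAlgebra.ι ℂ (α, θ)))
    (add : ∀ x y, P x → P y → P (x + y)) (mul : ∀ x y, P x → P y → P (x * y)) (k) : P k := by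
  refine TensorProduct.induction_on k (by simpa using scalar 0) (fun r a => ?_) add
  · have h : ∀ a : ExteriorAlgebra ℂ (Module.Dual ℂ 𝔥 × U), P (1 ⊗ₜ a) := by
      intro a
      induction a using ext_induction with
      | one => exact scalar 1
      | add x y hx hy => rw [TensorProduct.tmul_add]; exact add _ _ hx hy
      | smul c x hx =>
        have := mul _ _ (scalar (algebraMap ℂ Z.R c)) hx
        rwa [Algebra.TensorProduct.tmul_mul_tmul, one_mul, mul_one,
          Algebra.algebraMap_eq_smul_one, TensorProduct.smul_tmul] at this
      | ι_mul m x hx =>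
        have := mul _ _ (gen m.1 m.2) hx
        rwa [Algebra.TensorProduct.tmul_mul_tmul, one_mul] at this
    have := mul _ _ (scalar r) (h a)
    rwa [Algebra.TensorProduct.tmul_mul_tmul, one_mul, mul_one] at this

variable (Z) in
/-- The action of `l` on `R ⊗ Λ (𝔥* ⊕ U)` that corresponds to conjugation of operators; `𝔥*` is
twisted by `κ⁻¹`, as `𝔥` is twisted by `κ`. -/
def kAct (l : L) (actU : U →ₗ[ℂ] U) : KAlg Z U →ₐ[ℂ] KAlg Z U :=
  Algebra.TensorProduct.map (Z.act l) (ExteriorAlgebra.map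
    (LinearMap.prodMap ((S.κ l : ℂ)⁻¹ • LinearMap.dualMap (S.Ad l⁻¹ : 𝔥 →ₗ[ℂ] 𝔥)) actU))

variable (Z U) in
/-- The parity automorphism of `R ⊗ Λ (𝔥* ⊕ U)`. -/
def kPar : KAlg Z U →ₐ[ℂ] KAlg Z U :=
  Algebra.TensorProduct.map (AlgHom.id ℂ Z.R)
    (CliffordAlgebra.involute (Q := (0 : QuadraticForm ℂ (Module.Dual ℂ 𝔥 × U))))

theorem involute_ι_ext {M : Type} [AddCommGroup M] [Module ℂ M] (m : M) :
    CliffordAlgebra.involute (Q := (0 : QuadraticForm ℂ M)) (ExteriorAlgebra.ι ℂ m) =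
      -ExteriorAlgebra.ι ℂ m := CliffordAlgebra.involute_ι m

theorem involute_ι_mul {M : Type} [AddCommGroup M] [Module ℂ M] (m : M)
    (w : ExteriorAlgebra ℂ M) :
    CliffordAlgebra.involute (Q := (0 : QuadraticForm ℂ M)) (ExteriorAlgebra.ι ℂ m * w) =
      -(ExteriorAlgebra.ι ℂ m * CliffordAlgebra.involute (Q := (0 : QuadraticForm ℂ M)) w) := by
  rw [← neg_mul, ← involute_ι_ext]
  exact map_mul _ _ _

theorem contract_ext_ι_mul {M : Type} [AddCommGroup M] [Module ℂ M] (α : Module.Dual ℂ M) (m : M)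
    (w : ExteriorAlgebra ℂ M) :
    CliffordAlgebra.contractLeft (Q := (0 : QuadraticForm ℂ M)) α (ExteriorAlgebra.ι ℂ m * w) =
      α m • w - ExteriorAlgebra.ι ℂ m *
        CliffordAlgebra.contractLeft (Q := (0 : QuadraticForm ℂ M)) α w :=
  CliffordAlgebra.contractLeft_ι_mul _ _ _

theorem map_ι_mul {M N : Type} [AddCommGroup M] [Module ℂ M] [AddCommGroup N] [Module ℂ N]
    (f : M →ₗ[ℂ] N) (m : M) (w : ExteriorAlgebra ℂ M) :
    ExteriorAlgebra.map f (ExteriorAlgebra.ι ℂ m * w) =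
      ExteriorAlgebra.ι ℂ (f m) * ExteriorAlgebra.map f w := by
  rw [map_mul (ExteriorAlgebra.map f), ExteriorAlgebra.map_apply_ι]

theorem map_involute {M N : Type} [AddCommGroup M] [Module ℂ M] [AddCommGroup N] [Module ℂ N]
    (f : M →ₗ[ℂ] N) (w : ExteriorAlgebra ℂ M) :
    ExteriorAlgebra.map f (CliffordAlgebra.involute (Q := (0 : QuadraticForm ℂ M)) w) =
      CliffordAlgebra.involute (Q := (0 : QuadraticForm ℂ N)) (ExteriorAlgebra.map f w) := by
  induction w using ext_induction with
  | one => rw [map_one, map_one, map_one]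
  | add x y hx hy => rw [map_add, map_add, map_add, map_add, hx, hy]
  | smul c x hx => rw [map_smul, map_smul, map_smul, map_smul, hx]
  | ι_mul m x hx => rw [involute_ι_mul, map_ι_mul, involute_ι_mul, map_neg, map_ι_mul, hx]

theorem contract_map {M N : Type} [AddCommGroup M] [Module ℂ M] [AddCommGroup N] [Module ℂ N]
    (f : M →ₗ[ℂ] N) (α : Module.Dual ℂ N) (w : ExteriorAlgebra ℂ M) :
    CliffordAlgebra.contractLeft (Q := (0 : QuadraticForm ℂ N)) α (ExteriorAlgebra.map f w) =
      ExteriorAlgebra.map f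
        (CliffordAlgebra.contractLeft (Q := (0 : QuadraticForm ℂ M)) (α ∘ₗ f) w) := by
  induction w using ext_induction with
  | one =>
    rw [map_one, CliffordAlgebra.contractLeft_one, CliffordAlgebra.contractLeft_one]
    exact (map_zero _).symm
  | add x y hx hy => rw [map_add, map_add, map_add, map_add, hx, hy]
  | smul c x hx => rw [map_smul, map_smul, map_smul, map_smul, hx]
  | ι_mul m x hx =>
    rw [map_ι_mul, contract_ext_ι_mul, contract_ext_ι_mul, map_sub, map_smul, map_ι_mul, hx]
    rfl

theorem baseAct_smul (l : L) (r : Z.R) (y : Base Z V) :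
    baseAct Z V l (r • y) = Z.act l r • baseAct Z V l y := tensorAct_smul _ _ _ _

theorem basePar_smul (r : Z.R) (y : Base Z V) :
    basePar Z V (r • y) = r • basePar Z V y := lTensor_smul' _ _ _

variable {e}

theorem baseAct_baseMul {l : L} {actU : U →ₗ[ℂ] U}
    (hact : ∀ v, e (V.act l v) = ExteriorAlgebra.map actU (e v)) (k : KAlg Z U) (y : Base Z V) :
    baseAct Z V l (baseMul Z e k y) = baseMul Z e (kAct Z l actU k) (baseAct Z V l y) := by
  induction k using kalg_induction generalizing y with
  | add a b ha hb => simp only [map_add, LinearMap.add_apply, ha, hb]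
  | mul a b ha hb => simp only [map_mul, Module.End.mul_apply, ha, hb]
  | scalar r =>
    rw [baseMul_scalar, baseAct_smul, kAct, Algebra.TensorProduct.map_tmul, map_one,
      baseMul_scalar]
  | gen α θ =>
    induction y using base_tmul_induction with
    | add a b ha hb => simp only [map_add, ha, hb]
    | tmul r w v =>
      have hα : ((S.κ l : ℂ)⁻¹ • LinearMap.dualMap (S.Ad l⁻¹ : 𝔥 →ₗ[ℂ] 𝔥) α) ∘ₗ
          ((S.κ l : ℂ) • (S.Ad l : 𝔥 →ₗ[ℂ] 𝔥)) = α := by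
        ext x
        change (S.κ l : ℂ)⁻¹ * α (S.Ad l⁻¹ ((S.κ l : ℂ) • S.Ad l x)) = α x
        rw [map_smul, map_smul, ← S.Ad_mul, inv_mul_cancel, S.Ad_one, smul_eq_mul, ← mul_assoc,
          inv_mul_cancel₀ (Units.ne_zero _), one_mul]
      have h3 : V.act l (e.symm (ExteriorAlgebra.ι ℂ θ * e v)) =
          e.symm (ExteriorAlgebra.ι ℂ (actU θ) * e (V.act l v)) := by
        apply e.injective
        rw [hact, e.apply_symm_apply, e.apply_symm_apply, map_ι_mul, hact]
      have h4 : kAct Z l actU ((1 : Z.R) ⊗ₜ ExteriorAlgebra.ι ℂ (α, θ)) =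
          1 ⊗ₜ ExteriorAlgebra.ι ℂ
            ((S.κ l : ℂ)⁻¹ • LinearMap.dualMap (S.Ad l⁻¹ : 𝔥 →ₗ[ℂ] 𝔥) α, actU θ) := by
        rw [kAct, Algebra.TensorProduct.map_tmul, map_one, ExteriorAlgebra.map_apply_ι]
        rfl
      rw [baseMul_gen, map_add, baseAct_tmul, baseAct_tmul, baseAct_tmul, h4, baseMul_gen, h3]
      congr 3
      · rw [Symmetry.extAct, AlgHom.toLinearMap_apply, AlgHom.toLinearMap_apply, contract_map, hα]
      · exact map_involute _ _

theorem basePar_baseMul (hpar : ∀ v, e (V.par v) =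
      CliffordAlgebra.involute (Q := (0 : QuadraticForm ℂ U)) (e v)) (k : KAlg Z U)
    (y : Base Z V) :
    basePar Z V (baseMul Z e k y) = baseMul Z e (kPar Z U k) (basePar Z V y) := by
  induction k using kalg_induction generalizing y with
  | add a b ha hb => simp only [map_add, LinearMap.add_apply, ha, hb]
  | mul a b ha hb => simp only [map_mul, Module.End.mul_apply, ha, hb]
  | scalar r =>
    rw [baseMul_scalar, basePar_smul, kPar, Algebra.TensorProduct.map_tmul, map_one,
      baseMul_scalar]
    rfl
  | gen α θ =>
    induction y using base_tmul_induction with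
    | add a b ha hb => simp only [map_add, ha, hb]
    | tmul r w v =>
      have h3 : V.par (e.symm (ExteriorAlgebra.ι ℂ θ * e v)) =
          -e.symm (ExteriorAlgebra.ι ℂ θ * e (V.par v)) := by
        apply e.injective
        rw [hpar, e.apply_symm_apply, map_neg, e.apply_symm_apply, involute_ι_mul, hpar]
      have h4 : kPar Z U ((1 : Z.R) ⊗ₜ ExteriorAlgebra.ι ℂ (α, θ)) =
          -(1 ⊗ₜ ExteriorAlgebra.ι ℂ (α, θ)) := by
        rw [kPar, Algebra.TensorProduct.map_tmul, map_one, ← TensorProduct.tmul_neg]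
        exact congrArg _ (involute_ι_ext (α, θ))
      have h5 := eq_neg_of_add_eq_zero_left (involute_contractLeft α w)
      rw [baseMul_gen, map_add, basePar_tmul, basePar_tmul, basePar_tmul, h4, map_neg,
        LinearMap.neg_apply, baseMul_gen, h3, h5]
      simp only [TensorProduct.tmul_neg, TensorProduct.neg_tmul, neg_add, neg_neg]

/-- The operator on `CE_𝔥 ⊗^Δ M` defined by `k ∈ R ⊗ Λ (𝔥* ⊕ U)` has the weight and the parity
of `k`. -/
theorem covariant_op_baseMul {actU : L → U →ₗ[ℂ] U}
    (hact : ∀ l v, e (V.act l v) = ExteriorAlgebra.map (actU l) (e v))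
    (hpar : ∀ v, e (V.par v) =
      CliffordAlgebra.involute (Q := (0 : QuadraticForm ℂ U)) (e v))
    {k : KAlg Z U} {χ : L → ℂ} {ε : ℂ} (hε : ε * ε = 1) (hχ : ∀ l, χ l • kAct Z l (actU l) k = k)
    (hk : kPar Z U k = ε • k) : Covariant χ ε (op (baseMul Z e k)) := by
  refine covariant_op (fun y => ?_) (fun l y => ?_)
  · rw [basePar_baseMul hpar, hk, map_smul, LinearMap.smul_apply, smul_smul, hε, one_smul]
  · conv_lhs => rw [← hχ l]
    rw [baseAct_baseMul (hact l), map_smul, LinearMap.smul_apply]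

end Koszul

/-! ### The Chevalley–Eilenberg and the Koszul differential -/

section Differentials

variable {𝔥 L : Type} [LieRing 𝔥] [LieAlgebra ℂ 𝔥] [Group L] {S : Symmetry 𝔥 L}

/-- Left multiplication by `U(𝔥)` on `U(𝔥) ⊗ Λ 𝔥`. -/
def ceMul : UniversalEnvelopingAlgebra ℂ 𝔥 →ₗ[ℂ] CE 𝔥 →ₗ[ℂ] CE 𝔥 :=
  LinearMap.rTensorHom (ExteriorAlgebra ℂ 𝔥) ∘ₗ
    LinearMap.mul ℂ (UniversalEnvelopingAlgebra ℂ 𝔥)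

theorem ceMul_tmul (u u' : UniversalEnvelopingAlgebra ℂ 𝔥) (w : ExteriorAlgebra ℂ 𝔥) :
    ceMul u (u' ⊗ₜ w) = (u * u') ⊗ₜ w := rfl

theorem ceMul_mul (u u' : UniversalEnvelopingAlgebra ℂ 𝔥) (z : CE 𝔥) :
    ceMul (u * u') z = ceMul u (ceMul u' z) := by
  refine TensorProduct.induction_on z (by simp) (fun u'' w => ?_) (fun a b ha hb => ?_)
  · rw [ceMul_tmul, ceMul_tmul, ceMul_tmul, mul_assoc]
  · simp only [map_add, ha, hb]

theorem ceMul_one (z : CE 𝔥) : ceMul 1 z = z := by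
  refine TensorProduct.induction_on z (by simp) (fun u'' w => ?_) (fun a b ha hb => ?_)
  · rw [ceMul_tmul, one_mul]
  · simp only [map_add, ha, hb]

/-- The Chevalley–Eilenberg differential of `U(𝔥) ⊗ Λ 𝔥`. -/
def dCE : CE 𝔥 →ₗ[ℂ] CE 𝔥 :=
  TensorProduct.lift (ceMul.compl₂ dCEOne)

theorem dCE_tmul (u : UniversalEnvelopingAlgebra ℂ 𝔥) (w : ExteriorAlgebra ℂ 𝔥) :
    dCE (u ⊗ₜ w) = ceMul u (dCEOne w) := rfl

theorem dCE_ceMul (u : UniversalEnvelopingAlgebra ℂ 𝔥) (z : CE 𝔥) :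
    dCE (ceMul u z) = ceMul u (dCE z) := by
  refine TensorProduct.induction_on z (by simp) (fun u'' w => ?_) (fun a b ha hb => ?_)
  · rw [ceMul_tmul, dCE_tmul, dCE_tmul, ceMul_mul]
  · simp only [map_add, ha, hb]

variable {Z : EqSpace S} {V : EqModule S}

variable (Z V) in
/-- The operator on `CE_𝔥 ⊗^Δ M` defined by an operator on `CE_𝔥`. -/
def totCE (f : CE 𝔥 →ₗ[ℂ] CE 𝔥) : Module.End Z.R (Total Z V) :=
  LinearMap.baseChange Z.R (LinearMap.rTensor V.V f)

theorem totCE_tmul (f : CE 𝔥 →ₗ[ℂ] CE 𝔥) (r : Z.R) (z : CE 𝔥) (v : V.V) :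
    totCE Z V f (r ⊗ₜ (z ⊗ₜ v)) = r ⊗ₜ (f z ⊗ₜ v) := rfl

theorem totLie_tmul_ce (x : 𝔥) (r : Z.R) (z : CE 𝔥) (v : V.V) :
    totLie Z V x (r ⊗ₜ (z ⊗ₜ v)) = Z.der x r ⊗ₜ (z ⊗ₜ v) +
      (r ⊗ₜ (ceMul (UniversalEnvelopingAlgebra.ι ℂ x) z ⊗ₜ v) + r ⊗ₜ (z ⊗ₜ V.lie x v)) := by
  refine TensorProduct.induction_on z (by simp) (fun u w => ?_) (fun a b ha hb => ?_)
  · rw [totLie_tmul, ceMul_tmul]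
  · simp only [map_add, TensorProduct.add_tmul, TensorProduct.tmul_add, ha, hb]
    abel

theorem total_ce_induction {P : Total Z V → Prop} (add : ∀ x y, P x → P y → P (x + y))
    (tmul : ∀ r z v, P (r ⊗ₜ (z ⊗ₜ v))) (y) : P y :=
  total_tmul_induction add (fun r u w v => tmul r (u ⊗ₜ w) v) y

/-- A `U(𝔥)`-linear operator on `CE_𝔥` commutes with the diagonal action of `𝔥`. -/
theorem totCE_lie {f : CE 𝔥 →ₗ[ℂ] CE 𝔥} (hf : ∀ u z, f (ceMul u z) = ceMul u (f z)) (x : 𝔥)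
    (y : Total Z V) : totCE Z V f (totLie Z V x y) = totLie Z V x (totCE Z V f y) := by
  induction y using total_ce_induction with
  | add a b ha hb => simp only [map_add, ha, hb]
  | tmul r z v =>
    rw [totLie_tmul_ce, map_add, map_add, totCE_tmul, totCE_tmul, totCE_tmul, totCE_tmul,
      totLie_tmul_ce, hf]

theorem totCE_totalSpan (f : CE 𝔥 →ₗ[ℂ] CE 𝔥) {V' : Submodule ℂ V.V} {y : Total Z V}
    (hy : y ∈ totalSpan Z V') : totCE Z V f y ∈ totalSpan Z V' := by
  refine Submodule.span_induction ?_ ?_ (fun y z _ _ hy hz => ?_) (fun r y hy h => ?_) hy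
  · rintro y ⟨z, v, hv, rfl⟩
    exact Submodule.subset_span ⟨f z, v, hv, rfl⟩
  · rw [map_zero]; exact Submodule.zero_mem _
  · rw [map_add]; exact Submodule.add_mem _ hy hz
  · rw [map_smul]; exact Submodule.smul_mem _ _ h

variable {U : Type} [AddCommGroup U] [Module ℂ U] (e : V.V ≃ₗ[ℂ] ExteriorAlgebra ℂ U)

variable (Z) in
/-- The map `c ↦ w ⊗ c` from `R ⊗ Λ U` to `Λ 𝔥 ⊗ M`. -/
def baseInsert : ExteriorAlgebra ℂ 𝔥 →ₗ[ℂ] Z.R ⊗[ℂ] ExteriorAlgebra ℂ U →ₗ[ℂ] Base Z V :=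
  LinearMap.lTensorHom Z.R ∘ₗ
    (TensorProduct.mk ℂ (ExteriorAlgebra ℂ 𝔥) V.V).compl₂ e.symm.toLinearMap

theorem baseInsert_tmul (w : ExteriorAlgebra ℂ 𝔥) (r : Z.R) (a : ExteriorAlgebra ℂ U) :
    baseInsert Z e w (r ⊗ₜ a) = r ⊗ₜ (w ⊗ₜ e.symm a) := rfl

/-- The Koszul differential `w ⊗ m ↦ (-1)^p w ⊗ ι_s m` on `Λ 𝔥 ⊗ M`. -/
def baseKoszul (s : U →ₗ[ℂ] Z.R) : Module.End Z.R (Base Z V) :=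
  LinearMap.liftBaseChange Z.R (TensorProduct.lift
    (((baseInsert Z e) ∘ₗ
      (CliffordAlgebra.involute (Q := (0 : QuadraticForm ℂ 𝔥))).toLinearMap).compl₂
        (contract s ∘ₗ e.toLinearMap)))

theorem baseKoszul_tmul (s : U →ₗ[ℂ] Z.R) (r : Z.R) (w : ExteriorAlgebra ℂ 𝔥) (v : V.V) :
    baseKoszul e s (r ⊗ₜ (w ⊗ₜ v)) = r • baseInsert Z e
      (CliffordAlgebra.involute (Q := (0 : QuadraticForm ℂ 𝔥)) w) (contract s (e v)) := by
  simp [baseKoszul]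

theorem baseMul_insert (α : Module.Dual ℂ 𝔥) (θ : U) (w : ExteriorAlgebra ℂ 𝔥)
    (c : Z.R ⊗[ℂ] ExteriorAlgebra ℂ U) :
    baseMul Z e (1 ⊗ₜ ExteriorAlgebra.ι ℂ (α, θ)) (baseInsert Z e w c) =
      baseInsert Z e (CliffordAlgebra.contractLeft (Q := (0 : QuadraticForm ℂ 𝔥)) α w) c +
      baseInsert Z e (CliffordAlgebra.involute (Q := (0 : QuadraticForm ℂ 𝔥)) w)
        (wedge Z.R θ c) := by
  induction c with
  | zero => simp
  | add a b ha hb => simp only [map_add, ha, hb]; abel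
  | tmul r a =>
    rw [baseInsert_tmul, baseMul_gen, e.apply_symm_apply, wedge_tmul, baseInsert_tmul,
      baseInsert_tmul]

theorem involute_involute_ext {M : Type} [AddCommGroup M] [Module ℂ M] (w : ExteriorAlgebra ℂ M) :
    CliffordAlgebra.involute (Q := (0 : QuadraticForm ℂ M))
      (CliffordAlgebra.involute (Q := (0 : QuadraticForm ℂ M)) w) = w :=
  CliffordAlgebra.involute_involute w

/-- The anticommutator of the Koszul differential with the operator of `(α, θ)` is the function
`s θ`. -/
theorem baseKoszul_gen (s : U →ₗ[ℂ] Z.R) (α : Module.Dual ℂ 𝔥) (θ : U) (y : Base Z V) :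
    baseKoszul e s (baseMul Z e (1 ⊗ₜ ExteriorAlgebra.ι ℂ (α, θ)) y) +
      baseMul Z e (1 ⊗ₜ ExteriorAlgebra.ι ℂ (α, θ)) (baseKoszul e s y) = s θ • y := by
  induction y using base_tmul_induction with
  | add a b ha hb => simp only [map_add, smul_add, ← ha, ← hb]; abel
  | tmul r w v =>
    rw [baseMul_gen, map_add, baseKoszul_tmul, baseKoszul_tmul, baseKoszul_tmul, map_smul,
      baseMul_insert, e.apply_symm_apply, contract_ι_mul, involute_involute_ext, map_sub,
      baseInsert_tmul, e.symm_apply_apply, smul_add, smul_sub,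
      eq_neg_of_add_eq_zero_left (involute_contractLeft α w), map_neg, LinearMap.neg_apply,
      smul_neg, TensorProduct.smul_tmul', TensorProduct.smul_tmul', smul_eq_mul, smul_eq_mul,
      mul_comm (s θ)]
    abel

/-- The Koszul element `∑ r_i θ_i` of `R ⊗ U`, in `R ⊗ Λ (𝔥* ⊕ U)`. -/
def kVec : Z.R ⊗[ℂ] U →ₗ[ℂ] KAlg Z U :=
  LinearMap.lTensor Z.R (ExteriorAlgebra.ι ℂ ∘ₗ LinearMap.inr ℂ (Module.Dual ℂ 𝔥) U)

theorem kVec_tmul (r : Z.R) (θ : U) :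
    (kVec (r ⊗ₜ θ) : KAlg Z U) = r ⊗ₜ ExteriorAlgebra.ι ℂ (0, θ) := rfl

theorem baseMul_smul_tmul (r : Z.R) (a : ExteriorAlgebra ℂ (Module.Dual ℂ 𝔥 × U))
    (y : Base Z V) : baseMul Z e (r ⊗ₜ a) y = r • baseMul Z e (1 ⊗ₜ a) y := by
  have : r ⊗ₜ[ℂ] a = (r ⊗ₜ 1) * ((1 : Z.R) ⊗ₜ[ℂ] a) := by
    rw [Algebra.TensorProduct.tmul_mul_tmul, one_mul, mul_one]
  rw [this, map_mul, Module.End.mul_apply, baseMul_scalar]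

theorem baseKoszul_kVec (s : U →ₗ[ℂ] Z.R) (ε : Z.R ⊗[ℂ] U) (y : Base Z V) :
    baseKoszul e s (baseMul Z e (kVec ε) y) + baseMul Z e (kVec ε) (baseKoszul e s y) =
      LinearMap.liftBaseChange Z.R s ε • y := by
  induction ε with
  | zero => simp
  | add a b ha hb =>
    simp only [map_add, LinearMap.add_apply, add_smul, ← ha, ← hb]
    abel
  | tmul r θ =>
    rw [kVec_tmul, baseMul_smul_tmul e r _ y, baseMul_smul_tmul e r _ (baseKoszul e s y), map_smul,
      ← smul_add, baseKoszul_gen,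
      smul_smul, LinearMap.liftBaseChange_tmul, smul_eq_mul]

/-- The total differential of a Koszul matrix factorization, as a sum of three operators. -/
theorem koszul_Dtot_eq {s : U →ₗ[ℂ] Z.R}
    {A : KAlg Z U} {E : MF Z} {e : E.V.V ≃ₗ[ℂ] ExteriorAlgebra ℂ U}
    (h : ∀ (w : ExteriorAlgebra ℂ 𝔥) (v : E.V.V),
      LinearMap.lTensor Z.R (LinearMap.lTensor (ExteriorAlgebra ℂ 𝔥) e.toLinearMap)
        (E.V.insert Z (CliffordAlgebra.involute (Q := (0 : QuadraticForm ℂ 𝔥)) w)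
          (E.D (1 ⊗ₜ v)) + E.del (1 ⊗ₜ (w ⊗ₜ v))) =
      LinearMap.lTensor Z.R (TensorProduct.mk ℂ (ExteriorAlgebra ℂ 𝔥) (ExteriorAlgebra ℂ U)
        (CliffordAlgebra.involute (Q := (0 : QuadraticForm ℂ 𝔥)) w)) (contract s (e v)) +
      koszulMul A (w ⊗ₜ e v)) :
    totCE Z E.V dCE + op (baseKoszul e s + baseMul Z e A) = E.Dtot := by
  refine total_ext (fun x y => ?_) E.Dtot_lie (fun w v => ?_)
  · rw [LinearMap.add_apply, LinearMap.add_apply, totCE_lie dCE_ceMul, op_lie,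
      map_add (totLie Z E.V x)]
  · rw [E.Dtot_one, LinearMap.add_apply, totCE_tmul, dCE_tmul, ceMul_one, ← baseIncl_tmul, op_incl,
      ← baseIncl_eq]
    congr 2
    have inj : Function.Injective (LinearMap.lTensor Z.R
        (LinearMap.lTensor (ExteriorAlgebra ℂ 𝔥) e.toLinearMap)) :=
      ((LinearEquiv.lTensor _ e).lTensor Z.R).injective
    apply inj
    rw [h, LinearMap.add_apply, map_add, lTensor_baseMul, baseKoszul_tmul, one_smul]
    congr 1
    generalize contract s (e v) = c
    induction c with
    | zero => simp
    | add a b ha hb => simp only [map_add, ha, hb]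
    | tmul r a => rw [baseInsert_tmul]; simp

end Differentials

/-! ### The filtration by exterior degree -/

section Filtration

variable {U : Type} [AddCommGroup U] [Module ℂ U]

/-- The subspace `⊕_{q ≥ p} Λ^q U` of `Λ U`. -/
def extGE (U : Type) [AddCommGroup U] [Module ℂ U] (p : ℕ) : Submodule ℂ (ExteriorAlgebra ℂ U) :=
  LinearMap.range (ExteriorAlgebra.ι ℂ : U →ₗ[ℂ] ExteriorAlgebra ℂ U) ^ p * ⊤

theorem extGE_zero : extGE U 0 = ⊤ := by
  rw [extGE, pow_zero, one_mul]

theorem extGE_succ (p : ℕ) : extGE U (p + 1) =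
    LinearMap.range (ExteriorAlgebra.ι ℂ : U →ₗ[ℂ] ExteriorAlgebra ℂ U) * extGE U p := by
  rw [extGE, extGE, pow_succ', mul_assoc]

theorem ι_mul_extGE {p : ℕ} (θ : U) {a : ExteriorAlgebra ℂ U} (ha : a ∈ extGE U p) :
    ExteriorAlgebra.ι ℂ θ * a ∈ extGE U (p + 1) := by
  rw [extGE_succ]
  exact Submodule.mul_mem_mul ⟨θ, rfl⟩ ha

theorem extGE_antitone (p : ℕ) : extGE U (p + 1) ≤ extGE U p := by
  rw [extGE, extGE, pow_succ, mul_assoc]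
  exact Submodule.mul_le.mpr fun m hm n _ => Submodule.mul_mem_mul hm trivial

theorem extDer_extGE (φ : U →ₗ[ℂ] U) {p : ℕ} {a : ExteriorAlgebra ℂ U} (ha : a ∈ extGE U p) :
    extDer φ a ∈ extGE U p := by
  induction p generalizing a with
  | zero => rw [extGE_zero]; trivial
  | succ p ih =>
    rw [extGE_succ] at ha
    refine Submodule.mul_induction_on ha (fun m hm n hn => ?_) (fun x y hx hy => ?_)
    · obtain ⟨θ, rfl⟩ := hm
      rw [extDer_ι_mul]
      exact Submodule.add_mem _ (ι_mul_extGE _ hn) (ι_mul_extGE _ (ih hn))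
    · rw [map_add]; exact Submodule.add_mem _ hx hy

theorem extGE_eq_bot [Module.Finite ℂ U] : extGE U (Module.finrank ℂ U + 1) = ⊥ := by
  have h : (⋀[ℂ]^(Module.finrank ℂ U + 1) U : Submodule ℂ (ExteriorAlgebra ℂ U)) = ⊥ := by
    rw [← Submodule.finrank_eq_zero (R := ℂ), exteriorPower.finrank_eq, Nat.choose_succ_self]
  have h' : LinearMap.range (ExteriorAlgebra.ι ℂ : U →ₗ[ℂ] ExteriorAlgebra ℂ U) ^
      (Module.finrank ℂ U + 1) = ⊥ := h
  rw [extGE, h', Submodule.bot_mul]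

variable {𝔥 L : Type} [LieRing 𝔥] [LieAlgebra ℂ 𝔥] [Group L] {S : Symmetry 𝔥 L}
variable {Z : EqSpace S} {V : EqModule S} (e : V.V ≃ₗ[ℂ] ExteriorAlgebra ℂ U)

/-- The part of `V ≃ Λ U` of exterior degree at least `p`. -/
def vGE (p : ℕ) : Submodule ℂ V.V := (extGE U p).comap e.toLinearMap

/-- The submodule of `Λ 𝔥 ⊗ M` spanned by a subspace of `V`. -/
def baseSpan (Z : EqSpace S) (V' : Submodule ℂ V.V) : Submodule Z.R (Base Z V) :=
  Submodule.span Z.R {y | ∃ (w : ExteriorAlgebra ℂ 𝔥), ∃ v ∈ V', y = 1 ⊗ₜ (w ⊗ₜ v)}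

theorem baseIncl_baseSpan {V' : Submodule ℂ V.V} {y : Base Z V} (hy : y ∈ baseSpan Z V') :
    baseIncl Z V y ∈ totalSpan Z V' := by
  have : baseSpan Z V' ≤ (totalSpan Z V').comap (baseIncl Z V) := by
    rw [baseSpan, Submodule.span_le]
    rintro _ ⟨w, v, hv, rfl⟩
    exact Submodule.subset_span ⟨1 ⊗ₜ w, v, hv, rfl⟩
  exact this hy

theorem baseSpan_map {V₁ V₂ : Submodule ℂ V.V} {f : Module.End Z.R (Base Z V)}
    (h : ∀ w, ∀ v ∈ V₁, f (1 ⊗ₜ (w ⊗ₜ v)) ∈ baseSpan Z V₂) {y : Base Z V}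
    (hy : y ∈ baseSpan Z V₁) : f y ∈ baseSpan Z V₂ := by
  have : baseSpan Z V₁ ≤ (baseSpan Z V₂).comap f := by
    rw [baseSpan, Submodule.span_le]
    rintro _ ⟨w, v, hv, rfl⟩
    exact h w v hv
  exact this hy

theorem vGE_wedge {p : ℕ} (θ : U) {v : V.V} (hv : v ∈ vGE e p) :
    e.symm (ExteriorAlgebra.ι ℂ θ * e v) ∈ vGE e (p + 1) := by
  rw [vGE, Submodule.mem_comap]
  change e (e.symm _) ∈ _
  rw [e.apply_symm_apply]
  exact ι_mul_extGE θ hv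

theorem baseMul_baseSpan (k : KAlg Z U) {p : ℕ} {y : Base Z V}
    (hy : y ∈ baseSpan Z (vGE e p)) : baseMul Z e k y ∈ baseSpan Z (vGE e p) := by
  induction k using kalg_induction generalizing y with
  | add a b ha hb => rw [map_add]; exact Submodule.add_mem _ (ha hy) (hb hy)
  | mul a b ha hb => rw [map_mul]; exact ha (hb hy)
  | scalar r => rw [baseMul_scalar]; exact Submodule.smul_mem _ _ hy
  | gen α θ =>
    refine baseSpan_map (fun w v hv => ?_) hy
    rw [baseMul_gen]
    exact Submodule.add_mem _ (Submodule.subset_span ⟨_, v, hv, rfl⟩)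
      (Submodule.subset_span ⟨_, _, extGE_antitone p (vGE_wedge e θ hv), rfl⟩)

theorem kVec_baseSpan (ε : Z.R ⊗[ℂ] U) {p : ℕ} {y : Base Z V} (hy : y ∈ baseSpan Z (vGE e p)) :
    baseMul Z e (kVec ε) y ∈ baseSpan Z (vGE e (p + 1)) := by
  induction ε with
  | zero => rw [map_zero, map_zero]; exact Submodule.zero_mem _
  | add a b ha hb => rw [map_add, map_add]; exact Submodule.add_mem _ ha hb
  | tmul r θ =>
    rw [kVec_tmul, baseMul_smul_tmul]
    refine Submodule.smul_mem _ _ (baseSpan_map (fun w v hv => ?_) hy)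
    rw [baseMul_gen, map_zero, LinearMap.zero_apply, TensorProduct.zero_tmul,
      TensorProduct.tmul_zero, zero_add]
    exact Submodule.subset_span ⟨_, _, vGE_wedge e θ hv, rfl⟩

variable {e}

/-- An operator that raises the exterior degree in `Λ U` is nilpotent. -/
theorem isNilpotent_of_raises [Module.Finite ℂ U] {T : Module.End Z.R (Total Z V)}
    (h : ∀ p y, y ∈ totalSpan Z (vGE e p) → T y ∈ totalSpan Z (vGE e (p + 1))) :
    IsNilpotent T := by
  have key : ∀ p y, (T ^ p) y ∈ totalSpan Z (vGE e p) := by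
    intro p
    induction p with
    | zero =>
      intro y
      have : vGE e 0 = ⊤ := by rw [vGE, extGE_zero, Submodule.comap_top]
      rw [this]
      exact mem_totalSpan_top _
    | succ p ih => intro y; rw [pow_succ', Module.End.mul_apply]; exact h p _ (ih y)
  refine ⟨Module.finrank ℂ U + 1, LinearMap.ext fun y => ?_⟩
  have h0 : totalSpan Z (vGE e (Module.finrank ℂ U + 1)) = ⊥ := by
    rw [eq_bot_iff, totalSpan, Submodule.span_le]
    rintro _ ⟨z, v, hv, rfl⟩
    rw [vGE, extGE_eq_bot, Submodule.mem_comap, Submodule.mem_bot] at hv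
    have : v = 0 := e.map_eq_zero_iff.mp hv
    rw [this, TensorProduct.tmul_zero, TensorProduct.tmul_zero]
    exact Submodule.zero_mem _
  have := key (Module.finrank ℂ U + 1) y
  rw [h0, Submodule.mem_bot] at this
  exact this

end Filtration

/-! ### Twists of Koszul matrix factorizations -/

section KoszulTwist

variable {𝔥 L : Type} [LieRing 𝔥] [LieAlgebra ℂ 𝔥] [Group L] {S : Symmetry 𝔥 L}
variable {Z : EqSpace S} {U : Type} [AddCommGroup U] [Module ℂ U]

/-- If `c` is an invariant function of weight `χ` and `1` is contained, equivariantly, in the ideal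
generated by `c` and by the equations `s`, then a Koszul matrix factorization of these equations is
isomorphic to its twist by `χ`. -/
theorem IsKoszul.isomorphic_twist [Module.Finite ℂ U] {lieU : 𝔥 → U →ₗ[ℂ] U}
    {actU : L → U →ₗ[ℂ] U} {s : U →ₗ[ℂ] Z.R} {A : KAlg Z U} {E : MF Z}
    (hE : IsKoszul Z lieU actU s A E) (χ : L →* ℂˣ) (hχ : (fun l => (χ l : ℂ)) ∈ S.coord)
    {c v : Z.R} {ε : Z.R ⊗[ℂ] U} (hc : ∀ x, Z.der x c = 0) (hcχ : ∀ l, (χ l : ℂ) • Z.act l c = c)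
    (hv : ∀ l, Z.act l v = (χ l : ℂ) • v)
    (hε : ∀ l, tensorAct (Z.act l) (actU l) ε = (S.κ l : ℂ) • ε)
    (h1 : LinearMap.liftBaseChange Z.R s ε + c * v = 1) :
    MF.Isomorphic (E.twist χ hχ) E := by
  obtain ⟨-, e, hlie, hact, hpar, hD⟩ := hE
  have hD := koszul_Dtot_eq hD
  set K := op (baseMul Z e (kVec ε)) with hK
  set v' := op (baseMul Z e (v ⊗ₜ 1 : KAlg Z U)) with hv'
  set D := totCE Z E.V dCE + op (baseKoszul e s + baseMul Z e A) with hDdef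
  have hC : (c • 1 : Module.End Z.R (Total Z E.V)) = op (baseMul Z e (c ⊗ₜ 1 : KAlg Z U)) := by
    refine total_ext (covariant_smul hc hcχ).lie (op_lie _) (fun w u => ?_)
    rw [← baseIncl_tmul, op_incl, baseMul_scalar, map_smul]
    rfl
  have kact : ∀ l, kAct Z l (actU l) (kVec ε) = kVec (tensorAct (Z.act l) (actU l) ε) := by
    intro l
    generalize ε = ε
    induction ε with
    | zero => simp
    | add a b ha hb => simp only [map_add, ha, hb]
    | tmul r θ =>
      rw [kVec_tmul, kAct, Algebra.TensorProduct.map_tmul, ExteriorAlgebra.map_apply_ι]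
      change _ = (kVec (Z.act l r ⊗ₜ actU l θ) : KAlg Z U)
      rw [kVec_tmul, LinearMap.prodMap_apply, map_zero]
  have kpar : kPar Z U (kVec ε) = -kVec ε := by
    generalize ε = ε
    induction ε with
    | zero => simp
    | add a b ha hb => simp only [map_add, ha, hb, neg_add]
    | tmul r θ =>
      rw [kVec_tmul, kPar, Algebra.TensorProduct.map_tmul, ← TensorProduct.tmul_neg]
      exact congrArg (fun t => r ⊗ₜ[ℂ] t) (involute_ι_ext _)
  have hKcov : Covariant (fun l => (S.κ l : ℂ)⁻¹) (-1) K := by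
    refine covariant_op_baseMul hact hpar (by norm_num) (fun l => ?_) ?_
    · rw [kact, hε, map_smul, smul_smul, inv_mul_cancel₀ (Units.ne_zero _), one_smul]
    · rw [kpar, neg_smul, one_smul]
  have hvcov : Covariant (fun l => (χ l : ℂ)⁻¹) 1 v' := by
    refine covariant_op_baseMul hact hpar (by norm_num) (fun l => ?_) ?_
    · rw [kAct, Algebra.TensorProduct.map_tmul, map_one, hv, ← TensorProduct.smul_tmul', smul_smul,
        inv_mul_cancel₀ (Units.ne_zero _), one_smul]
    · rw [kPar, Algebra.TensorProduct.map_tmul, map_one, one_smul]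
      rfl
  have hstable : ∀ p x, ∀ u ∈ vGE e p, E.V.lie x u ∈ vGE e p := by
    intro p x u hu
    change e (E.V.lie x u) ∈ extGE U p
    rw [hlie]
    exact extDer_extGE _ hu
  have hKraise : ∀ p y, y ∈ totalSpan Z (vGE e p) → K y ∈ totalSpan Z (vGE e (p + 1)) := by
    intro p y hy
    refine totalSpan_map (hstable p) (hstable (p + 1)) (op_lie _) (fun w u hu => ?_) hy
    rw [← baseIncl_tmul, op_incl]
    exact baseIncl_baseSpan (kVec_baseSpan e ε (Submodule.subset_span ⟨w, u, hu, rfl⟩))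
  -- as `[ι_s, K] = s ε = 1 - c v`, only terms that raise the degree in `Λ U` remain
  have hN : D * K + K * D + c • 1 * v' = 1 +
      (totCE Z E.V dCE * K + K * totCE Z E.V dCE +
        (op (baseMul Z e A) * K + K * op (baseMul Z e A))) := by
    have h2 : op (baseKoszul e s) * K + K * op (baseKoszul e s) + c • 1 * v' = 1 := by
      rw [hC, hK, hv', ← map_mul, ← map_mul, ← map_mul, ← map_add, ← map_add]
      have : baseKoszul e s * baseMul Z e (kVec ε) + baseMul Z e (kVec ε) * baseKoszul e s +
          baseMul Z e (c ⊗ₜ 1 : KAlg Z U) * baseMul Z e (v ⊗ₜ 1 : KAlg Z U) = 1 := by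
        refine LinearMap.ext fun y => ?_
        rw [LinearMap.add_apply, LinearMap.add_apply, Module.End.mul_apply, Module.End.mul_apply,
          Module.End.mul_apply, baseKoszul_kVec, baseMul_scalar, baseMul_scalar, smul_smul,
          ← add_smul, h1, one_smul, Module.End.one_apply]
      rw [this, map_one]
    rw [hDdef, map_add]
    generalize c • (1 : Module.End Z.R (Total Z E.V)) * v' = X at h2 ⊢
    rw [← h2]
    noncomm_ring
  have hnil : IsNilpotent (totCE Z E.V dCE * K + K * totCE Z E.V dCE +
        (op (baseMul Z e A) * K + K * op (baseMul Z e A))) := by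
    refine isNilpotent_of_raises (e := e) fun p y hy => ?_
    have hA : ∀ p y, y ∈ totalSpan Z (vGE e p) →
        op (baseMul Z e A) y ∈ totalSpan Z (vGE e p) := by
      intro p y hy
      refine totalSpan_map (hstable p) (hstable p) (op_lie _) (fun w u hu => ?_) hy
      rw [← baseIncl_tmul, op_incl]
      exact baseIncl_baseSpan (baseMul_baseSpan e A (Submodule.subset_span ⟨w, u, hu, rfl⟩))
    exact Submodule.add_mem _
      (Submodule.add_mem _ (totCE_totalSpan _ (hKraise p y hy))
        (hKraise p _ (totCE_totalSpan _ hy)))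
      (Submodule.add_mem _ (hA _ _ (hKraise p y hy)) (hKraise p _ (hA p y hy)))
  obtain ⟨u, hu⟩ := IsNilpotent.isUnit_one_add (R := Module.End Z.R (Total Z E.V)) hnil
  rw [← hN] at hu
  exact EquivMF.isomorphic_twist E χ hχ hc hcχ hKcov hvcov (D := D) hD (φ := ↑u⁻¹)
    (by rw [← hu, Units.mul_inv]) (by rw [← hu, Units.inv_mul])

/-- Koszul matrix factorizations are stable under pull-back. -/
theorem IsKoszul.pullback {Z' : EqSpace S} (φ : EqSpace.Hom Z Z') {lieU : 𝔥 → U →ₗ[ℂ] U}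
    {actU : L → U →ₗ[ℂ] U} {s : U →ₗ[ℂ] Z.R} {A : KAlg Z U} {E : MF Z}
    (hE : IsKoszul Z lieU actU s A E) :
    IsKoszul Z' lieU actU (φ.φ.toLinearMap ∘ₗ s)
      (scalarMap φ.φ (ExteriorAlgebra ℂ (Module.Dual ℂ 𝔥 × U)) A) (E.pullback φ) := by
  obtain ⟨hA, e, hlie, hact, hpar, hD⟩ := hE
  refine ⟨?_, e, hlie, hact, hpar, fun w (v : E.V.V) => ?_⟩
  · refine Submodule.span_induction ?_ ?_ (fun x y _ _ hx hy => ?_) (fun r x _ hx => ?_) hA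
    · rintro _ ⟨a, θ, rfl⟩
      exact Submodule.subset_span ⟨a, θ, by simp [scalarMap]⟩
    · rw [map_zero]; exact Submodule.zero_mem _
    · rw [map_add]; exact Submodule.add_mem _ hx hy
    · rw [scalarMap_smul]; exact Submodule.smul_mem _ _ hx
  · have hc : ∀ a, contract (φ.φ.toLinearMap ∘ₗ s) a = scalarMap φ.φ _ (contract s a) := by
      have hw : ∀ θ y, wedge Z'.R θ (scalarMap φ.φ (ExteriorAlgebra ℂ U) y) =
          scalarMap φ.φ (ExteriorAlgebra ℂ U) (wedge Z.R θ y) := fun θ y =>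
        (scalarMap_lTensor φ.φ (LinearMap.mulLeft ℂ (ExteriorAlgebra.ι ℂ θ)) y).symm
      intro a
      induction a using ext_induction with
      | one => rw [contract_one, contract_one, map_zero]
      | add x y hx hy => simp only [map_add, hx, hy]
      | smul c x hx => simp only [map_smul, hx]
      | ι_mul m x hx =>
        rw [contract_ι_mul, contract_ι_mul, hx, hw, map_sub]
        rfl
    have hk : koszulMul (scalarMap φ.φ (ExteriorAlgebra ℂ (Module.Dual ℂ 𝔥 × U)) A) (w ⊗ₜ e v) =
        scalarMap φ.φ _ (koszulMul A (w ⊗ₜ e v)) :=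
      (scalarMap_lTensor φ.φ _ A).symm
    have hl : E.V.insert Z' (CliffordAlgebra.involute (Q := (0 : QuadraticForm ℂ 𝔥)) w)
        (extend φ.φ E.D (1 ⊗ₜ v)) + extend φ.φ E.del (1 ⊗ₜ (w ⊗ₜ v)) =
        scalarMap φ.φ _ (E.V.insert Z
          (CliffordAlgebra.involute (Q := (0 : QuadraticForm ℂ 𝔥)) w) (E.D (1 ⊗ₜ v)) +
          E.del (1 ⊗ₜ (w ⊗ₜ v))) := by
      rw [extend_tmul, extend_tmul, one_smul, one_smul, map_add]
      exact congrArg (· + _) (scalarMap_lTensor _ _ _).symm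
    refine (congrArg (LinearMap.lTensor Z'.R (LinearMap.lTensor (ExteriorAlgebra ℂ 𝔥)
      e.toLinearMap)) hl).trans ?_
    refine (scalarMap_lTensor φ.φ _ _).symm.trans ?_
    rw [hD, map_add]
    refine congrArg₂ (· + ·) ?_ hk.symm
    rw [hc]
    exact scalarMap_lTensor φ.φ _ _

end KoszulTwist

/-! ### Trivializing a twist by an invertible function -/

section FramedTwist

open Filter Topology

/-- The evaluation of regular functions at a point. -/
def Geometry.eval {𝔥 L : Type} [LieRing 𝔥] [LieAlgebra ℂ 𝔥] [Group L] {S : Symmetry 𝔥 L}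
    (G : Geometry S) (p : G.Z) : G.toSpace.R →ₐ[ℂ] ℂ :=
  (Pi.evalAlgHom ℂ (fun _ : G.Z => ℂ) p).comp (regular G.Z).val

theorem Geometry.eval_ext {𝔥 L : Type} [LieRing 𝔥] [LieAlgebra ℂ 𝔥] [Group L] {S : Symmetry 𝔥 L}
    {G : Geometry S} {f g : G.toSpace.R} (h : ∀ p, G.eval p f = G.eval p g) : f = g :=
  Subtype.ext (funext h)

theorem Geometry.eval_act {𝔥 L : Type} [LieRing 𝔥] [LieAlgebra ℂ 𝔥] [Group L] {S : Symmetry 𝔥 L}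
    (G : Geometry S) (l : L) (p : G.Z) (f : G.toSpace.R) :
    G.eval p (G.toSpace.act l f) = G.eval (G.move l⁻¹ p) f := rfl

/-- An invertible invariant function of weight `χ` trivializes the twist by `χ`. -/
theorem isomorphic_twist_of_mul_eq_one {𝔥 L : Type} [LieRing 𝔥] [LieAlgebra ℂ 𝔥] [Group L]
    {S : Symmetry 𝔥 L} {Z : EqSpace S} (E : MF Z) (χ : L →* ℂˣ)
    (hχ : (fun l => (χ l : ℂ)) ∈ S.coord) {c v : Z.R} (hc : ∀ x, Z.der x c = 0)
    (hcχ : ∀ l, (χ l : ℂ) • Z.act l c = c) (hv : c * v = 1) :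
    MF.Isomorphic (E.twist χ hχ) E := by
  have hder : ∀ x, Z.der x v = 0 := fun x => by
    have h := congrArg (Z.der x) hv
    rw [Derivation.leibniz, hc, smul_zero, add_zero, Derivation.map_one_eq_zero] at h
    have h2 := congrArg (v * ·) h
    simp only [smul_eq_mul, mul_zero, ← mul_assoc] at h2
    rwa [mul_comm v, hv, one_mul] at h2
  have hact : ∀ l, (χ l : ℂ)⁻¹ • Z.act l v = v := fun l => by
    have h := congrArg (Z.act l) hv
    rw [map_mul, map_one] at h
    have h4 : v * ((χ l : ℂ) • Z.act l c) * ((χ l : ℂ)⁻¹ • Z.act l v) = v := by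
      rw [mul_assoc, smul_mul_smul_comm, mul_inv_cancel₀ (Units.ne_zero _), one_smul,
        h, mul_one]
    rwa [hcχ, mul_comm v, hv, one_mul] at h4
  obtain ⟨D, hD⟩ : ∃ D : Module.End Z.R (Total Z E.V), D = E.Dtot := ⟨_, rfl⟩
  have h1 : D * 0 + 0 * D + c • 1 * v • 1 = 1 := by
    rw [mul_zero, zero_mul, add_zero, zero_add, smul_mul_smul_comm, hv, one_smul, one_mul]
  exact isomorphic_twist E χ hχ hc hcχ (e := 0) (v := v • 1) (φ := 1)
    ⟨fun _ _ => by simp, fun _ => by simp, fun _ _ => by simp⟩ (covariant_smul hder hact)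
    hD (by rw [h1, one_mul]) (by rw [h1, one_mul])

variable {n : ℕ} [NeZero n]

theorem le_last (i : Fin n) : i ≤ last n := Nat.le_pred_of_lt i.2

theorem weight_chiLast (l : Torus n) : weight (chiLast n) 0 0 0 l = l.1 (last n) := by
  have : ∏ i, l.1 i ^ chiLast n i = l.1 (last n) := by
    rw [Finset.prod_eq_single (last n)]
    · rw [chiLast, Pi.single_eq_same, zpow_one]
    · intro i _ hi
      rw [chiLast, Pi.single_eq_of_ne hi, zpow_zero]
    · intro h; exact absurd (Finset.mem_univ _) h
  simp [weight, this]

theorem nil_mulVec_last (x : nil n) (u : Fin n → ℂ) : x.1.mulVec u (last n) = 0 := by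
  rw [Matrix.mulVec, dotProduct]
  exact Finset.sum_eq_zero fun j _ => by rw [x.2 _ _ (le_last j), zero_mul]

/-! ### The framed non-reduced space -/

/-- The underlying set of the framed non-reduced space. -/
abbrev nonFrSet (n : ℕ) [NeZero n] : Set (NonAmb n × (Fin n → ℂ)) :=
  {p | p.1 ∈ nonSet n ∧ p ∈ nonStable n}

theorem nonFrame_regular : (fun p : nonFrSet n => ((nong1 n p.1.1)⁻¹.mulVec p.1.2) (last n)) ∈
    regular (nonFrSet n) := by
  have h1 : RegularMat fun p : nonFrSet n => nong1 n p.1.1 :=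
    RegularMat.linear (nong1 n ∘ₗ LinearMap.fst ℂ (NonAmb n) (Fin n → ℂ))
  have h2 := h1.inv fun p => p.2.1.1.1
  have h3 : ∀ j, (fun p : nonFrSet n => p.1.2 j) ∈ regular (nonFrSet n) := fun j =>
    polyFun_regular _ (linear_polyFun (LinearMap.proj j ∘ₗ
      LinearMap.snd ℂ (NonAmb n) (Fin n → ℂ)))
  have : (fun p : nonFrSet n => ((nong1 n p.1.1)⁻¹.mulVec p.1.2) (last n)) =
      ∑ j, (fun p : nonFrSet n => (nong1 n p.1.1)⁻¹ (last n) j) * fun p => p.1.2 j := by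
    ext p
    simp [Matrix.mulVec, dotProduct, Finset.sum_apply]
  rw [this]
  exact sum_mem fun j _ => mul_mem (h2 _ _) (h3 j)

/-- The function `(g₁⁻¹ u)_n` on the framed non-reduced space. -/
def nonFrame (n : ℕ) [NeZero n] : (nonFr n).toSpace.R :=
  (⟨_, nonFrame_regular⟩ : regular (nonFrSet n))

theorem nonFrame_line (x : nil n) {p : NonAmb n} (h : (nong1 n p).det ≠ 0) (u : Fin n → ℂ) (t : ℂ)
    (hd : (nong1 n p * (1 + t • x.1)).det ≠ 0) :
    ((nong1 n p * (1 + t • x.1))⁻¹.mulVec u) (last n) = ((nong1 n p)⁻¹.mulVec u) (last n) := by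
  obtain ⟨w, hw⟩ : ∃ w, w = (nong1 n p * (1 + t • x.1))⁻¹.mulVec u := ⟨_, rfl⟩
  have h1 : (nong1 n p)⁻¹.mulVec u = (1 + t • x.1).mulVec w := by
    have h2 : u = (nong1 n p * (1 + t • x.1)).mulVec w := by
      rw [hw, Matrix.mulVec_mulVec, Matrix.mul_nonsing_inv _ (isUnit_iff_ne_zero.2 hd),
        Matrix.one_mulVec]
    conv_lhs => rw [h2]
    rw [Matrix.mulVec_mulVec, ← mul_assoc,
      Matrix.nonsing_inv_mul _ (isUnit_iff_ne_zero.2 h), one_mul]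
  rw [h1, ← hw, Matrix.add_mulVec, Matrix.one_mulVec, Matrix.smul_mulVec, Pi.add_apply,
    Pi.smul_apply, nil_mulVec_last, smul_zero, add_zero]

theorem nonFrame_der (x : nilSq n) : (nonFr n).toSpace.der x (nonFrame n) = 0 := by
  refine Subtype.ext (funext fun p => ?_)
  have hconst : HasLineDerivAt ℂ (extZero (nonFrame n).1) 0 p.1 (-(nonFr n).ξ x p.1) := by
    refine HasDerivAt.congr_of_eventuallyEq (hasDerivAt_const (0 : ℂ) ((nonFrame n).1 p)) ?_
    filter_upwards [tangent_neg ((nonFr n).tangent x) p] with t ht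
    rw [extZero_mem _ ht]
    have key : ∀ (q : NonAmb n) (u : Fin n → ℂ), (nong1 n q).det ≠ 0 →
        (nong1 n (q + t • (-nonXi n x q))).det ≠ 0 →
        ((nong1 n (q + t • (-nonXi n x q)))⁻¹.mulVec (u + t • (-(0 : Fin n → ℂ)))) (last n) =
          ((nong1 n q)⁻¹.mulVec u) (last n) := by
      intro q u hq hd
      have hg : nong1 n (q + t • (-nonXi n x q)) = nong1 n q * (1 + t • x.1.1) := by
        change q.2.1.1 + t • (- -(q.2.1.1 * x.1.1)) = q.2.1.1 * (1 + t • x.1.1)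
        rw [neg_neg, mul_add, mul_one, mul_smul_comm]
      rw [hg] at hd ⊢
      rw [neg_zero, smul_zero, add_zero]
      exact nonFrame_line x.1 hq _ t hd
    exact key p.1.1 p.1.2 p.2.1.1.1 ht.1.1.1
  exact hconst.lineDeriv

theorem nonFrame_move (l : Matrix.GeneralLinearGroup (Fin n) ℂ × Torus n) (p : (nonFr n).Z) :
    (nonFr n).eval ((nonFr n).move l p) (nonFrame n) =
      l.2.1 (last n) * (nonFr n).eval p (nonFrame n) := by
  have key : ∀ (g : Mat n) (u : Fin n → ℂ), g.det ≠ 0 →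
      (((1 : ℂ) • ((l.1 : Mat n) * g * dg l.2.1⁻¹))⁻¹.mulVec
        ((l.1 : Mat n).mulVec u)) (last n) = l.2.1 (last n) * (g⁻¹.mulVec u) (last n) := by
    intro g u hg
    rw [one_smul, inv_sandwich _ _ _ _ _ (gl_mul_inv l.1) (dg_mul_inv _) hg,
      Matrix.mulVec_mulVec, mul_assoc, gl_inv_mul, mul_one, ← Matrix.mulVec_mulVec, dg_last]
  exact key (nong1 n p.1.1) p.1.2 p.2.1.1.1

theorem nonFrame_act (l : Matrix.GeneralLinearGroup (Fin n) ℂ × Torus n) :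
    (((weight (chiLast n) 0 0 0).comp (MonoidHom.snd _ _) l : ℂˣ) : ℂ) •
      (nonFr n).toSpace.act l (nonFrame n) = nonFrame n := by
  refine Geometry.eval_ext fun p => ?_
  rw [map_smul, Geometry.eval_act, nonFrame_move, smul_eq_mul, ← mul_assoc]
  have : (((weight (chiLast n) 0 0 0).comp (MonoidHom.snd _ _) l : ℂˣ) : ℂ) *
      ((l⁻¹).2.1 (last n) : ℂˣ) = 1 := by
    rw [MonoidHom.comp_apply, weight_chiLast]
    exact Units.mul_inv (l.2.1 (last n))
  rw [this, one_mul]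

/-- The inverse of `(g₁⁻¹ u)_n`. -/
def nonFrameInv (n : ℕ) [NeZero n] : (nonFr n).toSpace.R :=
  (⟨_, regular_inv nonFrame_regular fun p => p.2.2.2⟩ : regular (nonFrSet n))

theorem nonFrame_mul_inv : nonFrame n * nonFrameInv n = 1 := by
  refine Geometry.eval_ext fun p => (map_mul ((nonFr n).eval p) _ _).trans ?_
  rw [map_one]
  have key : ∀ q : nonFrSet n, ((nong1 n q.1.1)⁻¹.mulVec q.1.2) (last n) *
      (((nong1 n q.1.1)⁻¹.mulVec q.1.2) (last n))⁻¹ = 1 := fun q => mul_inv_cancel₀ q.2.2.2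
  exact key p

/-- On the framed non-reduced space `(g₁⁻¹ u)_n` is invertible and trivializes the twist. -/
theorem isomorphic_twist_non (E : MF (nonGeom n).toSpace) :
    MF.Isomorphic (MF.pullback (nonFgt n) (twistNon E (chiLast n) 0))
      (MF.pullback (nonFgt n) E) :=
  isomorphic_twist_of_mul_eq_one (MF.pullback (nonFgt n) E) _
    (weight_coord_snd (chiLast n) 0 0 0) nonFrame_der nonFrame_act nonFrame_mul_inv

/-! ### The framed reduced space -/

/-- The underlying set of the framed reduced space. -/
abbrev redFrSet (n : ℕ) [NeZero n] : Set ((Mat n × Mat n × Mat n) × (Fin n → ℂ)) :=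
  {p | p.1 ∈ redSet n ∧ p ∈ redStable n}

/-- The matrix `g` with its last column replaced by the framing `u`. -/
def redFrameMat (n : ℕ) [NeZero n] (p : (Mat n × Mat n × Mat n) × (Fin n → ℂ)) : Mat n :=
  p.1.2.1.updateCol (last n) p.2

theorem redFrame_entry (i j : Fin n) :
    (fun p : redFrSet n => p.1.1.2.1 i j) ∈ regular (redFrSet n) :=
  polyFun_regular _ (linear_polyFun ((LinearMap.proj j ∘ₗ LinearMap.proj i) ∘ₗ
      LinearMap.fst ℂ (Mat n) (Mat n) ∘ₗ LinearMap.snd ℂ (Mat n) (Mat n × Mat n) ∘ₗ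
      LinearMap.fst ℂ (Mat n × Mat n × Mat n) (Fin n → ℂ)))

theorem redFrame_vec (i : Fin n) : (fun p : redFrSet n => p.1.2 i) ∈ regular (redFrSet n) :=
  polyFun_regular _ (linear_polyFun (LinearMap.proj i ∘ₗ
    LinearMap.snd ℂ (Mat n × Mat n × Mat n) (Fin n → ℂ)))

theorem redFrameMat_regular : RegularMat fun p : redFrSet n => redFrameMat n p.1 := by
  intro i j
  by_cases hj : j = last n
  · subst hj
    simp only [redFrameMat, Matrix.updateCol_self]
    exact redFrame_vec i
  · simp only [redFrameMat, Matrix.updateCol_ne hj]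
    exact redFrame_entry i j

theorem redFrameMat_det (p : redFrSet n) : (redFrameMat n p.1).det ≠ 0 := by
  have h : (redFrameMat n p.1).det = p.1.1.2.1.det * (p.1.1.2.1⁻¹.mulVec p.1.2) (last n) := by
    have h1 : p.1.1.2.1.det • p.1.1.2.1⁻¹ = p.1.1.2.1.adjugate := by
      rw [Matrix.inv_def, smul_smul, Ring.inverse_eq_inv', mul_inv_cancel₀ p.2.1.2.1, one_smul]
    rw [← smul_eq_mul, ← Pi.smul_apply, ← Matrix.smul_mulVec, h1, ← Matrix.cramer_eq_adjugate_mulVec,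
      Matrix.cramer_apply]
    rfl
  rw [h]
  exact mul_ne_zero p.2.1.2.1 p.2.2.2

/-- The torus element that acts on the columns of `redFrameMat`. -/
def frameTorus (t : Fin n → ℂˣ) : Fin n → ℂˣ := Function.update t (last n) 1

theorem frameTorus_inv (t : Fin n → ℂˣ) : frameTorus t⁻¹ = (frameTorus t)⁻¹ := by
  funext k
  by_cases hk : k = last n
  · subst hk; simp [frameTorus]
  · simp [frameTorus, Function.update_of_ne hk]

theorem redFrameMat_move (l : Torus n) (p : (Mat n × Mat n × Mat n) × (Fin n → ℂ)) :
    redFrameMat n (redSigma n l p.1, redTau n l p.2) =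
      dg l.1 * redFrameMat n p * dg (frameTorus l.2.1)⁻¹ := by
  change ((1 : ℂ) • (dg l.1 * p.1.2.1 * dg l.2.1⁻¹)).updateCol (last n) ((dg l.1).mulVec p.2) =
    dg l.1 * (p.1.2.1.updateCol (last n) p.2) * dg (frameTorus l.2.1)⁻¹
  ext i j
  rw [one_smul]
  by_cases hj : j = last n
  · subst hj
    rw [Matrix.updateCol_self, dg_last]
    simp [dg, frameTorus, Matrix.diagonal_mul, Matrix.mul_diagonal]
  · rw [Matrix.updateCol_ne hj]
    simp [dg, frameTorus, Matrix.diagonal_mul, Matrix.mul_diagonal, Matrix.updateCol_ne hj,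
      Function.update_of_ne hj]

/-- The entries of the inverse of `redFrameMat`. -/
def redFrameInv (i j : Fin n) : (redFr n).toSpace.R :=
  (redFrameMat_regular.inv redFrameMat_det).toMatrix i j

theorem redFrameInv_act (l : Torus n) (i j : Fin n) :
    (redFr n).toSpace.act l (redFrameInv i j) =
      (((frameTorus l.2.1 i)⁻¹ * l.1 j : ℂˣ) : ℂ) • redFrameInv i j := by
  refine Geometry.eval_ext fun p => ?_
  rw [map_smul, Geometry.eval_act]
  have key : ∀ q : redFrSet n, (redFrameMat n (redSigma n l⁻¹ q.1.1, redTau n l⁻¹ q.1.2))⁻¹ i j =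
      (((frameTorus l.2.1 i)⁻¹ * l.1 j : ℂˣ) : ℂ) * (redFrameMat n q.1)⁻¹ i j := by
    intro q
    rw [redFrameMat_move, inv_sandwich _ _ _ _ _ (dg_mul_inv _) (dg_mul_inv _)
      (redFrameMat_det q)]
    have h : frameTorus (l⁻¹).2.1 = (frameTorus l.2.1)⁻¹ := frameTorus_inv _
    rw [h]
    simp [dg, Matrix.diagonal_mul, Matrix.mul_diagonal]
    ring
  exact key p

/-- The elementary matrix `E_{j n}`, if it is strictly upper triangular, and `0` otherwise. -/
def lastUnit (j : Fin n) : nil n :=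
  ⟨if j = last n then 0 else Matrix.single j (last n) 1, by
    split_ifs with h
    · exact zero_mem _
    · intro i k hik
      rw [Matrix.single_apply, if_neg]
      rintro ⟨rfl, rfl⟩
      exact h (le_antisymm (le_last _) hik)⟩

theorem eqAct_lastUnit (c : ℂ) (t s : Fin n → ℂˣ) {j : Fin n} (hj : j ≠ last n) :
    eqAct c t s (lastUnit j) = (c * (t j * (s (last n))⁻¹ : ℂˣ)) • lastUnit j := by
  refine Subtype.ext ?_
  change c • (dg t * (if j = last n then 0 else _) * dg s⁻¹) =
    _ • (if j = last n then 0 else _)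
  rw [if_neg hj, mul_smul]
  congr 1
  ext a b
  simp only [dg, Matrix.diagonal_mul, Matrix.mul_diagonal, Matrix.single_apply,
    Matrix.smul_apply, smul_eq_mul]
  split_ifs with h
  · obtain ⟨rfl, rfl⟩ := h
    simp
  · simp

/-- The function `u_n` on the framed reduced space. -/
def redFrame (n : ℕ) [NeZero n] : (redFr n).toSpace.R :=
  (⟨_, redFrame_vec (last n)⟩ : regular (redFrSet n))

theorem redFrame_der (x : nilSq n) : (redFr n).toSpace.der x (redFrame n) = 0 := by
  refine Subtype.ext (funext fun p => ?_)
  refine (lieFun_linear ((redFr n).ξ x) ((redFr n).tangent x) (LinearMap.proj (last n) ∘ₗ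
    LinearMap.snd ℂ (Mat n × Mat n × Mat n) (Fin n → ℂ)) p).trans ?_
  change -(x.1.1.mulVec p.1.2 (last n)) = 0
  rw [nil_mulVec_last, neg_zero]

theorem redFrame_act (l : Torus n) : ((weight (chiLast n) 0 0 0 l : ℂˣ) : ℂ) •
    (redFr n).toSpace.act l (redFrame n) = redFrame n := by
  refine Geometry.eval_ext fun p => ?_
  rw [map_smul, Geometry.eval_act, weight_chiLast]
  have key : ∀ u : Fin n → ℂ, ((l.1 (last n) : ℂˣ) : ℂ) * (dg (l⁻¹).1).mulVec u (last n) =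
      u (last n) := by
    intro u
    rw [dg_last, ← mul_assoc]
    have : ((l.1 (last n) : ℂˣ) : ℂ) * ((l⁻¹).1 (last n) : ℂˣ) = 1 :=
      Units.mul_inv (l.1 (last n))
    rw [this, one_mul]
  exact key p.1.2

theorem eval_lowerEntries_lastUnit (p : redFrSet n) (j : Fin n) :
    (redFr n).eval p ((redFgt n).φ (lowerEntries redg_regular (lastUnit j))) =
      if j = last n then 0 else p.1.1.2.1 (last n) j := by
  change ((if j = last n then 0 else Matrix.single j (last n) 1) * p.1.1.2.1).trace = _
  split_ifs with hj
  · rw [zero_mul, Matrix.trace_zero]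
  · rw [Matrix.trace_single_mul, one_smul]

/-- On the framed reduced space the last row of the product of `G'`, which is `g` with the last column
replaced by `u`, and of `G'⁻¹` expresses `1` through `u_n` and the equations `g_{nj}`, `j < n`, of
the unit. -/
theorem isomorphic_twist_red {A : regular (redSet n) ⊗[ℂ]
      ExteriorAlgebra ℂ (Module.Dual ℂ (nilSq n) × nil n)} {E : MF (redGeom n).toSpace}
    (hE : IsUnitRed n A E) :
    MF.Isomorphic (MF.pullback (redFgt n) (twistRed E (chiLast n) 0))
      (MF.pullback (redFgt n) E) := by
  refine (hE.pullback (redFgt n)).isomorphic_twist _ (weight_coord (chiLast n) 0 0 0)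
    -- the entries of the last column of `G'⁻¹`, where the last entry is paired with `u_n`
    (c := redFrame n) (v := redFrameInv (last n) (last n))
    (ε := ∑ j, redFrameInv j (last n) ⊗ₜ lastUnit j) redFrame_der redFrame_act
    (fun l => ?_) (fun l => ?_) ?_
  · rw [redFrameInv_act, weight_chiLast]
    simp [frameTorus]
  · rw [map_sum, Finset.smul_sum]
    refine Finset.sum_congr rfl fun j _ => ?_
    change (redFr n).toSpace.act l (redFrameInv j (last n)) ⊗ₜ eqAct _ _ _ (lastUnit j) = _
    by_cases hj : j = last n
    · have : lastUnit j = 0 := Subtype.ext (if_pos hj)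
      rw [this, map_zero, TensorProduct.tmul_zero, TensorProduct.tmul_zero, smul_zero]
    · have h2 : ((symRed n).κ l : ℂ) = l.2.2.2 := by simp [symRed, weight]
      rw [redFrameInv_act, eqAct_lastUnit _ _ _ hj, h2, TensorProduct.tmul_smul,
        ← TensorProduct.smul_tmul', smul_smul]
      congr 1
      rw [mul_assoc, ← Units.val_mul]
      have : frameTorus l.2.1 j = l.2.1 j := Function.update_of_ne hj _ _
      rw [this]
      have : l.2.1 j * (l.1 (last n))⁻¹ * ((l.2.1 j)⁻¹ * l.1 (last n)) = 1 := by
        rw [mul_comm ((l.2.1 j)⁻¹), mul_assoc, inv_mul_cancel_left, mul_inv_cancel]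
      rw [this, Units.val_one, mul_one]
  · refine Geometry.eval_ext fun p => ?_
    have h1 : ∀ q : redFrSet n, ∑ j, redFrameMat n q.1 (last n) j *
        (redFrameMat n q.1)⁻¹ j (last n) = 1 := fun q => by
      rw [← Matrix.mul_apply, Matrix.mul_nonsing_inv _
        (isUnit_iff_ne_zero.2 (redFrameMat_det q)), Matrix.one_apply_eq]
    have h3 : ∀ q : redFrSet n, ∀ j, (redFrameMat n q.1)⁻¹ j (last n) *
        (if j = last n then 0 else q.1.1.2.1 (last n) j) =
        if j = last n then 0 else redFrameMat n q.1 (last n) j *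
          (redFrameMat n q.1)⁻¹ j (last n) := by
      intro q j
      split_ifs with hj
      · rw [mul_zero]
      · rw [redFrameMat, Matrix.updateCol_ne hj, mul_comm]
    have h4 : ∀ q : redFrSet n, ∑ j, (redFrameMat n q.1)⁻¹ j (last n) *
        (if j = last n then 0 else q.1.1.2.1 (last n) j) +
        q.1.2 (last n) * (redFrameMat n q.1)⁻¹ (last n) (last n) = 1 := by
      intro q
      rw [← h1 q, Finset.sum_congr rfl fun j _ => h3 q j,
        ← Finset.sum_erase_add _ _ (Finset.mem_univ (last n)),
        ← Finset.sum_erase_add _ _ (Finset.mem_univ (last n)), if_pos rfl, add_zero]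
      congr 1
      · refine Finset.sum_congr rfl fun j hj => ?_
        rw [if_neg (Finset.ne_of_mem_erase hj)]
      · rw [redFrameMat, Matrix.updateCol_self]
    rw [map_add, map_mul, map_sum, map_sum, map_one]
    refine Eq.trans (congrArg₂ (· + ·) (Finset.sum_congr rfl fun j _ => ?_) rfl) (h4 p)
    rw [LinearMap.liftBaseChange_tmul, smul_eq_mul, map_mul]
    exact congrArg₂ (· * ·) rfl (eval_lowerEntries_lastUnit p j)

end FramedTwist

/-! ### Cartan calculus on the Chevalley–Eilenberg complex -/

section Cartan

/-- If `d` satisfies Cartan's formula for `W` and `W'`, then `[d, Lx]` anticommutes with `W`; here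
`W`, `W'` stand for the exterior multiplications by `y` and `[x, y]`, and `L` for the Lie
derivatives. -/
theorem cartan_bracket {A : Type*} [Ring A] {d Lx Ly Lz W W' : A}
    (h1 : Lx * W - W * Lx + W' = 0) (h2 : d * W + W * d = Ly) (h3 : d * W' + W' * d = Lz)
    (h4 : Ly * Lx - Lx * Ly = Lz) : (d * Lx - Lx * d) * W = -(W * (d * Lx - Lx * d)) := by
  have : (d * Lx - Lx * d) * W + W * (d * Lx - Lx * d) =
      (d * W + W * d) * Lx - Lx * (d * W + W * d) - (d * W' + W' * d) +
      (d * (Lx * W - W * Lx + W') + (Lx * W - W * Lx + W') * d) := by noncomm_ring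
  rw [h1, h2, h3, h4] at this
  rw [← add_eq_zero_iff_eq_neg, this]
  simp

/-- If `d` commutes with the Lie derivative `L = [d, W]`, then `d²` commutes with `W`. -/
theorem cartan_square {A : Type*} [Ring A] {d L W : A}
    (h1 : d * W + W * d = L) (h2 : d * L = L * d) : d * d * W = W * (d * d) := by
  subst h1
  have : d * (d * W + W * d) - (d * W + W * d) * d = d * d * W - W * (d * d) := by noncomm_ring
  rw [← sub_eq_zero, ← this, h2, sub_self]

/-- If the parity `p` anticommutes with `W` and commutes with `[d, W]`, then `[d, p]` commutes with
`W`. -/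
theorem cartan_parity {A : Type*} [Ring A] {d p W : A}
    (h2 : p * W = -(W * p)) (h3 : p * (d * W + W * d) = (d * W + W * d) * p) :
    (d * p + p * d) * W = W * (d * p + p * d) := by
  have : (d * p + p * d) * W - W * (d * p + p * d) =
      d * (p * W + W * p) - (p * W + W * p) * d + (p * (d * W + W * d) - (d * W + W * d) * p) := by
    noncomm_ring
  rw [← sub_eq_zero, this, h2, h3]
  simp

variable {𝔥 L : Type} [LieRing 𝔥] [LieAlgebra ℂ 𝔥] [Group L] {S : Symmetry 𝔥 L}

/-- Exterior multiplication by `x` on `U(𝔥) ⊗ Λ 𝔥`. -/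
def ceWedge (x : 𝔥) : Module.End ℂ (CE 𝔥) := wedge (UniversalEnvelopingAlgebra ℂ 𝔥) x

/-- Right multiplication by `x` on `U(𝔥)`, extended to `U(𝔥) ⊗ Λ 𝔥`. -/
def ceRight (x : 𝔥) : Module.End ℂ (CE 𝔥) :=
  LinearMap.rTensor (ExteriorAlgebra ℂ 𝔥)
    (LinearMap.mulRight ℂ (UniversalEnvelopingAlgebra.ι ℂ x))

/-- The adjoint action of `x` on `Λ 𝔥`, extended to `U(𝔥) ⊗ Λ 𝔥`. -/
def ceAd (x : 𝔥) : Module.End ℂ (CE 𝔥) :=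
  LinearMap.lTensor (UniversalEnvelopingAlgebra ℂ 𝔥) (adExt x)

theorem ceWedge_tmul (x : 𝔥) (u : UniversalEnvelopingAlgebra ℂ 𝔥) (w : ExteriorAlgebra ℂ 𝔥) :
    ceWedge x (u ⊗ₜ w) = u ⊗ₜ (ExteriorAlgebra.ι ℂ x * w) := rfl

theorem ceRight_tmul (x : 𝔥) (u : UniversalEnvelopingAlgebra ℂ 𝔥) (w : ExteriorAlgebra ℂ 𝔥) :
    ceRight x (u ⊗ₜ w) = (u * UniversalEnvelopingAlgebra.ι ℂ x) ⊗ₜ w := rfl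

theorem ceAd_tmul (x : 𝔥) (u : UniversalEnvelopingAlgebra ℂ 𝔥) (w : ExteriorAlgebra ℂ 𝔥) :
    ceAd x (u ⊗ₜ w) = u ⊗ₜ adExt x w := rfl

theorem ce_ext {f g : Module.End ℂ (CE 𝔥)} (h : ∀ u w, f (u ⊗ₜ w) = g (u ⊗ₜ w)) : f = g :=
  TensorProduct.ext' h

theorem ceWedge_ceMul (x : 𝔥) (u : UniversalEnvelopingAlgebra ℂ 𝔥) (z : CE 𝔥) :
    ceWedge x (ceMul u z) = ceMul u (ceWedge x z) := by
  have : ceWedge x * (ceMul u : Module.End ℂ (CE 𝔥)) = (ceMul u : Module.End ℂ (CE 𝔥)) * ceWedge x :=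
    ce_ext fun _ _ => rfl
  exact LinearMap.congr_fun this z

theorem ceAd_ceMul (x : 𝔥) (u : UniversalEnvelopingAlgebra ℂ 𝔥) (z : CE 𝔥) :
    ceAd x (ceMul u z) = ceMul u (ceAd x z) := by
  have : ceAd x * (ceMul u : Module.End ℂ (CE 𝔥)) = (ceMul u : Module.End ℂ (CE 𝔥)) * ceAd x :=
    ce_ext fun _ _ => rfl
  exact LinearMap.congr_fun this z

theorem ceRight_ceMul (x : 𝔥) (u : UniversalEnvelopingAlgebra ℂ 𝔥) (z : CE 𝔥) :
    ceRight x (ceMul u z) = ceMul u (ceRight x z) := by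
  have : ceRight x * (ceMul u : Module.End ℂ (CE 𝔥)) =
      (ceMul u : Module.End ℂ (CE 𝔥)) * ceRight x :=
    ce_ext fun u' w => by
      rw [Module.End.mul_apply, Module.End.mul_apply, ceMul_tmul, ceRight_tmul, ceRight_tmul,
        ceMul_tmul, mul_assoc]
  exact LinearMap.congr_fun this z

/-- Cartan's formula: the anticommutator of the Chevalley–Eilenberg differential and of the exterior
multiplication by `x` is the difference of the right multiplication by `x` and of `ad_x`. -/
theorem dCE_ceWedge (x : 𝔥) :
    (dCE : Module.End ℂ (CE 𝔥)) * ceWedge x + ceWedge x * dCE = ceRight x - ceAd x := by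
  refine ce_ext fun u w => ?_
  rw [LinearMap.add_apply, LinearMap.sub_apply, Module.End.mul_apply, Module.End.mul_apply,
    ceWedge_tmul, dCE_tmul, dCE_tmul, dCEOne_ι_mul, map_sub, map_sub, ceMul_tmul, ceMul_tmul,
    ceWedge_ceMul, mul_one, ceRight_tmul, ceAd_tmul]
  exact sub_add_cancel _ _

theorem adExt_ι_mul (x y : 𝔥) (w : ExteriorAlgebra ℂ 𝔥) :
    adExt x (ExteriorAlgebra.ι ℂ y * w) =
      ExteriorAlgebra.ι ℂ ⁅x, y⁆ * w + ExteriorAlgebra.ι ℂ y * adExt x w := extDer_ι_mul _ _ _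

theorem ceAd_ceWedge (x y : 𝔥) :
    ceAd x * ceWedge y = ceWedge y * ceAd x + ceWedge ⁅x, y⁆ := by
  refine ce_ext fun u w => ?_
  rw [LinearMap.add_apply, Module.End.mul_apply, Module.End.mul_apply, ceWedge_tmul, ceWedge_tmul,
    ceAd_tmul, ceAd_tmul, ceWedge_tmul, adExt_ι_mul, TensorProduct.tmul_add, add_comm]

theorem adExt_adExt (x y : 𝔥) (w : ExteriorAlgebra ℂ 𝔥) :
    adExt x (adExt y w) - adExt y (adExt x w) = adExt ⁅x, y⁆ w := by
  induction w using ext_induction with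
  | one => simp [adExt, extDer_one]
  | add a b ha hb => simp only [map_add, ← ha, ← hb]; abel
  | smul c a ha => simp only [map_smul, ← ha, smul_sub]
  | ι_mul m a ha =>
    rw [adExt_ι_mul, adExt_ι_mul, adExt_ι_mul, map_add, map_add, adExt_ι_mul, adExt_ι_mul,
      adExt_ι_mul, adExt_ι_mul, ← ha, lie_lie, map_sub, sub_mul, mul_sub]
    abel

theorem ceAd_mul (x y : 𝔥) : ceAd x * ceAd y - ceAd y * ceAd x = ceAd ⁅x, y⁆ := by
  refine ce_ext fun u w => ?_
  rw [LinearMap.sub_apply, Module.End.mul_apply, Module.End.mul_apply, ceAd_tmul, ceAd_tmul,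
    ceAd_tmul, ceAd_tmul, ceAd_tmul, ← TensorProduct.tmul_sub, adExt_adExt]

theorem ceRight_mul (x y : 𝔥) : ceRight y * ceRight x - ceRight x * ceRight y = ceRight ⁅x, y⁆ := by
  let _ : LieRing (UniversalEnvelopingAlgebra ℂ 𝔥) := LieRing.ofAssociativeRing
  refine ce_ext fun u w => ?_
  rw [LinearMap.sub_apply, Module.End.mul_apply, Module.End.mul_apply, ceRight_tmul, ceRight_tmul,
    ceRight_tmul, ceRight_tmul, ceRight_tmul, ← TensorProduct.sub_tmul,
    (UniversalEnvelopingAlgebra.ι ℂ).map_lie, LieRing.of_associative_ring_bracket, mul_sub,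
    mul_assoc, mul_assoc]

/-- Induction over the exterior degree: an operator on `U(𝔥) ⊗ Λ 𝔥` is determined by its
commutators with `U(𝔥)` and with the exterior multiplications, and by its value at `1`. -/
theorem ce_eq_zero {T : Module.End ℂ (CE 𝔥)} {c : ℂ} (hT : ∀ u z, T (ceMul u z) = ceMul u (T z))
    (h1 : T (1 ⊗ₜ 1) = 0) (hW : ∀ x, T * ceWedge x = c • (ceWedge x * T)) : T = 0 := by
  have h : ∀ w, T (1 ⊗ₜ w) = 0 := by
    intro w
    induction w using ext_induction with
    | one => exact h1
    | add a b ha hb => rw [TensorProduct.tmul_add, map_add, ha, hb, add_zero]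
    | smul c a ha => rw [TensorProduct.tmul_smul, map_smul, ha, smul_zero]
    | ι_mul m a ha =>
      have := LinearMap.congr_fun (hW m) (1 ⊗ₜ a)
      rw [Module.End.mul_apply, LinearMap.smul_apply, Module.End.mul_apply, ha, map_zero,
        smul_zero, ceWedge_tmul] at this
      exact this
  refine ce_ext fun u w => ?_
  have := hT u (1 ⊗ₜ w)
  rwa [ceMul_tmul, mul_one, h, map_zero] at this

theorem dCE_one : dCE (1 ⊗ₜ 1 : CE 𝔥) = 0 := by
  rw [dCE_tmul, dCEOne_one, map_zero]

/-- The Chevalley–Eilenberg differential commutes with the Lie derivatives. -/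
theorem dCE_lieDer (x : 𝔥) :
    (dCE : Module.End ℂ (CE 𝔥)) * (ceRight x - ceAd x) = (ceRight x - ceAd x) * dCE := by
  rw [← sub_eq_zero]
  obtain ⟨d, hd⟩ : ∃ d : Module.End ℂ (CE 𝔥), d = dCE := ⟨_, rfl⟩
  refine ce_eq_zero (c := -1) (fun u z => ?_) ?_ (fun y => ?_)
  · simp only [LinearMap.sub_apply, Module.End.mul_apply, map_sub, ceRight_ceMul, ceAd_ceMul,
      dCE_ceMul]
  · rw [LinearMap.sub_apply, Module.End.mul_apply, Module.End.mul_apply, dCE_one, map_zero, sub_zero,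
      LinearMap.sub_apply, ceRight_tmul, ceAd_tmul, adExt, extDer_one, TensorProduct.tmul_zero,
      sub_zero, dCE_tmul, dCEOne_one, map_zero]
  · have h1 : (ceRight x - ceAd x) * ceWedge y - ceWedge y * (ceRight x - ceAd x) +
        ceWedge ⁅x, y⁆ = 0 := by
      have : ceRight x * ceWedge y = ceWedge y * ceRight x := ce_ext fun _ _ => rfl
      rw [sub_mul, mul_sub, this, ceAd_ceWedge]
      abel
    have h2 := dCE_ceWedge y
    have h3 := dCE_ceWedge ⁅x, y⁆
    have h4 : (ceRight y - ceAd y) * (ceRight x - ceAd x) -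
        (ceRight x - ceAd x) * (ceRight y - ceAd y) = ceRight ⁅x, y⁆ - ceAd ⁅x, y⁆ := by
      have e1 : ceRight x * ceAd y = ceAd y * ceRight x := ce_ext fun _ _ => rfl
      have e2 : ceRight y * ceAd x = ceAd x * ceRight y := ce_ext fun _ _ => rfl
      rw [← ceRight_mul, ← ceAd_mul, sub_mul, mul_sub, mul_sub, sub_mul, mul_sub, mul_sub, e1, e2]
      abel
    rw [← hd] at h2 h3 ⊢
    generalize ceRight x - ceAd x = Lx at *
    generalize ceRight y - ceAd y = Ly at *
    generalize ceRight ⁅x, y⁆ - ceAd ⁅x, y⁆ = Lz at *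
    generalize ceWedge ⁅x, y⁆ = W' at *
    generalize ceWedge y = W at *
    rw [neg_one_smul ℂ (W * (d * Lx - Lx * d))]
    exact cartan_bracket h1 h2 h3 h4

/-- The Chevalley–Eilenberg differential has square zero: its square commutes with the exterior
multiplications, because `d` commutes with the Lie derivatives, and vanishes at `1`. -/
theorem dCE_dCE : (dCE : Module.End ℂ (CE 𝔥)) * dCE = 0 := by
  obtain ⟨d, hd⟩ : ∃ d : Module.End ℂ (CE 𝔥), d = dCE := ⟨_, rfl⟩
  refine ce_eq_zero (c := 1) (fun u z => ?_) ?_ (fun y => ?_)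
  · simp only [Module.End.mul_apply, dCE_ceMul]
  · rw [Module.End.mul_apply, dCE_one, map_zero]
  · have h1 := dCE_ceWedge y
    have h2 := dCE_lieDer y
    rw [← hd] at h1 h2 ⊢
    generalize ceRight y - ceAd y = Ly at *
    generalize ceWedge y = W at *
    rw [one_smul]
    exact cartan_square h1 h2

theorem adExt_involute (x : 𝔥) (w : ExteriorAlgebra ℂ 𝔥) :
    adExt x (CliffordAlgebra.involute (Q := (0 : QuadraticForm ℂ 𝔥)) w) =
      CliffordAlgebra.involute (Q := (0 : QuadraticForm ℂ 𝔥)) (adExt x w) := by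
  induction w using ext_induction with
  | one => rw [map_one, adExt, extDer_one, map_zero]
  | add a b ha hb => rw [map_add, map_add, map_add, map_add, ha, hb]
  | smul c a ha => rw [map_smul, map_smul, map_smul, map_smul, ha]
  | ι_mul m a ha =>
    rw [involute_ι_mul, map_neg, adExt_ι_mul, adExt_ι_mul, ha, map_add, involute_ι_mul,
      involute_ι_mul, neg_add]

/-- The parity operator of `U(𝔥) ⊗ Λ 𝔥`. -/
def cePar' : Module.End ℂ (CE 𝔥) := LinearMap.lTensor (UniversalEnvelopingAlgebra ℂ 𝔥)
  (CliffordAlgebra.involute (Q := (0 : QuadraticForm ℂ 𝔥))).toLinearMap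

theorem cePar'_tmul (u : UniversalEnvelopingAlgebra ℂ 𝔥) (w : ExteriorAlgebra ℂ 𝔥) :
    cePar' (u ⊗ₜ w) = u ⊗ₜ CliffordAlgebra.involute (Q := (0 : QuadraticForm ℂ 𝔥)) w := rfl

theorem cePar'_ceMul (u : UniversalEnvelopingAlgebra ℂ 𝔥) (z : CE 𝔥) :
    cePar' (ceMul u z) = ceMul u (cePar' z) := by
  have : cePar' * (ceMul u : Module.End ℂ (CE 𝔥)) = (ceMul u : Module.End ℂ (CE 𝔥)) * cePar' :=
    ce_ext fun _ _ => rfl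
  exact LinearMap.congr_fun this z

/-- The Chevalley–Eilenberg differential is odd. -/
theorem dCE_par : (dCE : Module.End ℂ (CE 𝔥)) * cePar' = -(cePar' * dCE) := by
  rw [← add_eq_zero_iff_eq_neg]
  refine ce_eq_zero (c := 1) (fun u z => ?_) ?_ (fun x => ?_)
  · simp only [LinearMap.add_apply, Module.End.mul_apply, map_add, cePar'_ceMul, dCE_ceMul]
  · rw [LinearMap.add_apply, Module.End.mul_apply, Module.End.mul_apply, dCE_one, map_zero, add_zero,
      cePar'_tmul, map_one, dCE_one]
  · obtain ⟨d, hd⟩ : ∃ d : Module.End ℂ (CE 𝔥), d = dCE := ⟨_, rfl⟩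
    have h1 := dCE_ceWedge x
    have h2 : cePar' * ceWedge x = -(ceWedge x * cePar') := ce_ext fun u w => by
      rw [Module.End.mul_apply, ceWedge_tmul, cePar'_tmul, involute_ι_mul, TensorProduct.tmul_neg]
      rfl
    have h3 : cePar' * (ceRight x - ceAd x) = (ceRight x - ceAd x) * cePar' := ce_ext fun u w => by
      simp only [Module.End.mul_apply, LinearMap.sub_apply, map_sub, ceRight_tmul, ceAd_tmul,
        cePar'_tmul, adExt_involute]
    rw [← hd] at h1 ⊢
    rw [← h1] at h3
    generalize ceWedge x = W at *
    generalize (cePar' : Module.End ℂ (CE 𝔥)) = p at *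
    rw [one_smul]
    exact cartan_parity h2 h3

end Cartan

/-! ### Koszul differentials and equivariance -/

section Generators

variable {𝔥 L : Type} [LieRing 𝔥] [LieAlgebra ℂ 𝔥] [Group L] {S : Symmetry 𝔥 L}
variable {Z : EqSpace S} {V : EqModule S} {U : Type} [AddCommGroup U] [Module ℂ U]
variable (e : V.V ≃ₗ[ℂ] ExteriorAlgebra ℂ U)

/-- Induction over the degree in `Λ U`: the module `Λ 𝔥 ⊗ M` is generated by `Λ 𝔥` under the
exterior multiplications by elements of `U`. -/
theorem base_koszul_induction {P : Base Z V → Prop} (add : ∀ x y, P x → P y → P (x + y))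
    (smul : ∀ (r : Z.R) y, P y → P (r • y)) (one : ∀ w, P (1 ⊗ₜ (w ⊗ₜ e.symm 1)))
    (gen : ∀ θ y, P y → P (baseMul Z e (1 ⊗ₜ ExteriorAlgebra.ι ℂ (0, θ)) y)) (y) : P y := by
  have key : ∀ (a : ExteriorAlgebra ℂ U) w, P (1 ⊗ₜ (w ⊗ₜ e.symm a)) := by
    intro a
    induction a using ext_induction with
    | one => exact one
    | add a b ha hb =>
      intro w
      rw [map_add, TensorProduct.tmul_add, TensorProduct.tmul_add]
      exact add _ _ (ha w) (hb w)
    | smul c a ha =>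
      intro w
      have := smul (algebraMap ℂ Z.R c) _ (ha w)
      rwa [algebraMap_smul, ← TensorProduct.tmul_smul, ← TensorProduct.tmul_smul,
        ← map_smul] at this
    | ι_mul θ a ha =>
      intro w
      have := gen θ _ (ha (CliffordAlgebra.involute (Q := (0 : QuadraticForm ℂ 𝔥)) w))
      rwa [baseMul_gen, involute_involute_ext, e.apply_symm_apply, map_zero, LinearMap.zero_apply,
        TensorProduct.zero_tmul, TensorProduct.tmul_zero, zero_add] at this
  induction y using base_tmul_induction with
  | add x y hx hy => exact add _ _ hx hy
  | tmul r w v =>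
    have := smul r _ (key (e v) w)
    rwa [e.symm_apply_apply, TensorProduct.smul_tmul', smul_eq_mul, mul_one] at this

theorem baseKoszul_one (s : U →ₗ[ℂ] Z.R) (w : ExteriorAlgebra ℂ 𝔥) :
    baseKoszul e s (1 ⊗ₜ (w ⊗ₜ e.symm 1) : Base Z V) = 0 := by
  rw [baseKoszul_tmul, e.apply_symm_apply, contract_one, map_zero, smul_zero]

theorem baseKoszul_baseMul (s : U →ₗ[ℂ] Z.R) (α : Module.Dual ℂ 𝔥) (θ : U) (y : Base Z V) :
    baseKoszul e s (baseMul Z e (1 ⊗ₜ ExteriorAlgebra.ι ℂ (α, θ)) y) =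
      s θ • y - baseMul Z e (1 ⊗ₜ ExteriorAlgebra.ι ℂ (α, θ)) (baseKoszul e s y) :=
  eq_sub_of_add_eq (baseKoszul_gen e s α θ y)

theorem baseKoszul_sq (s : U →ₗ[ℂ] Z.R) :
    baseKoszul e s * baseKoszul e s = (0 : Module.End Z.R (Base Z V)) := by
  refine LinearMap.ext fun y => ?_
  rw [Module.End.mul_apply, LinearMap.zero_apply]
  induction y using base_koszul_induction e with
  | add x y hx hy => rw [map_add, map_add, hx, hy, add_zero]
  | smul r y hy => rw [map_smul, map_smul, hy, smul_zero]
  | one w => rw [baseKoszul_one, map_zero]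
  | gen θ y hy => rw [baseKoszul_baseMul, map_sub, baseKoszul_baseMul, hy, map_smul, map_zero,
      sub_zero, sub_self]

variable {e}

/-- The operator of `(α, θ)` commutes with the action of `𝔥` on `M`, up to the operator of `x · θ`.
-/
theorem baseLie_gen {lieU : 𝔥 → U →ₗ[ℂ] U} (hlie : ∀ x v, e (V.lie x v) = extDer (lieU x) (e v))
    (x : 𝔥) (α : Module.Dual ℂ 𝔥) (θ : U) (y : Base Z V) :
    baseLie Z V x (baseMul Z e (1 ⊗ₜ ExteriorAlgebra.ι ℂ (α, θ)) y) =
      baseMul Z e (1 ⊗ₜ ExteriorAlgebra.ι ℂ (α, θ)) (baseLie Z V x y) +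
      baseMul Z e (1 ⊗ₜ ExteriorAlgebra.ι ℂ (0, lieU x θ)) y := by
  induction y using base_tmul_induction with
  | add a b ha hb => simp only [map_add, ha, hb]; abel
  | tmul r w v =>
    have h : V.lie x (e.symm (ExteriorAlgebra.ι ℂ θ * e v)) =
        e.symm (ExteriorAlgebra.ι ℂ (lieU x θ) * e v) +
          e.symm (ExteriorAlgebra.ι ℂ θ * e (V.lie x v)) := by
      apply e.injective
      rw [hlie, e.apply_symm_apply, extDer_ι_mul, map_add, e.apply_symm_apply,
        e.apply_symm_apply, hlie]
    rw [baseMul_gen, baseMul_gen, map_add, baseLie_tmul, baseLie_tmul, baseLie_tmul, map_add,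
      baseMul_gen, baseMul_gen, h, map_zero, LinearMap.zero_apply, TensorProduct.zero_tmul,
      TensorProduct.tmul_zero, TensorProduct.tmul_add, TensorProduct.tmul_add]
    abel

theorem baseLie_one {lieU : 𝔥 → U →ₗ[ℂ] U} (hlie : ∀ x v, e (V.lie x v) = extDer (lieU x) (e v))
    (x : 𝔥) (w : ExteriorAlgebra ℂ 𝔥) :
    baseLie Z V x (1 ⊗ₜ (w ⊗ₜ e.symm 1)) = 0 := by
  have : V.lie x (e.symm 1) = 0 := by
    apply e.injective
    rw [hlie, e.apply_symm_apply, extDer_one, map_zero]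
  rw [baseLie_tmul, this, Derivation.map_one_eq_zero, TensorProduct.zero_tmul,
    TensorProduct.tmul_zero, TensorProduct.tmul_zero, add_zero]

/-- The Koszul differential of an equivariant form is equivariant. -/
theorem baseKoszul_baseLie {lieU : 𝔥 → U →ₗ[ℂ] U}
    (hlie : ∀ x v, e (V.lie x v) = extDer (lieU x) (e v)) {s : U →ₗ[ℂ] Z.R}
    (hs : ∀ x θ, s (lieU x θ) = Z.der x (s θ)) (x : 𝔥) (y : Base Z V) :
    baseKoszul e s (baseLie Z V x y) = baseLie Z V x (baseKoszul e s y) := by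
  induction y using base_koszul_induction e with
  | add a b ha hb => simp only [map_add, ha, hb]
  | smul r y hy =>
    rw [baseLie_smul, map_add, map_smul, map_smul, map_smul, baseLie_smul, hy]
  | one w => rw [baseKoszul_one, baseLie_one hlie, map_zero, map_zero]
  | gen θ y hy =>
    rw [baseLie_gen hlie, map_add, baseKoszul_baseMul, baseKoszul_baseMul, baseKoszul_baseMul,
      map_sub, baseLie_smul, baseLie_gen hlie, hy, hs]
    abel

theorem baseKoszul_basePar (hpar : ∀ v, e (V.par v) =
      CliffordAlgebra.involute (Q := (0 : QuadraticForm ℂ U)) (e v)) (s : U →ₗ[ℂ] Z.R)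
    (y : Base Z V) : baseKoszul e s (basePar Z V y) = -basePar Z V (baseKoszul e s y) := by
  have h1 : ∀ θ : U, kPar Z U (1 ⊗ₜ ExteriorAlgebra.ι ℂ ((0 : Module.Dual ℂ 𝔥), θ)) =
      -(1 ⊗ₜ ExteriorAlgebra.ι ℂ ((0 : Module.Dual ℂ 𝔥), θ)) := by
    intro θ
    rw [kPar, Algebra.TensorProduct.map_tmul, involute_ι_ext, TensorProduct.tmul_neg]
    rfl
  induction y using base_koszul_induction e with
  | add a b ha hb => simp only [map_add, ha, hb, neg_add]
  | smul r y hy => rw [basePar_smul, map_smul, map_smul, basePar_smul, hy, smul_neg]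
  | one w =>
    have : V.par (e.symm 1) = e.symm 1 := by
      apply e.injective
      rw [hpar, e.apply_symm_apply, map_one]
    rw [basePar_tmul, this, baseKoszul_one, baseKoszul_one, map_zero, neg_zero]
  | gen θ y hy =>
    rw [basePar_baseMul hpar, h1, map_neg, LinearMap.neg_apply, map_neg, baseKoszul_baseMul,
      baseKoszul_baseMul, map_sub, basePar_smul, basePar_baseMul hpar, h1, map_neg,
      LinearMap.neg_apply, hy, map_neg]

theorem baseKoszul_baseAct {actU : L → U →ₗ[ℂ] U}
    (hact : ∀ l v, e (V.act l v) = ExteriorAlgebra.map (actU l) (e v)) {s : U →ₗ[ℂ] Z.R}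
    (hs : ∀ l θ, s (actU l θ) = (S.κ l : ℂ) • Z.act l (s θ)) (l : L) (y : Base Z V) :
    baseKoszul e s (baseAct Z V l y) = (S.κ l : ℂ) • baseAct Z V l (baseKoszul e s y) := by
  have h1 : ∀ θ : U, kAct Z l (actU l) (1 ⊗ₜ ExteriorAlgebra.ι ℂ ((0 : Module.Dual ℂ 𝔥), θ)) =
      1 ⊗ₜ ExteriorAlgebra.ι ℂ ((0 : Module.Dual ℂ 𝔥), actU l θ) := by
    intro θ
    rw [kAct, Algebra.TensorProduct.map_tmul, ExteriorAlgebra.map_apply_ι, map_one]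
    simp
  induction y using base_koszul_induction e with
  | add a b ha hb => simp only [map_add, ha, hb, smul_add]
  | smul r y hy => rw [baseAct_smul, map_smul, map_smul, baseAct_smul, hy, smul_comm]
  | one w =>
    have : V.act l (e.symm 1) = e.symm 1 := by
      apply e.injective
      rw [hact, e.apply_symm_apply, map_one]
    rw [baseAct_tmul, this, map_one, baseKoszul_one, baseKoszul_one, map_zero, smul_zero]
  | gen θ y hy =>
    rw [baseAct_baseMul (hact l), h1, baseKoszul_baseMul, baseKoszul_baseMul, map_sub, baseAct_smul,
      baseAct_baseMul (hact l), h1, hy, hs, smul_sub, smul_assoc, LinearMap.map_smul_of_tower]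

/-! ### Operators on `Λ 𝔥` -/

variable (Z V) in
/-- The extension to `Λ 𝔥 ⊗ M` of an operator on `Λ 𝔥`. -/
def baseExt (f : Module.End ℂ (ExteriorAlgebra ℂ 𝔥)) : Module.End Z.R (Base Z V) :=
  LinearMap.baseChange Z.R (LinearMap.rTensor V.V f)

theorem baseExt_tmul (f : Module.End ℂ (ExteriorAlgebra ℂ 𝔥)) (r : Z.R) (w : ExteriorAlgebra ℂ 𝔥)
    (v : V.V) : baseExt Z V f (r ⊗ₜ (w ⊗ₜ v)) = r ⊗ₜ (f w ⊗ₜ v) := rfl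

theorem totCE_lTensor (f : Module.End ℂ (ExteriorAlgebra ℂ 𝔥)) :
    totCE Z V (LinearMap.lTensor (UniversalEnvelopingAlgebra ℂ 𝔥) f) = op (baseExt Z V f) := by
  refine total_ext (totCE_lie fun u z => ?_) (op_lie _) fun w v => ?_
  · have : LinearMap.lTensor (UniversalEnvelopingAlgebra ℂ 𝔥) f *
        (ceMul u : Module.End ℂ (CE 𝔥)) = (ceMul u : Module.End ℂ (CE 𝔥)) *
          LinearMap.lTensor (UniversalEnvelopingAlgebra ℂ 𝔥) f := ce_ext fun _ _ => rfl
    exact LinearMap.congr_fun this z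
  · rw [← baseIncl_tmul, op_incl, baseExt_tmul, baseIncl_tmul, baseIncl_tmul]
    rfl

variable (Z V) in
/-- Exterior multiplication by `x` on `CE ⊗ M`. -/
def totWedge (x : 𝔥) : Module.End Z.R (Total Z V) := totCE Z V (ceWedge x)

variable (Z V) in
/-- The adjoint action of `x` on the factor `Λ 𝔥` of `CE ⊗ M`. -/
def totAd (x : 𝔥) : Module.End Z.R (Total Z V) := totCE Z V (ceAd x)

variable (Z V) in
/-- Right multiplication by `x` on the factor `U(𝔥)` of `CE ⊗ M`. -/
def totRight (x : 𝔥) : Module.End Z.R (Total Z V) := totCE Z V (ceRight x)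

theorem totWedge_eq (x : 𝔥) : totWedge Z V x =
    op (baseExt Z V (LinearMap.mulLeft ℂ (ExteriorAlgebra.ι ℂ x))) := totCE_lTensor _

theorem totAd_eq (x : 𝔥) : totAd Z V x = op (baseExt Z V (adExt x)) := totCE_lTensor _

theorem totCE_mul (f g : Module.End ℂ (CE 𝔥)) :
    totCE Z V (f * g) = totCE Z V f * totCE Z V g := by
  refine LinearMap.ext fun y => ?_
  rw [Module.End.mul_apply]
  induction y using total_ce_induction with
  | add a b ha hb => rw [map_add, ha, hb, map_add, map_add]
  | tmul r z v => rw [totCE_tmul, totCE_tmul, totCE_tmul]; rfl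

theorem totCE_add (f g : Module.End ℂ (CE 𝔥)) :
    totCE Z V (f + g) = totCE Z V f + totCE Z V g := by
  refine LinearMap.ext fun y => ?_
  rw [LinearMap.add_apply]
  induction y using total_ce_induction with
  | add a b ha hb => rw [map_add, ha, hb, map_add, map_add]; abel
  | tmul r z v =>
    rw [totCE_tmul, totCE_tmul, totCE_tmul, LinearMap.add_apply, TensorProduct.add_tmul,
      TensorProduct.tmul_add]

/-- Cartan's formula on `CE ⊗ M`. -/
theorem totCE_totWedge (x : 𝔥) : totCE Z V dCE * totWedge Z V x + totWedge Z V x * totCE Z V dCE =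
    totRight Z V x - totAd Z V x := by
  have h : totCE Z V (dCE * ceWedge x + ceWedge x * dCE + ceAd x) = totCE Z V (ceRight x) := by
    rw [dCE_ceWedge]
    exact congrArg _ (sub_add_cancel _ _)
  rw [totCE_add, totCE_add, totCE_mul, totCE_mul] at h
  exact @eq_sub_of_add_eq (Module.End Z.R (Total Z V)) _ _ _ _ h

/-- Induction over the degree in `Λ 𝔥`: an operator on `CE ⊗ M` that commutes with `U(𝔥)` is
determined by its commutators with the exterior multiplications and its restriction to `M`. -/
theorem total_eq_zero {T : Module.End Z.R (Total Z V)} (c : ℂ)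
    (hT : ∀ x y, T (totLie Z V x y) = totLie Z V x (T y))
    (h1 : ∀ v, T (1 ⊗ₜ ((1 ⊗ₜ 1) ⊗ₜ v)) = 0)
    (hW : ∀ x, T * totWedge Z V x = c • (totWedge Z V x * T)) : T = 0 := by
  refine total_ext hT (fun x y => by simp) fun w v => ?_
  rw [LinearMap.zero_apply]
  induction w using ext_induction with
  | one => exact h1 v
  | add a b ha hb =>
    rw [TensorProduct.tmul_add, TensorProduct.add_tmul, TensorProduct.tmul_add, map_add, ha, hb,
      add_zero]
  | smul c a ha =>
    rw [TensorProduct.tmul_smul, ← TensorProduct.smul_tmul', TensorProduct.tmul_smul,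
      LinearMap.map_smul_of_tower, ha, smul_zero]
  | ι_mul m a ha =>
    have := LinearMap.congr_fun (hW m) (1 ⊗ₜ ((1 ⊗ₜ a) ⊗ₜ v))
    rw [Module.End.mul_apply, LinearMap.smul_apply, Module.End.mul_apply, ha, map_zero,
      smul_zero, totWedge, totCE_tmul, ceWedge_tmul] at this
    exact this

theorem totRight_incl (x : 𝔥) (y : Base Z V) :
    totRight Z V x (baseIncl Z V y) =
      totLie Z V x (baseIncl Z V y) - baseIncl Z V (baseLie Z V x y) := by
  induction y using base_tmul_induction with
  | add a b ha hb => simp only [map_add, ha, hb]; abel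
  | tmul r w v =>
    rw [baseIncl_tmul, totRight, totCE_tmul, ceRight_tmul, totLie_tmul, baseLie_tmul, map_add,
      baseIncl_tmul, baseIncl_tmul, one_mul, mul_one]
    abel

/-- The commutator of the extension of `f` with a right multiplication measures the failure of `f`
to commute with `𝔥`, as right multiplication by `x` is, on `Λ 𝔥 ⊗ M`, the difference of the action
of `x` on `CE ⊗ M` and on `M`. -/
theorem totRight_op (x : 𝔥) {f f' : Module.End Z.R (Base Z V)}
    (h : ∀ y, baseLie Z V x (f y) = f (baseLie Z V x y) + f' y) :
    op f * totRight Z V x - totRight Z V x * op f = op f' := by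
  have hR : ∀ y z, totRight Z V x (totLie Z V y z) = totLie Z V y (totRight Z V x z) :=
    totCE_lie (ceRight_ceMul x)
  refine total_ext (fun y z => ?_) (op_lie _) fun w v => ?_
  · rw [LinearMap.sub_apply, LinearMap.sub_apply, Module.End.mul_apply, Module.End.mul_apply,
      Module.End.mul_apply, Module.End.mul_apply, hR, op_lie, op_lie, hR, map_sub]
  · rw [← baseIncl_tmul, LinearMap.sub_apply, Module.End.mul_apply, Module.End.mul_apply,
      totRight_incl, op_incl, totRight_incl, map_sub, op_lie, op_incl, op_incl, op_incl, h,
      map_add]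
    abel

/-! ### Operators defined by `R ⊗ Λ(𝔥* ⊕ U)` -/

variable (Z e) in
/-- The operator on `CE ⊗ M` of an element of `R ⊗ Λ(𝔥* ⊕ U)`. -/
def opMul : KAlg Z U →ₐ[ℂ] Module.End Z.R (Total Z V) := op.comp (baseMul Z e)

variable (Z e) in
/-- The operator of a function `r`. -/
def opFun (r : Z.R) : Module.End Z.R (Total Z V) := opMul Z e (r ⊗ₜ 1)

variable (Z e) in
/-- The operator of `(α, θ) ∈ 𝔥* ⊕ U`. -/
def opGen (α : Module.Dual ℂ 𝔥) (θ : U) : Module.End Z.R (Total Z V) :=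
  opMul Z e (1 ⊗ₜ ExteriorAlgebra.ι ℂ (α, θ))

theorem opMul_incl (k : KAlg Z U) (y : Base Z V) :
    opMul Z e k (baseIncl Z V y) = baseIncl Z V (baseMul Z e k y) := op_incl _ _

theorem opMul_lie (k : KAlg Z U) (x : 𝔥) (y : Total Z V) :
    opMul Z e k (totLie Z V x y) = totLie Z V x (opMul Z e k y) := op_lie _ _ _

theorem opGen_add (α α' : Module.Dual ℂ 𝔥) (θ θ' : U) :
    opGen Z e (α + α') (θ + θ') = opGen Z e α θ + opGen Z e α' θ' := by
  rw [opGen, opGen, opGen, ← map_add, ← TensorProduct.tmul_add, ← map_add, Prod.mk_add_mk]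

theorem opGen_smul (c : ℂ) (α : Module.Dual ℂ 𝔥) (θ : U) :
    opGen Z e (c • α) (c • θ) = c • opGen Z e α θ := by
  rw [opGen, opGen, ← map_smul, ← TensorProduct.tmul_smul, ← map_smul, Prod.smul_mk]

theorem opGen_sum {ι : Type*} [Fintype ι] (α : ι → Module.Dual ℂ 𝔥) (θ : ι → U) :
    opGen Z e (∑ m, α m) (∑ m, θ m) = ∑ m, opGen Z e (α m) (θ m) := by
  let f : Module.Dual ℂ 𝔥 × U →+ Module.End Z.R (Total Z V) :=
    { toFun := fun p => opGen Z e p.1 p.2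
      map_zero' := by
        rw [opGen, Prod.fst_zero, Prod.snd_zero, Prod.mk_zero_zero, map_zero,
          TensorProduct.tmul_zero, map_zero]
      map_add' := fun p q => opGen_add _ _ _ _ }
  have := map_sum f (fun m => (α m, θ m)) Finset.univ
  rw [← prod_mk_sum] at this
  exact this

theorem op_ext {f g : Module.End Z.R (Base Z V)} (h : ∀ r w v, f (r ⊗ₜ (w ⊗ₜ v)) =
    g (r ⊗ₜ (w ⊗ₜ v))) : f = g := by
  refine LinearMap.ext fun y => ?_
  induction y using base_tmul_induction with
  | add a b ha hb => rw [map_add, map_add, ha, hb]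
  | tmul r w v => exact h r w v

theorem opFun_baseExt (r : Z.R) (f : Module.End ℂ (ExteriorAlgebra ℂ 𝔥)) :
    opFun Z e r * op (baseExt Z V f) = op (baseExt Z V f) * opFun Z e r := by
  rw [opFun, opMul, AlgHom.comp_apply, ← map_mul, ← map_mul]
  congr 1
  refine LinearMap.ext fun y => ?_
  rw [Module.End.mul_apply, Module.End.mul_apply, baseMul_scalar, baseMul_scalar, map_smul]

/-- Only the component in `𝔥*` sees the exterior multiplications on `Λ 𝔥`. -/
theorem opGen_totWedge (α : Module.Dual ℂ 𝔥) (θ : U) (x : 𝔥) :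
    opGen Z e α θ * totWedge Z V x + totWedge Z V x * opGen Z e α θ = α x • 1 := by
  rw [opGen, opMul, AlgHom.comp_apply, totWedge_eq, ← map_mul, ← map_mul, ← map_add,
    ← map_one (op (Z := Z) (V := V)), ← map_smul]
  congr 1
  refine op_ext fun r w v => ?_
  rw [LinearMap.add_apply, Module.End.mul_apply, Module.End.mul_apply, LinearMap.smul_apply,
    Module.End.one_apply, baseMul_gen, map_add, baseExt_tmul, baseMul_gen, baseExt_tmul,
    baseExt_tmul, LinearMap.mulLeft_apply, LinearMap.mulLeft_apply, LinearMap.mulLeft_apply,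
    contract_ext_ι_mul, involute_ι_mul, TensorProduct.sub_tmul, TensorProduct.tmul_sub,
    TensorProduct.neg_tmul, TensorProduct.tmul_neg, ← TensorProduct.smul_tmul',
    TensorProduct.tmul_smul]
  abel

theorem contract_adExt (α : Module.Dual ℂ 𝔥) (x : 𝔥) (w : ExteriorAlgebra ℂ 𝔥) :
    CliffordAlgebra.contractLeft (Q := (0 : QuadraticForm ℂ 𝔥)) α (adExt x w) =
      adExt x (CliffordAlgebra.contractLeft (Q := (0 : QuadraticForm ℂ 𝔥)) α w) +
      CliffordAlgebra.contractLeft (Q := (0 : QuadraticForm ℂ 𝔥))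
        (α ∘ₗ (LieAlgebra.ad ℂ 𝔥 x : 𝔥 →ₗ[ℂ] 𝔥)) w := by
  induction w using ext_induction with
  | one =>
    rw [adExt, extDer_one, map_zero, CliffordAlgebra.contractLeft_one,
      CliffordAlgebra.contractLeft_one, map_zero, add_zero]
  | add a b ha hb => simp only [map_add, ha, hb]; abel
  | smul c a ha => simp only [map_smul, ha, smul_add]
  | ι_mul m a ha =>
    rw [adExt_ι_mul, map_add, contract_ext_ι_mul, contract_ext_ι_mul, contract_ext_ι_mul,
      contract_ext_ι_mul, map_sub, map_smul, adExt_ι_mul, ha, mul_add]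
    have : (α ∘ₗ (LieAlgebra.ad ℂ 𝔥 x : 𝔥 →ₗ[ℂ] 𝔥)) m = α ⁅x, m⁆ := rfl
    rw [this]
    abel

theorem opGen_totAd (α : Module.Dual ℂ 𝔥) (θ : U) (x : 𝔥) :
    opGen Z e α θ * totAd Z V x - totAd Z V x * opGen Z e α θ =
      opGen Z e (α ∘ₗ (LieAlgebra.ad ℂ 𝔥 x : 𝔥 →ₗ[ℂ] 𝔥)) 0 := by
  rw [opGen, opGen, opMul, AlgHom.comp_apply, AlgHom.comp_apply, totAd_eq, ← map_mul, ← map_mul]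
  refine (map_sub (op (Z := Z) (V := V)) _ _).symm.trans (congrArg _ ?_)
  refine op_ext fun r w v => ?_
  rw [LinearMap.sub_apply, Module.End.mul_apply, Module.End.mul_apply, baseMul_gen, baseMul_gen,
    map_add, baseExt_tmul, baseMul_gen, baseExt_tmul, baseExt_tmul, contract_adExt,
    ← adExt_involute, map_zero, zero_mul, map_zero, TensorProduct.tmul_zero,
    TensorProduct.tmul_zero, TensorProduct.add_tmul, TensorProduct.tmul_add]
  abel

theorem opFun_totRight (r : Z.R) (x : 𝔥) :
    opFun Z e r * totRight Z V x - totRight Z V x * opFun Z e r = opFun Z e (Z.der x r) :=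
  totRight_op x fun y => by
    change baseLie Z V x (baseMul Z e (r ⊗ₜ 1) y) = baseMul Z e (r ⊗ₜ 1) (baseLie Z V x y) +
      baseMul Z e (Z.der x r ⊗ₜ 1) y
    rw [baseMul_scalar, baseMul_scalar, baseMul_scalar, baseLie_smul, add_comm]

theorem opGen_totRight {lieU : 𝔥 → U →ₗ[ℂ] U}
    (hlie : ∀ x v, e (V.lie x v) = extDer (lieU x) (e v)) (α : Module.Dual ℂ 𝔥) (θ : U) (x : 𝔥) :
    opGen Z e α θ * totRight Z V x - totRight Z V x * opGen Z e α θ =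
      opGen Z e 0 (lieU x θ) := totRight_op x fun y => baseLie_gen hlie x α θ y

theorem totCE_dCE_one (v : V.V) : totCE Z V dCE (1 ⊗ₜ ((1 ⊗ₜ 1) ⊗ₜ v)) = 0 := by
  rw [totCE_tmul, dCE_one, TensorProduct.zero_tmul, TensorProduct.tmul_zero]

theorem involute_one_ext {M : Type} [AddCommGroup M] [Module ℂ M] :
    CliffordAlgebra.involute (Q := (0 : QuadraticForm ℂ M)) (1 : ExteriorAlgebra ℂ M) = 1 :=
  map_one _

theorem contract_ext_one {M : Type} [AddCommGroup M] [Module ℂ M] (α : Module.Dual ℂ M) :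
    CliffordAlgebra.contractLeft (Q := (0 : QuadraticForm ℂ M)) α (1 : ExteriorAlgebra ℂ M) = 0 :=
  CliffordAlgebra.contractLeft_one (Q := (0 : QuadraticForm ℂ M)) α

theorem opFun_one (r : Z.R) (v : V.V) :
    opFun Z e r (1 ⊗ₜ ((1 ⊗ₜ 1) ⊗ₜ v)) = r • 1 ⊗ₜ ((1 ⊗ₜ 1) ⊗ₜ v) := by
  rw [← baseIncl_tmul, opFun, opMul_incl, baseMul_scalar, map_smul]

theorem opGen_one (α : Module.Dual ℂ 𝔥) (θ : U) (v : V.V) :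
    opGen Z e α θ (1 ⊗ₜ ((1 ⊗ₜ 1) ⊗ₜ v)) =
      1 ⊗ₜ ((1 ⊗ₜ 1) ⊗ₜ e.symm (ExteriorAlgebra.ι ℂ θ * e v)) := by
  rw [← baseIncl_tmul, opGen, opMul_incl, baseMul_gen, involute_one_ext,
    contract_ext_one, TensorProduct.zero_tmul, TensorProduct.tmul_zero, zero_add,
    baseIncl_tmul]

theorem commutator_sub {A : Type*} [Ring A] {r s t p q : A} (hp : r * s - s * r = p)
    (hq : r * t - t * r = q) : r * (s - t) - (s - t) * r = -q + p := by
  rw [← hp, ← hq]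
  noncomm_ring

theorem commutator_sub_commute {A : Type*} [Ring A] {r s t p : A} (hp : r * s - s * r = p)
    (hq : r * t = t * r) : r * (s - t) - (s - t) * r = p := by
  rw [commutator_sub hp (sub_eq_zero.2 hq), neg_zero, zero_add]

/-- The step in the exterior degree for `[d, r] = -∑ η_m s_m`: the difference of the two sides
anticommutes with the exterior multiplication `W`. -/
theorem cartan_scalar {A ι : Type*} [Ring A] [Algebra ℂ A] [Fintype ι] {d Lx W r r' : A}
    {η s : ι → A} {c : ι → ℂ} (hL : d * W + W * d = Lx) (hr : r * W = W * r)
    (hs : ∀ m, s m * W = W * s m) (hη : ∀ m, η m * W + W * η m = c m • 1)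
    (h : r * Lx - Lx * r = r') (h' : r' = ∑ m, c m • s m) :
    (d * r - r * d + ∑ m, η m * s m) * W = -(W * (d * r - r * d + ∑ m, η m * s m)) := by
  have h1 : (d * r - r * d) * W + W * (d * r - r * d) =
      (d * W + W * d) * r - r * (d * W + W * d) + (d * (r * W - W * r) + (r * W - W * r) * d) := by
    noncomm_ring
  rw [hr, sub_self, hL, mul_zero, zero_mul, add_zero, add_zero,
    ← neg_sub (r * Lx) (Lx * r), h] at h1
  have h2 : (∑ m, η m * s m) * W + W * ∑ m, η m * s m = r' := by
    rw [h', Finset.sum_mul, Finset.mul_sum, ← Finset.sum_add_distrib]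
    refine Finset.sum_congr rfl fun m _ => ?_
    rw [mul_assoc, hs, ← mul_assoc, ← mul_assoc, ← add_mul, hη, smul_mul_assoc, one_mul]
  rw [← add_eq_zero_iff_eq_neg, add_mul, mul_add, add_add_add_comm, h1, h2, neg_add_cancel]

/-- The step in the exterior degree for `[d, G] = ∑ B_m C_m`: the difference of the two sides
commutes with the exterior multiplication `W`. -/
theorem cartan_gen {A ι : Type*} [Ring A] [Algebra ℂ A] [Fintype ι] {d Lx W G G' : A} {a : ℂ}
    {B C : ι → A} {b c : ι → ℂ} (hL : d * W + W * d = Lx) (hG : G * W + W * G = a • 1)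
    (hB : ∀ m, B m * W + W * B m = b m • 1) (hC : ∀ m, C m * W + W * C m = c m • 1)
    (h : G * Lx - Lx * G = G') (h' : G' = ∑ m, (c m • B m - b m • C m)) :
    (d * G + G * d - ∑ m, B m * C m) * W = W * (d * G + G * d - ∑ m, B m * C m) := by
  have h1 : (d * G + G * d) * W - W * (d * G + G * d) =
      d * (G * W + W * G) - (G * W + W * G) * d + (G * (d * W + W * d) - (d * W + W * d) * G) := by
    noncomm_ring
  rw [hG, hL, h, mul_smul_comm, smul_mul_assoc, mul_one, one_mul, sub_self, zero_add] at h1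
  have h2 : (∑ m, B m * C m) * W - W * ∑ m, B m * C m = G' := by
    rw [h', Finset.sum_mul, Finset.mul_sum, ← Finset.sum_sub_distrib]
    refine Finset.sum_congr rfl fun m _ => ?_
    have e1 : B m * C m * W - W * (B m * C m) =
      B m * (C m * W + W * C m) - (B m * W + W * B m) * C m := by noncomm_ring
    rw [e1, hB, hC, mul_smul_comm, smul_mul_assoc, mul_one, one_mul]
  rw [← sub_eq_zero, sub_mul, mul_sub, sub_sub_sub_comm, h1, h2, sub_self]

/-- The differential of a function. -/
theorem totCE_opFun {ι : Type*} [Fintype ι] {r : Z.R} {α : ι → Module.Dual ℂ 𝔥} {s : ι → Z.R}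
    (h : ∀ x, Z.der x r = ∑ m, α m x • s m) :
    totCE Z V dCE * opFun Z e r - opFun Z e r * totCE Z V dCE =
      -∑ m, opGen Z e (α m) 0 * opFun Z e (s m) := by
  refine (@add_eq_zero_iff_eq_neg (Module.End Z.R (Total Z V)) _ _ _).1 ?_
  refine total_eq_zero (-1) (fun x y => ?_) (fun v => ?_) (fun x => ?_)
  · simp only [LinearMap.add_apply, LinearMap.sub_apply, Module.End.mul_apply, LinearMap.sum_apply,
      totCE_lie dCE_ceMul, opFun, opGen, opMul_lie, map_add, map_sub, map_sum]
  · simp only [LinearMap.add_apply, LinearMap.sub_apply, Module.End.mul_apply, LinearMap.sum_apply,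
      totCE_dCE_one, opFun_one, map_smul, opGen_one, map_zero, zero_mul, TensorProduct.tmul_zero,
      smul_zero, Finset.sum_const_zero, sub_zero, add_zero]
  · rw [neg_one_smul ℂ (totWedge Z V x * _)]
    have hw : ∀ r, opFun Z e r * totWedge Z V x = totWedge Z V x * opFun Z e r := fun r => by
      rw [totWedge_eq, opFun_baseExt]
    refine cartan_scalar (totCE_totWedge x) (hw r) (fun m => hw (s m))
      (fun m => opGen_totWedge (α m) 0 x) ?_ ?_ (r' := opFun Z e (Z.der x r))
    · refine commutator_sub_commute (A := Module.End Z.R (Total Z V)) (opFun_totRight r x) ?_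
      rw [totAd_eq, opFun_baseExt]
    · rw [h, opFun, TensorProduct.sum_tmul, map_sum]
      refine Finset.sum_congr rfl fun m _ => ?_
      rw [← TensorProduct.smul_tmul', map_smul, opFun]

/-- The Chevalley–Eilenberg part of the differential of an element of `𝔥* ⊕ U`. -/
theorem totCE_opGen {ι : Type*} [Fintype ι] {lieU : 𝔥 → U →ₗ[ℂ] U}
    (hlie : ∀ x v, e (V.lie x v) = extDer (lieU x) (e v))
    {α : Module.Dual ℂ 𝔥} {θ : U} {β γ : ι → Module.Dual ℂ 𝔥} {τ : ι → U}
    (h1 : ∀ x y, -α ⁅x, y⁆ = ∑ m, (γ m x * β m y - β m x * γ m y))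
    (h2 : ∀ x, lieU x θ = -∑ m, β m x • τ m) :
    totCE Z V dCE * opGen Z e α θ + opGen Z e α θ * totCE Z V dCE =
      ∑ m, opGen Z e (β m) 0 * opGen Z e (γ m) (τ m) := by
  rw [← sub_eq_zero]
  refine total_eq_zero 1 (fun x y => ?_) (fun v => ?_) (fun x => ?_)
  · simp only [LinearMap.add_apply, LinearMap.sub_apply, Module.End.mul_apply, LinearMap.sum_apply,
      totCE_lie dCE_ceMul, opGen, opMul_lie, map_add, map_sub, map_sum]
  · simp only [LinearMap.add_apply, LinearMap.sub_apply, Module.End.mul_apply, LinearMap.sum_apply,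
      totCE_dCE_one, opGen_one, map_zero, zero_mul, TensorProduct.tmul_zero,
      Finset.sum_const_zero, sub_zero, add_zero]
  · rw [one_smul]
    refine cartan_gen (totCE_totWedge x) (opGen_totWedge α θ x)
      (fun m => opGen_totWedge (β m) 0 x) (fun m => opGen_totWedge (γ m) (τ m) x)
      (G' := opGen Z e (-(α ∘ₗ (LieAlgebra.ad ℂ 𝔥 x : 𝔥 →ₗ[ℂ] 𝔥))) (lieU x θ)) ?_ ?_
    · have e1 := opGen_totRight (Z := Z) hlie α θ x
      have e2 := opGen_totAd (Z := Z) (e := e) α θ x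
      have e3 := opGen_add (Z := Z) (e := e) (-(α ∘ₗ (LieAlgebra.ad ℂ 𝔥 x : 𝔥 →ₗ[ℂ] 𝔥))) 0 0 (lieU x θ)
      have e4 := opGen_smul (Z := Z) (e := e) (-1) (α ∘ₗ (LieAlgebra.ad ℂ 𝔥 x : 𝔥 →ₗ[ℂ] 𝔥)) (0 : U)
      rw [neg_one_smul, smul_zero, neg_one_smul ℂ (opGen Z e _ 0)] at e4
      rw [add_zero, zero_add] at e3
      rw [e3, e4]
      exact commutator_sub (A := Module.End Z.R (Total Z V)) e1 e2
    · have e1 : -(α ∘ₗ (LieAlgebra.ad ℂ 𝔥 x : 𝔥 →ₗ[ℂ] 𝔥)) =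
          ∑ m, (γ m x • β m - β m x • γ m) := by
        refine LinearMap.ext fun y => ?_
        rw [LinearMap.sum_apply]
        exact h1 x y
      have e2 : lieU x θ = ∑ m, (γ m x • (0 : U) - β m x • τ m) := by
        rw [h2, ← Finset.sum_neg_distrib]
        refine Finset.sum_congr rfl fun m _ => ?_
        rw [smul_zero, zero_sub]
      have e3 : ∀ m, γ m x • opGen Z e (β m) 0 - β m x • opGen Z e (γ m) (τ m) =
          opGen Z e (γ m x • β m - β m x • γ m) (γ m x • (0 : U) - β m x • τ m) := by
        intro m
        rw [← opGen_smul, ← opGen_smul]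
        have := opGen_add (Z := Z) (e := e) (γ m x • β m - β m x • γ m) (β m x • γ m)
          (γ m x • (0 : U) - β m x • τ m) (β m x • τ m)
        rw [sub_add_cancel, sub_add_cancel] at this
        rw [this]
        exact @add_sub_cancel_right (Module.End Z.R (Total Z V)) _ _ _
      rw [e1, e2, opGen_sum]
      exact Finset.sum_congr rfl fun m _ => (e3 m).symm

/-! ### The differential `d_ce + ι_s` -/

variable (Z e) in
/-- The differential `d_ce + ι_s` of `CE ⊗ M`. -/
def dKoszul (s : U →ₗ[ℂ] Z.R) : Module.End Z.R (Total Z V) :=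
  totCE Z V dCE + op (baseKoszul e s)

theorem dKoszul_lie (s : U →ₗ[ℂ] Z.R) (x : 𝔥) (y : Total Z V) :
    dKoszul Z e s (totLie Z V x y) = totLie Z V x (dKoszul Z e s y) := by
  rw [dKoszul, LinearMap.add_apply, LinearMap.add_apply, totCE_lie dCE_ceMul, op_lie, map_add]

theorem opFun_baseKoszul (s : U →ₗ[ℂ] Z.R) (r : Z.R) :
    op (baseKoszul e s) * opFun Z e r = opFun Z e r * op (baseKoszul e s) := by
  rw [opFun, opMul, AlgHom.comp_apply, ← map_mul, ← map_mul]
  congr 1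
  refine LinearMap.ext fun y => ?_
  rw [Module.End.mul_apply, Module.End.mul_apply, baseMul_scalar, baseMul_scalar, map_smul]

theorem opGen_baseKoszul (s : U →ₗ[ℂ] Z.R) (α : Module.Dual ℂ 𝔥) (θ : U) :
    op (baseKoszul e s) * opGen Z e α θ + opGen Z e α θ * op (baseKoszul e s) =
      opFun Z e (s θ) := by
  rw [opFun, opGen, opMul, AlgHom.comp_apply, AlgHom.comp_apply, ← map_mul, ← map_mul, ← map_add]
  congr 1
  refine LinearMap.ext fun y => ?_
  rw [LinearMap.add_apply, Module.End.mul_apply, Module.End.mul_apply, baseMul_scalar,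
    baseKoszul_gen]

theorem dKoszul_opFun {ι : Type*} [Fintype ι] (σ : U →ₗ[ℂ] Z.R) {r : Z.R}
    {α : ι → Module.Dual ℂ 𝔥} {s : ι → Z.R} (h : ∀ x, Z.der x r = ∑ m, α m x • s m) :
    dKoszul Z e σ * opFun Z e r - opFun Z e r * dKoszul Z e σ =
      -∑ m, opGen Z e (α m) 0 * opFun Z e (s m) := by
  rw [← totCE_opFun h, dKoszul, add_mul, mul_add, opFun_baseKoszul]
  abel

theorem dKoszul_opGen {ι : Type*} [Fintype ι] (σ : U →ₗ[ℂ] Z.R) {lieU : 𝔥 → U →ₗ[ℂ] U}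
    (hlie : ∀ x v, e (V.lie x v) = extDer (lieU x) (e v))
    {α : Module.Dual ℂ 𝔥} {θ : U} {β γ : ι → Module.Dual ℂ 𝔥} {τ : ι → U}
    (h1 : ∀ x y, -α ⁅x, y⁆ = ∑ m, (γ m x * β m y - β m x * γ m y))
    (h2 : ∀ x, lieU x θ = -∑ m, β m x • τ m) :
    dKoszul Z e σ * opGen Z e α θ + opGen Z e α θ * dKoszul Z e σ =
      opFun Z e (σ θ) + ∑ m, opGen Z e (β m) 0 * opGen Z e (γ m) (τ m) := by
  rw [← totCE_opGen hlie h1 h2, ← opGen_baseKoszul σ α, dKoszul, add_mul, mul_add]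
  abel

/-- If `I` anticommutes with `W` and commutes with the Lie derivative `[d, W]`, then `[d, I]`
commutes with `W`. -/
theorem cartan_koszul {A : Type*} [Ring A] {d Lx W I : A} (hL : d * W + W * d = Lx)
    (hI : I * W = -(W * I)) (h : I * Lx = Lx * I) :
    (d * I + I * d) * W = W * (d * I + I * d) := by
  have h1 : (d * I + I * d) * W - W * (d * I + I * d) =
      d * (I * W + W * I) - (I * W + W * I) * d + (I * (d * W + W * d) - (d * W + W * d) * I) := by
    noncomm_ring
  rw [← sub_eq_zero, h1, hL, h, hI]
  simp

/-- The Chevalley–Eilenberg and the Koszul differential anticommute, because `s` is equivariant. -/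
theorem totCE_baseKoszul {lieU : 𝔥 → U →ₗ[ℂ] U}
    (hlie : ∀ x v, e (V.lie x v) = extDer (lieU x) (e v)) {s : U →ₗ[ℂ] Z.R}
    (hs : ∀ x θ, s (lieU x θ) = Z.der x (s θ)) :
    totCE Z V dCE * op (baseKoszul e s) + op (baseKoszul e s) * totCE Z V dCE = 0 := by
  refine total_eq_zero 1 (fun x y => ?_) (fun v => ?_) (fun x => ?_)
  · simp only [LinearMap.add_apply, Module.End.mul_apply, totCE_lie dCE_ceMul, op_lie, map_add]
  · rw [LinearMap.add_apply, Module.End.mul_apply, Module.End.mul_apply, totCE_dCE_one, map_zero,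
      add_zero, ← baseIncl_tmul, op_incl, baseKoszul_tmul, one_smul, map_one]
    generalize contract s (e v) = c
    induction c with
    | zero => simp
    | add a b ha hb => rw [map_add, map_add, map_add, ha, hb, add_zero]
    | tmul r a =>
      rw [baseInsert_tmul, baseIncl_tmul, totCE_tmul, dCE_one, TensorProduct.zero_tmul,
        TensorProduct.tmul_zero]
  · rw [one_smul]
    have key : ∀ (f : Module.End ℂ (ExteriorAlgebra ℂ 𝔥)) (w : ExteriorAlgebra ℂ 𝔥)
        (c : Z.R ⊗[ℂ] ExteriorAlgebra ℂ U), baseExt Z V f (baseInsert Z e w c) =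
          baseInsert Z e (f w) c := by
      intro f w c
      induction c with
      | zero => simp
      | add a b ha hb => rw [map_add, map_add, ha, hb, map_add]
      | tmul r a => rfl
    refine cartan_koszul (A := Module.End Z.R (Total Z V)) (totCE_totWedge x) ?_ ?_
    · rw [totWedge_eq, ← map_mul, ← map_mul, ← map_neg]
      congr 1
      refine op_ext fun r w v => ?_
      rw [LinearMap.neg_apply, Module.End.mul_apply, Module.End.mul_apply, baseKoszul_tmul,
        baseExt_tmul, baseKoszul_tmul, map_smul, key, LinearMap.mulLeft_apply,
        LinearMap.mulLeft_apply, involute_ι_mul, map_neg, LinearMap.neg_apply, smul_neg]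
    · have e1 : op (baseKoszul e s) * totAd Z V x = totAd Z V x * op (baseKoszul e s) := by
        rw [totAd_eq, ← map_mul, ← map_mul]
        congr 1
        refine op_ext fun r w v => ?_
        rw [Module.End.mul_apply, Module.End.mul_apply, baseKoszul_tmul, baseExt_tmul,
          baseKoszul_tmul, map_smul, key, adExt_involute]
      have e2 := totRight_op x (f := baseKoszul e s) (f' := 0) fun y => by
        rw [baseKoszul_baseLie hlie hs, LinearMap.zero_apply, add_zero]
      rw [map_zero] at e2
      exact (@sub_eq_zero (Module.End Z.R (Total Z V)) _ _ _).1
        (commutator_sub_commute (A := Module.End Z.R (Total Z V)) e2 e1)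

/-- The differential `d_ce + ι_s` has square zero, for an equivariant `s`. -/
theorem dKoszul_sq {lieU : 𝔥 → U →ₗ[ℂ] U}
    (hlie : ∀ x v, e (V.lie x v) = extDer (lieU x) (e v)) {s : U →ₗ[ℂ] Z.R}
    (hs : ∀ x θ, s (lieU x θ) = Z.der x (s θ)) : dKoszul Z e s * dKoszul Z e s = 0 := by
  have h1 : totCE Z V dCE * totCE Z V dCE = 0 := by
    rw [← totCE_mul, dCE_dCE]
    refine LinearMap.ext fun y => ?_
    induction y using total_ce_induction with
    | add a b ha hb => rw [map_add, ha, hb, map_add]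
    | tmul r z v => rw [totCE_tmul]; simp
  have h2 : op (baseKoszul e s) * op (baseKoszul e s) = (0 : Module.End Z.R (Total Z V)) := by
    rw [← map_mul, baseKoszul_sq, map_zero]
  rw [dKoszul, mul_add, add_mul, add_mul, h1, h2, zero_add, add_zero, add_comm,
    totCE_baseKoszul hlie hs]

theorem extAct_adExt (l : L) (x : 𝔥) (w : ExteriorAlgebra ℂ 𝔥) :
    S.extAct l (adExt x w) = adExt (S.Ad l x) (S.extAct l w) := by
  have key : ∀ m w, S.extAct l (ExteriorAlgebra.ι ℂ m * w) =
      ExteriorAlgebra.ι ℂ ((S.κ l : ℂ) • S.Ad l m) * S.extAct l w := fun m w => map_ι_mul _ _ _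
  induction w using ext_induction with
  | one =>
    have : S.extAct l 1 = 1 := map_one (ExteriorAlgebra.map ((S.κ l : ℂ) • (S.Ad l : 𝔥 →ₗ[ℂ] 𝔥)))
    rw [adExt, adExt, this, extDer_one, extDer_one, map_zero]
  | add a b ha hb => simp only [map_add, ha, hb]
  | smul c a ha => simp only [map_smul, ha]
  | ι_mul m a ha =>
    rw [adExt_ι_mul, map_add, key, key, key, adExt_ι_mul, ha, lie_smul, LieHom.map_lie]

theorem dCE_ceAct (l : L) (z : CE 𝔥) :
    dCE (S.ceAct l z) = (S.κ l : ℂ) • S.ceAct l (dCE z) := by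
  let _ : LieRing (UniversalEnvelopingAlgebra ℂ 𝔥) := LieRing.ofAssociativeRing
  have key : ∀ m w, S.extAct l (ExteriorAlgebra.ι ℂ m * w) =
      ExteriorAlgebra.ι ℂ ((S.κ l : ℂ) • S.Ad l m) * S.extAct l w := fun m w => map_ι_mul _ _ _
  have hmul : ∀ u z, S.ceAct l (ceMul u z) = ceMul (UniversalEnvelopingAlgebra.lift ℂ
      ((UniversalEnvelopingAlgebra.ι ℂ).comp (S.Ad l)) u) (S.ceAct l z) := by
    intro u z
    refine TensorProduct.induction_on z (by simp) (fun u' w => ?_) (fun a b ha hb => ?_)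
    · rw [ceMul_tmul, ceAct_tmul, ceAct_tmul, ceMul_tmul, map_mul]
    · simp only [map_add, ha, hb]
  have hwedge : ∀ m z, S.ceAct l (wedge _ m z) =
      wedge _ ((S.κ l : ℂ) • S.Ad l m) (S.ceAct l z) := by
    intro m z
    refine TensorProduct.induction_on z (by simp) (fun u' w => ?_) (fun a b ha hb => ?_)
    · rw [wedge_tmul, ceAct_tmul, ceAct_tmul, wedge_tmul, key]
    · simp only [map_add, ha, hb]
  have h1 : ∀ w, dCEOne (S.extAct l w) = (S.κ l : ℂ) • S.ceAct l (dCEOne w) := by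
    intro w
    induction w using ext_induction with
    | one =>
      have : S.extAct l 1 = 1 := map_one (ExteriorAlgebra.map ((S.κ l : ℂ) • (S.Ad l : 𝔥 →ₗ[ℂ] 𝔥)))
      rw [this, dCEOne_one, map_zero, smul_zero]
    | add a b ha hb => simp only [map_add, ha, hb, smul_add]
    | smul c a ha => simp only [map_smul, ha]; rw [smul_comm]
    | ι_mul m a ha =>
      rw [key, dCEOne_ι_mul, dCEOne_ι_mul, map_sub, map_sub, ceAct_tmul, ceAct_tmul, hwedge, ha,
        extAct_adExt, UniversalEnvelopingAlgebra.lift_ι_apply, map_one]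
      have e1 : adExt ((S.κ l : ℂ) • S.Ad l m) = (S.κ l : ℂ) • adExt (S.Ad l m) := by
        refine LinearMap.ext fun w => ?_
        rw [adExt, map_smul]
        exact extDer_smul _ _ _
      rw [e1, map_smul, LinearMap.smul_apply, TensorProduct.tmul_smul, smul_sub, smul_sub,
        ← TensorProduct.smul_tmul', map_smul]
      rfl
  refine TensorProduct.induction_on z (by simp) (fun u w => ?_) (fun a b ha hb => ?_)
  · rw [ceAct_tmul, dCE_tmul, dCE_tmul, hmul, h1, map_smul]
  · simp only [map_add, ha, hb, smul_add]

theorem covariant_dKoszul {actU : L → U →ₗ[ℂ] U}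
    (hact : ∀ l v, e (V.act l v) = ExteriorAlgebra.map (actU l) (e v))
    (hpar : ∀ v, e (V.par v) =
      CliffordAlgebra.involute (Q := (0 : QuadraticForm ℂ U)) (e v)) {s : U →ₗ[ℂ] Z.R}
    (hs : ∀ l θ, s (actU l θ) = (S.κ l : ℂ) • Z.act l (s θ)) :
    Covariant (fun l => (S.κ l : ℂ)) (-1) (dKoszul Z e s) := by
  refine Covariant.add ⟨totCE_lie dCE_ceMul, fun y => ?_, fun l y => ?_⟩
    (covariant_op (fun y => ?_) (baseKoszul_baseAct hact hs))
  · induction y using total_ce_induction with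
    | add a b ha hb => rw [map_add, map_add, ha, hb, map_add, map_add, smul_add]
    | tmul r z v =>
      have := LinearMap.congr_fun (dCE_par (𝔥 := 𝔥)) z
      have e1 : ∀ z, totPar Z V (r ⊗ₜ (z ⊗ₜ v)) = r ⊗ₜ (cePar' z ⊗ₜ V.par v) := fun _ => rfl
      rw [e1, totCE_tmul, totCE_tmul, e1]
      rw [Module.End.mul_apply, LinearMap.neg_apply, Module.End.mul_apply] at this
      rw [this, TensorProduct.neg_tmul, TensorProduct.tmul_neg]
      exact (neg_one_smul ℂ _).symm
  · induction y using total_ce_induction with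
    | add a b ha hb => rw [map_add, map_add, ha, hb, map_add, map_add, smul_add]
    | tmul r z v =>
      have e1 : ∀ z, totAct Z V l (r ⊗ₜ (z ⊗ₜ v)) = Z.act l r ⊗ₜ (S.ceAct l z ⊗ₜ V.act l v) :=
        fun _ => rfl
      rw [e1, totCE_tmul, totCE_tmul, e1, dCE_ceAct, ← TensorProduct.smul_tmul',
        TensorProduct.tmul_smul]
  · rw [baseKoszul_basePar hpar]
    exact (neg_one_smul ℂ _).symm

end Generators

/-! ### Supercommutative differential algebras -/

/-- A supercommutative differential algebra: `γ` is the parity automorphism (`1` on even and `-1` on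
odd elements) and `d` is an odd derivation of square zero. -/
structure SuperDG (S : Type) [Ring S] [Algebra ℂ S] where
  γ : S →ₐ[ℂ] S
  d : S →ₗ[ℂ] S
  γ_γ : ∀ a, γ (γ a) = a
  even_comm : ∀ a, γ a = a → ∀ b, a * b = b * a
  odd_comm : ∀ a, γ a = -a → ∀ b, a * b = γ b * a
  d_mul : ∀ a b, d (a * b) = d a * b + γ a * d b
  d_γ : ∀ a, d (γ a) = -γ (d a)
  d_d : ∀ a, d (d a) = 0

namespace SuperDG

variable {S : Type} [Ring S] [Algebra ℂ S] (G : SuperDG S) {n : ℕ}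

theorem odd_sq {a : S} (ha : G.γ a = -a) : a * a = 0 := by
  have h := G.odd_comm a ha a
  rw [ha, neg_mul, eq_neg_iff_add_eq_zero, ← two_smul ℂ] at h
  exact (smul_eq_zero_iff_right (two_ne_zero' ℂ)).1 h

theorem d_one : G.d 1 = 0 := by
  have h := G.d_mul 1 1
  rw [map_one G.γ, mul_one, one_mul, mul_one] at h
  exact left_eq_add.1 h

/-- The subalgebra of even elements. -/
def even : Subalgebra ℂ S where
  carrier := {a | G.γ a = a}
  mul_mem' {a b} ha hb := by rw [Set.mem_ofPred_eq, map_mul, ha, hb]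
  add_mem' {a b} ha hb := by rw [Set.mem_ofPred_eq, map_add, ha, hb]
  algebraMap_mem' c := G.γ.commutes c

instance : CommRing G.even :=
  { (inferInstance : Ring G.even) with
    mul_comm := fun a b => Subtype.ext (G.even_comm a a.2 b) }

/-- The ideal of the even subalgebra that is generated by the products of two odd elements. -/
def oddIdeal : Ideal G.even :=
  Ideal.span {x | ∃ a b : S, G.γ a = -a ∧ G.γ b = -b ∧ (x : S) = a * b}

theorem isNilpotent_of_mem_oddIdeal {x : G.even} (hx : x ∈ G.oddIdeal) : IsNilpotent x := by
  rw [← mem_nilradical]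
  refine (Ideal.span_le.2 ?_ : G.oddIdeal ≤ nilradical G.even) hx
  rintro x ⟨a, b, ha, hb, h⟩
  refine mem_nilradical.2 ⟨2, Subtype.ext ?_⟩
  have : (x : S) * x = 0 := by
    rw [h, mul_assoc, ← mul_assoc b, G.odd_comm b hb a, ha, neg_mul, neg_mul, mul_neg, mul_assoc a b b,
      ← mul_assoc a, G.odd_sq ha, zero_mul, neg_zero]
  rw [pow_two]
  exact this

/-! ### Matrices, and the covariant derivative -/

/-- The covariant derivative `∂M - a M + γ(M) b` of a matrix, for connections `a` and `b` on its target
and its source. -/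
def md (a b M : Matrix (Fin n) (Fin n) S) : Matrix (Fin n) (Fin n) S :=
  M.map G.d - a * M + M.map G.γ * b

theorem map_γ_mul (M N : Matrix (Fin n) (Fin n) S) :
    (M * N).map G.γ = M.map G.γ * N.map G.γ := Matrix.map_mul

theorem map_d_mul (M N : Matrix (Fin n) (Fin n) S) :
    (M * N).map G.d = M.map G.d * N + M.map G.γ * N.map G.d := by
  ext i j
  simp only [Matrix.map_apply, Matrix.mul_apply, Matrix.add_apply, map_sum, G.d_mul,
    Finset.sum_add_distrib]

theorem map_d_add (M N : Matrix (Fin n) (Fin n) S) :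
    (M + N).map G.d = M.map G.d + N.map G.d := by
  ext i j
  simp only [Matrix.map_apply, Matrix.add_apply, map_add]

theorem map_d_sub (M N : Matrix (Fin n) (Fin n) S) :
    (M - N).map G.d = M.map G.d - N.map G.d := by
  ext i j
  simp only [Matrix.map_apply, Matrix.sub_apply, map_sub]

theorem map_γ_add (M N : Matrix (Fin n) (Fin n) S) :
    (M + N).map G.γ = M.map G.γ + N.map G.γ := by
  ext i j
  simp only [Matrix.map_apply, Matrix.add_apply, map_add]

theorem map_γ_sub (M N : Matrix (Fin n) (Fin n) S) :
    (M - N).map G.γ = M.map G.γ - N.map G.γ := by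
  ext i j
  simp only [Matrix.map_apply, Matrix.sub_apply, map_sub]

theorem map_d_γ (M : Matrix (Fin n) (Fin n) S) : (M.map G.γ).map G.d = -(M.map G.d).map G.γ := by
  ext i j
  simp only [Matrix.map_apply, Matrix.neg_apply, G.d_γ]

theorem map_d_d (M : Matrix (Fin n) (Fin n) S) : (M.map G.d).map G.d = 0 := by
  ext i j
  simp only [Matrix.map_apply, Matrix.zero_apply, G.d_d]

/-- The Leibniz rule for the covariant derivative of a product. -/
theorem md_mul (a b c M N : Matrix (Fin n) (Fin n) S) :
    G.md a c (M * N) = G.md a b M * N + M.map G.γ * G.md b c N := by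
  rw [md, md, md, map_d_mul, map_γ_mul]
  noncomm_ring

theorem md_sub (a b M N : Matrix (Fin n) (Fin n) S) :
    G.md a b (M - N) = G.md a b M - G.md a b N := by
  rw [md, md, md, map_d_sub, map_γ_sub]
  noncomm_ring

theorem map_γ_γ (M : Matrix (Fin n) (Fin n) S) : (M.map G.γ).map G.γ = M := by
  ext i j
  simp only [Matrix.map_apply, G.γ_γ]

theorem map_γ_smul (s : S) (M : Matrix (Fin n) (Fin n) S) :
    (s • M).map G.γ = G.γ s • M.map G.γ := by
  ext i j
  simp only [Matrix.map_apply, Matrix.smul_apply, smul_eq_mul, map_mul]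

/-- The Leibniz rule for the multiplication by an odd scalar. -/
theorem md_smul (a b M : Matrix (Fin n) (Fin n) S) {s : S} (hs : G.γ s = -s)
    (ha : a.map G.γ = -a) : G.md a b (s • M) = G.d s • M - s • G.md a b M := by
  have h1 : (s • M).map G.d = G.d s • M - s • M.map G.d := by
    ext i j
    simp only [Matrix.map_apply, Matrix.smul_apply, Matrix.sub_apply, smul_eq_mul, G.d_mul, hs,
      neg_mul, sub_eq_add_neg]
  have h2 : a * s • M = -(s • (a * M)) := by
    ext i j
    simp only [Matrix.mul_apply, Matrix.smul_apply, Matrix.neg_apply, smul_eq_mul, Finset.mul_sum,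
      ← Finset.sum_neg_distrib]
    refine Finset.sum_congr rfl fun k _ => ?_
    rw [← mul_assoc, G.odd_comm _ (congrFun (congrFun ha i) k), hs, neg_mul, neg_mul, mul_assoc]
  rw [md, md, h1, h2, map_γ_smul, hs, Matrix.smul_mul, smul_add, smul_sub, neg_smul]
  abel

/-- If `a` and `b` are flat, the covariant derivative has square zero. -/
theorem md_md {a b : Matrix (Fin n) (Fin n) S} (ha : a.map G.γ = -a) (hb : b.map G.γ = -b)
    (hda : a.map G.d = a * a) (hdb : b.map G.d = b * b) (M : Matrix (Fin n) (Fin n) S) :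
    G.md a b (G.md a b M) = 0 := by
  have h1 : (G.md a b M).map G.d = -(a * a) * M + a * M.map G.d - (M.map G.d).map G.γ * b +
      M * (b * b) := by
    rw [md, map_d_add, map_d_sub, map_d_d, map_d_mul, map_d_mul, map_d_γ, map_γ_γ, ha, hda, hdb]
    noncomm_ring
  have h2 : (G.md a b M).map G.γ = (M.map G.d).map G.γ + a * M.map G.γ - M * b := by
    rw [md, map_γ_add, map_γ_sub, map_γ_mul, map_γ_mul, map_γ_γ, ha, hb]
    noncomm_ring
  rw [md, h1, h2, md]
  noncomm_ring

/-- The trace is a horizontal map. -/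
theorem d_trace {a : Matrix (Fin n) (Fin n) S} (ha : a.map G.γ = -a)
    (M : Matrix (Fin n) (Fin n) S) : G.d M.trace = (G.md a a M).trace := by
  have h1 : (a * M).trace = (M.map G.γ * a).trace := by
    simp only [Matrix.trace, Matrix.diag, Matrix.mul_apply]
    rw [Finset.sum_comm]
    refine Finset.sum_congr rfl fun i _ => Finset.sum_congr rfl fun j _ => ?_
    refine G.odd_comm _ ?_ _
    exact congrFun (congrFun ha j) i
  rw [md, Matrix.trace_add, Matrix.trace_sub, h1, sub_add_cancel, Matrix.trace, Matrix.trace,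
    map_sum]
  rfl

/-- `M` is homogeneous of weight `c` for the torus elements `p` (on its target) and `q` (on its
source), which act through `α`. -/
def Homog (α : S →ₐ[ℂ] S) (c : ℂ) (p q : Fin n → ℂ) (M : Matrix (Fin n) (Fin n) S) : Prop :=
  ∀ i j, α (M i j) = (c * p i * (q j)⁻¹) • M i j

variable {α : S →ₐ[ℂ] S} {c c' : ℂ} {p q r : Fin n → ℂ} {M N : Matrix (Fin n) (Fin n) S}

theorem Homog.mul (hM : Homog α c p q M) (hN : Homog α c' q r N) (hq : ∀ i, q i ≠ 0) :
    Homog α (c * c') p r (M * N) := by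
  intro i j
  rw [Matrix.mul_apply, map_sum, Finset.smul_sum]
  refine Finset.sum_congr rfl fun k _ => ?_
  rw [map_mul, hM, hN, smul_mul_smul_comm]
  congr 1
  have := hq k
  field_simp

theorem Homog.sub (hM : Homog α c p q M) (hN : Homog α c p q N) : Homog α c p q (M - N) := by
  intro i j
  rw [Matrix.sub_apply, map_sub, hM, hN, smul_sub]

theorem Homog.add (hM : Homog α c p q M) (hN : Homog α c p q N) : Homog α c p q (M + N) := by
  intro i j
  rw [Matrix.add_apply, map_add, hM, hN, smul_add]

theorem Homog.congr (hM : Homog α c p q M) (h : c = c') : Homog α c' p q M := h ▸ hM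

theorem Homog.smul (hM : Homog α c p q M) {s : S} (hs : α s = c' • s) :
    Homog α (c' * c) p q (s • M) := by
  intro i j
  rw [Matrix.smul_apply, smul_eq_mul, map_mul, hs, hM, smul_mul_smul_comm, mul_assoc c', mul_assoc,
    mul_assoc, mul_assoc c]

theorem Homog.trace (hM : Homog α c p p M) (hp : ∀ i, p i ≠ 0) : α M.trace = c • M.trace := by
  rw [Matrix.trace, map_sum, Finset.smul_sum]
  refine Finset.sum_congr rfl fun i _ => ?_
  rw [Matrix.diag_apply, hM, mul_assoc, mul_inv_cancel₀ (hp i), mul_one]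

theorem Homog.map_γ (hM : Homog α c p q M) (hα : ∀ s, α (G.γ s) = G.γ (α s)) :
    Homog α c p q (M.map G.γ) := by
  intro i j
  rw [Matrix.map_apply, hα, hM, map_smul]

theorem Homog.map_d (hM : Homog α c p q M) {κ : ℂ} (hα : ∀ s, α (G.d s) = κ⁻¹ • G.d (α s)) :
    Homog α (κ⁻¹ * c) p q (M.map G.d) := by
  intro i j
  rw [Matrix.map_apply, hα, hM, map_smul, smul_smul, mul_assoc κ⁻¹, mul_assoc, mul_assoc,
    mul_assoc c]

theorem Homog.md (hM : Homog α c p q M) {κ : ℂ} (hα : ∀ s, α (G.γ s) = G.γ (α s))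
    (hd : ∀ s, α (G.d s) = κ⁻¹ • G.d (α s)) {a b : Matrix (Fin n) (Fin n) S}
    (ha : Homog α κ⁻¹ p p a) (hb : Homog α κ⁻¹ q q b) (hp : ∀ i, p i ≠ 0) (hq : ∀ i, q i ≠ 0) :
    Homog α (κ⁻¹ * c) p q (G.md a b M) :=
  ((hM.map_d G hd).sub (ha.mul hM hp)).add
    (((hM.map_γ G hα).mul hb hq).congr (mul_comm _ _))

end SuperDG

namespace SuperDG

variable {S : Type} [Ring S] [Algebra ℂ S] (G : SuperDG S) {n : ℕ}

/-! ### Triangular matrices -/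

/-- Strictly upper triangular matrices. -/
def Strict {R : Type*} [Zero R] (M : Matrix (Fin n) (Fin n) R) : Prop := ∀ i j, j ≤ i → M i j = 0

/-- Upper triangular matrices. -/
def Upper {R : Type*} [Zero R] (M : Matrix (Fin n) (Fin n) R) : Prop := ∀ i j, j < i → M i j = 0

section Triangular

variable {R : Type*} [Ring R] {M N : Matrix (Fin n) (Fin n) R}

theorem Strict.upper (hM : Strict M) : Upper M := fun i j h => hM i j h.le

theorem Upper.mul (hM : Upper M) (hN : Upper N) : Upper (M * N) := by
  intro i j h
  rw [Matrix.mul_apply]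
  refine Finset.sum_eq_zero fun k _ => ?_
  rcases lt_or_ge k i with hk | hk
  · rw [hM i k hk, zero_mul]
  · rw [hN k j (h.trans_le hk), mul_zero]

theorem Upper.mul_strict (hM : Upper M) (hN : Strict N) : Strict (M * N) := by
  intro i j h
  rw [Matrix.mul_apply]
  refine Finset.sum_eq_zero fun k _ => ?_
  rcases lt_or_ge k i with hk | hk
  · rw [hM i k hk, zero_mul]
  · rw [hN k j (h.trans hk), mul_zero]

theorem Strict.mul_upper (hM : Strict M) (hN : Upper N) : Strict (M * N) := by
  intro i j h
  rw [Matrix.mul_apply]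
  refine Finset.sum_eq_zero fun k _ => ?_
  rcases le_or_gt k i with hk | hk
  · rw [hM i k hk, zero_mul]
  · rw [hN k j (h.trans_lt hk), mul_zero]

theorem Strict.trace (hM : Strict M) : M.trace = 0 :=
  Finset.sum_eq_zero fun i _ => hM i i le_rfl

theorem Upper.sub (hM : Upper M) (hN : Upper N) : Upper (M - N) := fun i j h => by
  rw [Matrix.sub_apply, hM i j h, hN i j h, sub_zero]

theorem Upper.smul (hM : Upper M) (s : R) : Upper (s • M) := fun i j h => by
  rw [Matrix.smul_apply, hM i j h, smul_zero]

theorem Upper.adjugate {R : Type*} [CommRing R] {M : Matrix (Fin n) (Fin n) R} (hM : Upper M) :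
    Upper M.adjugate := by
  intro i j h
  rw [Matrix.adjugate_apply, Matrix.det_of_isUpperTriangular]
  · refine Finset.prod_eq_zero (Finset.mem_univ j) ?_
    rw [Matrix.updateRow_self, Pi.single_eq_of_ne h.ne]
  · intro a b hab
    by_cases ha : a = j
    · subst ha
      rw [Matrix.updateRow_self, Pi.single_eq_of_ne]
      rintro rfl
      exact absurd (h.trans hab) (lt_irrefl _)
    · rw [Matrix.updateRow_ne ha]
      exact hM a b hab

end Triangular

variable {G} in
theorem Upper.md {a b M : Matrix (Fin n) (Fin n) S} (hM : Upper M) (ha : Strict a)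
    (hb : Strict b) : Upper (G.md a b M) := by
  intro i j h
  have hγ : Upper (M.map G.γ) := fun i j h => by rw [Matrix.map_apply, hM i j h, map_zero]
  rw [SuperDG.md, Matrix.add_apply, Matrix.sub_apply, (ha.upper.mul hM) i j h,
    (hγ.mul hb.upper) i j h, Matrix.map_apply, hM i j h, map_zero, sub_zero, add_zero]

/-! ### Weights of determinants and adjugates -/

section Weights

variable {E : Type*} [CommRing E] [Algebra ℂ E] {α : E →ₐ[ℂ] E} {p q : Fin n → ℂ}
  {M : Matrix (Fin n) (Fin n) E}

theorem mapMatrix_eq (hM : ∀ i j, α (M i j) = (p i * (q j)⁻¹) • M i j) :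
    α.mapMatrix M = Matrix.diagonal (fun i => algebraMap ℂ E (p i)) * M *
      Matrix.diagonal (fun i => algebraMap ℂ E (q i)⁻¹) := by
  ext i j
  rw [AlgHom.mapMatrix_apply, Matrix.map_apply, hM, Matrix.mul_diagonal, Matrix.diagonal_mul,
    Algebra.smul_def, map_mul]
  ring

theorem map_det_of_homog (hM : ∀ i j, α (M i j) = (p i * (q j)⁻¹) • M i j) :
    α M.det = ((∏ i, p i) * (∏ i, q i)⁻¹) • M.det := by
  rw [AlgHom.map_det, mapMatrix_eq hM, Matrix.det_mul, Matrix.det_mul, Matrix.det_diagonal,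
    Matrix.det_diagonal, ← map_prod, ← map_prod, Finset.prod_inv_distrib, Algebra.smul_def, map_mul]
  ring

theorem map_adjugate_of_homog (hM : ∀ i j, α (M i j) = (p i * (q j)⁻¹) • M i j)
    (hp : ∀ i, p i ≠ 0) (hq : ∀ i, q i ≠ 0) (i j : Fin n) :
    α (M.adjugate i j) = ((∏ i, p i) * (∏ i, q i)⁻¹ * q i * (p j)⁻¹) • M.adjugate i j := by
  have h : α (M.adjugate i j) = (α.mapMatrix M.adjugate) i j := rfl
  have h1 : (∏ l ∈ Finset.univ.erase j, p l) = (∏ l, p l) * (p j)⁻¹ := by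
    rw [← Finset.mul_prod_erase Finset.univ p (Finset.mem_univ j)]
    have := hp j
    field_simp
  have h2 : (∏ l ∈ Finset.univ.erase i, (q l)⁻¹) = (∏ l, q l)⁻¹ * q i := by
    rw [← Finset.mul_prod_erase Finset.univ q (Finset.mem_univ i), Finset.prod_inv_distrib]
    have := hq i
    field_simp
  rw [h, AlgHom.map_adjugate, mapMatrix_eq hM, Matrix.adjugate_mul_distrib,
    Matrix.adjugate_mul_distrib, Matrix.adjugate_diagonal, Matrix.adjugate_diagonal, ← mul_assoc,
    Matrix.mul_diagonal, Matrix.diagonal_mul, ← map_prod, ← map_prod, h1, h2, Algebra.smul_def]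
  simp only [map_mul]
  ring

end Weights

/-! ### The universal correction term -/

variable (n) in
/-- The matrices that enter into the unit: `g` with its inverse `k`, the matrices `X` and `Y`, the
odd coordinates `Θ` and `Ξ` that resolve the equations `g_{ij} = 0` and `X_{ij} = 0` (for `i > j`), and
the connections `η₁` and `η₂` of the two copies of `𝔫`. -/
structure UnitData where
  g : Matrix (Fin n) (Fin n) S
  k : Matrix (Fin n) (Fin n) S
  X : Matrix (Fin n) (Fin n) S
  Y : Matrix (Fin n) (Fin n) S
  Θ : Matrix (Fin n) (Fin n) S
  Ξ : Matrix (Fin n) (Fin n) S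
  η₁ : Matrix (Fin n) (Fin n) S
  η₂ : Matrix (Fin n) (Fin n) S
  g_even : Homog G.γ 1 1 1 g
  k_even : Homog G.γ 1 1 1 k
  X_even : Homog G.γ 1 1 1 X
  Y_even : Homog G.γ 1 1 1 Y
  Θ_odd : Homog G.γ (-1) 1 1 Θ
  Ξ_odd : Homog G.γ (-1) 1 1 Ξ
  η₁_odd : Homog G.γ (-1) 1 1 η₁
  η₂_odd : Homog G.γ (-1) 1 1 η₂
  g_k : g * k = 1
  d_g : g.map G.d = η₁ * g - g * η₂
  d_k : k.map G.d = η₂ * k - k * η₁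
  d_X : X.map G.d = η₁ * X - X * η₁
  d_Y : Y.map G.d = η₂ * Y - Y * η₂
  d_η₁ : η₁.map G.d = η₁ * η₁
  d_η₂ : η₂.map G.d = η₂ * η₂
  d_Θ : ∀ i j, j < i → G.d (Θ i j) = g i j + (η₁ * Θ + Θ * η₂) i j
  Θ_eq_zero : ∀ i j, i ≤ j → Θ i j = 0
  d_Ξ : ∀ i j, j < i → G.d (Ξ i j) = X i j + (η₁ * Ξ + Ξ * η₁) i j
  Y_strict : Strict Y
  η₁_strict : Strict η₁
  η₂_strict : Strict η₂

/-- An automorphism `α` (of weight `κ⁻¹` on `d`) for which all matrices are homogeneous. -/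
structure UnitData.Weight (D : G.UnitData n) where
  α : S →ₐ[ℂ] S
  κ : ℂ
  ν : ℂ
  p : Fin n → ℂ
  q : Fin n → ℂ
  κ_ne : κ ≠ 0
  ν_ne : ν ≠ 0
  p_ne : ∀ i, p i ≠ 0
  q_ne : ∀ i, q i ≠ 0
  α_γ : ∀ s, α (G.γ s) = G.γ (α s)
  α_d : ∀ s, α (G.d s) = κ⁻¹ • G.d (α s)
  g : Homog α 1 p q D.g
  k : Homog α 1 q p D.k
  X : Homog α ν p p D.X
  Y : Homog α (ν⁻¹ * κ⁻¹ * κ⁻¹) q q D.Y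
  Θ : Homog α κ p q D.Θ
  Ξ : Homog α (κ * ν) p p D.Ξ
  η₁ : Homog α κ⁻¹ p p D.η₁
  η₂ : Homog α κ⁻¹ q q D.η₂

variable {G}

theorem Homog.map_eq {α : S →ₐ[ℂ] S} {M : Matrix (Fin n) (Fin n) S} (h : Homog α 1 1 1 M) :
    M.map α = M := by
  ext i j
  rw [Matrix.map_apply, h]
  simp

theorem Homog.map_eq_neg {α : S →ₐ[ℂ] S} {M : Matrix (Fin n) (Fin n) S} (h : Homog α (-1) 1 1 M) :
    M.map α = -M := by
  ext i j
  rw [Matrix.map_apply, h]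
  simp

namespace UnitData

variable (D : G.UnitData n)

/-- The parity, as a weight. -/
def parity : D.Weight where
  α := G.γ
  κ := -1
  ν := 1
  p := 1
  q := 1
  κ_ne := by norm_num
  ν_ne := one_ne_zero
  p_ne _ := one_ne_zero
  q_ne _ := one_ne_zero
  α_γ _ := rfl
  α_d s := by rw [G.d_γ, inv_neg, inv_one, neg_one_smul, neg_neg]
  g := D.g_even
  k := D.k_even
  X := D.X_even
  Y := D.Y_even.congr (by norm_num)
  Θ := D.Θ_odd
  Ξ := D.Ξ_odd.congr (by norm_num)
  η₁ := D.η₁_odd.congr (by norm_num)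
  η₂ := D.η₂_odd.congr (by norm_num)

theorem md_g : G.md D.η₁ D.η₂ D.g = 0 := by
  rw [md, D.d_g, D.g_even.map_eq]
  abel

theorem md_k : G.md D.η₂ D.η₁ D.k = 0 := by
  rw [md, D.d_k, D.k_even.map_eq]
  abel

theorem md_X : G.md D.η₁ D.η₁ D.X = 0 := by
  rw [md, D.d_X, D.X_even.map_eq]
  abel

theorem md_Y : G.md D.η₂ D.η₂ D.Y = 0 := by
  rw [md, D.d_Y, D.Y_even.map_eq]
  abel

/-- The upper triangular closed matrix that is homotopic to `g`. -/
def gHat : Matrix (Fin n) (Fin n) S := D.g - G.md D.η₁ D.η₂ D.Θ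

/-- The upper triangular closed matrix that is homotopic to `X`. -/
def XHat : Matrix (Fin n) (Fin n) S := D.X - G.md D.η₁ D.η₁ D.Ξ

theorem md_gHat : G.md D.η₁ D.η₂ D.gHat = 0 := by
  rw [gHat, md_sub, md_g, md_md _ D.η₁_odd.map_eq_neg D.η₂_odd.map_eq_neg D.d_η₁ D.d_η₂, sub_zero]

theorem md_XHat : G.md D.η₁ D.η₁ D.XHat = 0 := by
  rw [XHat, md_sub, md_X, md_md _ D.η₁_odd.map_eq_neg D.η₁_odd.map_eq_neg D.d_η₁ D.d_η₁, sub_zero]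

theorem md_Θ_apply (i j : Fin n) :
    G.md D.η₁ D.η₂ D.Θ i j = G.d (D.Θ i j) - (D.η₁ * D.Θ + D.Θ * D.η₂) i j := by
  rw [md, D.Θ_odd.map_eq_neg, Matrix.neg_mul, ← sub_eq_add_neg, Matrix.sub_apply, Matrix.sub_apply,
    Matrix.add_apply, Matrix.map_apply, sub_sub]

theorem gHat_upper : Upper D.gHat := by
  intro i j h
  rw [gHat, Matrix.sub_apply, md_Θ_apply, D.d_Θ i j h]
  abel

theorem gHat_apply {i j : Fin n} (h : i ≤ j) :
    D.gHat i j = D.g i j + (D.η₁ * D.Θ + D.Θ * D.η₂) i j := by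
  rw [gHat, Matrix.sub_apply, md_Θ_apply, D.Θ_eq_zero i j h, map_zero]
  abel

theorem XHat_upper : Upper D.XHat := by
  intro i j h
  rw [XHat, Matrix.sub_apply, md, D.Ξ_odd.map_eq_neg, Matrix.neg_mul, ← sub_eq_add_neg,
    Matrix.sub_apply, Matrix.sub_apply, Matrix.map_apply, D.d_Ξ i j h, Matrix.add_apply]
  abel

namespace Weight

variable {D} (w : D.Weight)

theorem gHat : Homog w.α 1 w.p w.q D.gHat :=
  w.g.sub ((w.Θ.md G w.α_γ w.α_d w.η₁ w.η₂ w.p_ne w.q_ne).congr (inv_mul_cancel₀ w.κ_ne))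

theorem XHat : Homog w.α w.ν w.p w.p D.XHat :=
  w.X.sub ((w.Ξ.md G w.α_γ w.α_d w.η₁ w.η₁ w.p_ne w.p_ne).congr
    (by rw [← mul_assoc, inv_mul_cancel₀ w.κ_ne, one_mul]))

/-- The restriction of `α` to even elements. -/
def αE : G.even →ₐ[ℂ] G.even :=
  (w.α.comp G.even.val).codRestrict G.even fun x => by
    change G.γ (w.α x) = w.α x
    rw [← w.α_γ]
    exact congrArg w.α x.2

theorem coe_αE (x : G.even) : (w.αE x : S) = w.α x := rfl

end Weight

theorem gHat_even : Homog G.γ 1 1 1 D.gHat := D.parity.gHat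

/-- A matrix of even elements, over the commutative ring of even elements. -/
def toEven {M : Matrix (Fin n) (Fin n) S} (h : Homog G.γ 1 1 1 M) :
    Matrix (Fin n) (Fin n) G.even := fun i j => ⟨M i j, (congrFun (congrFun h.map_eq i) j :)⟩

theorem toEven_homog {M : Matrix (Fin n) (Fin n) S} (h : Homog G.γ 1 1 1 M) (w : D.Weight)
    {p q : Fin n → ℂ} (hM : Homog w.α 1 p q M) (i j : Fin n) :
    w.αE (toEven h i j) = (p i * (q j)⁻¹) • toEven h i j :=
  Subtype.ext ((hM i j).trans (by rw [one_mul]; rfl))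

/-- The determinant of `ĝ`. -/
def c : G.even := (toEven D.gHat_even).det

/-- The determinant of `k = g⁻¹`. -/
def v : G.even := (toEven D.k_even).det

theorem c_eq : D.c = ∏ i, toEven D.gHat_even i i :=
  Matrix.det_of_isUpperTriangular fun i j h => Subtype.ext (D.gHat_upper i j h)

theorem d_gHat_diag (i : Fin n) : G.d (D.gHat i i) = 0 := by
  have h : G.md D.η₁ D.η₂ D.gHat i i = 0 := by rw [md_gHat, Matrix.zero_apply]
  rw [md, D.gHat_even.map_eq, Matrix.add_apply, Matrix.sub_apply, Matrix.map_apply,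
    (D.η₁_strict.mul_upper D.gHat_upper) i i le_rfl,
    (D.gHat_upper.mul_strict D.η₂_strict) i i le_rfl, sub_zero, add_zero] at h
  exact h

/-- The diagonal entries of the closed upper triangular matrix `ĝ` are closed, as `η₁` and `η₂` are
strictly upper triangular; hence so is their product `c`. -/
theorem d_c : G.d D.c = 0 := by
  rw [c_eq]
  refine Finset.prod_induction _ (fun x : G.even => G.d x = 0) (fun a b ha hb => ?_) G.d_one
    (fun i _ => D.d_gHat_diag i)
  rw [Subalgebra.coe_mul, G.d_mul, ha, hb, zero_mul, mul_zero, add_zero]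

theorem exists_lt_perm {σ : Equiv.Perm (Fin n)} (h : σ ≠ 1) : ∃ k, k < σ k := by
  by_contra! H
  refine h (Equiv.ext fun i => ?_)
  have h1 : ∑ i, (σ i : ℕ) = ∑ i : Fin n, (i : ℕ) := Equiv.sum_comp σ (fun i => (i : ℕ))
  have h2 := (Finset.sum_eq_sum_iff_of_le (s := Finset.univ) (f := fun i => (σ i : ℕ))
    (g := fun i : Fin n => (i : ℕ)) fun i _ => H i).1 h1 i (Finset.mem_univ i)
  exact Fin.ext h2

/-- An index `k < σ k`, for a permutation `σ ≠ 1`. -/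
def pivot (σ : Equiv.Perm (Fin n)) (h : σ ≠ 1) : Fin n := (exists_lt_perm h).choose

theorem pivot_lt (σ : Equiv.Perm (Fin n)) (h : σ ≠ 1) : pivot σ h < σ (pivot σ h) :=
  (exists_lt_perm h).choose_spec

/-- The factor `∏_{l ≠ k} g_{σ l, l}` of the Leibniz formula for `det g`. -/
def minor (σ : Equiv.Perm (Fin n)) (k : Fin n) : G.even :=
  ∏ l ∈ Finset.univ.erase k, toEven D.g_even (σ l) l

/-- The term of `e` for the permutation `σ`. -/
def eTerm (σ : Equiv.Perm (Fin n)) : S :=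
  if h : σ = 1 then 0 else
    (Equiv.Perm.sign σ : ℤ) • (D.minor σ (pivot σ h) * D.Θ (σ (pivot σ h)) (pivot σ h) * D.v)

/-- The element `e` with `∂e + c v = 1` up to nilpotents. In the Leibniz formula for `1 = det g ⬝ det k`
each term for `σ ≠ 1` has a factor `g_{σ k, k}` below the diagonal, which is replaced by
`Θ_{σ k, k}`. -/
def e : S := ∑ σ, D.eTerm σ

theorem Weight.eTerm {D : G.UnitData n} (w : D.Weight) (σ : Equiv.Perm (Fin n)) :
    w.α (D.eTerm σ) = w.κ • D.eTerm σ := by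
  by_cases h : σ = 1
  · rw [UnitData.eTerm, dif_pos h, map_zero, smul_zero]
  · have h1 : w.αE (D.minor σ (pivot σ h)) = (∏ l ∈ Finset.univ.erase (pivot σ h),
        (w.p (σ l) * (w.q l)⁻¹)) • D.minor σ (pivot σ h) := by
      rw [UnitData.minor, map_prod, ← Finset.prod_smul]
      exact Finset.prod_congr rfl fun l _ => D.toEven_homog D.g_even w w.g _ _
    have h1' := congrArg (Subtype.val) h1
    have h2 : w.α D.v = ((∏ i, w.q i) * (∏ i, w.p i)⁻¹) • (D.v : S) :=
      congrArg Subtype.val (map_det_of_homog (D.toEven_homog D.k_even w w.k))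
    have h3 : (∏ l ∈ Finset.univ.erase (pivot σ h), (w.p (σ l) * (w.q l)⁻¹)) *
        (w.p (σ (pivot σ h)) * (w.q (pivot σ h))⁻¹) = (∏ i, w.p i) * (∏ i, w.q i)⁻¹ := by
      rw [Finset.prod_erase_mul _ _ (Finset.mem_univ _), Finset.prod_mul_distrib,
        Finset.prod_inv_distrib, Equiv.prod_comp]
    rw [w.coe_αE] at h1'
    rw [UnitData.eTerm, dif_neg h, map_zsmul, map_mul, map_mul, h1', h2, w.Θ]
    change _ • ((_ • (D.minor σ (pivot σ h) : S)) * _ * _) = _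
    rw [smul_mul_smul_comm, smul_mul_smul_comm, smul_comm w.κ]
    congr 2
    have hp : ∏ i, w.p i ≠ 0 := Finset.prod_ne_zero_iff.2 fun i _ => w.p_ne i
    have hq : ∏ i, w.q i ≠ 0 := Finset.prod_ne_zero_iff.2 fun i _ => w.q_ne i
    calc _ = w.κ * ((∏ l ∈ Finset.univ.erase (pivot σ h), (w.p (σ l) * (w.q l)⁻¹)) *
        (w.p (σ (pivot σ h)) * (w.q (pivot σ h))⁻¹)) * ((∏ i, w.q i) * (∏ i, w.p i)⁻¹) := by ring
      _ = w.κ := by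
        rw [h3]
        field_simp

theorem Weight.e {D : G.UnitData n} (w : D.Weight) : w.α D.e = w.κ • D.e := by
  rw [UnitData.e, map_sum, Finset.smul_sum]
  exact Finset.sum_congr rfl fun σ _ => w.eTerm σ

theorem e_odd : G.γ D.e = -D.e := (D.parity.e).trans (neg_one_smul ℂ _)

theorem Weight.c {D : G.UnitData n} (w : D.Weight) :
    w.αE D.c = ((∏ i, w.p i) * (∏ i, w.q i)⁻¹) • D.c :=
  map_det_of_homog (D.toEven_homog D.gHat_even w w.gHat)

theorem Weight.v {D : G.UnitData n} (w : D.Weight) :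
    w.αE D.v = ((∏ i, w.q i) * (∏ i, w.p i)⁻¹) • D.v :=
  map_det_of_homog (D.toEven_homog D.k_even w w.k)

theorem d_odd {a : S} (ha : G.γ a = a) : G.γ (G.d a) = -G.d a := by
  rw [← neg_neg (G.γ (G.d a)), ← G.d_γ, ha]

theorem d_even {a : S} (ha : G.γ a = -a) : G.γ (G.d a) = G.d a := by
  rw [← neg_neg (G.γ (G.d a)), ← G.d_γ, ha, map_neg, neg_neg]

theorem coe_zsmul (z : ℤ) (x : G.even) : ((z • x : G.even) : S) = z • (x : S) :=
  map_zsmul G.even.val z x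

theorem coe_sum {ι : Type*} (s : Finset ι) (f : ι → G.even) :
    ((∑ i ∈ s, f i : G.even) : S) = ∑ i ∈ s, (f i : S) := map_sum G.even.val f s

/-- The element `∂e + c v`. -/
def ω : G.even := ⟨G.d D.e + D.c * D.v, by
  have h : G.γ ((D.c * D.v : G.even) : S) = (D.c * D.v : G.even) := (D.c * D.v).2
  rw [Subalgebra.coe_mul] at h
  change G.γ _ = _
  rw [map_add, d_even D.e_odd, h]⟩

theorem mem_oddIdeal {x : G.even} {a b : S} (ha : G.γ a = -a) (hb : G.γ b = -b)
    (h : (x : S) = a * b) : x ∈ G.oddIdeal := Ideal.subset_span ⟨a, b, ha, hb, h⟩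

theorem mem_oddIdeal_of_matrix {x : G.even} {M N : Matrix (Fin n) (Fin n) S}
    (hM : Homog G.γ (-1) 1 1 M) (hN : Homog G.γ (-1) 1 1 N) {i j : Fin n}
    (h : (x : S) = (M * N) i j) : x ∈ G.oddIdeal := by
  have hM' : ∀ i j, G.γ (M i j) = -M i j := fun i j => congrFun (congrFun hM.map_eq_neg i) j
  have hN' : ∀ i j, G.γ (N i j) = -N i j := fun i j => congrFun (congrFun hN.map_eq_neg i) j
  have h1 : ∀ k, G.γ (M i k * N k j) = M i k * N k j := fun k => by
    rw [map_mul, hM', hN', neg_mul_neg]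
  have h2 : x = ∑ k, (⟨M i k * N k j, h1 k⟩ : G.even) := by
    refine Subtype.ext ?_
    rw [h, Matrix.mul_apply]
    rw [coe_sum]
  rw [h2]
  exact Ideal.sum_mem _ fun k _ => mem_oddIdeal (hM' i k) (hN' k j) rfl

/-- The element `η₁ Θ + Θ η₂` is a sum of products of odd elements. -/
theorem exists_correction (i j : Fin n) :
    ∃ x ∈ G.oddIdeal, (x : S) = (D.η₁ * D.Θ + D.Θ * D.η₂) i j := by
  have h : ∀ {M N : Matrix (Fin n) (Fin n) S}, Homog G.γ (-1) 1 1 M → Homog G.γ (-1) 1 1 N →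
      Homog G.γ 1 1 1 (M * N) := fun hM hN =>
    (hM.mul hN fun _ => one_ne_zero).congr (by norm_num)
  exact ⟨toEven (h D.η₁_odd D.Θ_odd) i j + toEven (h D.Θ_odd D.η₂_odd) i j,
    Ideal.add_mem _ (mem_oddIdeal_of_matrix D.η₁_odd D.Θ_odd rfl)
      (mem_oddIdeal_of_matrix D.Θ_odd D.η₂_odd rfl), rfl⟩

/-- Modulo products of odd elements the derivative of the term of `e` for `σ` is the term of the
Leibniz formula. -/
theorem d_eTerm (σ : Equiv.Perm (Fin n)) (h : σ ≠ 1) : ∃ x ∈ G.oddIdeal,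
    G.d (D.eTerm σ) = (Equiv.Perm.sign σ : ℤ) •
      (((∏ l, toEven D.g_even (σ l) l) * D.v : G.even) : S) + (x : S) := by
  obtain ⟨k, hk⟩ : ∃ k, k = pivot σ h := ⟨_, rfl⟩
  obtain ⟨y, hy, hy'⟩ := D.exists_correction (σ k) k
  have hlt : k < σ k := hk ▸ pivot_lt σ h
  have hΘ : G.γ (D.Θ (σ k) k) = -D.Θ (σ k) k := congrFun (congrFun D.Θ_odd.map_eq_neg _) _
  obtain ⟨m, hm⟩ : ∃ m, m = D.minor σ k := ⟨_, rfl⟩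
  have hm' : G.γ (m : S) = m := m.2
  have hv : G.γ (D.v : S) = D.v := D.v.2
  have e1 : G.d (m * D.Θ (σ k) k * D.v) = G.d (m : S) * (D.Θ (σ k) k * D.v) +
      m * (D.g (σ k) k + y) * D.v + -(m * D.Θ (σ k) k) * G.d (D.v : S) := by
    rw [G.d_mul, G.d_mul, map_mul, hm', hΘ, D.d_Θ _ _ hlt, ← hy', add_mul, mul_assoc, mul_neg]
  have o1 : G.γ (G.d (m : S) * (D.Θ (σ k) k * D.v)) = G.d (m : S) * (D.Θ (σ k) k * D.v) := by
    rw [map_mul, map_mul, hv, hΘ, d_odd hm', neg_mul, neg_mul, mul_neg, neg_neg]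
  have o2 : G.γ (-(m * D.Θ (σ k) k) * G.d (D.v : S)) = -(m * D.Θ (σ k) k) * G.d (D.v : S) := by
    rw [map_mul, map_neg, map_mul, hm', hΘ, d_odd hv, mul_neg, mul_neg, neg_neg, neg_mul]
  obtain ⟨x, hx⟩ : ∃ x : G.even, x = ⟨_, o1⟩ + m * y * D.v + ⟨_, o2⟩ := ⟨_, rfl⟩
  refine ⟨(Equiv.Perm.sign σ : ℤ) • x, ?_, ?_⟩
  · have hx' : x ∈ G.oddIdeal := by
      rw [hx]
      refine Ideal.add_mem _ (Ideal.add_mem _ (mem_oddIdeal (d_odd hm') ?_ rfl)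
        (Ideal.mul_mem_right _ _ (Ideal.mul_mem_left _ _ hy))) (mem_oddIdeal ?_ (d_odd hv) rfl)
      · rw [map_mul, hv, hΘ, neg_mul]
      · rw [map_neg, map_mul, hm', hΘ, mul_neg]
    exact zsmul_mem hx' _
  · have e2 : D.eTerm σ = (Equiv.Perm.sign σ : ℤ) • (m * D.Θ (σ k) k * D.v) := by
      rw [eTerm, dif_neg h, hm, hk]
    have e3 : ∏ l, toEven D.g_even (σ l) l = m * toEven D.g_even (σ k) k := by
      rw [hm, minor, Finset.prod_erase_mul _ _ (Finset.mem_univ k)]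
    have e4 : (((m * toEven D.g_even (σ k) k) * D.v : G.even) : S) =
      m * D.g (σ k) k * D.v := rfl
    have e5 : (x : S) = G.d (m : S) * (D.Θ (σ k) k * D.v) + m * y * D.v +
      -(m * D.Θ (σ k) k) * G.d (D.v : S) := by rw [hx]; rfl
    have e6 : (((Equiv.Perm.sign σ : ℤ) • x : G.even) : S) = (Equiv.Perm.sign σ : ℤ) • (x : S) :=
      coe_zsmul _ _
    rw [e2, map_zsmul, e1, e3, e4, e6, e5, ← smul_add]
    congr 1
    rw [mul_add, add_mul]
    abel

/-- The element `∂e + c v` is `1` modulo products of odd elements: the terms of `∂e` are those of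
the Leibniz formula for `det g · det k = 1`, except for the term of the identity permutation, which
is that of `c v`. -/
theorem one_sub_ω : 1 - D.ω ∈ G.oddIdeal := by
  obtain ⟨F, hF⟩ : ∃ F : Equiv.Perm (Fin n) → G.even, F = fun σ =>
    (Equiv.Perm.sign σ : ℤ) • ((∏ l, toEven D.g_even (σ l) l) * D.v) := ⟨_, rfl⟩
  have h1 : ∀ σ, ∃ x ∈ G.oddIdeal, G.d (D.eTerm σ) =
      ((F σ - (if σ = 1 then F σ else 0) + x : G.even) : S) := by
    intro σ
    by_cases h : σ = 1
    · refine ⟨0, Ideal.zero_mem _, ?_⟩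
      rw [eTerm, dif_pos h, if_pos h, map_zero, sub_self, add_zero]
      rfl
    · obtain ⟨x, hx, h'⟩ := D.d_eTerm σ h
      refine ⟨x, hx, ?_⟩
      rw [if_neg h, sub_zero, h', hF, ← coe_zsmul]
      rfl
  choose x hx h using h1
  have h2 : D.ω = ∑ σ, F σ - F 1 + ∑ σ, x σ + D.c * D.v := by
    have : ∑ σ, (F σ - (if σ = 1 then F σ else 0) + x σ) = ∑ σ, F σ - F 1 + ∑ σ, x σ := by
      rw [Finset.sum_add_distrib, Finset.sum_sub_distrib, Finset.sum_ite_eq',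
        if_pos (Finset.mem_univ _)]
    rw [← this]
    refine Subtype.ext ?_
    change G.d D.e + _ = _
    rw [e, map_sum, Finset.sum_congr rfl fun σ _ => h σ, ← coe_sum]
    rfl
  have h3 : ∑ σ, F σ = 1 := by
    have h3 : (toEven D.g_even).det * D.v = 1 := by
      rw [v, ← Matrix.det_mul]
      have : toEven D.g_even * toEven D.k_even = 1 := by
        refine Matrix.ext fun i j => Subtype.ext ?_
        have := congrFun (congrFun D.g_k i) j
        rw [Matrix.mul_apply] at this ⊢
        rw [coe_sum]
        refine this.trans ?_
        rw [Matrix.one_apply, Matrix.one_apply]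
        split_ifs <;> rfl
      rw [this, Matrix.det_one]
    rw [← h3, Matrix.det_apply, Finset.sum_mul, hF]
    refine Finset.sum_congr rfl fun σ _ => ?_
    rw [smul_mul_assoc]
    rfl
  have h4 : (∏ i, toEven D.g_even i i) - D.c ∈ G.oddIdeal := by
    rw [← Ideal.Quotient.eq, c_eq, map_prod, map_prod]
    refine Finset.prod_congr rfl fun i _ => ?_
    obtain ⟨y, hy, hy'⟩ := D.exists_correction i i
    rw [eq_comm, Ideal.Quotient.eq]
    have : toEven D.gHat_even i i - toEven D.g_even i i = y := by
      refine Subtype.ext ?_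
      change D.gHat i i - D.g i i = y
      rw [D.gHat_apply le_rfl, hy', add_sub_cancel_left]
    rwa [this]
  have h5 : F 1 = (∏ i, toEven D.g_even i i) * D.v := by
    rw [hF]
    simp
  have h6 : 1 - D.ω = ((∏ i, toEven D.g_even i i) - D.c) * D.v - ∑ σ, x σ := by
    rw [h2, h3, h5]
    ring
  rw [h6]
  exact Ideal.sub_mem _ (Ideal.mul_mem_right _ _ h4) (Ideal.sum_mem _ fun σ _ => hx σ)

/-- The products of odd elements generate a nil ideal. -/
theorem isUnit_ω : IsUnit D.ω := by
  have := (isNilpotent_of_mem_oddIdeal G D.one_sub_ω).isUnit_one_sub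
  rwa [sub_sub_cancel] at this

/-- The inverse of `∂e + c v`. -/
def φ : G.even := ↑D.isUnit_ω.unit⁻¹

theorem ω_φ : D.ω * D.φ = 1 := D.isUnit_ω.mul_val_inv

theorem Weight.ω {D : G.UnitData n} (w : D.Weight) : w.αE D.ω = D.ω := by
  have hp : ∏ i, w.p i ≠ 0 := Finset.prod_ne_zero_iff.2 fun i _ => w.p_ne i
  have hq : ∏ i, w.q i ≠ 0 := Finset.prod_ne_zero_iff.2 fun i _ => w.q_ne i
  have h1 : w.αE (D.c * D.v) = D.c * D.v := by
    rw [map_mul, w.c, w.v, smul_mul_smul_comm]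
    have : (∏ i, w.p i) * (∏ i, w.q i)⁻¹ * ((∏ i, w.q i) * (∏ i, w.p i)⁻¹) = 1 := by field_simp
    rw [this, one_smul]
  have h2 : w.α (G.d D.e) = G.d D.e := by
    rw [w.α_d, w.e, map_smul, smul_smul, inv_mul_cancel₀ w.κ_ne, one_smul]
  refine Subtype.ext ?_
  change w.α (G.d D.e + (D.c * D.v : G.even)) = G.d D.e + (D.c * D.v : G.even)
  rw [map_add, h2, ← w.coe_αE, h1]

theorem Weight.φ {D : G.UnitData n} (w : D.Weight) : w.αE D.φ = D.φ := by
  have h : D.ω * w.αE D.φ = 1 := by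
    conv_lhs => rw [← w.ω]
    rw [← map_mul, ω_φ, map_one]
  calc w.αE D.φ = D.ω * D.φ * w.αE D.φ := by rw [ω_φ, one_mul]
    _ = D.φ * (D.ω * w.αE D.φ) := by ring
    _ = D.φ := by rw [h, mul_one]

/-- An odd element `h` with `∂h = 1 - c ψ`. -/
def h : S := D.e * D.φ

/-- The inverse of `c` up to homotopy. -/
def ψ : S := D.v * D.φ - D.h * (G.d D.v * D.φ)

theorem Weight.h {D : G.UnitData n} (w : D.Weight) : w.α D.h = w.κ • D.h := by
  rw [UnitData.h, map_mul, w.e, ← w.coe_αE, w.φ, smul_mul_assoc]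

theorem Weight.ψ {D : G.UnitData n} (w : D.Weight) :
    w.α D.ψ = ((∏ i, w.q i) * (∏ i, w.p i)⁻¹) • D.ψ := by
  have hv : w.α D.v = ((∏ i, w.q i) * (∏ i, w.p i)⁻¹) • (D.v : S) := congrArg Subtype.val w.v
  have hφ : w.α D.φ = D.φ := congrArg Subtype.val w.φ
  rw [UnitData.ψ, map_sub, map_mul, map_mul, map_mul, w.h, w.α_d, hv, hφ, map_smul, smul_smul,
    smul_mul_assoc, smul_mul_assoc, smul_mul_assoc, mul_smul_comm, smul_smul, ← mul_assoc,
    mul_inv_cancel₀ w.κ_ne, one_mul, smul_sub]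

theorem coe_comm (x : G.even) (s : S) : (x : S) * s = s * x := G.even_comm x x.2 s

theorem h_odd : G.γ D.h = -D.h := (D.parity.h).trans (neg_one_smul ℂ _)

theorem ψ_even : G.γ D.ψ = D.ψ := (D.parity.ψ).trans (by
  change ((∏ _i : Fin n, (1 : ℂ)) * (∏ _i : Fin n, (1 : ℂ))⁻¹) • D.ψ = D.ψ
  simp)

theorem d_φ : G.d D.φ = -(D.c * (D.φ * (G.d D.v * D.φ))) := by
  have hω : G.d D.ω = D.c * G.d D.v := by
    change G.d (G.d D.e + D.c * D.v) = _
    have : G.γ (D.c : S) = D.c := D.c.2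
    rw [map_add, G.d_d, G.d_mul, d_c, zero_mul, zero_add, zero_add, this]
  have h1 : G.d ((D.ω * D.φ : G.even) : S) = 0 := by rw [ω_φ]; exact G.d_one
  have h2 : G.γ (D.ω : S) = D.ω := D.ω.2
  rw [Subalgebra.coe_mul, G.d_mul, hω, h2] at h1
  have h3 : ((D.φ * D.ω : G.even) : S) = 1 := by rw [mul_comm, ω_φ]; rfl
  rw [Subalgebra.coe_mul] at h3
  have h4 : (D.φ : S) * (D.c * G.d D.v * D.φ + D.ω * G.d D.φ) = 0 := by rw [h1, mul_zero]
  rw [mul_add, ← mul_assoc (D.φ : S) D.ω, h3, one_mul] at h4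
  rw [eq_neg_of_add_eq_zero_right h4, coe_comm D.φ, coe_comm D.φ]
  simp only [mul_assoc]

/-- The element `c` is invertible up to the homotopy `h`. -/
theorem d_h : G.d D.h = 1 - D.c * D.ψ := by
  have h1 : G.d D.e * D.φ = 1 - D.c * D.v * D.φ := by
    rw [eq_sub_iff_add_eq, ← add_mul]
    exact congrArg Subtype.val D.ω_φ
  rw [h, G.d_mul, h1, d_φ, D.e_odd, ψ, h, neg_mul_neg, mul_sub, ← mul_assoc (D.e),
    ← coe_comm D.c D.e]
  noncomm_ring

theorem d_ψ : G.d D.ψ = 0 := by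
  have hv : G.γ (D.v : S) = D.v := D.v.2
  obtain ⟨u, hu⟩ : ∃ u, u = G.d (D.v : S) * D.φ := ⟨_, rfl⟩
  have hφ : G.γ (D.φ : S) = D.φ := D.φ.2
  have hdv := d_odd hv
  have hu1 : G.γ u = -u := by rw [hu, map_mul, hdv, hφ, neg_mul]
  have huu : u * u = 0 := G.odd_sq hu1
  have hdφ : G.d D.φ = -(D.c * (D.φ * u)) := by rw [d_φ, hu]
  have hdu : G.d u = 0 := by
    rw [hu, G.d_mul, G.d_d, zero_mul, zero_add, hdv, hdφ, neg_mul_neg, coe_comm D.c,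
      ← mul_assoc, ← mul_assoc, ← hu, huu, zero_mul]
  have h1 : G.d D.ψ = u - D.c * D.ψ * u - (1 - D.c * D.ψ) * u + (D.c * (D.ψ - D.v * D.φ)) * u := by
    rw [ψ, map_sub, G.d_mul, ← hu, hv, hdφ, G.d_mul, hdu, mul_zero, add_zero, d_h, ψ, ← hu,
      mul_neg, ← mul_assoc (D.v : S), coe_comm D.v]
    noncomm_ring
  rw [h1]
  have h2 : (D.c : S) * (D.ψ - D.v * D.φ) * u = 0 := by
    rw [ψ, ← hu, sub_sub_cancel_left, mul_neg, neg_mul, ← mul_assoc, mul_assoc, huu, mul_zero,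
      neg_zero]
  rw [h2]
  noncomm_ring

/-- The adjugate of `ĝ`. -/
def C : Matrix (Fin n) (Fin n) S := fun i j => ((toEven D.gHat_even).adjugate i j : S)

theorem C_upper : Upper D.C := by
  intro i j hij
  have : Upper (toEven D.gHat_even) := fun i j hij => Subtype.ext (D.gHat_upper i j hij)
  exact congrArg Subtype.val (this.adjugate i j hij)

theorem C_mul_gHat : D.C * D.gHat = (D.c : S) • (1 : Matrix (Fin n) (Fin n) S) := by
  ext i j
  have := congrArg (Subtype.val : G.even → S)
    (congrFun (congrFun (Matrix.adjugate_mul (toEven D.gHat_even)) i) j)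
  rw [Matrix.mul_apply, coe_sum] at this
  refine (Matrix.mul_apply).trans (this.trans ?_)
  rw [Matrix.smul_apply, Matrix.smul_apply, Matrix.one_apply, Matrix.one_apply]
  split_ifs <;> rfl

theorem gHat_mul_C : D.gHat * D.C = (D.c : S) • (1 : Matrix (Fin n) (Fin n) S) := by
  ext i j
  have := congrArg (Subtype.val : G.even → S)
    (congrFun (congrFun (Matrix.mul_adjugate (toEven D.gHat_even)) i) j)
  rw [Matrix.mul_apply, coe_sum] at this
  refine (Matrix.mul_apply).trans (this.trans ?_)
  rw [Matrix.smul_apply, Matrix.smul_apply, Matrix.one_apply, Matrix.one_apply]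
  split_ifs <;> rfl

theorem Weight.C {D : G.UnitData n} (w : D.Weight) :
    Homog w.α ((∏ i, w.p i) * (∏ i, w.q i)⁻¹) w.q w.p D.C := fun i j =>
  congrArg Subtype.val (map_adjugate_of_homog (D.toEven_homog D.gHat_even w w.gHat)
    w.p_ne w.q_ne i j)

theorem C_even : Homog G.γ 1 1 1 D.C := (D.parity.C).congr (by
  change (∏ _i : Fin n, (1 : ℂ)) * (∏ _i : Fin n, (1 : ℂ))⁻¹ = 1
  simp)

theorem mul_smul_one_of_even (x : G.even) (M : Matrix (Fin n) (Fin n) S) :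
    M * ((x : S) • (1 : Matrix (Fin n) (Fin n) S)) = (x : S) • M := by
  ext i j
  rw [Matrix.mul_apply, Finset.sum_eq_single j]
  · rw [Matrix.smul_apply, Matrix.smul_apply, Matrix.one_apply_eq, smul_eq_mul, smul_eq_mul,
      mul_one, coe_comm]
  · intro k _ hk
    rw [Matrix.smul_apply, Matrix.one_apply_ne hk, smul_zero, mul_zero]
  · intro hj
    exact absurd (Finset.mem_univ j) hj

theorem md_C_mul_gHat : G.md D.η₂ D.η₁ D.C * D.gHat = 0 := by
  have h1 := G.md_mul D.η₂ D.η₁ D.η₂ D.C D.gHat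
  rw [md_gHat, mul_zero, add_zero, C_mul_gHat] at h1
  have h2 : ((D.c : S) • (1 : Matrix (Fin n) (Fin n) S)).map G.d = 0 := by
    ext i j
    rw [Matrix.map_apply, Matrix.smul_apply, Matrix.one_apply, Matrix.zero_apply, smul_eq_mul]
    split_ifs
    · rw [mul_one, d_c]
    · rw [mul_zero, map_zero]
  have h3 : ((D.c : S) • (1 : Matrix (Fin n) (Fin n) S)).map G.γ =
      (D.c : S) • (1 : Matrix (Fin n) (Fin n) S) := by
    rw [← C_mul_gHat, map_γ_mul, D.C_even.map_eq, D.gHat_even.map_eq]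
  rw [← h1, md, h2, h3, mul_smul_one_of_even, Matrix.smul_mul, one_mul]
  abel

/-- The adjugate `C` of `ĝ` is closed after multiplication by `c`, but not closed in general. -/
theorem c_smul_md_C : (D.c : S) • G.md D.η₂ D.η₁ D.C = 0 := by
  have h1 : G.md D.η₂ D.η₁ D.C * (D.gHat * D.C) = 0 := by
    rw [← mul_assoc, md_C_mul_gHat, zero_mul]
  rwa [gHat_mul_C, mul_smul_one_of_even] at h1

/-- The adjugate of `ĝ`, corrected to a closed matrix. -/
def C' : Matrix (Fin n) (Fin n) S := D.C - D.h • G.md D.η₂ D.η₁ D.C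

theorem C'_upper : Upper D.C' :=
  D.C_upper.sub ((D.C_upper.md D.η₂_strict D.η₁_strict).smul _)

theorem C'_mul_gHat : D.C' * D.gHat = (D.c : S) • (1 : Matrix (Fin n) (Fin n) S) := by
  rw [C', sub_mul, Matrix.smul_mul, md_C_mul_gHat, smul_zero, sub_zero, C_mul_gHat]

theorem md_C' : G.md D.η₂ D.η₁ D.C' = 0 := by
  have h1 : ((D.c : S) * D.ψ) • G.md D.η₂ D.η₁ D.C = 0 := by
    rw [coe_comm, mul_smul, c_smul_md_C, smul_zero]
  rw [C', md_sub, md_smul _ _ _ _ D.h_odd D.η₂_odd.map_eq_neg,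
    md_md _ D.η₂_odd.map_eq_neg D.η₁_odd.map_eq_neg D.d_η₂ D.d_η₁, smul_zero, sub_zero, d_h,
    sub_smul, one_smul, h1, sub_zero, sub_self]

theorem Weight.C' {D : G.UnitData n} (w : D.Weight) :
    Homog w.α ((∏ i, w.p i) * (∏ i, w.q i)⁻¹) w.q w.p D.C' :=
  w.C.sub (((w.C.md G w.α_γ w.α_d w.η₂ w.η₁ w.q_ne w.p_ne).smul w.h).congr
    (by rw [← mul_assoc, mul_inv_cancel₀ w.κ_ne, one_mul]))

/-- The closed strictly upper triangular matrix that is homotopic to `X g Y`. -/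
def Zm : Matrix (Fin n) (Fin n) S := D.XHat * D.gHat * D.Y

theorem Zm_strict : Strict D.Zm := (D.XHat_upper.mul D.gHat_upper).mul_strict D.Y_strict

theorem Weight.Zm {D : G.UnitData n} (w : D.Weight) :
    Homog w.α (w.κ⁻¹ * w.κ⁻¹) w.p w.q D.Zm :=
  ((w.XHat.mul w.gHat w.p_ne).mul w.Y w.q_ne).congr (by
    have := w.ν_ne
    field_simp)

theorem XHat_even : Homog G.γ 1 1 1 D.XHat := D.parity.XHat

theorem Zm_even : Homog G.γ 1 1 1 D.Zm := D.parity.Zm.congr (by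
  change (-1 : ℂ)⁻¹ * (-1 : ℂ)⁻¹ = 1
  norm_num)

theorem C'_even : Homog G.γ 1 1 1 D.C' := (D.parity.C').congr (by
  change (∏ _i : Fin n, (1 : ℂ)) * (∏ _i : Fin n, (1 : ℂ))⁻¹ = 1
  simp)

theorem md_Zm : G.md D.η₁ D.η₂ D.Zm = 0 := by
  rw [Zm, md_mul _ _ D.η₂, md_mul _ _ D.η₁, md_XHat, md_gHat, md_Y]
  simp

/-- The trace of `Zm k`. -/
def T : S := (D.Zm * D.k).trace

theorem d_T : G.d D.T = 0 := by
  rw [T, G.d_trace D.η₁_odd.map_eq_neg, md_mul _ _ D.η₂, md_Zm, md_k]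
  simp

theorem Weight.T {D : G.UnitData n} (w : D.Weight) : w.α D.T = (w.κ⁻¹ * w.κ⁻¹) • D.T :=
  ((w.Zm.mul w.k w.q_ne).congr (mul_one _)).trace w.p_ne

/-- The correction term: its derivative is the potential `Tr (X g Y k)`. -/
def A : S := (D.Ξ * (D.g * D.Y * D.k)).trace + (D.XHat * D.Θ * (D.Y * D.k)).trace + D.h * D.T -
  D.ψ * (D.Zm * D.C' * D.Θ * D.k).trace

theorem Weight.A {D : G.UnitData n} (w : D.Weight) : w.α D.A = w.κ⁻¹ • D.A := by
  have hκ := w.κ_ne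
  have hν := w.ν_ne
  have hp : ∏ i, w.p i ≠ 0 := Finset.prod_ne_zero_iff.2 fun i _ => w.p_ne i
  have hq : ∏ i, w.q i ≠ 0 := Finset.prod_ne_zero_iff.2 fun i _ => w.q_ne i
  have h1 : w.α (D.Ξ * (D.g * D.Y * D.k)).trace = w.κ⁻¹ • (D.Ξ * (D.g * D.Y * D.k)).trace :=
    Homog.trace ((w.Ξ.mul ((w.g.mul w.Y w.q_ne).mul w.k w.q_ne) w.p_ne).congr
      (by field_simp)) w.p_ne
  have h2 : w.α (D.XHat * D.Θ * (D.Y * D.k)).trace =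
      w.κ⁻¹ • (D.XHat * D.Θ * (D.Y * D.k)).trace :=
    Homog.trace (((w.XHat.mul w.Θ w.p_ne).mul (w.Y.mul w.k w.q_ne) w.q_ne).congr
      (by field_simp)) w.p_ne
  have h3 : w.α (D.h * D.T) = w.κ⁻¹ • (D.h * D.T) := by
    rw [map_mul, w.h, w.T, smul_mul_smul_comm]
    congr 1
    field_simp
  have h4 : w.α (D.Zm * D.C' * D.Θ * D.k).trace =
      (w.κ⁻¹ * ((∏ i, w.p i) * (∏ i, w.q i)⁻¹)) • (D.Zm * D.C' * D.Θ * D.k).trace :=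
    Homog.trace ((((w.Zm.mul w.C' w.q_ne).mul w.Θ w.p_ne).mul w.k w.q_ne).congr
      (by field_simp)) w.p_ne
  have h5 : w.α (D.ψ * (D.Zm * D.C' * D.Θ * D.k).trace) =
      w.κ⁻¹ • (D.ψ * (D.Zm * D.C' * D.Θ * D.k).trace) := by
    rw [map_mul, w.ψ, h4, smul_mul_smul_comm]
    congr 1
    field_simp
  rw [UnitData.A, map_sub, map_add, map_add, h1, h2, h3, h5, smul_sub, smul_add, smul_add]

theorem md_Θ : G.md D.η₁ D.η₂ D.Θ = D.g - D.gHat := by rw [gHat, sub_sub_cancel]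

theorem md_Ξ : G.md D.η₁ D.η₁ D.Ξ = D.X - D.XHat := by rw [XHat, sub_sub_cancel]

/-- The first two terms of `A` replace `X` and `g` by `X̂` and `ĝ`, and leave the potential `Tr (X̂
ĝ Y k) = T`. As `h` is a homotopy from `1` to `c ψ`, the third term leaves `c ψ T`. This is `ψ Tr (Z
C' ĝ k)`; replacing `ĝ` by `g` by means of the last term leaves `ψ Tr (Z C')`, which vanishes
because `Z C'` is strictly upper triangular. -/
theorem d_A : G.d D.A = (D.X * D.g * D.Y * D.k).trace := by
  have hη := D.η₁_odd.map_eq_neg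
  have h1 : G.d (D.Ξ * (D.g * D.Y * D.k)).trace = ((D.X - D.XHat) * (D.g * D.Y * D.k)).trace := by
    rw [G.d_trace hη, md_mul _ _ D.η₁, md_mul _ _ D.η₂ D.η₁ (D.g * D.Y),
      md_mul _ _ D.η₂ D.η₂ D.g, md_g, md_Y, md_k, md_Ξ]
    simp
  have h2 : G.d (D.XHat * D.Θ * (D.Y * D.k)).trace =
      (D.XHat * (D.g - D.gHat) * (D.Y * D.k)).trace := by
    rw [G.d_trace hη, md_mul _ _ D.η₂, md_mul _ _ D.η₁, md_mul _ _ D.η₂ D.η₁ D.Y, md_XHat, md_Y,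
      md_k, md_Θ, D.XHat_even.map_eq]
    simp
  have h3 : G.d (D.h * D.T) = D.T - D.c * D.ψ * D.T := by
    rw [G.d_mul, d_T, mul_zero, add_zero, d_h, sub_mul, one_mul]
  have h4 : G.d (D.Zm * D.C' * D.Θ * D.k).trace = -(D.c * D.T) := by
    have e1 : D.Zm * D.C' * (D.g - D.gHat) * D.k = D.Zm * D.C' - (D.c : S) • (D.Zm * D.k) := by
      rw [mul_sub, sub_mul, mul_assoc _ D.g, D.g_k, mul_one, mul_assoc D.Zm D.C' D.gHat,
        C'_mul_gHat, mul_smul_one_of_even, Matrix.smul_mul]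
    rw [G.d_trace hη, md_mul _ _ D.η₂, md_mul _ _ D.η₁, md_mul _ _ D.η₂ D.η₁ D.Zm, md_Zm, md_C',
      md_k, md_Θ, map_γ_mul, D.Zm_even.map_eq, D.C'_even.map_eq, mul_zero, mul_zero, zero_mul,
      zero_add, zero_mul, zero_add, add_zero, e1, Matrix.trace_sub, Matrix.trace_smul,
      (D.Zm_strict.mul_upper D.C'_upper).trace, zero_sub]
    rfl
  have h5 : (D.X - D.XHat) * (D.g * D.Y * D.k) + D.XHat * (D.g - D.gHat) * (D.Y * D.k) =
      D.X * D.g * D.Y * D.k - D.Zm * D.k := by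
    rw [Zm]
    noncomm_ring
  rw [A, map_sub, map_add, map_add, h1, h2, ← Matrix.trace_add, h5, Matrix.trace_sub, h3, G.d_mul,
    d_ψ, zero_mul, zero_add, ψ_even, h4, mul_neg, sub_neg_eq_add, ← mul_assoc, ← coe_comm D.c, T]
  abel

/-! ### The ideal of the equations -/

/-- The left ideal generated by the entries of `Θ` and `Ξ`. -/
def oddSpan : Submodule S S :=
  Submodule.span S (Set.range (fun ij : Fin n × Fin n => D.Θ ij.1 ij.2) ∪
    Set.range (fun ij : Fin n × Fin n => D.Ξ ij.1 ij.2))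

theorem mul_mem_oddSpan {x : S} (hx : x ∈ D.oddSpan) (s : S) : x * s ∈ D.oddSpan := by
  induction hx using Submodule.span_induction with
  | mem x hx =>
    have h : G.γ x = -x := by
      rcases hx with ⟨ij, rfl⟩ | ⟨ij, rfl⟩
      · exact congrFun (congrFun D.Θ_odd.map_eq_neg _) _
      · exact congrFun (congrFun D.Ξ_odd.map_eq_neg _) _
    rw [G.odd_comm x h]
    exact Submodule.smul_mem _ _ (Submodule.subset_span hx)
  | zero => rw [zero_mul]; exact Submodule.zero_mem _
  | add x y _ _ hx hy => rw [add_mul]; exact Submodule.add_mem _ hx hy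
  | smul r x _ hx => rw [smul_eq_mul, mul_assoc]; exact Submodule.smul_mem _ _ hx

theorem matrix_mul_mem_right {M : Matrix (Fin n) (Fin n) S} (hM : ∀ i j, M i j ∈ D.oddSpan)
    (N : Matrix (Fin n) (Fin n) S) (i j : Fin n) : (M * N) i j ∈ D.oddSpan := by
  rw [Matrix.mul_apply]
  exact Submodule.sum_mem _ fun k _ => D.mul_mem_oddSpan (hM i k) _

theorem matrix_mul_mem_left {M : Matrix (Fin n) (Fin n) S} (hM : ∀ i j, M i j ∈ D.oddSpan)
    (N : Matrix (Fin n) (Fin n) S) (i j : Fin n) : (N * M) i j ∈ D.oddSpan := by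
  rw [Matrix.mul_apply]
  exact Submodule.sum_mem _ fun k _ => Submodule.smul_mem _ _ (hM k j)

theorem trace_mem {M : Matrix (Fin n) (Fin n) S} (hM : ∀ i j, M i j ∈ D.oddSpan) :
    M.trace ∈ D.oddSpan := Submodule.sum_mem _ fun i _ => hM i i

theorem A_mem : D.A ∈ D.oddSpan := by
  have hΘ : ∀ i j, D.Θ i j ∈ D.oddSpan := fun i j =>
    Submodule.subset_span (Or.inl ⟨(i, j), rfl⟩)
  have hΞ : ∀ i j, D.Ξ i j ∈ D.oddSpan := fun i j =>
    Submodule.subset_span (Or.inr ⟨(i, j), rfl⟩)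
  have he : D.e ∈ D.oddSpan := by
    refine Submodule.sum_mem _ fun σ _ => ?_
    by_cases h : σ = 1
    · rw [eTerm, dif_pos h]
      exact Submodule.zero_mem _
    · rw [eTerm, dif_neg h]
      exact zsmul_mem (D.mul_mem_oddSpan (Submodule.smul_mem _ _ (hΘ _ _)) _) _
  refine Submodule.sub_mem _ (Submodule.add_mem _ (Submodule.add_mem _ ?_ ?_) ?_) ?_
  · exact D.trace_mem (D.matrix_mul_mem_right hΞ _)
  · exact D.trace_mem (D.matrix_mul_mem_right (D.matrix_mul_mem_left hΘ _) _)
  · exact D.mul_mem_oddSpan (D.mul_mem_oddSpan he _) _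
  · exact Submodule.smul_mem _ _
      (D.trace_mem (D.matrix_mul_mem_right (D.matrix_mul_mem_left hΘ _) _))

end UnitData

end SuperDG

/-! ### Supercommutative algebras of operators -/

/-- Pairs of matrices, as matrices over a product. -/
def pairMat {K K' : Type} {n : ℕ} (M : Matrix (Fin n) (Fin n) K) (N : Matrix (Fin n) (Fin n) K') :
    Matrix (Fin n) (Fin n) (K × K') := fun i j => (M i j, N i j)

theorem pairMat_mul {K K' : Type} [Ring K] [Ring K'] {n : ℕ}
    (M N : Matrix (Fin n) (Fin n) K) (M' N' : Matrix (Fin n) (Fin n) K') :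
    pairMat M M' * pairMat N N' = pairMat (M * N) (M' * N') := by
  ext i j
  · rw [Matrix.mul_apply, Prod.fst_sum]; exact (Matrix.mul_apply).symm
  · rw [Matrix.mul_apply, Prod.snd_sum]; exact (Matrix.mul_apply).symm

theorem pairMat_trace {K K' : Type} [Ring K] [Ring K'] {n : ℕ}
    (M : Matrix (Fin n) (Fin n) K) (M' : Matrix (Fin n) (Fin n) K') :
    (pairMat M M').trace = (M.trace, M'.trace) := by
  ext
  · exact Prod.fst_sum
  · exact Prod.snd_sum

/-- A supercommutative algebra `K`, acting by operators (through `F`) on a space with an odd operator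
`D` of square zero, together with matrices over `K` such that the supercommutator with `D` obeys the
structure equations of `SuperDG.UnitData`. Here `γ` is the parity automorphism of the algebra `E` of all
operators. -/
structure OpData (K E : Type) [Ring K] [Algebra ℂ K] [Ring E] [Algebra ℂ E] (n : ℕ) where
  F : K →ₐ[ℂ] E
  γ : E →ₐ[ℂ] E
  D : E
  g : Matrix (Fin n) (Fin n) K
  k : Matrix (Fin n) (Fin n) K
  X : Matrix (Fin n) (Fin n) K
  Y : Matrix (Fin n) (Fin n) K
  Θ : Matrix (Fin n) (Fin n) K
  Ξ : Matrix (Fin n) (Fin n) K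
  η₁ : Matrix (Fin n) (Fin n) K
  η₂ : Matrix (Fin n) (Fin n) K
  γ_γ : ∀ a, γ (γ a) = a
  γ_D : γ D = -D
  D_D : D * D = 0
  super : ∀ a : K, ∃ a₀ a₁ : E, F a = a₀ + a₁ ∧ γ a₀ = a₀ ∧ γ a₁ = -a₁ ∧
    ∀ b : K, a₀ * F b = F b * a₀ ∧ a₁ * F b = γ (F b) * a₁
  g_even : ∀ i j, γ (F (g i j)) = F (g i j)
  k_even : ∀ i j, γ (F (k i j)) = F (k i j)
  X_even : ∀ i j, γ (F (X i j)) = F (X i j)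
  Y_even : ∀ i j, γ (F (Y i j)) = F (Y i j)
  Θ_odd : ∀ i j, γ (F (Θ i j)) = -F (Θ i j)
  Ξ_odd : ∀ i j, γ (F (Ξ i j)) = -F (Ξ i j)
  η₁_odd : ∀ i j, γ (F (η₁ i j)) = -F (η₁ i j)
  η₂_odd : ∀ i j, γ (F (η₂ i j)) = -F (η₂ i j)
  g_k : g * k = 1
  D_g : ∀ i j, D * F (g i j) - F (g i j) * D = F ((η₁ * g - g * η₂) i j)
  D_k : ∀ i j, D * F (k i j) - F (k i j) * D = F ((η₂ * k - k * η₁) i j)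
  D_X : ∀ i j, D * F (X i j) - F (X i j) * D = F ((η₁ * X - X * η₁) i j)
  D_Y : ∀ i j, D * F (Y i j) - F (Y i j) * D = F ((η₂ * Y - Y * η₂) i j)
  D_η₁ : ∀ i j, D * F (η₁ i j) + F (η₁ i j) * D = F ((η₁ * η₁) i j)
  D_η₂ : ∀ i j, D * F (η₂ i j) + F (η₂ i j) * D = F ((η₂ * η₂) i j)
  D_Θ : ∀ i j, j < i →
    D * F (Θ i j) + F (Θ i j) * D = F (g i j + (η₁ * Θ + Θ * η₂) i j)
  Θ_eq_zero : ∀ i j, i ≤ j → Θ i j = 0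
  D_Ξ : ∀ i j, j < i →
    D * F (Ξ i j) + F (Ξ i j) * D = F (X i j + (η₁ * Ξ + Ξ * η₁) i j)
  Ξ_eq_zero : ∀ i j, i ≤ j → Ξ i j = 0
  Y_strict : SuperDG.Strict Y
  η₁_strict : SuperDG.Strict η₁
  η₂_strict : SuperDG.Strict η₂

namespace OpData

variable {K E : Type} [Ring K] [Algebra ℂ K] [Ring E] [Algebra ℂ E] {n : ℕ}

section

variable (O : OpData K E n)

/-- The subalgebra of `K` generated by the entries of the matrices. -/
def alg : Subalgebra ℂ K :=
  Algebra.adjoin ℂ {x | ∃ i j, x = O.g i j ∨ x = O.k i j ∨ x = O.X i j ∨ x = O.Y i j ∨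
    x = O.Θ i j ∨ x = O.Ξ i j ∨ x = O.η₁ i j ∨ x = O.η₂ i j}

theorem g_mem (i j : Fin n) : O.g i j ∈ O.alg :=
  Algebra.subset_adjoin ⟨i, j, Or.inl rfl⟩
theorem k_mem (i j : Fin n) : O.k i j ∈ O.alg :=
  Algebra.subset_adjoin ⟨i, j, Or.inr (Or.inl rfl)⟩
theorem X_mem (i j : Fin n) : O.X i j ∈ O.alg :=
  Algebra.subset_adjoin ⟨i, j, Or.inr (Or.inr (Or.inl rfl))⟩
theorem Y_mem (i j : Fin n) : O.Y i j ∈ O.alg :=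
  Algebra.subset_adjoin ⟨i, j, Or.inr (Or.inr (Or.inr (Or.inl rfl)))⟩
theorem Θ_mem (i j : Fin n) : O.Θ i j ∈ O.alg :=
  Algebra.subset_adjoin ⟨i, j, Or.inr (Or.inr (Or.inr (Or.inr (Or.inl rfl))))⟩
theorem Ξ_mem (i j : Fin n) : O.Ξ i j ∈ O.alg :=
  Algebra.subset_adjoin ⟨i, j, Or.inr (Or.inr (Or.inr (Or.inr (Or.inr (Or.inl rfl)))))⟩
theorem η₁_mem (i j : Fin n) : O.η₁ i j ∈ O.alg :=
  Algebra.subset_adjoin ⟨i, j, Or.inr (Or.inr (Or.inr (Or.inr (Or.inr (Or.inr (Or.inl rfl))))))⟩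
theorem η₂_mem (i j : Fin n) : O.η₂ i j ∈ O.alg :=
  Algebra.subset_adjoin ⟨i, j, Or.inr (Or.inr (Or.inr (Or.inr (Or.inr (Or.inr (Or.inr rfl))))))⟩

theorem mul_entry_mem {M N : Matrix (Fin n) (Fin n) K} (hM : ∀ i j, M i j ∈ O.alg)
    (hN : ∀ i j, N i j ∈ O.alg) (i j : Fin n) : (M * N) i j ∈ O.alg := by
  rw [Matrix.mul_apply]
  exact sum_mem fun _ _ => mul_mem (hM _ _) (hN _ _)

/-- The algebra of operators generated by the entries of the matrices. -/
def ops : Subalgebra ℂ E := O.alg.map O.F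

theorem F_mem {a : K} (ha : a ∈ O.alg) : O.F a ∈ O.ops := ⟨a, ha, rfl⟩

/-- The supercommutator with `D`. -/
def comm : E →ₗ[ℂ] E := LinearMap.mulLeft ℂ O.D - LinearMap.mulRight ℂ O.D ∘ₗ O.γ.toLinearMap

theorem comm_apply (a : E) : O.comm a = O.D * a - O.γ a * O.D := rfl

theorem comm_mul (a b : E) : O.comm (a * b) = O.comm a * b + O.γ a * O.comm b := by
  rw [comm_apply, comm_apply, comm_apply, map_mul]
  noncomm_ring

theorem comm_even {a : E} (ha : O.γ a = a) : O.comm a = O.D * a - a * O.D := by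
  rw [comm_apply, ha]

theorem comm_odd {a : E} (ha : O.γ a = -a) : O.comm a = O.D * a + a * O.D := by
  rw [comm_apply, ha, neg_mul, sub_neg_eq_add]

/-- A property that holds for all even and for all odd elements of `alg` whose supercommutator with
`D` lies in the algebra `ops` holds for the entries of the matrices. -/
theorem gen_cases {P : K → Prop} (he : ∀ a ∈ O.alg, O.γ (O.F a) = O.F a →
    O.comm (O.F a) ∈ O.ops → P a) (ho : ∀ a ∈ O.alg, O.γ (O.F a) = -O.F a →
    O.comm (O.F a) ∈ O.ops → P a) (i j : Fin n) :
    P (O.g i j) ∧ P (O.k i j) ∧ P (O.X i j) ∧ P (O.Y i j) ∧ P (O.Θ i j) ∧ P (O.Ξ i j) ∧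
      P (O.η₁ i j) ∧ P (O.η₂ i j) := by
  refine ⟨he _ (O.g_mem i j) (O.g_even i j) ?_, he _ (O.k_mem i j) (O.k_even i j) ?_,
    he _ (O.X_mem i j) (O.X_even i j) ?_, he _ (O.Y_mem i j) (O.Y_even i j) ?_,
    ho _ (O.Θ_mem i j) (O.Θ_odd i j) ?_, ho _ (O.Ξ_mem i j) (O.Ξ_odd i j) ?_,
    ho _ (O.η₁_mem i j) (O.η₁_odd i j) ?_, ho _ (O.η₂_mem i j) (O.η₂_odd i j) ?_⟩
  · rw [O.comm_even (O.g_even i j), O.D_g]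
    exact O.F_mem (sub_mem (O.mul_entry_mem O.η₁_mem O.g_mem i j)
      (O.mul_entry_mem O.g_mem O.η₂_mem i j))
  · rw [O.comm_even (O.k_even i j), O.D_k]
    exact O.F_mem (sub_mem (O.mul_entry_mem O.η₂_mem O.k_mem i j)
      (O.mul_entry_mem O.k_mem O.η₁_mem i j))
  · rw [O.comm_even (O.X_even i j), O.D_X]
    exact O.F_mem (sub_mem (O.mul_entry_mem O.η₁_mem O.X_mem i j)
      (O.mul_entry_mem O.X_mem O.η₁_mem i j))
  · rw [O.comm_even (O.Y_even i j), O.D_Y]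
    exact O.F_mem (sub_mem (O.mul_entry_mem O.η₂_mem O.Y_mem i j)
      (O.mul_entry_mem O.Y_mem O.η₂_mem i j))
  · rcases lt_or_ge j i with h | h
    · rw [O.comm_odd (O.Θ_odd i j), O.D_Θ i j h]
      exact O.F_mem (add_mem (O.g_mem i j) (add_mem (O.mul_entry_mem O.η₁_mem O.Θ_mem i j)
        (O.mul_entry_mem O.Θ_mem O.η₂_mem i j)))
    · rw [O.Θ_eq_zero i j h, map_zero, map_zero]
      exact zero_mem _
  · rcases lt_or_ge j i with h | h
    · rw [O.comm_odd (O.Ξ_odd i j), O.D_Ξ i j h]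
      exact O.F_mem (add_mem (O.X_mem i j) (add_mem (O.mul_entry_mem O.η₁_mem O.Ξ_mem i j)
        (O.mul_entry_mem O.Ξ_mem O.η₁_mem i j)))
    · rw [O.Ξ_eq_zero i j h, map_zero, map_zero]
      exact zero_mem _
  · rw [O.comm_odd (O.η₁_odd i j), O.D_η₁]
    exact O.F_mem (O.mul_entry_mem O.η₁_mem O.η₁_mem i j)
  · rw [O.comm_odd (O.η₂_odd i j), O.D_η₂]
    exact O.F_mem (O.mul_entry_mem O.η₂_mem O.η₂_mem i j)

theorem gen_cases_mem {P : K → Prop} (he : ∀ a ∈ O.alg, O.γ (O.F a) = O.F a →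
    O.comm (O.F a) ∈ O.ops → P a) (ho : ∀ a ∈ O.alg, O.γ (O.F a) = -O.F a →
    O.comm (O.F a) ∈ O.ops → P a) (a : K) (ha : ∃ i j, a = O.g i j ∨ a = O.k i j ∨ a = O.X i j ∨
      a = O.Y i j ∨ a = O.Θ i j ∨ a = O.Ξ i j ∨ a = O.η₁ i j ∨ a = O.η₂ i j) : P a := by
  obtain ⟨i, j, h⟩ := ha
  obtain ⟨h1, h2, h3, h4, h5, h6, h7, h8⟩ := O.gen_cases he ho i j
  rcases h with rfl | rfl | rfl | rfl | rfl | rfl | rfl | rfl <;> assumption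

theorem γ_mem {x : E} (hx : x ∈ O.ops) : O.γ x ∈ O.ops := by
  obtain ⟨a, ha, rfl⟩ := hx
  change O.γ (O.F a) ∈ O.ops
  induction ha using Algebra.adjoin_induction with
  | mem a ha =>
    refine O.gen_cases_mem (P := fun a => O.γ (O.F a) ∈ O.ops) (fun a ha h _ => ?_)
      (fun a ha h _ => ?_) a ha
    · rw [h]; exact O.F_mem ha
    · rw [h]; exact neg_mem (O.F_mem ha)
  | algebraMap c => rw [AlgHom.commutes, AlgHom.commutes]; exact O.ops.algebraMap_mem c
  | add a b _ _ ha hb => rw [map_add, map_add]; exact add_mem ha hb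
  | mul a b _ _ ha hb => rw [map_mul, map_mul]; exact mul_mem ha hb

/-- The supercommutator with `D` preserves the algebra of operators, as it does so on the
generators. -/
theorem comm_mem {x : E} (hx : x ∈ O.ops) : O.comm x ∈ O.ops := by
  obtain ⟨a, ha, rfl⟩ := hx
  change O.comm (O.F a) ∈ O.ops
  induction ha using Algebra.adjoin_induction with
  | mem a ha =>
    exact O.gen_cases_mem (P := fun a => O.comm (O.F a) ∈ O.ops) (fun _ _ _ h => h)
      (fun _ _ _ h => h) a ha
  | algebraMap c =>
    rw [AlgHom.commutes, comm_apply, AlgHom.commutes, Algebra.commutes, sub_self]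
    exact zero_mem _
  | add a b _ _ ha hb => rw [map_add, map_add]; exact add_mem ha hb
  | mul a b ha' hb' ha hb =>
    rw [map_mul, comm_mul]
    exact add_mem (mul_mem ha (O.F_mem hb')) (mul_mem (O.γ_mem (O.F_mem ha')) hb)

/-- The supercommutator with `D` makes the algebra generated by the entries of the matrices a
supercommutative differential algebra. -/
def superDG : SuperDG O.ops where
  γ := (O.γ.comp O.ops.val).codRestrict O.ops fun x => O.γ_mem x.2
  d := (O.comm ∘ₗ O.ops.val.toLinearMap).codRestrict (Subalgebra.toSubmodule O.ops)
    fun x => O.comm_mem x.2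
  γ_γ a := Subtype.ext (O.γ_γ a)
  even_comm := by
    rintro ⟨_, a, ha, rfl⟩ h ⟨_, b, hb, rfl⟩
    obtain ⟨a₀, a₁, h1, h2, h3, h4⟩ := O.super a
    have h' : O.γ (O.F a) = O.F a := congrArg Subtype.val h
    have h5 : a₁ = 0 := by
      rw [h1, map_add, h2, h3, add_right_inj, neg_eq_iff_add_eq_zero, ← two_smul ℂ] at h'
      exact (smul_eq_zero_iff_right (two_ne_zero' ℂ)).1 h'
    refine Subtype.ext ?_
    change O.F a * O.F b = O.F b * O.F a
    rw [h1, h5, add_zero]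
    exact (h4 b).1
  odd_comm := by
    rintro ⟨_, a, ha, rfl⟩ h ⟨_, b, hb, rfl⟩
    obtain ⟨a₀, a₁, h1, h2, h3, h4⟩ := O.super a
    have h' : O.γ (O.F a) = -O.F a := congrArg Subtype.val h
    have h5 : a₀ = 0 := by
      rw [h1, map_add, h2, h3, neg_add, add_left_inj, eq_neg_iff_add_eq_zero, ← two_smul ℂ] at h'
      exact (smul_eq_zero_iff_right (two_ne_zero' ℂ)).1 h'
    refine Subtype.ext ?_
    change O.F a * O.F b = O.γ (O.F b) * O.F a
    rw [h1, h5, zero_add]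
    exact (h4 b).2
  d_mul a b := Subtype.ext (O.comm_mul a b)
  d_γ a := Subtype.ext (by
    change O.D * O.γ a - O.γ (O.γ a) * O.D = -O.γ (O.D * a - O.γ a * O.D)
    rw [map_sub, map_mul, map_mul, O.γ_D]
    noncomm_ring)
  d_d a := Subtype.ext (by
    change O.D * (O.D * a - O.γ a * O.D) - O.γ (O.D * a - O.γ a * O.D) * O.D = 0
    have h1 : O.D * (O.D * a) = 0 := by rw [← mul_assoc, O.D_D, zero_mul]
    have h2 : a * O.D * O.D = 0 := by rw [mul_assoc, O.D_D, mul_zero]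
    rw [map_sub, map_mul, map_mul, O.γ_D, O.γ_γ, mul_sub, sub_mul, h1, mul_neg, neg_mul (a * O.D),
      h2]
    noncomm_ring)

/-- A matrix over the algebra of operators, given by a matrix over `K`. -/
def mat {M : Matrix (Fin n) (Fin n) K} (hM : ∀ i j, M i j ∈ O.alg) :
    Matrix (Fin n) (Fin n) O.ops := fun i j => ⟨O.F (M i j), O.F_mem (hM i j)⟩

theorem mat_eq {M N : Matrix (Fin n) (Fin n) O.ops} (h : ∀ i j, (M i j : E) = N i j) : M = N :=
  Matrix.ext fun i j => Subtype.ext (h i j)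

theorem mat_mul {M N : Matrix (Fin n) (Fin n) K} (hM : ∀ i j, M i j ∈ O.alg)
    (hN : ∀ i j, N i j ∈ O.alg) : O.mat hM * O.mat hN = O.mat (O.mul_entry_mem hM hN) := by
  refine O.mat_eq fun i j => ?_
  rw [Matrix.mul_apply]
  refine (map_sum O.ops.val _ _).trans ?_
  change ∑ m, O.F (M i m) * O.F (N m j) = O.F ((M * N) i j)
  rw [Matrix.mul_apply, map_sum]
  exact Finset.sum_congr rfl fun m _ => (map_mul O.F _ _).symm

theorem mat_homog {M : Matrix (Fin n) (Fin n) K} (hM : ∀ i j, M i j ∈ O.alg) {α : O.ops →ₐ[ℂ] O.ops}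
    {c : ℂ} {p q : Fin n → ℂ}
    (h : ∀ i j, (α (O.mat hM i j) : E) = (c * p i * (q j)⁻¹) • O.F (M i j)) :
    SuperDG.Homog α c p q (O.mat hM) := fun i j => Subtype.ext (h i j)

theorem mat_even {M : Matrix (Fin n) (Fin n) K} (hM : ∀ i j, M i j ∈ O.alg)
    (h : ∀ i j, O.γ (O.F (M i j)) = O.F (M i j)) : SuperDG.Homog O.superDG.γ 1 1 1 (O.mat hM) :=
  O.mat_homog hM fun i j => (h i j).trans (by simp)

theorem mat_odd {M : Matrix (Fin n) (Fin n) K} (hM : ∀ i j, M i j ∈ O.alg)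
    (h : ∀ i j, O.γ (O.F (M i j)) = -O.F (M i j)) :
    SuperDG.Homog O.superDG.γ (-1) 1 1 (O.mat hM) :=
  O.mat_homog hM fun i j => (h i j).trans (by simp)

theorem mat_strict {M : Matrix (Fin n) (Fin n) K} (hM : ∀ i j, M i j ∈ O.alg)
    (h : SuperDG.Strict M) : SuperDG.Strict (O.mat hM) := fun i j hij =>
  Subtype.ext ((congrArg O.F (h i j hij)).trans (map_zero O.F))

/-- The structure equations in the algebra of operators. -/
def unitData : O.superDG.UnitData n where
  g := O.mat O.g_mem
  k := O.mat O.k_mem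
  X := O.mat O.X_mem
  Y := O.mat O.Y_mem
  Θ := O.mat O.Θ_mem
  Ξ := O.mat O.Ξ_mem
  η₁ := O.mat O.η₁_mem
  η₂ := O.mat O.η₂_mem
  g_even := O.mat_even _ O.g_even
  k_even := O.mat_even _ O.k_even
  X_even := O.mat_even _ O.X_even
  Y_even := O.mat_even _ O.Y_even
  Θ_odd := O.mat_odd _ O.Θ_odd
  Ξ_odd := O.mat_odd _ O.Ξ_odd
  η₁_odd := O.mat_odd _ O.η₁_odd
  η₂_odd := O.mat_odd _ O.η₂_odd
  g_k := by
    rw [mat_mul]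
    refine O.mat_eq fun i j => ?_
    change O.F ((O.g * O.k) i j) = _
    rw [O.g_k, Matrix.one_apply, Matrix.one_apply]
    split_ifs
    · exact map_one O.F
    · exact map_zero O.F
  d_g := by
    rw [mat_mul, mat_mul]
    refine O.mat_eq fun i j => (O.comm_even (O.g_even i j)).trans ((O.D_g i j).trans ?_)
    exact map_sub O.F _ _
  d_k := by
    rw [mat_mul, mat_mul]
    refine O.mat_eq fun i j => (O.comm_even (O.k_even i j)).trans ((O.D_k i j).trans ?_)
    exact map_sub O.F _ _
  d_X := by
    rw [mat_mul, mat_mul]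
    refine O.mat_eq fun i j => (O.comm_even (O.X_even i j)).trans ((O.D_X i j).trans ?_)
    exact map_sub O.F _ _
  d_Y := by
    rw [mat_mul, mat_mul]
    refine O.mat_eq fun i j => (O.comm_even (O.Y_even i j)).trans ((O.D_Y i j).trans ?_)
    exact map_sub O.F _ _
  d_η₁ := by
    rw [mat_mul]
    exact O.mat_eq fun i j => (O.comm_odd (O.η₁_odd i j)).trans (O.D_η₁ i j)
  d_η₂ := by
    rw [mat_mul]
    exact O.mat_eq fun i j => (O.comm_odd (O.η₂_odd i j)).trans (O.D_η₂ i j)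
  d_Θ i j h := by
    rw [mat_mul, mat_mul]
    refine Subtype.ext ((O.comm_odd (O.Θ_odd i j)).trans ((O.D_Θ i j h).trans ?_))
    rw [map_add, Matrix.add_apply, map_add]
    rfl
  Θ_eq_zero i j h := Subtype.ext ((congrArg O.F (O.Θ_eq_zero i j h)).trans (map_zero O.F))
  d_Ξ i j h := by
    rw [mat_mul, mat_mul]
    refine Subtype.ext ((O.comm_odd (O.Ξ_odd i j)).trans ((O.D_Ξ i j h).trans ?_))
    rw [map_add, Matrix.add_apply, map_add]
    rfl
  Y_strict := O.mat_strict _ O.Y_strict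
  η₁_strict := O.mat_strict _ O.η₁_strict
  η₂_strict := O.mat_strict _ O.η₂_strict

/-- The automorphism `α` multiplies `D` by `κ⁻¹`, and all matrices are homogeneous for it. -/
structure IsWeight (α : E →ₐ[ℂ] E) (κ ν : ℂ) (p q : Fin n → ℂ) : Prop where
  α_γ : ∀ a, α (O.γ a) = O.γ (α a)
  α_D : α O.D = κ⁻¹ • O.D
  g : ∀ i j, α (O.F (O.g i j)) = (1 * p i * (q j)⁻¹) • O.F (O.g i j)
  k : ∀ i j, α (O.F (O.k i j)) = (1 * q i * (p j)⁻¹) • O.F (O.k i j)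
  X : ∀ i j, α (O.F (O.X i j)) = (ν * p i * (p j)⁻¹) • O.F (O.X i j)
  Y : ∀ i j, α (O.F (O.Y i j)) = (ν⁻¹ * κ⁻¹ * κ⁻¹ * q i * (q j)⁻¹) • O.F (O.Y i j)
  Θ : ∀ i j, α (O.F (O.Θ i j)) = (κ * p i * (q j)⁻¹) • O.F (O.Θ i j)
  Ξ : ∀ i j, α (O.F (O.Ξ i j)) = (κ * ν * p i * (p j)⁻¹) • O.F (O.Ξ i j)
  η₁ : ∀ i j, α (O.F (O.η₁ i j)) = (κ⁻¹ * p i * (p j)⁻¹) • O.F (O.η₁ i j)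
  η₂ : ∀ i j, α (O.F (O.η₂ i j)) = (κ⁻¹ * q i * (q j)⁻¹) • O.F (O.η₂ i j)

end

variable {O : OpData K E n}

namespace IsWeight

variable {α : E →ₐ[ℂ] E} {κ ν : ℂ} {p q : Fin n → ℂ}

theorem mem_ops (w : O.IsWeight α κ ν p q) {x : E} (hx : x ∈ O.ops) : α x ∈ O.ops := by
  obtain ⟨a, ha, rfl⟩ := hx
  change α (O.F a) ∈ O.ops
  induction ha using Algebra.adjoin_induction with
  | mem a ha =>
    obtain ⟨i, j, h⟩ := ha
    have key : ∀ {b : K} {c : ℂ}, b ∈ O.alg → α (O.F b) = c • O.F b → α (O.F b) ∈ O.ops :=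
      fun hb h => h ▸ O.ops.smul_mem (O.F_mem hb) _
    rcases h with rfl | rfl | rfl | rfl | rfl | rfl | rfl | rfl
    · exact key (O.g_mem i j) (w.g i j)
    · exact key (O.k_mem i j) (w.k i j)
    · exact key (O.X_mem i j) (w.X i j)
    · exact key (O.Y_mem i j) (w.Y i j)
    · exact key (O.Θ_mem i j) (w.Θ i j)
    · exact key (O.Ξ_mem i j) (w.Ξ i j)
    · exact key (O.η₁_mem i j) (w.η₁ i j)
    · exact key (O.η₂_mem i j) (w.η₂ i j)
  | algebraMap c => rw [AlgHom.commutes, AlgHom.commutes]; exact O.ops.algebraMap_mem c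
  | add a b _ _ ha hb => rw [map_add, map_add]; exact add_mem ha hb
  | mul a b _ _ ha hb => rw [map_mul, map_mul]; exact mul_mem ha hb

/-- The restriction of `α` to the algebra generated by the entries of the matrices. -/
def weight (w : O.IsWeight α κ ν p q) (hκ : κ ≠ 0) (hν : ν ≠ 0) (hp : ∀ i, p i ≠ 0)
    (hq : ∀ i, q i ≠ 0) : O.unitData.Weight where
  α := (α.comp O.ops.val).codRestrict O.ops fun x => w.mem_ops x.2
  κ := κ
  ν := ν
  p := p
  q := q
  κ_ne := hκ
  ν_ne := hν
  p_ne := hp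
  q_ne := hq
  α_γ s := Subtype.ext (w.α_γ s)
  α_d s := Subtype.ext (by
    change α (O.D * s - O.γ s * O.D) = κ⁻¹ • (O.D * α s - O.γ (α s) * O.D)
    rw [map_sub, map_mul, map_mul, w.α_D, w.α_γ, smul_mul_assoc, mul_smul_comm, smul_sub])
  g := O.mat_homog O.g_mem w.g
  k := O.mat_homog O.k_mem w.k
  X := O.mat_homog O.X_mem w.X
  Y := O.mat_homog O.Y_mem w.Y
  Θ := O.mat_homog O.Θ_mem w.Θ
  Ξ := O.mat_homog O.Ξ_mem w.Ξ
  η₁ := O.mat_homog O.η₁_mem w.η₁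
  η₂ := O.mat_homog O.η₂_mem w.η₂

end IsWeight

/-- The correction term is the operator of an element of `K` all of whose terms contain an entry of
`Θ` or `Ξ`. -/
theorem exists_lift {x : O.ops} (hx : x ∈ O.unitData.oddSpan) : ∃ a ∈ O.alg, O.F a = x ∧
    a ∈ Submodule.span K {y | ∃ i j, y = O.Θ i j ∨ y = O.Ξ i j} := by
  induction hx using Submodule.span_induction with
  | mem x hx =>
    rcases hx with ⟨ij, rfl⟩ | ⟨ij, rfl⟩
    · exact ⟨_, O.Θ_mem ij.1 ij.2, rfl, Submodule.subset_span ⟨_, _, Or.inl rfl⟩⟩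
    · exact ⟨_, O.Ξ_mem ij.1 ij.2, rfl, Submodule.subset_span ⟨_, _, Or.inr rfl⟩⟩
  | zero => exact ⟨0, zero_mem _, map_zero O.F, Submodule.zero_mem _⟩
  | add x y _ _ hx hy =>
    obtain ⟨a, h1, h2, h3⟩ := hx
    obtain ⟨b, h4, h5, h6⟩ := hy
    exact ⟨a + b, add_mem h1 h4, by rw [map_add, h2, h5]; rfl, Submodule.add_mem _ h3 h6⟩
  | smul r x _ hx =>
    obtain ⟨a, h1, h2, h3⟩ := hx
    obtain ⟨_, b, hb, rfl⟩ := r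
    exact ⟨b * a, mul_mem hb h1, by rw [map_mul, h2]; rfl, Submodule.smul_mem _ b h3⟩

/-- There is an odd operator `A` in the algebra generated by the matrices, with `[D, A]` the potential
`Tr (X g Y g⁻¹)`; it is homogeneous, and all its terms contain an entry of `Θ` or `Ξ`. -/
theorem exists_correction (O : OpData K E n) : ∃ a ∈ O.alg, O.γ (O.F a) = -O.F a ∧
    O.F a * O.F a = 0 ∧
    O.D * O.F a + O.F a * O.D = O.F (O.X * O.g * O.Y * O.k).trace ∧
    (∀ {α : E →ₐ[ℂ] E} {κ ν : ℂ} {p q : Fin n → ℂ}, O.IsWeight α κ ν p q → κ ≠ 0 → ν ≠ 0 →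
      (∀ i, p i ≠ 0) → (∀ i, q i ≠ 0) → α (O.F a) = κ⁻¹ • O.F a) ∧
    a ∈ Submodule.span K {y | ∃ i j, y = O.Θ i j ∨ y = O.Ξ i j} := by
  obtain ⟨a, h1, h2, h3⟩ := exists_lift O.unitData.A_mem
  have hγ : O.superDG.γ O.unitData.A = -O.unitData.A :=
    (O.unitData.parity.A).trans (by
      change ((-1 : ℂ)⁻¹ • O.unitData.A : O.ops) = _
      rw [inv_neg, inv_one, neg_one_smul])
  have hγ' : O.γ (O.F a) = -O.F a := by
    rw [h2]; exact congrArg Subtype.val hγ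
  refine ⟨a, h1, hγ', ?_, ?_, fun w hκ hν hp hq => ?_, h3⟩
  · rw [h2]
    exact congrArg Subtype.val (O.superDG.odd_sq hγ)
  · rw [← O.comm_odd hγ', h2]
    refine (congrArg Subtype.val O.unitData.d_A).trans ?_
    change ((O.mat O.X_mem * O.mat O.g_mem * O.mat O.Y_mem * O.mat O.k_mem).trace : E) = _
    rw [mat_mul, mat_mul, mat_mul, Matrix.trace, Matrix.trace, map_sum]
    exact map_sum O.ops.val _ _
  · have h := congrArg Subtype.val (w.weight hκ hν hp hq).A
    rw [h2]
    exact h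

variable {K' E' : Type} [Ring K'] [Algebra ℂ K'] [Ring E'] [Algebra ℂ E']

/-- The product of two such algebras of operators. -/
def prod (O : OpData K E n) (O' : OpData K' E' n) : OpData (K × K') (E × E') n where
  F := AlgHom.prodMap O.F O'.F
  γ := AlgHom.prodMap O.γ O'.γ
  D := (O.D, O'.D)
  g := pairMat O.g O'.g
  k := pairMat O.k O'.k
  X := pairMat O.X O'.X
  Y := pairMat O.Y O'.Y
  Θ := pairMat O.Θ O'.Θ
  Ξ := pairMat O.Ξ O'.Ξ
  η₁ := pairMat O.η₁ O'.η₁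
  η₂ := pairMat O.η₂ O'.η₂
  γ_γ a := Prod.ext (O.γ_γ a.1) (O'.γ_γ a.2)
  γ_D := Prod.ext O.γ_D O'.γ_D
  D_D := Prod.ext O.D_D O'.D_D
  super a := by
    obtain ⟨a₀, a₁, h1, h2, h3, h4⟩ := O.super a.1
    obtain ⟨b₀, b₁, h1', h2', h3', h4'⟩ := O'.super a.2
    exact ⟨(a₀, b₀), (a₁, b₁), Prod.ext h1 h1', Prod.ext h2 h2', Prod.ext h3 h3', fun b =>
      ⟨Prod.ext (h4 b.1).1 (h4' b.2).1, Prod.ext (h4 b.1).2 (h4' b.2).2⟩⟩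
  g_even i j := Prod.ext (O.g_even i j) (O'.g_even i j)
  k_even i j := Prod.ext (O.k_even i j) (O'.k_even i j)
  X_even i j := Prod.ext (O.X_even i j) (O'.X_even i j)
  Y_even i j := Prod.ext (O.Y_even i j) (O'.Y_even i j)
  Θ_odd i j := Prod.ext (O.Θ_odd i j) (O'.Θ_odd i j)
  Ξ_odd i j := Prod.ext (O.Ξ_odd i j) (O'.Ξ_odd i j)
  η₁_odd i j := Prod.ext (O.η₁_odd i j) (O'.η₁_odd i j)
  η₂_odd i j := Prod.ext (O.η₂_odd i j) (O'.η₂_odd i j)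
  g_k := by
    rw [pairMat_mul, O.g_k, O'.g_k]
    ext i j
    · change (1 : Matrix (Fin n) (Fin n) K) i j = _
      rw [Matrix.one_apply, Matrix.one_apply]; split_ifs <;> rfl
    · change (1 : Matrix (Fin n) (Fin n) K') i j = _
      rw [Matrix.one_apply, Matrix.one_apply]; split_ifs <;> rfl
  D_g i j := by
    rw [pairMat_mul, pairMat_mul]; exact Prod.ext (O.D_g i j) (O'.D_g i j)
  D_k i j := by
    rw [pairMat_mul, pairMat_mul]; exact Prod.ext (O.D_k i j) (O'.D_k i j)
  D_X i j := by
    rw [pairMat_mul, pairMat_mul]; exact Prod.ext (O.D_X i j) (O'.D_X i j)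
  D_Y i j := by
    rw [pairMat_mul, pairMat_mul]; exact Prod.ext (O.D_Y i j) (O'.D_Y i j)
  D_η₁ i j := by rw [pairMat_mul]; exact Prod.ext (O.D_η₁ i j) (O'.D_η₁ i j)
  D_η₂ i j := by rw [pairMat_mul]; exact Prod.ext (O.D_η₂ i j) (O'.D_η₂ i j)
  D_Θ i j h := by
    rw [pairMat_mul, pairMat_mul]; exact Prod.ext (O.D_Θ i j h) (O'.D_Θ i j h)
  Θ_eq_zero i j h := Prod.ext (O.Θ_eq_zero i j h) (O'.Θ_eq_zero i j h)
  D_Ξ i j h := by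
    rw [pairMat_mul, pairMat_mul]; exact Prod.ext (O.D_Ξ i j h) (O'.D_Ξ i j h)
  Ξ_eq_zero i j h := Prod.ext (O.Ξ_eq_zero i j h) (O'.Ξ_eq_zero i j h)
  Y_strict i j h := Prod.ext (O.Y_strict i j h) (O'.Y_strict i j h)
  η₁_strict i j h := Prod.ext (O.η₁_strict i j h) (O'.η₁_strict i j h)
  η₂_strict i j h := Prod.ext (O.η₂_strict i j h) (O'.η₂_strict i j h)

theorem IsWeight.prod {O' : OpData K' E' n} {α : E →ₐ[ℂ] E} {α' : E' →ₐ[ℂ] E'} {κ ν : ℂ}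
    {p q : Fin n → ℂ} (w : O.IsWeight α κ ν p q) (w' : O'.IsWeight α' κ ν p q) :
    (O.prod O').IsWeight (AlgHom.prodMap α α') κ ν p q where
  α_γ a := Prod.ext (w.α_γ a.1) (w'.α_γ a.2)
  α_D := Prod.ext w.α_D w'.α_D
  g i j := Prod.ext (w.g i j) (w'.g i j)
  k i j := Prod.ext (w.k i j) (w'.k i j)
  X i j := Prod.ext (w.X i j) (w'.X i j)
  Y i j := Prod.ext (w.Y i j) (w'.Y i j)
  Θ i j := Prod.ext (w.Θ i j) (w'.Θ i j)
  Ξ i j := Prod.ext (w.Ξ i j) (w'.Ξ i j)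
  η₁ i j := Prod.ext (w.η₁ i j) (w'.η₁ i j)
  η₂ i j := Prod.ext (w.η₂ i j) (w'.η₂ i j)

end OpData

/-! ### Exterior algebras of representations -/

section ExteriorModule

variable {M : Type} [AddCommGroup M] [Module ℂ M]

theorem extDer_map {φ ψ f : M →ₗ[ℂ] M} (h : ∀ m, f (φ m) = ψ (f m)) (w : ExteriorAlgebra ℂ M) :
    ExteriorAlgebra.map f (extDer φ w) = extDer ψ (ExteriorAlgebra.map f w) := by
  induction w using ext_induction with
  | one => rw [extDer_one, map_one, extDer_one, map_zero]
  | add x y hx hy => simp only [map_add, hx, hy]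
  | smul c x hx => simp only [map_smul, hx]
  | ι_mul m x hx => rw [extDer_ι_mul, map_add, map_ι_mul, map_ι_mul, map_ι_mul, extDer_ι_mul, hx, h]

theorem extDer_lie {φ ψ χ : M →ₗ[ℂ] M} (h : ∀ m, χ m = φ (ψ m) - ψ (φ m))
    (w : ExteriorAlgebra ℂ M) : extDer χ w = extDer φ (extDer ψ w) - extDer ψ (extDer φ w) := by
  induction w using ext_induction with
  | one => simp [extDer_one]
  | add x y hx hy => simp only [map_add, hx, hy]; abel
  | smul c x hx => simp only [map_smul, hx, smul_sub]
  | ι_mul m x hx =>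
    simp only [extDer_ι_mul, map_add, hx, h, map_sub, sub_mul, mul_sub]
    abel

theorem extDer_involute (φ : M →ₗ[ℂ] M) (w : ExteriorAlgebra ℂ M) :
    CliffordAlgebra.involute (Q := (0 : QuadraticForm ℂ M)) (extDer φ w) =
      extDer φ (CliffordAlgebra.involute (Q := (0 : QuadraticForm ℂ M)) w) := by
  induction w using ext_induction with
  | one => rw [extDer_one, map_zero, involute_one_ext, extDer_one]
  | add x y hx hy => simp only [map_add, hx, hy]
  | smul c x hx => simp only [map_smul, hx]
  | ι_mul m x hx =>
    rw [extDer_ι_mul, map_add, involute_ι_mul, involute_ι_mul, involute_ι_mul, map_neg,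
      extDer_ι_mul, hx, neg_add]

instance exteriorAlgebra_finite [Module.Finite ℂ M] : Module.Finite ℂ (ExteriorAlgebra ℂ M) := by
  have h : ∀ p, p ≤ Module.finrank ℂ M + 1 → ∃ N : Submodule ℂ (ExteriorAlgebra ℂ M),
      N.FG ∧ N ⊔ extGE M p = ⊤ := by
    intro p hp
    induction p with
    | zero => exact ⟨⊥, Submodule.fg_bot, by rw [extGE_zero, sup_top_eq]⟩
    | succ p ih =>
      obtain ⟨N, h1, h2⟩ := ih (Nat.le_of_succ_le hp)
      refine ⟨N ⊔ (⋀[ℂ]^p M : Submodule ℂ (ExteriorAlgebra ℂ M)),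
        h1.sup (Submodule.FG.pow (by
          rw [LinearMap.range_eq_map]
          exact Submodule.FG.map _ Module.Finite.fg_top) p), ?_⟩
      rw [eq_top_iff, ← h2, sup_assoc]
      refine sup_le_sup le_rfl ?_
      have h3 : (⊤ : Submodule ℂ (ExteriorAlgebra ℂ M)) ≤ 1 ⊔ extGE M 1 := by
        intro x _
        induction x using ext_induction with
        | one => exact Submodule.mem_sup_left (Submodule.one_le.1 le_rfl)
        | add x y hx hy => exact Submodule.add_mem _ (hx trivial) (hy trivial)
        | smul c x hx => exact Submodule.smul_mem _ _ (hx trivial)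
        | ι_mul m x _ =>
          exact Submodule.mem_sup_right (ι_mul_extGE m (p := 0) (by rw [extGE_zero]; trivial))
      calc extGE M p ≤ LinearMap.range (ExteriorAlgebra.ι ℂ : M →ₗ[ℂ] _) ^ p * (1 ⊔ extGE M 1) :=
            mul_le_mul' le_rfl h3
        _ = _ := by
          rw [Submodule.mul_sup, mul_one, extGE, extGE, ← mul_assoc, ← pow_add]
  obtain ⟨N, h1, h2⟩ := h _ le_rfl
  rw [extGE_eq_bot, sup_bot_eq] at h2
  exact ⟨h2 ▸ h1⟩

variable {𝔥 L : Type} [LieRing 𝔥] [LieAlgebra ℂ 𝔥] [Group L] {S : Symmetry 𝔥 L}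

/-- The super representation `Λ U`, for a representation `U`. -/
def EqModule.exterior (U : EqModule S) : EqModule S where
  V := ExteriorAlgebra ℂ U.V
  lie := LinearMap.mk₂ ℂ (fun x w => extDer (U.lie x) w)
    (fun x y w => by rw [map_add, extDer_add]) (fun c x w => by rw [map_smul, extDer_smul])
    (fun x v w => map_add _ _ _) (fun c x w => map_smul _ _ _)
  lie_lie x y w := extDer_lie (U.lie_lie x y) w
  act :=
    { toFun := fun l => (ExteriorAlgebra.map (U.act l)).toLinearMap
      map_one' := by
        rw [map_one]
        exact congrArg AlgHom.toLinearMap (ExteriorAlgebra.map_id (R := ℂ) (M := U.V))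
      map_mul' := fun l m => by
        rw [map_mul]
        exact congrArg AlgHom.toLinearMap (ExteriorAlgebra.map_comp_map (U.act m) (U.act l)).symm }
  act_lie l x w := extDer_map (U.act_lie l x) w
  act_coord := by
    intro f w
    change (fun l => f (ExteriorAlgebra.map (U.act l) w)) ∈ S.coord
    induction w using ext_induction generalizing f with
    | one =>
      simp only [map_one]
      exact S.coord.algebraMap_mem (f 1)
    | add x y hx hy =>
      simp only [map_add]
      exact S.coord.add_mem (hx f) (hy f)
    | smul c x hx =>
      simp only [map_smul]
      exact S.coord.smul_mem (hx f) c
    | ι_mul m x hx =>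
      obtain ⟨b, hb⟩ :
          ∃ b : Module.Basis (Fin (Module.finrank ℂ U.V)) ℂ U.V, b = Module.finBasis ℂ U.V :=
        ⟨_, rfl⟩
      have h : (fun l => f (ExteriorAlgebra.map (U.act l) (ExteriorAlgebra.ι ℂ m * x))) =
          ∑ i, (fun l => b.coord i (U.act l m)) * fun l =>
            (f ∘ₗ LinearMap.mulLeft ℂ (ExteriorAlgebra.ι ℂ (b i)))
              (ExteriorAlgebra.map (U.act l) x) := by
        funext l
        rw [map_ι_mul]
        conv_lhs => rw [← b.sum_repr (U.act l m)]
        simp only [map_sum, map_smul, Finset.sum_mul, smul_mul_assoc, Finset.sum_apply,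
          Pi.mul_apply, smul_eq_mul]
        rfl
      rw [h]
      exact sum_mem fun i _ => mul_mem (U.act_coord _ m) (hx _)
  par := (CliffordAlgebra.involute (Q := (0 : QuadraticForm ℂ U.V))).toLinearMap
  par_par w := involute_involute_ext w
  par_lie x w := extDer_involute (U.lie x) w
  par_act l w := (map_involute (U.act l) w).symm

end ExteriorModule

/-! ### Conjugation of operators -/

/-- Conjugation by an invertible element. -/
def conjHom {A : Type} [Ring A] [Algebra ℂ A] (u v : A) (h : u * v = 1) (h' : v * u = 1) :
    A →ₐ[ℂ] A where
  toFun a := u * a * v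
  map_one' := by rw [mul_one, h]
  map_mul' a b := by
    have : u * a * v * (u * b * v) = u * a * (v * u) * b * v := by noncomm_ring
    rw [this, h', mul_one, mul_assoc u a b]
  map_zero' := by rw [mul_zero, zero_mul]
  map_add' a b := by rw [mul_add, add_mul]
  commutes' c := by rw [← Algebra.commutes, mul_assoc, h, mul_one]

section Conjugation

variable {𝔥 L : Type} [LieRing 𝔥] [LieAlgebra ℂ 𝔥] [Group L] {S : Symmetry 𝔥 L}
variable {Z : EqSpace S} {V : EqModule S}

theorem ext_map_map {l m : L} (h : l * m = 1) (w : ExteriorAlgebra ℂ 𝔥) :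
    S.extAct l (S.extAct m w) = w := by
  have hκ : (S.κ l : ℂ) * (S.κ m : ℂ) = 1 := by
    rw [← Units.val_mul, ← map_mul, h, map_one, Units.val_one]
  have h1 : ((S.κ l : ℂ) • (S.Ad l : 𝔥 →ₗ[ℂ] 𝔥)) ∘ₗ ((S.κ m : ℂ) • (S.Ad m : 𝔥 →ₗ[ℂ] 𝔥)) =
      LinearMap.id := by
    refine LinearMap.ext fun x => ?_
    change (S.κ l : ℂ) • S.Ad l ((S.κ m : ℂ) • S.Ad m x) = x
    rw [map_smul, smul_smul, hκ, one_smul, ← S.Ad_mul, h, S.Ad_one]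
  change ExteriorAlgebra.map _ (ExteriorAlgebra.map _ w) = w
  rw [← AlgHom.comp_apply, ExteriorAlgebra.map_comp_map, h1, ExteriorAlgebra.map_id,
    AlgHom.id_apply]

theorem totAct_totAct {l m : L} (h : l * m = 1) (y : Total Z V) :
    totAct Z V l (totAct Z V m y) = y := by
  induction y using total_induction with
  | add x y hx hy => rw [map_add, map_add, hx, hy]
  | smul r y hy => rw [totAct_smul, totAct_smul, hy, ← Z.act_mul, h, Z.act_one]
  | lie x y hy => rw [totAct_lie, totAct_lie, hy, ← S.Ad_mul, h, S.Ad_one]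
  | gen w v =>
    rw [← baseIncl_tmul, totAct_incl, totAct_incl, baseAct_tmul, baseAct_tmul, ext_map_map h,
      map_one, map_one, ← Module.End.mul_apply, ← map_mul, h, map_one, Module.End.one_apply]

theorem totPar_totPar (y : Total Z V) : totPar Z V (totPar Z V y) = y := by
  induction y using total_induction with
  | add x y hx hy => rw [map_add, map_add, hx, hy]
  | smul r y hy => rw [totPar_smul, totPar_smul, hy]
  | lie x y hy => rw [totPar_lie, totPar_lie, hy]
  | gen w v =>
    rw [← baseIncl_tmul, totPar_incl, totPar_incl, basePar_tmul, basePar_tmul,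
      involute_involute_ext, V.par_par]

variable (Z V) in
/-- Conjugation of operators by the action of `l`. -/
def actConj (l : L) : Module.End ℂ (Total Z V) →ₐ[ℂ] Module.End ℂ (Total Z V) :=
  conjHom (totAct Z V l) (totAct Z V l⁻¹) (LinearMap.ext (totAct_totAct (mul_inv_cancel l)))
    (LinearMap.ext (totAct_totAct (inv_mul_cancel l)))

variable (Z V) in
/-- Conjugation of operators by the parity. -/
def parConj : Module.End ℂ (Total Z V) →ₐ[ℂ] Module.End ℂ (Total Z V) :=
  conjHom (totPar Z V) (totPar Z V) (LinearMap.ext totPar_totPar) (LinearMap.ext totPar_totPar)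

theorem actConj_apply (l : L) (T : Module.End ℂ (Total Z V)) (y : Total Z V) :
    actConj Z V l T y = totAct Z V l (T (totAct Z V l⁻¹ y)) := rfl

theorem parConj_apply (T : Module.End ℂ (Total Z V)) (y : Total Z V) :
    parConj Z V T y = totPar Z V (T (totPar Z V y)) := rfl

theorem parConj_parConj (T : Module.End ℂ (Total Z V)) : parConj Z V (parConj Z V T) = T :=
  LinearMap.ext fun y => by
    rw [parConj_apply, parConj_apply, totPar_totPar, totPar_totPar]

theorem totPar_totAct (l : L) (y : Total Z V) :
    totPar Z V (totAct Z V l y) = totAct Z V l (totPar Z V y) := by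
  induction y using total_induction with
  | add x y hx hy => simp only [map_add, hx, hy]
  | smul r y hy => rw [totPar_smul, totAct_smul, totAct_smul, totPar_smul, hy]
  | lie x y hy => rw [totPar_lie, totAct_lie, totAct_lie, totPar_lie, hy]
  | gen w v =>
    rw [← baseIncl_tmul, totPar_incl, totAct_incl, totAct_incl, totPar_incl, basePar_tmul,
      baseAct_tmul, baseAct_tmul, basePar_tmul, V.par_act]
    congr 3
    exact (map_involute _ w).symm

theorem actConj_parConj (l : L) (T : Module.End ℂ (Total Z V)) :
    actConj Z V l (parConj Z V T) = parConj Z V (actConj Z V l T) :=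
  LinearMap.ext fun y => by
    rw [actConj_apply, parConj_apply, parConj_apply, actConj_apply, totPar_totAct, totPar_totAct]

variable (Z V) in
/-- An `R`-linear operator, as a linear operator over `ℂ`. -/
def toEnd : Module.End Z.R (Total Z V) →ₐ[ℂ] Module.End ℂ (Total Z V) where
  toFun T := T.restrictScalars ℂ
  map_one' := rfl
  map_mul' _ _ := rfl
  map_zero' := rfl
  map_add' _ _ := rfl
  commutes' _ := rfl

theorem toEnd_injective : Function.Injective (toEnd Z V) := fun _ _ h =>
  LinearMap.ext fun y => LinearMap.congr_fun h y

variable {T : Module.End Z.R (Total Z V)} {χ : L → ℂ} {ε : ℂ}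

theorem Covariant.parConj (h : Covariant χ ε T) :
    parConj Z V (toEnd Z V T) = ε • toEnd Z V T := by
  refine LinearMap.ext fun y => ?_
  have h1 : T (totPar Z V y) = ε • totPar Z V (T y) := h.par y
  change totPar Z V (T (totPar Z V y)) = ε • T y
  rw [h1, map_smul, totPar_totPar]

theorem Covariant.actConj (h : Covariant χ ε T) {l : L} (hχ : χ l ≠ 0) :
    actConj Z V l (toEnd Z V T) = (χ l)⁻¹ • toEnd Z V T := by
  refine LinearMap.ext fun y => ?_
  have h1 := h.act l (totAct Z V l⁻¹ y)
  rw [totAct_totAct (mul_inv_cancel l)] at h1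
  change totAct Z V l (T (totAct Z V l⁻¹ y)) = (χ l)⁻¹ • T y
  rw [h1, smul_smul, inv_mul_cancel₀ hχ, one_smul]

/-- Covariance in terms of the conjugation of operators by `L` and by the parity. -/
theorem covariant_of_conj (hlie : ∀ x y, T (totLie Z V x y) = totLie Z V x (T y))
    (hpar : parConj Z V (toEnd Z V T) = ε • toEnd Z V T) (hε : ε * ε = 1)
    (hχ : ∀ l, χ l ≠ 0) (hact : ∀ l, actConj Z V l (toEnd Z V T) = (χ l)⁻¹ • toEnd Z V T) :
    Covariant χ ε T where
  lie := hlie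
  par y := by
    have h : totPar Z V (T (totPar Z V (totPar Z V y))) = ε • T (totPar Z V y) :=
      LinearMap.congr_fun hpar (totPar Z V y)
    rw [totPar_totPar] at h
    rw [h, smul_smul, hε, one_smul]
  act l y := by
    have h : totAct Z V l (T (totAct Z V l⁻¹ (totAct Z V l y))) = (χ l)⁻¹ • T (totAct Z V l y) :=
      LinearMap.congr_fun (hact l) (totAct Z V l y)
    rw [totAct_totAct (inv_mul_cancel l)] at h
    rw [h, smul_smul, mul_inv_cancel₀ (hχ l), one_smul]

variable {U : Type} [AddCommGroup U] [Module ℂ U] {e : V.V ≃ₗ[ℂ] ExteriorAlgebra ℂ U}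

theorem totAct_opMul {l : L} {actU : U →ₗ[ℂ] U}
    (hact : ∀ v, e (V.act l v) = ExteriorAlgebra.map actU (e v)) (k : KAlg Z U) (y : Total Z V) :
    totAct Z V l (opMul Z e k y) = opMul Z e (kAct Z l actU k) (totAct Z V l y) := by
  induction y using total_induction with
  | add x y hx hy => simp only [map_add, hx, hy]
  | smul r y hy => rw [map_smul, totAct_smul, totAct_smul, map_smul, hy]
  | lie x y hy => rw [opMul_lie, totAct_lie, totAct_lie, opMul_lie, hy]
  | gen w v =>
    rw [← baseIncl_tmul, opMul_incl, totAct_incl, totAct_incl, opMul_incl, baseAct_baseMul hact]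

theorem totPar_opMul (hpar : ∀ v, e (V.par v) =
      CliffordAlgebra.involute (Q := (0 : QuadraticForm ℂ U)) (e v)) (k : KAlg Z U)
    (y : Total Z V) : totPar Z V (opMul Z e k y) = opMul Z e (kPar Z U k) (totPar Z V y) := by
  induction y using total_induction with
  | add x y hx hy => simp only [map_add, hx, hy]
  | smul r y hy => rw [map_smul, totPar_smul, totPar_smul, map_smul, hy]
  | lie x y hy => rw [opMul_lie, totPar_lie, totPar_lie, opMul_lie, hy]
  | gen w v =>
    rw [← baseIncl_tmul, opMul_incl, totPar_incl, totPar_incl, opMul_incl, basePar_baseMul hpar]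

theorem actConj_opMul {l : L} {actU : U →ₗ[ℂ] U}
    (hact : ∀ v, e (V.act l v) = ExteriorAlgebra.map actU (e v)) (k : KAlg Z U) :
    actConj Z V l (toEnd Z V (opMul Z e k)) = toEnd Z V (opMul Z e (kAct Z l actU k)) :=
  LinearMap.ext fun y => by
    refine (totAct_opMul hact k _).trans ?_
    rw [totAct_totAct (mul_inv_cancel l)]
    rfl

theorem parConj_opMul (hpar : ∀ v, e (V.par v) =
      CliffordAlgebra.involute (Q := (0 : QuadraticForm ℂ U)) (e v)) (k : KAlg Z U) :
    parConj Z V (toEnd Z V (opMul Z e k)) = toEnd Z V (opMul Z e (kPar Z U k)) :=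
  LinearMap.ext fun y => by
    refine (totPar_opMul hpar k _).trans ?_
    rw [totPar_totPar]
    rfl

end Conjugation

/-! ### The operators of the Koszul model of the unit -/

section KoszulAlgebra

variable {𝔥 L : Type} [LieRing 𝔥] [LieAlgebra ℂ 𝔥] [Group L] {S : Symmetry 𝔥 L}
variable {Z : EqSpace S} {V : EqModule S} {U : Type} [AddCommGroup U] [Module ℂ U]
  {e : V.V ≃ₗ[ℂ] ExteriorAlgebra ℂ U}

variable (Z U) in
/-- A function, as an element of `R ⊗ Λ(𝔥* ⊕ U)`. -/
def kFun (r : Z.R) : KAlg Z U := r ⊗ₜ 1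

variable (Z) in
/-- An element of `𝔥* ⊕ U`, as an element of `R ⊗ Λ(𝔥* ⊕ U)`. -/
def kGen (α : Module.Dual ℂ 𝔥) (θ : U) : KAlg Z U := 1 ⊗ₜ ExteriorAlgebra.ι ℂ (α, θ)

theorem kFun_mul (r r' : Z.R) : kFun Z U (r * r') = kFun Z U r * kFun Z U r' := by
  rw [kFun, kFun, kFun, Algebra.TensorProduct.tmul_mul_tmul, one_mul]

theorem kFun_comm (r : Z.R) (k : KAlg Z U) : kFun Z U r * k = k * kFun Z U r := by
  induction k using kalg_induction with
  | scalar r' =>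
    change kFun Z U r * kFun Z U r' = kFun Z U r' * kFun Z U r
    rw [← kFun_mul, ← kFun_mul, mul_comm]
  | gen α θ =>
    rw [kFun, Algebra.TensorProduct.tmul_mul_tmul, Algebra.TensorProduct.tmul_mul_tmul, one_mul,
      mul_one, one_mul, mul_one]
  | add x y hx hy => rw [mul_add, add_mul, hx, hy]
  | mul x y hx hy => rw [← mul_assoc, hx, mul_assoc, hy, mul_assoc]

theorem kGen_neg (α : Module.Dual ℂ 𝔥) : kGen Z (-α) (0 : U) = -kGen Z α 0 := by
  have h : ((-α, 0) : Module.Dual ℂ 𝔥 × U) = -(α, 0) := Prod.ext rfl neg_zero.symm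
  rw [kGen, h, map_neg, TensorProduct.tmul_neg]
  rfl

theorem kPar_kFun (r : Z.R) : kPar Z U (kFun Z U r) = kFun Z U r := by
  rw [kPar, kFun, Algebra.TensorProduct.map_tmul, map_one]
  rfl

theorem kPar_kGen (α : Module.Dual ℂ 𝔥) (θ : U) : kPar Z U (kGen Z α θ) = -kGen Z α θ := by
  rw [kPar, kGen, Algebra.TensorProduct.map_tmul, ← TensorProduct.tmul_neg, map_one]
  congr 1
  exact involute_ι_ext _

theorem kGen_comm (α : Module.Dual ℂ 𝔥) (θ : U) (k : KAlg Z U) :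
    kGen Z α θ * k = kPar Z U k * kGen Z α θ := by
  induction k using kalg_induction with
  | scalar r =>
    change _ * kFun Z U r = kPar Z U (kFun Z U r) * _
    rw [kPar_kFun, kFun_comm]
  | gen β τ =>
    change _ * kGen Z β τ = kPar Z U (kGen Z β τ) * _
    rw [kPar_kGen, kGen, kGen, neg_mul, Algebra.TensorProduct.tmul_mul_tmul,
      Algebra.TensorProduct.tmul_mul_tmul, ← TensorProduct.tmul_neg,
      eq_neg_of_add_eq_zero_left (ExteriorAlgebra.ι_add_mul_swap (R := ℂ) (α, θ) (β, τ))]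
  | add x y hx hy => rw [mul_add, map_add, add_mul, hx, hy]
  | mul x y hx hy => rw [← mul_assoc, hx, mul_assoc, hy, map_mul, mul_assoc]

theorem kPar_kPar (k : KAlg Z U) : kPar Z U (kPar Z U k) = k := by
  induction k using kalg_induction with
  | scalar r =>
    change kPar Z U (kPar Z U (kFun Z U r)) = kFun Z U r
    rw [kPar_kFun, kPar_kFun]
  | gen β τ =>
    change kPar Z U (kPar Z U (kGen Z β τ)) = kGen Z β τ
    rw [kPar_kGen, map_neg, kPar_kGen, neg_neg]
  | add x y hx hy => rw [map_add, map_add, hx, hy]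
  | mul x y hx hy => rw [map_mul, map_mul, hx, hy]

/-- The algebra `R ⊗ Λ(𝔥* ⊕ U)` is supercommutative. -/
theorem kalg_super (k : KAlg Z U) : ∃ a b : KAlg Z U, k = a + b ∧ kPar Z U a = a ∧
    kPar Z U b = -b ∧ ∀ c, a * c = c * a ∧ b * c = kPar Z U c * b := by
  induction k using kalg_induction with
  | scalar r =>
    exact ⟨kFun Z U r, 0, (add_zero _).symm, kPar_kFun r, by rw [map_zero, neg_zero], fun c =>
      ⟨kFun_comm r c, by rw [zero_mul, mul_zero]⟩⟩
  | gen α θ =>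
    exact ⟨0, kGen Z α θ, (zero_add _).symm, map_zero _, kPar_kGen α θ, fun c =>
      ⟨by rw [zero_mul, mul_zero], kGen_comm α θ c⟩⟩
  | add x y hx hy =>
    obtain ⟨a, b, h1, h2, h3, h4⟩ := hx
    obtain ⟨a', b', h1', h2', h3', h4'⟩ := hy
    refine ⟨a + a', b + b', by rw [h1, h1']; abel, by rw [map_add, h2, h2'],
      by rw [map_add, h3, h3', neg_add], fun c => ⟨?_, ?_⟩⟩
    · rw [add_mul, mul_add, (h4 c).1, (h4' c).1]
    · rw [add_mul, mul_add, (h4 c).2, (h4' c).2]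
  | mul x y hx hy =>
    obtain ⟨a, b, h1, h2, h3, h4⟩ := hx
    obtain ⟨a', b', h1', h2', h3', h4'⟩ := hy
    refine ⟨a * a' + b * b', a * b' + b * a', by rw [h1, h1']; noncomm_ring,
      by rw [map_add, map_mul, map_mul, h2, h2', h3, h3', neg_mul_neg],
      by rw [map_add, map_mul, map_mul, h2, h2', h3, h3', mul_neg, neg_mul, neg_add],
      fun c => ⟨?_, ?_⟩⟩
    · rw [add_mul, mul_add, mul_assoc a, (h4' c).1, ← mul_assoc, (h4 c).1, mul_assoc b, (h4' c).2,
        ← mul_assoc b, (h4 _).2, kPar_kPar, mul_assoc, mul_assoc]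
    · rw [add_mul, mul_add, mul_assoc a, (h4' c).2, ← mul_assoc a, (h4 _).1, mul_assoc b, (h4' c).1,
        ← mul_assoc b, (h4 c).2, mul_assoc, mul_assoc]

variable {n : ℕ}

variable (U) in
/-- A matrix of functions, as a matrix over `R ⊗ Λ(𝔥* ⊕ U)`. -/
def kMat (M : Matrix (Fin n) (Fin n) Z.R) : Matrix (Fin n) (Fin n) (KAlg Z U) :=
  fun i j => kFun Z U (M i j)

variable (Z U) in
/-- A matrix of linear forms on `𝔥`, as a matrix over `R ⊗ Λ(𝔥* ⊕ U)`. -/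
def kEta (a : Fin n → Fin n → Module.Dual ℂ 𝔥) : Matrix (Fin n) (Fin n) (KAlg Z U) :=
  fun i j => kGen Z (a i j) 0

variable (Z) in
/-- A matrix of elements of `U`, as a matrix over `R ⊗ Λ(𝔥* ⊕ U)`. -/
def kTheta (t : Fin n → Fin n → U) : Matrix (Fin n) (Fin n) (KAlg Z U) :=
  fun i j => kGen Z 0 (t i j)

theorem kFun_sum {ι : Type*} (s : Finset ι) (f : ι → Z.R) :
    kFun Z U (∑ i ∈ s, f i) = ∑ i ∈ s, kFun Z U (f i) := TensorProduct.sum_tmul s f 1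

theorem kMat_mul (M N : Matrix (Fin n) (Fin n) Z.R) :
    kMat U (M * N) = kMat U M * kMat U N := by
  refine Matrix.ext fun i j => ?_
  rw [Matrix.mul_apply, kMat, Matrix.mul_apply, kFun_sum]
  exact Finset.sum_congr rfl fun m _ => kFun_mul _ _

theorem kMat_one : kMat U (1 : Matrix (Fin n) (Fin n) Z.R) = 1 := by
  refine Matrix.ext fun i j => ?_
  rw [kMat, Matrix.one_apply, Matrix.one_apply]
  split_ifs
  · rfl
  · exact TensorProduct.zero_tmul _ _

variable (σ : U →ₗ[ℂ] Z.R)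

/-- The commutator of the differential with a matrix of functions on which `𝔥` acts by
`M ↦ M b - a M`. -/
theorem dKoszul_kMat {a b : Fin n → Fin n → Module.Dual ℂ 𝔥} {M : Matrix (Fin n) (Fin n) Z.R}
    (h : ∀ x i j, Z.der x (M i j) = ∑ m, b m j x • M i m - ∑ m, a i m x • M m j) (i j : Fin n) :
    dKoszul Z e σ * opMul Z e (kMat U M i j) - opMul Z e (kMat U M i j) * dKoszul Z e σ =
      opMul Z e ((kEta Z U a * kMat U M - kMat U M * kEta Z U b) i j) := by
  have h1 := dKoszul_opFun (e := e) (ι := Fin n ⊕ Fin n) σ (r := M i j)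
    (α := Sum.elim (fun m => b m j) (fun m => -a i m))
    (s := Sum.elim (fun m => M i m) (fun m => M m j)) (fun x => by
      rw [h, Fintype.sum_sum_type]
      simp only [Sum.elim_inl, Sum.elim_inr, LinearMap.neg_apply, neg_smul]
      rw [Finset.sum_neg_distrib, sub_eq_add_neg])
  have h2 : (kEta Z U a * kMat U M - kMat U M * kEta Z U b) i j = -∑ m : Fin n ⊕ Fin n,
      kGen Z (Sum.elim (fun m => b m j) (fun m => -a i m) m) (0 : U) *
        kFun Z U (Sum.elim (fun m => M i m) (fun m => M m j) m) := by
    rw [Fintype.sum_sum_type, Matrix.sub_apply, Matrix.mul_apply, Matrix.mul_apply]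
    simp only [Sum.elim_inl, Sum.elim_inr, kGen_neg, neg_mul, Finset.sum_neg_distrib, kMat, kEta,
      kFun_comm]
    abel
  rw [h2, map_neg, map_sum]
  refine h1.trans (congrArg Neg.neg (Finset.sum_congr rfl fun m _ => ?_))
  rw [map_mul]
  rfl

variable {lieU : 𝔥 → U →ₗ[ℂ] U}

/-- The structure equation of the matrix of the linear forms `a` with
`a [x, y] = a x a y - a y a x`. -/
theorem dKoszul_kEta (hlie : ∀ x v, e (V.lie x v) = extDer (lieU x) (e v))
    {a : Fin n → Fin n → Module.Dual ℂ 𝔥}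
    (h : ∀ x y i j, a i j ⁅x, y⁆ = ∑ m, (a i m x * a m j y - a i m y * a m j x)) (i j : Fin n) :
    dKoszul Z e σ * opMul Z e (kEta Z U a i j) + opMul Z e (kEta Z U a i j) * dKoszul Z e σ =
      opMul Z e ((kEta Z U a * kEta Z U a) i j) := by
  have h1 := dKoszul_opGen (e := e) σ hlie (α := a i j) (θ := 0) (β := fun m => a i m)
    (γ := fun m => a m j) (τ := fun _ => 0) (fun x y => by
      rw [h, ← Finset.sum_neg_distrib]
      exact Finset.sum_congr rfl fun m _ => by ring) (fun x => by simp)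
  refine h1.trans ?_
  rw [map_zero, opFun, TensorProduct.zero_tmul, map_zero, Matrix.mul_apply, map_sum]
  refine (zero_add (M := Module.End Z.R (Total Z V)) _).trans ?_
  exact Finset.sum_congr rfl fun m _ => (map_mul _ _ _).symm

/-- The structure equation of a matrix of equations. -/
theorem dKoszul_kTheta (hlie : ∀ x v, e (V.lie x v) = extDer (lieU x) (e v))
    {a b : Fin n → Fin n → Module.Dual ℂ 𝔥} {t : Fin n → Fin n → U}
    {r : Z.R} {i j : Fin n} (hr : σ (t i j) = r)
    (h : ∀ x, lieU x (t i j) = ∑ m, b m j x • t i m - ∑ m, a i m x • t m j) :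
    dKoszul Z e σ * opMul Z e (kTheta Z t i j) + opMul Z e (kTheta Z t i j) * dKoszul Z e σ =
      opMul Z e (kFun Z U r + (kEta Z U a * kTheta Z t + kTheta Z t * kEta Z U b) i j) := by
  have h1 := dKoszul_opGen (e := e) σ hlie (α := 0) (θ := t i j) (ι := Fin n ⊕ Fin n)
    (β := Sum.elim (fun m => -b m j) (fun m => a i m)) (γ := fun _ => 0)
    (τ := Sum.elim (fun m => t i m) (fun m => t m j)) (fun x y => by simp) (fun x => by
      rw [h, Fintype.sum_sum_type]
      simp only [Sum.elim_inl, Sum.elim_inr, LinearMap.neg_apply, neg_smul]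
      rw [Finset.sum_neg_distrib]
      abel)
  refine h1.trans ?_
  have h2 : (kEta Z U a * kTheta Z t + kTheta Z t * kEta Z U b) i j = ∑ m : Fin n ⊕ Fin n,
      kGen Z (Sum.elim (fun m => -b m j) (fun m => a i m) m) (0 : U) *
        kGen Z 0 (Sum.elim (fun m => t i m) (fun m => t m j) m) := by
    rw [Fintype.sum_sum_type, Matrix.add_apply, Matrix.mul_apply, Matrix.mul_apply]
    simp only [Sum.elim_inl, Sum.elim_inr, kGen_neg, kTheta, kEta, kGen_comm _ (t _ _), kPar_kGen]
    rw [add_comm]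
  rw [h2, hr, map_add, map_sum]
  refine congrArg (fun T => opFun Z e r + T) (Finset.sum_congr rfl fun m _ => ?_)
  rw [map_mul]
  rfl

end KoszulAlgebra

/-! ### Koszul models of the units -/

section UnitModel

variable {n : ℕ}

/-- A complex matrix, as a matrix over an algebra. -/
def scalarMat (R : Type) [CommRing R] [Algebra ℂ R] (x : Mat n) : Matrix (Fin n) (Fin n) R :=
  x.map (algebraMap ℂ R)

theorem scalarMat_mul (R : Type) [CommRing R] [Algebra ℂ R] (x y : Mat n) :
    scalarMat R (x * y) = scalarMat R x * scalarMat R y := Matrix.map_mul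

theorem scalarMat_sub (R : Type) [CommRing R] [Algebra ℂ R] (x y : Mat n) :
    scalarMat R (x - y) = scalarMat R x - scalarMat R y :=
  Matrix.ext fun _ _ => map_sub (algebraMap ℂ R) _ _

theorem scalarMat_smul (R : Type) [CommRing R] [Algebra ℂ R] (c : ℂ) (x : Mat n) :
    scalarMat R (c • x) = c • scalarMat R x :=
  Matrix.ext fun _ _ => by
    rw [Matrix.smul_apply, scalarMat, scalarMat, Matrix.map_apply, Matrix.map_apply,
      Matrix.smul_apply, smul_eq_mul, map_mul, Algebra.smul_def]

theorem scalarMat_map {R R' : Type} [CommRing R] [Algebra ℂ R] [CommRing R'] [Algebra ℂ R']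
    (f : R →ₐ[ℂ] R') (x : Mat n) : (scalarMat R x).map f = scalarMat R' x :=
  Matrix.ext fun _ _ => f.commutes _

theorem scalarMat_der {R : Type} [CommRing R] [Algebra ℂ R] (d : Derivation ℂ R R) (x : Mat n) :
    (scalarMat R x).map d = 0 :=
  Matrix.ext fun _ _ => d.map_algebraMap _

theorem scalarMat_mul_apply {R : Type} [CommRing R] [Algebra ℂ R] (x : Mat n)
    (M : Matrix (Fin n) (Fin n) R) (i j : Fin n) :
    (scalarMat R x * M) i j = ∑ m, x i m • M m j := by
  rw [Matrix.mul_apply]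
  exact Finset.sum_congr rfl fun m _ => (Algebra.smul_def _ _).symm

theorem mul_scalarMat_apply {R : Type} [CommRing R] [Algebra ℂ R] (x : Mat n)
    (M : Matrix (Fin n) (Fin n) R) (i j : Fin n) :
    (M * scalarMat R x) i j = ∑ m, x m j • M i m := by
  rw [Matrix.mul_apply]
  exact Finset.sum_congr rfl fun m _ => (mul_comm _ _).trans (Algebra.smul_def _ _).symm

theorem scalarMat_dg (R : Type) [CommRing R] [Algebra ℂ R] (t s : Fin n → ℂˣ)
    (M : Matrix (Fin n) (Fin n) R) (i j : Fin n) :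
    (scalarMat R (dg t) * M * scalarMat R (dg s)) i j = ((t i : ℂ) * s j) • M i j := by
  have h : ∀ u : Fin n → ℂˣ, scalarMat R (dg u) = Matrix.diagonal fun i => algebraMap ℂ R (u i) :=
    fun u => by
      rw [scalarMat, dg, Matrix.diagonal_map (map_zero _)]
  rw [h, h, Matrix.mul_diagonal, Matrix.diagonal_mul, Algebra.smul_def, map_mul]
  ring

/-- The elementary matrix `E_ij`, or zero unless `i < j`. -/
def nilUnit (i j : Fin n) : nil n :=
  ⟨if i < j then Matrix.single i j 1 else 0, fun a b h => by
    split_ifs with hij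
    · refine Matrix.single_apply_of_ne _ _ _ _ _ fun hab => ?_
      rw [hab.1, hab.2] at hij
      exact absurd hij h.not_gt
    · rfl⟩

theorem nilUnit_apply (i j a b : Fin n) :
    (nilUnit i j).1 a b = if i < j ∧ i = a ∧ j = b then 1 else 0 := by
  rw [nilUnit]
  by_cases h : i < j
  · simp [h, Matrix.single_apply]
  · simp [h]

theorem nilUnit_eq_zero {i j : Fin n} (h : j ≤ i) : nilUnit i j = 0 := by
  refine Subtype.ext ?_
  rw [nilUnit]
  simp [h.not_gt]

theorem nil_apply_eq_zero (x : nil n) {i j : Fin n} (h : j ≤ i) : x.1 i j = 0 := x.2 i j h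

theorem eqLie_nilUnit (x : nilSq n) {i j : Fin n} (h : j < i) :
    eqLie x (nilUnit j i) =
      ∑ m, x.2.1 m j • nilUnit m i - ∑ m, x.1.1 i m • nilUnit j m := by
  refine Subtype.ext (Matrix.ext fun a b => ?_)
  have e1 : (∑ m, x.2.1 m j • nilUnit m i : nil n).1 a b = x.2.1 a j * if i = b then 1 else 0 := by
    rw [AddSubmonoidClass.coe_finsetSum, Matrix.sum_apply, Finset.sum_eq_single a]
    · change x.2.1 a j * (nilUnit a i).1 a b = _
      rw [nilUnit_apply]
      rcases lt_or_ge a j with ha | ha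
      · simp [ha.trans h]
      · rw [nil_apply_eq_zero _ ha, zero_mul, zero_mul]
    · intro m _ hm
      change x.2.1 m j * (nilUnit m i).1 a b = _
      rw [nilUnit_apply, if_neg (fun h' => hm h'.2.1), mul_zero]
    · intro ha; exact absurd (Finset.mem_univ a) ha
  have e2 : (∑ m, x.1.1 i m • nilUnit j m : nil n).1 a b = x.1.1 i b * if j = a then 1 else 0 := by
    rw [AddSubmonoidClass.coe_finsetSum, Matrix.sum_apply, Finset.sum_eq_single b]
    · change x.1.1 i b * (nilUnit j b).1 a b = _
      rw [nilUnit_apply]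
      rcases lt_or_ge i b with hb | hb
      · simp [h.trans hb]
      · rw [nil_apply_eq_zero _ hb, zero_mul, zero_mul]
    · intro m _ hm
      change x.1.1 i m * (nilUnit j m).1 a b = _
      rw [nilUnit_apply, if_neg (fun h' => hm h'.2.2), mul_zero]
    · intro hb; exact absurd (Finset.mem_univ b) hb
  change (x.2.1 * (nilUnit j i).1 - (nilUnit j i).1 * x.1.1) a b =
    (∑ m, x.2.1 m j • nilUnit m i : nil n).1 a b - (∑ m, x.1.1 i m • nilUnit j m : nil n).1 a b
  rw [e1, e2, Matrix.sub_apply, Matrix.mul_apply, Matrix.mul_apply, Finset.sum_eq_single j,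
    Finset.sum_eq_single i]
  · rw [nilUnit_apply, nilUnit_apply]
    simp [h, mul_comm (x.1.1 i b)]
  · intro m _ hm; rw [nilUnit_apply, if_neg (fun h' => hm h'.2.2.symm), zero_mul]
  · intro hi; exact absurd (Finset.mem_univ i) hi
  · intro m _ hm; rw [nilUnit_apply, if_neg (fun h' => hm h'.2.1.symm), mul_zero]
  · intro hi; exact absurd (Finset.mem_univ j) hi

theorem eqAct_nilUnit (c : ℂ) (t s : Fin n → ℂˣ) (i j : Fin n) :
    eqAct c t s (nilUnit i j) = (c * t i * (s j : ℂ)⁻¹) • nilUnit i j := by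
  refine Subtype.ext (Matrix.ext fun a b => ?_)
  change c * (dg t * (nilUnit i j).1 * dg s⁻¹) a b = (c * t i * (s j : ℂ)⁻¹) * (nilUnit i j).1 a b
  rw [dg, dg, Matrix.mul_diagonal, Matrix.diagonal_mul, nilUnit_apply]
  split_ifs with h
  · rw [h.2.1, h.2.2, Pi.inv_apply, Units.val_inv_eq_inv_val]; ring
  · simp

variable {L : Type} [Group L]

/-- The data from which a unit is built: a space with matrices of functions `g`, `k = g⁻¹`, `X`, `Y`
that `𝔫 × 𝔫` and the torus (through a map `tor` from `L`) transform as the coordinates of the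
reduced space, and a representation `U` spanned by equations `θ P` for `Tr (P g)` and `ξ P`
for `Tr (P X)`, where `P` is strictly upper triangular. -/
structure UnitModel (S : Symmetry (nilSq n) L) where
  Z : EqSpace S
  U : EqModule S
  tor : L → Torus n
  Ad_eq : ∀ l x, S.Ad l⁻¹ x = torusAd (tor l)⁻¹ x
  κ_eq : ∀ l, S.κ l = (tor l).2.2.2
  g : Matrix (Fin n) (Fin n) Z.R
  k : Matrix (Fin n) (Fin n) Z.R
  X : Matrix (Fin n) (Fin n) Z.R
  Y : Matrix (Fin n) (Fin n) Z.R
  g_k : g * k = 1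
  Y_strict : ∀ i j, j ≤ i → Y i j = 0
  der_g : ∀ x, g.map (Z.der x) = g * scalarMat Z.R x.2.1 - scalarMat Z.R x.1.1 * g
  der_X : ∀ x, X.map (Z.der x) = X * scalarMat Z.R x.1.1 - scalarMat Z.R x.1.1 * X
  der_Y : ∀ x, Y.map (Z.der x) = Y * scalarMat Z.R x.2.1 - scalarMat Z.R x.2.1 * Y
  act_g : ∀ l, g.map (Z.act l) =
    scalarMat Z.R (dg (tor l).1⁻¹) * g * scalarMat Z.R (dg (tor l).2.1)
  act_X : ∀ l, X.map (Z.act l) = ((tor l).2.2.1 : ℂ)⁻¹ ^ 2 •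
    (scalarMat Z.R (dg (tor l).1⁻¹) * X * scalarMat Z.R (dg (tor l).1))
  act_Y : ∀ l, Y.map (Z.act l) = (((tor l).2.2.1 : ℂ) ^ 2 * ((tor l).2.2.2 : ℂ)⁻¹ ^ 2) •
    (scalarMat Z.R (dg (tor l).2.1⁻¹) * Y * scalarMat Z.R (dg (tor l).2.1))
  θ : nil n →ₗ[ℂ] U.V
  ξ : nil n →ₗ[ℂ] U.V
  span : ∀ u, ∃ P Q, u = θ P + ξ Q
  lie_θ : ∀ x P, U.lie x (θ P) = θ (eqLie x P)
  lie_ξ : ∀ x P, U.lie x (ξ P) = ξ (eqLieX x P)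
  act_θ : ∀ l P, U.act l (θ P) = θ (eqAct ((tor l).2.2.2 : ℂ) (tor l).2.1 (tor l).1 P)
  act_ξ : ∀ l P, U.act l (ξ P) =
    ξ (eqAct (((tor l).2.2.2 : ℂ) * ((tor l).2.2.1 : ℂ)⁻¹ ^ 2) (tor l).1 (tor l).1 P)
  s : U.V →ₗ[ℂ] Z.R
  s_θ : ∀ P, s (θ P) = (scalarMat Z.R P.1 * g).trace
  s_ξ : ∀ P, s (ξ P) = (scalarMat Z.R P.1 * X).trace

end UnitModel

section TotalEnd

variable {𝔥 L : Type} [LieRing 𝔥] [LieAlgebra ℂ 𝔥] [Group L] {S : Symmetry 𝔥 L}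

/-- The algebra of `ℂ`-linear operators on `CE_𝔥 ⊗^Δ M`. -/
def TotalEnd (Z : EqSpace S) (V : EqModule S) : Type := Module.End ℂ (Total Z V)

instance (Z : EqSpace S) (V : EqModule S) : Ring (TotalEnd Z V) :=
  inferInstanceAs (Ring (Module.End ℂ (Total Z V)))

instance (Z : EqSpace S) (V : EqModule S) : Algebra ℂ (TotalEnd Z V) :=
  inferInstanceAs (Algebra ℂ (Module.End ℂ (Total Z V)))

end TotalEnd

namespace UnitModel

variable {n : ℕ} {L : Type} [Group L] {S : Symmetry (nilSq n) L} (M : UnitModel S)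

/-- The form `P ↦ Tr (P F)` is equivariant for `𝔫 × 𝔫`, if `F` transforms as `g`. -/
theorem trace_lie {R : Type} [CommRing R] [Algebra ℂ R] (d : Derivation ℂ R R)
    {F : Matrix (Fin n) (Fin n) R} (x : nilSq n) (P : nil n)
    (h : F.map d = F * scalarMat R x.2.1 - scalarMat R x.1.1 * F) :
    (scalarMat R (eqLie x P).1 * F).trace = d (scalarMat R P.1 * F).trace := by
  rw [derMat_trace, derMat_mul, scalarMat_der, zero_mul, zero_add, h]
  change (scalarMat R (x.2.1 * P.1 - P.1 * x.1.1) * F).trace = _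
  rw [scalarMat_sub, scalarMat_mul, scalarMat_mul, sub_mul, mul_sub, Matrix.trace_sub,
    Matrix.trace_sub, mul_assoc, Matrix.trace_mul_comm, mul_assoc, mul_assoc]

theorem trace_act {R : Type} [CommRing R] [Algebra ℂ R] (f : R →ₐ[ℂ] R)
    {F : Matrix (Fin n) (Fin n) R} (P : nil n) {c d m : ℂ} (t s : Fin n → ℂˣ) (hc : c = m * d)
    (h : F.map f = d • (scalarMat R (dg s⁻¹) * F * scalarMat R (dg t))) :
    (scalarMat R (eqAct c t s P).1 * F).trace = m • f (scalarMat R P.1 * F).trace := by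
  have h1 : f (scalarMat R P.1 * F).trace = (scalarMat R P.1 * F.map f).trace := by
    have h2 : scalarMat R P.1 * F.map f = (scalarMat R P.1 * F).map f := by
      rw [Matrix.map_mul, scalarMat_map]
    rw [h2]
    exact map_sum f _ _
  rw [h1, h]
  change (scalarMat R (c • (dg t * P.1 * dg s⁻¹)) * F).trace = _
  rw [scalarMat_smul, scalarMat_mul, scalarMat_mul, smul_mul_assoc, Matrix.trace_smul,
    mul_smul_comm, Matrix.trace_smul, smul_smul, ← hc, mul_assoc, mul_assoc,
    Matrix.trace_mul_comm, ← mul_assoc, mul_assoc (scalarMat R P.1),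
    mul_assoc, mul_assoc]

/-- The equations are equivariant for `𝔫 × 𝔫`. -/
theorem s_lie (x : nilSq n) (u : M.U.V) : M.s (M.U.lie x u) = M.Z.der x (M.s u) := by
  obtain ⟨P, Q, rfl⟩ := M.span u
  rw [map_add, map_add, map_add, map_add, M.lie_θ, M.lie_ξ, M.s_θ, M.s_θ, M.s_ξ, M.s_ξ,
    trace_lie (M.Z.der x) x P (M.der_g x), eqLieX,
    trace_lie (M.Z.der x) (x.1, x.1) Q (M.der_X x)]

/-- The equations are equivariant, of weight `κ`, for `L`. -/
theorem s_act (l : L) (u : M.U.V) : M.s (M.U.act l u) = (S.κ l : ℂ) • M.Z.act l (M.s u) := by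
  obtain ⟨P, Q, rfl⟩ := M.span u
  rw [map_add, map_add, map_add, map_add, smul_add, M.act_θ, M.act_ξ, M.s_θ, M.s_θ, M.s_ξ, M.s_ξ,
    trace_act (M.Z.act l) P _ _ (mul_one _).symm ((M.act_g l).trans (one_smul ℂ _).symm),
    trace_act (M.Z.act l) Q _ _ rfl (M.act_X l), M.κ_eq]

/-- The representation `Λ U` on which the unit lives. -/
abbrev V : EqModule S := M.U.exterior

/-- The identification of the representation of the unit with `Λ U`. -/
abbrev e : M.V.V ≃ₗ[ℂ] ExteriorAlgebra ℂ M.U.V := LinearEquiv.refl ℂ _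

/-- The operators on `CE_𝔥 ⊗^Δ M` defined by `R ⊗ Λ(𝔥* ⊕ U)`. -/
def F : KAlg M.Z M.U.V →ₐ[ℂ] TotalEnd M.Z M.V :=
  (toEnd M.Z M.V).comp (opMul M.Z M.e)

/-- Conjugation with the parity operator. -/
def γ : TotalEnd M.Z M.V →ₐ[ℂ] TotalEnd M.Z M.V := parConj M.Z M.V

/-- Conjugation with the action of `l`. -/
def α (l : L) : TotalEnd M.Z M.V →ₐ[ℂ] TotalEnd M.Z M.V := actConj M.Z M.V l

/-- The Koszul differential, with the Chevalley-Eilenberg differential. -/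
def D : Module.End M.Z.R (Total M.Z M.V) := dKoszul M.Z M.e M.s

/-- The Koszul differential, as a `ℂ`-linear operator. -/
def δ : TotalEnd M.Z M.V := toEnd M.Z M.V M.D

/-- The entries of `x₁`, as linear forms on `𝔫 × 𝔫 ∋ (x₁, x₂)`. -/
def a₁ (i j : Fin n) : Module.Dual ℂ (nilSq n) :=
  LinearMap.proj j ∘ₗ LinearMap.proj i ∘ₗ (nil n).subtype ∘ₗ LinearMap.fst ℂ _ _

/-- The entries of `x₂`, as linear forms on `𝔫 × 𝔫 ∋ (x₁, x₂)`. -/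
def a₂ (i j : Fin n) : Module.Dual ℂ (nilSq n) :=
  LinearMap.proj j ∘ₗ LinearMap.proj i ∘ₗ (nil n).subtype ∘ₗ LinearMap.snd ℂ _ _

theorem a₁_apply (i j : Fin n) (x : nilSq n) : a₁ i j x = x.1.1 i j := rfl
theorem a₂_apply (i j : Fin n) (x : nilSq n) : a₂ i j x = x.2.1 i j := rfl

theorem a₁_lie (x y : nilSq n) (i j : Fin n) :
    a₁ i j ⁅x, y⁆ = ∑ m, (a₁ i m x * a₁ m j y - a₁ i m y * a₁ m j x) := by
  change (x.1.1 * y.1.1 - y.1.1 * x.1.1) i j = _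
  rw [Matrix.sub_apply, Matrix.mul_apply, Matrix.mul_apply, Finset.sum_sub_distrib]
  rfl

theorem a₂_lie (x y : nilSq n) (i j : Fin n) :
    a₂ i j ⁅x, y⁆ = ∑ m, (a₂ i m x * a₂ m j y - a₂ i m y * a₂ m j x) := by
  change (x.2.1 * y.2.1 - y.2.1 * x.2.1) i j = _
  rw [Matrix.sub_apply, Matrix.mul_apply, Matrix.mul_apply, Finset.sum_sub_distrib]
  rfl

theorem D_D : M.D * M.D = 0 := dKoszul_sq (fun _ _ => rfl) M.s_lie

theorem covariant_D : Covariant (fun l => (S.κ l : ℂ)) (-1) M.D :=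
  covariant_dKoszul (actU := fun l => M.U.act l) (fun _ _ => rfl) (fun _ => rfl) M.s_act

theorem γ_F (k : KAlg M.Z M.U.V) :
    M.γ (M.F k) = M.F (kPar M.Z M.U.V k) :=
  parConj_opMul (fun _ => rfl) k

theorem α_F (l : L) (k : KAlg M.Z M.U.V) :
    M.α l (M.F k) = M.F (kAct M.Z l (M.U.act l) k) :=
  actConj_opMul (fun _ => rfl) k

theorem γ_γ (T : TotalEnd M.Z M.V) : M.γ (M.γ T) = T := parConj_parConj T

theorem α_γ (l : L) (T : TotalEnd M.Z M.V) : M.α l (M.γ T) = M.γ (M.α l T) :=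
  actConj_parConj l T

theorem γ_δ : M.γ M.δ = -M.δ :=
  (M.covariant_D.parConj : M.γ M.δ = (-1 : ℂ) • M.δ).trans (neg_one_smul ℂ M.δ)

theorem α_δ (l : L) : M.α l M.δ = (S.κ l : ℂ)⁻¹ • M.δ :=
  M.covariant_D.actConj (Units.ne_zero _)

theorem δ_δ : M.δ * M.δ = 0 := congrArg (toEnd M.Z M.V) M.D_D

theorem F_even (r : M.Z.R) :
    M.γ (M.F (kFun M.Z M.U.V r)) = M.F (kFun M.Z M.U.V r) := by
  rw [γ_F, kPar_kFun]

theorem F_odd (α : Module.Dual ℂ (nilSq n)) (θ : M.U.V) :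
    M.γ (M.F (kGen M.Z α θ)) = -M.F (kGen M.Z α θ) := by
  rw [γ_F, kPar_kGen, map_neg]

theorem D_mat {a b : Fin n → Fin n → Module.Dual ℂ (nilSq n)} {x₁ x₂ : nilSq n → Mat n}
    (ha : ∀ x i j, a i j x = x₁ x i j) (hb : ∀ x i j, b i j x = x₂ x i j)
    {N : Matrix (Fin n) (Fin n) M.Z.R}
    (h : ∀ x, N.map (M.Z.der x) = N * scalarMat M.Z.R (x₂ x) - scalarMat M.Z.R (x₁ x) * N)
    (i j : Fin n) :
    M.δ * M.F (kMat M.U.V N i j) - M.F (kMat M.U.V N i j) * M.δ =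
      M.F ((kEta M.Z M.U.V a * kMat M.U.V N - kMat M.U.V N * kEta M.Z M.U.V b) i j) := by
  refine congrArg (toEnd M.Z M.V) (dKoszul_kMat (e := M.e) M.s (fun x i j => ?_) i j)
  have h1 := congrFun (congrFun (h x) i) j
  rw [Matrix.sub_apply, mul_scalarMat_apply, scalarMat_mul_apply] at h1
  simp only [ha, hb]
  exact h1

theorem der_k (x : nilSq n) : M.k.map (M.Z.der x) =
    M.k * scalarMat M.Z.R x.1.1 - scalarMat M.Z.R x.2.1 * M.k := by
  have hk : M.k * M.g = 1 := mul_eq_one_comm.mp M.g_k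
  rw [derMat_inv _ _ _ M.g_k, M.der_g]
  have : -(M.k * (M.g * scalarMat M.Z.R x.2.1 - scalarMat M.Z.R x.1.1 * M.g) * M.k) =
      M.k * scalarMat M.Z.R x.1.1 * (M.g * M.k) - (M.k * M.g) * scalarMat M.Z.R x.2.1 * M.k := by
    noncomm_ring
  rw [this, M.g_k, hk, mul_one, one_mul]

theorem act_k (l : L) : M.k.map (M.Z.act l) =
    scalarMat M.Z.R (dg (M.tor l).2.1⁻¹) * M.k * scalarMat M.Z.R (dg (M.tor l).1) := by
  have hk : M.k * M.g = 1 := mul_eq_one_comm.mp M.g_k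
  have h1 : M.k.map (M.Z.act l) * M.g.map (M.Z.act l) = 1 := by
    rw [← Matrix.map_mul, hk, Matrix.map_one _ (map_zero _) (map_one _)]
  have e : ∀ t : Fin n → ℂˣ, scalarMat M.Z.R (dg t) * scalarMat M.Z.R (dg t⁻¹) = 1 := fun t => by
    rw [← scalarMat_mul, dg_mul_inv]
    exact Matrix.map_one _ (map_zero _) (map_one _)
  have e' : ∀ t : Fin n → ℂˣ, scalarMat M.Z.R (dg t⁻¹) * scalarMat M.Z.R (dg t) = 1 :=
    fun t => mul_eq_one_comm.mp (e t)
  have h2 : M.g.map (M.Z.act l) * (scalarMat M.Z.R (dg (M.tor l).2.1⁻¹) * M.k *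
      scalarMat M.Z.R (dg (M.tor l).1)) = 1 := by
    rw [M.act_g]
    have : ∀ a g b b' k a' : Matrix (Fin n) (Fin n) M.Z.R, b * b' = 1 → g * k = 1 → a * a' = 1 →
        a * g * b * (b' * k * a') = 1 := by
      intro a g b b' k a' h1 h2 h3
      have : a * g * b * (b' * k * a') = a * (g * (b * b') * k) * a' := by noncomm_ring
      rw [this, h1, mul_one, h2, mul_one, h3]
    exact this _ _ _ _ _ _ (e _) M.g_k (e' _)
  exact left_inv_eq_right_inv h1 h2

/-- The equation for the entry `g_ij`. -/
def equ (τ : nil n →ₗ[ℂ] M.U.V) (i j : Fin n) : M.U.V := τ (nilUnit j i)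

theorem lie_equ {τ : nil n →ₗ[ℂ] M.U.V} {x y : nilSq n}
    (hτ : ∀ P, M.U.lie x (τ P) = τ (eqLie y P)) {i j : Fin n} (hij : j < i) :
    M.U.lie x (M.equ τ i j) =
      ∑ m, y.2.1 m j • M.equ τ i m - ∑ m, y.1.1 i m • M.equ τ m j := by
  rw [equ, hτ, eqLie_nilUnit _ hij, map_sub, map_sum, map_sum]
  simp only [map_smul]
  rfl

theorem s_equ {τ : nil n →ₗ[ℂ] M.U.V} {N : Matrix (Fin n) (Fin n) M.Z.R}
    (hs : ∀ P, M.s (τ P) = (scalarMat M.Z.R P.1 * N).trace) {i j : Fin n} (hij : j < i) :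
    M.s (M.equ τ i j) = N i j := by
  rw [equ, hs, Matrix.trace, Finset.sum_eq_single j]
  · rw [Matrix.diag_apply, scalarMat_mul_apply, Finset.sum_eq_single i]
    · rw [nilUnit_apply, if_pos ⟨hij, rfl, rfl⟩, one_smul]
    · intro m _ hm
      rw [nilUnit_apply, if_neg (fun h => hm h.2.2.symm), zero_smul]
    · intro h; exact absurd (Finset.mem_univ i) h
  · intro m _ hm
    rw [Matrix.diag_apply, scalarMat_mul_apply]
    refine Finset.sum_eq_zero fun m' _ => ?_
    rw [nilUnit_apply, if_neg (fun h => hm h.2.1.symm), zero_smul]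
  · intro h; exact absurd (Finset.mem_univ j) h

theorem D_equ {τ : nil n →ₗ[ℂ] M.U.V} {N : Matrix (Fin n) (Fin n) M.Z.R}
    {a b : Fin n → Fin n → Module.Dual ℂ (nilSq n)} {y : nilSq n → nilSq n}
    (ha : ∀ x i j, a i j x = (y x).1.1 i j) (hb : ∀ x i j, b i j x = (y x).2.1 i j)
    (hs : ∀ P, M.s (τ P) = (scalarMat M.Z.R P.1 * N).trace)
    (hτ : ∀ x P, M.U.lie x (τ P) = τ (eqLie (y x) P)) (i j : Fin n) (hij : j < i) :
    M.δ * M.F (kTheta M.Z (M.equ τ) i j) +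
      M.F (kTheta M.Z (M.equ τ) i j) * M.δ =
      M.F (kMat M.U.V N i j +
        (kEta M.Z M.U.V a * kTheta M.Z (M.equ τ) + kTheta M.Z (M.equ τ) * kEta M.Z M.U.V b) i j) := by
  refine congrArg (toEnd M.Z M.V) (dKoszul_kTheta (e := M.e) (lieU := fun x => M.U.lie x)
    (a := a) (b := b) (t := M.equ τ) M.s (fun _ _ => rfl) (M.s_equ hs hij) (fun x => ?_))
  simp only [ha, hb]
  exact M.lie_equ (hτ x) hij

theorem F_super (k : KAlg M.Z M.U.V) : ∃ T₀ T₁ : TotalEnd M.Z M.V,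
    M.F k = T₀ + T₁ ∧ M.γ T₀ = T₀ ∧ M.γ T₁ = -T₁ ∧
    ∀ b : KAlg M.Z M.U.V, T₀ * M.F b = M.F b * T₀ ∧ T₁ * M.F b = M.γ (M.F b) * T₁ := by
  obtain ⟨k₀, k₁, h1, h2, h3, h4⟩ := kalg_super (Z := M.Z) (U := M.U.V) k
  refine ⟨M.F k₀, M.F k₁, (congrArg M.F h1).trans (map_add M.F _ _),
    (M.γ_F k₀).trans (congrArg M.F h2),
    (M.γ_F k₁).trans ((congrArg M.F h3).trans (map_neg M.F k₁)), fun b => ⟨?_, ?_⟩⟩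
  · exact (map_mul M.F _ _).symm.trans ((congrArg M.F (h4 b).1).trans (map_mul M.F _ _))
  · rw [γ_F]
    exact (map_mul M.F _ _).symm.trans ((congrArg M.F (h4 b).2).trans (map_mul M.F _ _))

theorem kGen_zero : kGen M.Z (0 : Module.Dual ℂ (nilSq n)) (0 : M.U.V) = 0 := by
  have h : ((0, 0) : Module.Dual ℂ (nilSq n) × M.U.V) = 0 := rfl
  rw [kGen, h, map_zero, TensorProduct.tmul_zero]

theorem kTheta_eq_zero (τ : nil n →ₗ[ℂ] M.U.V) {i j : Fin n} (h : i ≤ j) :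
    kTheta M.Z (M.equ τ) i j = 0 := by
  rw [kTheta, equ, nilUnit_eq_zero h, map_zero, kGen_zero]

theorem kMat_Y_strict {i j : Fin n} (h : j ≤ i) : kMat M.U.V M.Y i j = 0 := by
  rw [kMat, M.Y_strict i j h]
  exact TensorProduct.zero_tmul _ _

theorem kEta_eq_zero {a : Fin n → Fin n → Module.Dual ℂ (nilSq n)} {i j : Fin n}
    (h : a i j = 0) : kEta M.Z M.U.V a i j = 0 := by
  rw [kEta, h, kGen_zero]

/-- The operators of the unit, together with the potential `Tr (X g Y g⁻¹)`. -/
def opData : OpData (KAlg M.Z M.U.V) (TotalEnd M.Z M.V) n where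
  F := M.F
  γ := M.γ
  D := M.δ
  g := kMat M.U.V M.g
  k := kMat M.U.V M.k
  X := kMat M.U.V M.X
  Y := kMat M.U.V M.Y
  Θ := kTheta M.Z (M.equ M.θ)
  Ξ := kTheta M.Z (M.equ M.ξ)
  η₁ := kEta M.Z M.U.V a₁
  η₂ := kEta M.Z M.U.V a₂
  γ_γ := M.γ_γ
  γ_D := M.γ_δ
  D_D := M.δ_δ
  super := M.F_super
  g_even _ _ := M.F_even _
  k_even _ _ := M.F_even _
  X_even _ _ := M.F_even _
  Y_even _ _ := M.F_even _
  Θ_odd _ _ := M.F_odd _ _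
  Ξ_odd _ _ := M.F_odd _ _
  η₁_odd _ _ := M.F_odd _ _
  η₂_odd _ _ := M.F_odd _ _
  g_k := by rw [← kMat_mul, M.g_k, kMat_one]
  D_g := M.D_mat (fun _ _ _ => rfl) (fun _ _ _ => rfl) M.der_g
  D_k := M.D_mat (fun _ _ _ => rfl) (fun _ _ _ => rfl) M.der_k
  D_X := M.D_mat (fun _ _ _ => rfl) (fun _ _ _ => rfl) M.der_X
  D_Y := M.D_mat (fun _ _ _ => rfl) (fun _ _ _ => rfl) M.der_Y
  D_η₁ i j := congrArg (toEnd M.Z M.V) (dKoszul_kEta (e := M.e) (lieU := fun x => M.U.lie x) M.s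
    (fun _ _ => rfl) a₁_lie i j)
  D_η₂ i j := congrArg (toEnd M.Z M.V) (dKoszul_kEta (e := M.e) (lieU := fun x => M.U.lie x) M.s
    (fun _ _ => rfl) a₂_lie i j)
  D_Θ := M.D_equ (y := id) (fun _ _ _ => rfl) (fun _ _ _ => rfl) M.s_θ M.lie_θ
  Θ_eq_zero _ _ h := M.kTheta_eq_zero _ h
  D_Ξ := M.D_equ (y := fun x => (x.1, x.1)) (fun _ _ _ => rfl) (fun _ _ _ => rfl) M.s_ξ M.lie_ξ
  Ξ_eq_zero _ _ h := M.kTheta_eq_zero _ h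
  Y_strict _ _ h := M.kMat_Y_strict h
  η₁_strict i j h := M.kEta_eq_zero (LinearMap.ext fun x => x.1.2 i j h)
  η₂_strict i j h := M.kEta_eq_zero (LinearMap.ext fun x => x.2.2 i j h)

theorem kAct_kFun (l : L) (r : M.Z.R) :
    kAct M.Z l (M.U.act l) (kFun M.Z M.U.V r) = kFun M.Z M.U.V (M.Z.act l r) := by
  rw [kAct, kFun, Algebra.TensorProduct.map_tmul, map_one]
  rfl

theorem kAct_kGen (l : L) (α : Module.Dual ℂ (nilSq n)) (u : M.U.V) :
    kAct M.Z l (M.U.act l) (kGen M.Z α u) =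
      kGen M.Z ((S.κ l : ℂ)⁻¹ • LinearMap.dualMap (S.Ad l⁻¹ : nilSq n →ₗ[ℂ] nilSq n) α)
        (M.U.act l u) := by
  rw [kAct, kGen, Algebra.TensorProduct.map_tmul, map_one, ExteriorAlgebra.map_apply_ι]
  rfl

theorem kFun_smul (c : ℂ) (r : M.Z.R) :
    kFun M.Z M.U.V (c • r) = c • kFun M.Z M.U.V r := rfl

theorem kGen_smul_left (c : ℂ) (α : Module.Dual ℂ (nilSq n)) :
    kGen M.Z (c • α) (0 : M.U.V) = c • kGen M.Z α 0 := by
  have h : ((c • α, 0) : Module.Dual ℂ (nilSq n) × M.U.V) = c • (α, 0) :=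
    Prod.ext rfl (smul_zero c).symm
  rw [kGen, h, map_smul, TensorProduct.tmul_smul]
  rfl

theorem kGen_smul_right (c : ℂ) (u : M.U.V) :
    kGen M.Z (0 : Module.Dual ℂ (nilSq n)) (c • u) = c • kGen M.Z 0 u := by
  have h : ((0, c • u) : Module.Dual ℂ (nilSq n) × M.U.V) = c • (0, u) :=
    Prod.ext (smul_zero c).symm rfl
  rw [kGen, h, map_smul, TensorProduct.tmul_smul]
  rfl

theorem act_kFun {l : L} {r : M.Z.R} {c : ℂ} (h : M.Z.act l r = c • r) :
    M.α l (M.F (kFun M.Z M.U.V r)) = c • M.F (kFun M.Z M.U.V r) := by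
  rw [α_F, kAct_kFun, h, kFun_smul, map_smul]

theorem act_kEqu {l : L} {u : M.U.V} {c : ℂ} (h : M.U.act l u = c • u) :
    M.α l (M.F (kGen M.Z 0 u)) = c • M.F (kGen M.Z 0 u) := by
  rw [α_F, kAct_kGen, h, map_zero, smul_zero]
  exact (congrArg M.F (M.kGen_smul_right c u)).trans (map_smul M.F c _)

theorem act_kForm {l : L} {α : Module.Dual ℂ (nilSq n)} {c : ℂ}
    (h : ∀ x, α (torusAd (M.tor l)⁻¹ x) = c * α x) :
    M.α l (M.F (kGen M.Z α 0)) =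
      ((S.κ l : ℂ)⁻¹ * c) • M.F (kGen M.Z α 0) := by
  have h1 : (S.κ l : ℂ)⁻¹ • LinearMap.dualMap (S.Ad l⁻¹ : nilSq n →ₗ[ℂ] nilSq n) α =
      ((S.κ l : ℂ)⁻¹ * c) • α := LinearMap.ext fun x => by
    change (S.κ l : ℂ)⁻¹ * α (S.Ad l⁻¹ x) = (S.κ l : ℂ)⁻¹ * c * α x
    rw [M.Ad_eq, h, mul_assoc]
  rw [α_F, kAct_kGen, h1, map_zero]
  exact (congrArg M.F (M.kGen_smul_left _ α)).trans (map_smul M.F _ _)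

/-- An element of `L` multiplies the operators of the unit by the weights given by its image in the
torus. -/
theorem isWeight (l : L) : M.opData.IsWeight (M.α l) (S.κ l)
    (((M.tor l).2.2.1 : ℂ)⁻¹ ^ 2) (fun i => ((M.tor l).1 i : ℂ)⁻¹)
    (fun i => ((M.tor l).2.1 i : ℂ)⁻¹) where
  α_γ := M.α_γ l
  α_D := M.α_δ l
  g i j := M.act_kFun (by
    have h := congrFun (congrFun (M.act_g l) i) j
    rw [scalarMat_dg] at h
    refine h.trans (congrArg (· • M.g i j) ?_)
    rw [Pi.inv_apply, Units.val_inv_eq_inv_val, inv_inv, one_mul])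
  k i j := M.act_kFun (by
    have h := congrFun (congrFun (M.act_k l) i) j
    rw [scalarMat_dg] at h
    refine h.trans (congrArg (· • M.k i j) ?_)
    rw [Pi.inv_apply, Units.val_inv_eq_inv_val, inv_inv, one_mul])
  X i j := M.act_kFun (by
    have h := congrFun (congrFun (M.act_X l) i) j
    rw [Matrix.smul_apply, scalarMat_dg, smul_smul] at h
    refine h.trans (congrArg (· • M.X i j) ?_)
    rw [Pi.inv_apply, Units.val_inv_eq_inv_val, inv_inv, mul_assoc])
  Y i j := M.act_kFun (by
    have h := congrFun (congrFun (M.act_Y l) i) j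
    rw [Matrix.smul_apply, scalarMat_dg, smul_smul] at h
    refine h.trans (congrArg (· • M.Y i j) ?_)
    rw [Pi.inv_apply, Units.val_inv_eq_inv_val, inv_inv, M.κ_eq]
    simp only [inv_pow, inv_inv]
    ring)
  Θ i j := M.act_kEqu (by
    rw [equ, M.act_θ, eqAct_nilUnit, map_smul, M.κ_eq, inv_inv]
    congr 1
    ring)
  Ξ i j := M.act_kEqu (by
    rw [equ, M.act_ξ, eqAct_nilUnit, map_smul, M.κ_eq, inv_inv]
    congr 1
    ring)
  η₁ i j := (M.act_kForm (c := ((M.tor l).1 i : ℂ)⁻¹ * (M.tor l).1 j) (fun x => by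
    change (dg (M.tor l).1⁻¹ * x.1.1 * dg (M.tor l).1⁻¹⁻¹) i j = _
    rw [inv_inv, dg, dg, Matrix.mul_diagonal, Matrix.diagonal_mul, Pi.inv_apply,
      Units.val_inv_eq_inv_val, a₁_apply]
    ring)).trans (congrArg (· • M.F (kGen M.Z (a₁ i j) 0)) (by
      rw [inv_inv, mul_assoc]))
  η₂ i j := (M.act_kForm (c := ((M.tor l).2.1 i : ℂ)⁻¹ * (M.tor l).2.1 j) (fun x => by
    change (dg (M.tor l).2.1⁻¹ * x.2.1 * dg (M.tor l).2.1⁻¹⁻¹) i j = _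
    rw [inv_inv, dg, dg, Matrix.mul_diagonal, Matrix.diagonal_mul, Pi.inv_apply,
      Units.val_inv_eq_inv_val, a₂_apply]
    ring)).trans (congrArg (· • M.F (kGen M.Z (a₂ i j) 0)) (by
      rw [inv_inv, mul_assoc]))

end UnitModel

/-! ### Matrix factorizations from Koszul operators -/

section Construction

variable {𝔥 L : Type} [LieRing 𝔥] [LieAlgebra ℂ 𝔥] [Group L] {S : Symmetry 𝔥 L}
variable {Z : EqSpace S} {V : EqModule S} {U : Type} [AddCommGroup U] [Module ℂ U]
  {e : V.V ≃ₗ[ℂ] ExteriorAlgebra ℂ U}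

/-- The projection of `R ⊗ Λ(𝔥* ⊕ U)` to `R ⊗ Λ U`. -/
def kProj : KAlg Z U →ₐ[ℂ] KAlg Z U :=
  Algebra.TensorProduct.map (AlgHom.id ℂ Z.R) (ExteriorAlgebra.map
    (LinearMap.prodMap (0 : Module.Dual ℂ 𝔥 →ₗ[ℂ] Module.Dual ℂ 𝔥) (LinearMap.id : U →ₗ[ℂ] U)))

theorem kProj_scalar (r : Z.R) : (kProj (r ⊗ₜ 1) : KAlg Z U) = r ⊗ₜ 1 := by
  rw [kProj, Algebra.TensorProduct.map_tmul, map_one]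
  rfl

theorem kProj_gen (α : Module.Dual ℂ 𝔥) (θ : U) :
    (kProj (1 ⊗ₜ ExteriorAlgebra.ι ℂ (α, θ)) : KAlg Z U) = 1 ⊗ₜ ExteriorAlgebra.ι ℂ (0, θ) := by
  rw [kProj, Algebra.TensorProduct.map_tmul, ExteriorAlgebra.map_apply_ι, map_one]
  rfl

theorem lower_tmul {p q : ℕ} (h : q < p) {w : ExteriorAlgebra ℂ 𝔥} (hw : w ∈ ⋀[ℂ]^q 𝔥) (v : V.V) :
    (1 ⊗ₜ (w ⊗ₜ v) : Base Z V) ∈ V.lower Z p :=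
  Submodule.subset_span ⟨q, h, w, hw, v, rfl⟩

theorem map_lower {T : Module.End Z.R (Base Z V)} {p p' : ℕ}
    (h : ∀ q < p, ∀ w ∈ ⋀[ℂ]^q 𝔥, ∀ v, T (1 ⊗ₜ (w ⊗ₜ v)) ∈ V.lower Z p') {y : Base Z V}
    (hy : y ∈ V.lower Z p) : T y ∈ V.lower Z p' := by
  have : V.lower Z p ≤ (V.lower Z p').comap T := Submodule.span_le.2 (by
    rintro _ ⟨q, hq, w, hw, v, rfl⟩
    exact h q hq w hw v)
  exact this hy

theorem lower_zero {y : Base Z V} (hy : y ∈ V.lower Z 0) : y = 0 := by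
  have : V.lower Z 0 ≤ ⊥ := Submodule.span_le.2 (by
    rintro _ ⟨q, hq, _⟩
    exact absurd hq (Nat.not_lt_zero q))
  exact this hy

theorem involute_mem_exteriorPower {M : Type} [AddCommGroup M] [Module ℂ M] (q : ℕ)
    {w : ExteriorAlgebra ℂ M} (hw : w ∈ ⋀[ℂ]^q M) :
    CliffordAlgebra.involute (Q := (0 : QuadraticForm ℂ M)) w ∈ ⋀[ℂ]^q M := by
  have h : (⋀[ℂ]^q M) ≤ (⋀[ℂ]^q M).comap
      (CliffordAlgebra.involute (Q := (0 : QuadraticForm ℂ M))).toLinearMap := by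
    clear hw
    induction q with
    | zero =>
      rintro x hx
      change x ∈ LinearMap.range (ExteriorAlgebra.ι ℂ) ^ 0 at hx
      rw [pow_zero] at hx
      obtain ⟨c, rfl⟩ := Submodule.mem_one.1 hx
      change CliffordAlgebra.involute (Q := (0 : QuadraticForm ℂ M))
        (algebraMap ℂ (CliffordAlgebra (0 : QuadraticForm ℂ M)) c) ∈
          LinearMap.range (ExteriorAlgebra.ι ℂ) ^ 0
      rw [pow_zero]
      exact Submodule.mem_one.2 ⟨c, (AlgHom.commutes
        (CliffordAlgebra.involute (Q := (0 : QuadraticForm ℂ M))) c).symm⟩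
    | succ q ih =>
      change LinearMap.range (ExteriorAlgebra.ι ℂ) ^ (q + 1) ≤ _
      rw [pow_succ', Submodule.mul_le]
      rintro _ ⟨m, rfl⟩ w hw
      change CliffordAlgebra.involute (Q := (0 : QuadraticForm ℂ M)) (ExteriorAlgebra.ι ℂ m * w) ∈
        LinearMap.range (ExteriorAlgebra.ι ℂ) ^ (q + 1)
      rw [involute_ι_mul, pow_succ']
      exact Submodule.neg_mem _ (Submodule.mul_mem_mul ⟨m, rfl⟩ (ih hw))
  exact h hw

theorem contractLeft_mem_exteriorPower {M : Type} [AddCommGroup M] [Module ℂ M]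
    (α : Module.Dual ℂ M) (q : ℕ) {w : ExteriorAlgebra ℂ M} (hw : w ∈ ⋀[ℂ]^(q + 1) M) :
    CliffordAlgebra.contractLeft (Q := (0 : QuadraticForm ℂ M)) α w ∈ ⋀[ℂ]^q M := by
  have h : (⋀[ℂ]^(q + 1) M) ≤ (⋀[ℂ]^q M).comap
      (CliffordAlgebra.contractLeft (Q := (0 : QuadraticForm ℂ M)) α) := by
    clear hw
    induction q with
    | zero =>
      change LinearMap.range (ExteriorAlgebra.ι ℂ) ^ (0 + 1) ≤ _
      rw [zero_add, pow_one]
      rintro _ ⟨m, rfl⟩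
      change CliffordAlgebra.contractLeft (Q := (0 : QuadraticForm ℂ M)) α
        (ExteriorAlgebra.ι ℂ m) ∈ LinearMap.range (ExteriorAlgebra.ι ℂ) ^ 0
      have := contract_ext_ι_mul α m 1
      rw [mul_one, contract_ext_one, mul_zero, sub_zero] at this
      rw [this, pow_zero]
      exact Submodule.mem_one.2 ⟨α m, Algebra.algebraMap_eq_smul_one _⟩
    | succ q ih =>
      change LinearMap.range (ExteriorAlgebra.ι ℂ) ^ (q + 1 + 1) ≤ _
      rw [pow_succ', Submodule.mul_le]
      rintro _ ⟨m, rfl⟩ w hw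
      change CliffordAlgebra.contractLeft (Q := (0 : QuadraticForm ℂ M)) α
        (ExteriorAlgebra.ι ℂ m * w) ∈ LinearMap.range (ExteriorAlgebra.ι ℂ) ^ (q + 1)
      rw [contract_ext_ι_mul]
      refine Submodule.sub_mem _ (Submodule.smul_mem _ _ hw) ?_
      rw [pow_succ']
      exact Submodule.mul_mem_mul ⟨m, rfl⟩ (ih hw)
  exact h hw

theorem contractLeft_exteriorPower_zero {M : Type} [AddCommGroup M] [Module ℂ M]
    (α : Module.Dual ℂ M) {w : ExteriorAlgebra ℂ M} (hw : w ∈ ⋀[ℂ]^0 M) :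
    CliffordAlgebra.contractLeft (Q := (0 : QuadraticForm ℂ M)) α w = 0 := by
  change w ∈ LinearMap.range (ExteriorAlgebra.ι ℂ) ^ 0 at hw
  rw [pow_zero] at hw
  obtain ⟨c, rfl⟩ := Submodule.mem_one.1 hw
  rw [Algebra.algebraMap_eq_smul_one, map_smul, contract_ext_one, smul_zero]

theorem contract_lower (α : Module.Dual ℂ 𝔥) {p q : ℕ} (h : q < p + 1) {w : ExteriorAlgebra ℂ 𝔥}
    (hw : w ∈ ⋀[ℂ]^q 𝔥) (v : V.V) : (1 ⊗ₜ (CliffordAlgebra.contractLeft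
      (Q := (0 : QuadraticForm ℂ 𝔥)) α w ⊗ₜ v) : Base Z V) ∈ V.lower Z p := by
  cases q with
  | zero =>
    rw [contractLeft_exteriorPower_zero α hw, TensorProduct.zero_tmul, TensorProduct.tmul_zero]
    exact Submodule.zero_mem _
  | succ q =>
    exact lower_tmul (Nat.succ_lt_succ_iff.1 h) (contractLeft_mem_exteriorPower α q hw) v

/-- The operators preserve the filtration by the degree in `Λ 𝔥`, and those of `𝔥*` lower it. -/
theorem baseMul_lower (k : KAlg Z U) (p : ℕ) :
    (∀ y ∈ V.lower Z p, baseMul Z e k y ∈ V.lower Z p) ∧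
    (∀ y ∈ V.lower Z p, baseMul Z e (kProj k) y ∈ V.lower Z p) ∧
    ∀ y ∈ V.lower Z (p + 1), baseMul Z e k y - baseMul Z e (kProj k) y ∈ V.lower Z p := by
  induction k using kalg_induction generalizing p with
  | scalar r =>
    refine ⟨fun y hy => ?_, fun y hy => ?_, fun y hy => ?_⟩
    · rw [baseMul_scalar]; exact Submodule.smul_mem _ _ hy
    · rw [kProj_scalar, baseMul_scalar]; exact Submodule.smul_mem _ _ hy
    · rw [kProj_scalar, sub_self]; exact Submodule.zero_mem _
  | gen α θ =>
    have h0 : ∀ (α : Module.Dual ℂ 𝔥), ∀ y ∈ V.lower Z p,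
        baseMul Z e (1 ⊗ₜ ExteriorAlgebra.ι ℂ (α, θ)) y ∈ V.lower Z p := by
      refine fun α y hy => map_lower (fun q hq w hw v => ?_) hy
      rw [baseMul_gen]
      exact Submodule.add_mem _ (contract_lower α (hq.trans p.lt_succ_self) hw v)
        (lower_tmul hq (involute_mem_exteriorPower q hw) _)
    refine ⟨h0 α, fun y hy => ?_, fun y hy => ?_⟩
    · rw [kProj_gen]; exact h0 0 y hy
    · rw [← LinearMap.sub_apply]
      refine map_lower (fun q hq w hw v => ?_) hy
      rw [kProj_gen, LinearMap.sub_apply, baseMul_gen, baseMul_gen, add_sub_add_right_eq_sub]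
      exact Submodule.sub_mem _ (contract_lower α hq hw v) (contract_lower 0 hq hw v)
  | add a b ha hb =>
    refine ⟨fun y hy => ?_, fun y hy => ?_, fun y hy => ?_⟩
    · rw [map_add]; exact Submodule.add_mem _ ((ha p).1 y hy) ((hb p).1 y hy)
    · rw [map_add, map_add]; exact Submodule.add_mem _ ((ha p).2.1 y hy) ((hb p).2.1 y hy)
    · have h := Submodule.add_mem _ ((ha p).2.2 y hy) ((hb p).2.2 y hy)
      rw [map_add, map_add, map_add, LinearMap.add_apply, LinearMap.add_apply]
      convert h using 1
      abel
  | mul a b ha hb =>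
    refine ⟨fun y hy => ?_, fun y hy => ?_, fun y hy => ?_⟩
    · rw [map_mul]; exact (ha p).1 _ ((hb p).1 y hy)
    · rw [map_mul, map_mul]; exact (ha p).2.1 _ ((hb p).2.1 y hy)
    · have h := Submodule.add_mem _ ((ha p).2.2 _ ((hb (p + 1)).1 y hy))
        ((ha p).2.1 _ ((hb p).2.2 y hy))
      rw [map_mul, map_mul, map_mul, Module.End.mul_apply, Module.End.mul_apply]
      convert h using 1
      rw [map_sub]
      abel

theorem insert_tmul (w : ExteriorAlgebra ℂ 𝔥) (r : Z.R) (v : V.V) :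
    V.insert Z w (r ⊗ₜ v) = r ⊗ₜ (w ⊗ₜ v) := rfl

theorem insert_smul (w : ExteriorAlgebra ℂ 𝔥) (r : Z.R) (y : Z.R ⊗[ℂ] V.V) :
    V.insert Z w (r • y) = r • V.insert Z w y := lTensor_smul' _ _ _

/-- An element of `U` acts on `M`. -/
theorem insert_gen (θ : U) (w : ExteriorAlgebra ℂ 𝔥) (y : Z.R ⊗[ℂ] V.V) :
    baseMul Z e (1 ⊗ₜ ExteriorAlgebra.ι ℂ (0, θ)) (V.insert Z w y) =
      V.insert Z (CliffordAlgebra.involute (Q := (0 : QuadraticForm ℂ 𝔥)) w)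
        (LinearMap.baseChange Z.R (e.symm.toLinearMap ∘ₗ
          LinearMap.mulLeft ℂ (ExteriorAlgebra.ι ℂ θ) ∘ₗ e.toLinearMap) y) := by
  induction y with
  | zero => simp only [map_zero]
  | add a b ha hb => simp only [map_add, ha, hb]
  | tmul r v =>
    rw [insert_tmul, baseMul_gen, map_zero, LinearMap.zero_apply, TensorProduct.zero_tmul,
      TensorProduct.tmul_zero, zero_add]
    rfl

/-- The operators of `Λ U` on `Λ 𝔥 ⊗ M` come from operators on `M`, up to a sign for odd
operators. -/
theorem exists_insert (k : KAlg Z U) : ∃ D₀ D₁ : Module.End Z.R (Z.R ⊗[ℂ] V.V), ∀ w y,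
    baseMul Z e (kProj k) (V.insert Z w y) = V.insert Z w (D₀ y) +
      V.insert Z (CliffordAlgebra.involute (Q := (0 : QuadraticForm ℂ 𝔥)) w) (D₁ y) ∧
    baseMul Z e (kProj (kPar Z U k)) (V.insert Z w y) = V.insert Z w (D₀ y) -
      V.insert Z (CliffordAlgebra.involute (Q := (0 : QuadraticForm ℂ 𝔥)) w) (D₁ y) := by
  induction k using kalg_induction with
  | scalar r =>
    refine ⟨LinearMap.lsmul Z.R _ r, 0, fun w y => ⟨?_, ?_⟩⟩
    · rw [kProj_scalar, baseMul_scalar, LinearMap.zero_apply, map_zero, add_zero,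
        LinearMap.lsmul_apply, insert_smul]
    · change baseMul Z e (kProj (kPar Z U (kFun Z U r))) _ = _
      rw [kPar_kFun, kFun, kProj_scalar, baseMul_scalar, LinearMap.zero_apply, map_zero, sub_zero,
        LinearMap.lsmul_apply, insert_smul]
  | gen α θ =>
    refine ⟨0, LinearMap.baseChange Z.R (e.symm.toLinearMap ∘ₗ
          LinearMap.mulLeft ℂ (ExteriorAlgebra.ι ℂ θ) ∘ₗ e.toLinearMap), fun w y => ⟨?_, ?_⟩⟩
    · rw [kProj_gen, insert_gen, LinearMap.zero_apply, map_zero, zero_add]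
    · change baseMul Z e (kProj (kPar Z U (kGen Z α θ))) _ = _
      rw [kPar_kGen, map_neg, kGen, kProj_gen, map_neg, LinearMap.zero_apply, map_zero, zero_sub,
        ← insert_gen]
      rfl
  | add a b ha hb =>
    obtain ⟨D₀, D₁, h⟩ := ha
    obtain ⟨D₀', D₁', h'⟩ := hb
    refine ⟨D₀ + D₀', D₁ + D₁', fun w y => ⟨?_, ?_⟩⟩
    · rw [map_add, map_add, LinearMap.add_apply, (h w y).1, (h' w y).1, LinearMap.add_apply,
        LinearMap.add_apply, map_add, map_add]
      abel
    · rw [map_add, map_add, map_add, LinearMap.add_apply, (h w y).2, (h' w y).2,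
        LinearMap.add_apply, LinearMap.add_apply, map_add, map_add]
      abel
  | mul a b ha hb =>
    obtain ⟨D₀, D₁, h⟩ := ha
    obtain ⟨D₀', D₁', h'⟩ := hb
    refine ⟨D₀ * D₀' + D₁ * D₁', D₀ * D₁' + D₁ * D₀', fun w y => ⟨?_, ?_⟩⟩
    · rw [map_mul, map_mul, Module.End.mul_apply, (h' w y).1, map_add, (h _ _).1, (h _ _).1,
        involute_involute_ext, LinearMap.add_apply, LinearMap.add_apply, map_add, map_add]
      simp only [Module.End.mul_apply]
      abel
    · rw [map_mul, map_mul, map_mul, Module.End.mul_apply, (h' w y).2, map_sub, (h _ _).2,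
        (h _ _).2, involute_involute_ext, LinearMap.add_apply, LinearMap.add_apply, map_add,
        map_add]
      simp only [Module.End.mul_apply]
      abel

variable (Z V) in
/-- The projection `CE_𝔥 ⊗^Δ M → M` defined by the augmentations of `U(𝔥)` and `Λ 𝔥`. -/
theorem exists_augmentation : ∃ a : Total Z V →ₗ[ℂ] Z.R ⊗[ℂ] V.V,
    ∀ y, a (baseIncl Z V (V.insert Z 1 y)) = y := by
  let _ : LieRing (UniversalEnvelopingAlgebra ℂ 𝔥) := LieRing.ofAssociativeRing
  let _ : LieRing ℂ := LieRing.ofAssociativeRing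
  obtain ⟨ε, hε⟩ : ∃ ε : UniversalEnvelopingAlgebra ℂ 𝔥 →ₗ[ℂ] ℂ, ε 1 = 1 :=
    ⟨(UniversalEnvelopingAlgebra.lift ℂ (0 : 𝔥 →ₗ⁅ℂ⁆ ℂ)).toLinearMap,
      map_one (UniversalEnvelopingAlgebra.lift ℂ (0 : 𝔥 →ₗ⁅ℂ⁆ ℂ))⟩
  obtain ⟨ε', hε'⟩ : ∃ ε' : ExteriorAlgebra ℂ 𝔥 →ₗ[ℂ] ℂ, ε' 1 = 1 :=
    ⟨(ExteriorAlgebra.algebraMapInv (R := ℂ) (M := 𝔥)).toLinearMap,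
      map_one (ExteriorAlgebra.algebraMapInv (R := ℂ) (M := 𝔥))⟩
  refine ⟨LinearMap.lTensor Z.R ((TensorProduct.lid ℂ V.V).toLinearMap ∘ₗ
    LinearMap.rTensor V.V (LinearMap.mul' ℂ ℂ ∘ₗ TensorProduct.map ε ε')), fun y => ?_⟩
  induction y with
  | zero => simp only [map_zero]
  | add a b ha hb => simp only [map_add, ha, hb]
  | tmul r v =>
    rw [insert_tmul, baseIncl_tmul, LinearMap.lTensor_tmul, LinearMap.comp_apply,
      LinearMap.rTensor_tmul, LinearMap.comp_apply, TensorProduct.map_tmul, hε, hε',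
      LinearMap.mul'_apply, mul_one]
    exact congrArg (fun z => r ⊗ₜ z) (one_smul ℂ v)

/-- The subspace `1 ⊗ Λ 𝔥 ⊗ M` is split off by the augmentation of `U(𝔥)`. -/
theorem baseIncl_injective : Function.Injective (baseIncl Z V) := by
  let _ : LieRing (UniversalEnvelopingAlgebra ℂ 𝔥) := LieRing.ofAssociativeRing
  let _ : LieRing ℂ := LieRing.ofAssociativeRing
  obtain ⟨ε, hε⟩ : ∃ ε : UniversalEnvelopingAlgebra ℂ 𝔥 →ₗ[ℂ] ℂ, ε 1 = 1 :=
    ⟨(UniversalEnvelopingAlgebra.lift ℂ (0 : 𝔥 →ₗ⁅ℂ⁆ ℂ)).toLinearMap,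
      map_one (UniversalEnvelopingAlgebra.lift ℂ (0 : 𝔥 →ₗ⁅ℂ⁆ ℂ))⟩
  refine Function.LeftInverse.injective (g := LinearMap.lTensor Z.R (LinearMap.rTensor V.V
    ((TensorProduct.lid ℂ (ExteriorAlgebra ℂ 𝔥)).toLinearMap ∘ₗ
      LinearMap.rTensor (ExteriorAlgebra ℂ 𝔥) ε))) (fun y => ?_)
  induction y using base_tmul_induction with
  | add a b ha hb => rw [map_add, map_add, ha, hb]
  | tmul r w v =>
    rw [baseIncl_tmul, LinearMap.lTensor_tmul, LinearMap.rTensor_tmul, LinearMap.comp_apply,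
      LinearMap.rTensor_tmul, hε]
    exact congrArg (fun z => r ⊗ₜ (z ⊗ₜ v)) (one_smul ℂ w)

/-- The Koszul differential of `Λ 𝔥 ⊗ M` comes from an operator on `M`, up to the sign of `Λ 𝔥`. -/
theorem exists_insert_baseKoszul (s : U →ₗ[ℂ] Z.R) : ∃ D : Module.End Z.R (Z.R ⊗[ℂ] V.V),
    ∀ w y, baseKoszul e s (V.insert Z w y) =
      V.insert Z (CliffordAlgebra.involute (Q := (0 : QuadraticForm ℂ 𝔥)) w) (D y) := by
  refine ⟨LinearMap.liftBaseChange Z.R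
    (LinearMap.lTensor Z.R e.symm.toLinearMap ∘ₗ contract s ∘ₗ e.toLinearMap), fun w y => ?_⟩
  induction y with
  | zero => simp only [map_zero]
  | add a b ha hb => simp only [map_add, ha, hb]
  | tmul r v =>
    rw [insert_tmul, baseKoszul_tmul, LinearMap.liftBaseChange_tmul, insert_smul]
    refine congrArg (r • ·) ?_
    change _ = V.insert Z _ (LinearMap.lTensor Z.R e.symm.toLinearMap (contract s (e v)))
    generalize contract s (e v) = c
    induction c with
    | zero => simp only [map_zero]
    | add a b ha hb => simp only [map_add, ha, hb]
    | tmul r a => rfl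

theorem Covariant.par_neg {χ : L → ℂ} {T : Module.End Z.R (Total Z V)} (h : Covariant χ (-1) T)
    (y : Total Z V) : T (totPar Z V y) = -totPar Z V (T y) := by
  rw [h.par]
  exact neg_one_smul ℂ (totPar Z V (T y))

theorem lTensor_baseKoszul (s : U →ₗ[ℂ] Z.R) (w : ExteriorAlgebra ℂ 𝔥) (v : V.V) :
    LinearMap.lTensor Z.R (LinearMap.lTensor (ExteriorAlgebra ℂ 𝔥) e.toLinearMap)
      (baseKoszul e s (1 ⊗ₜ (w ⊗ₜ v))) =
    LinearMap.lTensor Z.R (TensorProduct.mk ℂ (ExteriorAlgebra ℂ 𝔥) (ExteriorAlgebra ℂ U)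
      (CliffordAlgebra.involute (Q := (0 : QuadraticForm ℂ 𝔥)) w)) (contract s (e v)) := by
  rw [baseKoszul_tmul, one_smul]
  generalize contract s (e v) = c
  induction c with
  | zero => simp only [map_zero]
  | add a b ha hb => simp only [map_add, ha, hb]
  | tmul r m =>
    rw [baseInsert_tmul, LinearMap.lTensor_tmul, LinearMap.lTensor_tmul, LinearMap.lTensor_tmul]
    exact congrArg (fun z => r ⊗ₜ (_ ⊗ₜ z)) (e.apply_symm_apply m)

/-- The matrix factorization of the Koszul model with a given correction term. -/
theorem exists_koszul {lieU : 𝔥 → U →ₗ[ℂ] U} {actU : L → U →ₗ[ℂ] U} {s : U →ₗ[ℂ] Z.R}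
    {A : KAlg Z U} (hlie : ∀ x v, e (V.lie x v) = extDer (lieU x) (e v))
    (hact : ∀ l v, e (V.act l v) = ExteriorAlgebra.map (actU l) (e v))
    (hparV : ∀ v, e (V.par v) = CliffordAlgebra.involute (Q := (0 : QuadraticForm ℂ U)) (e v))
    (hspan : A ∈ Submodule.span Z.R
      {y | ∃ (a : ExteriorAlgebra ℂ (Module.Dual ℂ 𝔥 × U)) (θ : U),
        y = 1 ⊗ₜ (a * ExteriorAlgebra.ι ℂ (0, θ))})
    (hpar : opMul Z e (kPar Z U A) = opMul Z e (-A))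
    (hcov : Covariant (fun l => (S.κ l : ℂ)) (-1) (dKoszul Z e s + opMul Z e A))
    (hsq : ∀ y, (dKoszul Z e s + opMul Z e A : Module.End Z.R (Total Z V))
      ((dKoszul Z e s + opMul Z e A : Module.End Z.R (Total Z V)) y) = Z.W • y) :
    ∃ E : MF Z, IsKoszul Z lieU actU s A E := by
  have hpar' : baseMul Z e (kPar Z U A) = baseMul Z e (-A) := LinearMap.ext fun y => by
    apply baseIncl_injective
    rw [← opMul_incl, ← opMul_incl, hpar]
  -- the odd part of the correction term defines the same operator
  obtain ⟨A', hA', hAA'⟩ : ∃ A', kPar Z U A' = -A' ∧ baseMul Z e A' = baseMul Z e A := by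
    refine ⟨(2⁻¹ : ℂ) • (A - kPar Z U A), ?_, ?_⟩
    · rw [map_smul, map_sub, kPar_kPar, ← smul_neg, neg_sub]
    · rw [map_smul, map_sub, hpar', ← map_sub, sub_neg_eq_add, ← two_smul ℂ A, map_smul, smul_smul,
        inv_mul_cancel₀ two_ne_zero, one_smul]
  obtain ⟨D₀, hD₀⟩ := exists_insert_baseKoszul (V := V) (Z := Z) (e := e) s
  obtain ⟨B₀, B₁, hB⟩ := exists_insert (V := V) (e := e) A'
  have hB' : ∀ w y, baseMul Z e (kProj A') (V.insert Z w y) = V.insert Z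
      (CliffordAlgebra.involute (Q := (0 : QuadraticForm ℂ 𝔥)) w) (B₁ y) := by
    intro w y
    have h1 := (hB w y).2
    rw [hA', map_neg, map_neg, LinearMap.neg_apply, (hB w y).1, neg_add, sub_eq_add_neg,
      add_left_inj, neg_eq_iff_add_eq_zero, ← two_smul ℂ, smul_eq_zero] at h1
    rw [(hB w y).1, h1.resolve_left two_ne_zero, zero_add]
  -- the operator on `Λ 𝔥 ⊗ M`
  have hT : ∀ w y, (baseKoszul e s + baseMul Z e A) (V.insert Z w y) =
      V.insert Z (CliffordAlgebra.involute (Q := (0 : QuadraticForm ℂ 𝔥)) w)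
        ((D₀ + B₁) y) + baseMul Z e (A' - kProj A') (V.insert Z w y) := by
    intro w y
    rw [LinearMap.add_apply, hD₀, ← hAA', map_sub, LinearMap.sub_apply, hB', LinearMap.add_apply,
      map_add]
    abel
  have hT' : ∀ w (v : V.V), V.insert Z
      (CliffordAlgebra.involute (Q := (0 : QuadraticForm ℂ 𝔥)) w) ((D₀ + B₁) (1 ⊗ₜ v)) +
        baseMul Z e (A' - kProj A') (1 ⊗ₜ (w ⊗ₜ v)) =
      (baseKoszul e s + baseMul Z e A) (1 ⊗ₜ (w ⊗ₜ v)) := fun w v => (hT w (1 ⊗ₜ v)).symm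
  have hdel : ∀ p, ∀ w ∈ ⋀[ℂ]^p 𝔥, ∀ v, baseMul Z e (A' - kProj A')
      (1 ⊗ₜ (w ⊗ₜ v) : Base Z V) ∈ V.lower Z p := by
    intro p w hw v
    have := (baseMul_lower (V := V) (e := e) A' p).2.2 _ (lower_tmul p.lt_succ_self hw v)
    rwa [map_sub]
  have hdel0 : ∀ y, baseMul Z e (A' - kProj A') (V.insert Z 1 y) = 0 := by
    intro y
    induction y using free_induction with
    | one v => exact lower_zero (hdel 0 1 (by
        change (1 : ExteriorAlgebra ℂ 𝔥) ∈ LinearMap.range (ExteriorAlgebra.ι ℂ) ^ 0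
        rw [pow_zero]
        exact Submodule.mem_one.2 ⟨1, map_one _⟩) v)
    | add a b ha hb => rw [map_add, map_add, ha, hb, add_zero]
    | smul r y hy => rw [insert_smul, map_smul, hy, smul_zero]
  have hDtot : dKoszul Z e s + opMul Z e A = totCE Z V dCE +
      op (baseKoszul e s + baseMul Z e A) := by
    rw [map_add, ← add_assoc]
    rfl
  rw [hDtot] at hcov hsq
  have hgen : ∀ w v, (totCE Z V dCE + op (baseKoszul e s + baseMul Z e A))
      (1 ⊗ₜ ((1 ⊗ₜ w) ⊗ₜ v)) = 1 ⊗ₜ (dCEOne w ⊗ₜ v) + V.incl Z (V.insert Z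
      (CliffordAlgebra.involute (Q := (0 : QuadraticForm ℂ 𝔥)) w) ((D₀ + B₁) (1 ⊗ₜ v)) +
        baseMul Z e (A' - kProj A') (1 ⊗ₜ (w ⊗ₜ v))) := by
    intro w v
    rw [LinearMap.add_apply, totCE_tmul, dCE_tmul, ceMul_one, ← baseIncl_tmul, op_incl,
      ← baseIncl_eq, hT']
  obtain ⟨a, ha⟩ := exists_augmentation Z V
  -- in degree zero, the total differential is `D`
  have hzero : ∀ y, (totCE Z V dCE + op (baseKoszul e s + baseMul Z e A))
      (baseIncl Z V (V.insert Z 1 y)) =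
        baseIncl Z V (V.insert Z 1 ((D₀ + B₁) y)) := by
    intro y
    have h1 : totCE Z V dCE (baseIncl Z V (V.insert Z 1 y)) = 0 := by
      induction y using free_induction with
      | one v =>
        rw [insert_tmul, baseIncl_tmul, totCE_tmul, dCE_one, TensorProduct.zero_tmul,
          TensorProduct.tmul_zero]
      | add a b ha hb => rw [map_add, map_add, map_add, ha, hb, add_zero]
      | smul r y hy => rw [insert_smul, map_smul, map_smul, hy, smul_zero]
    rw [LinearMap.add_apply, h1, zero_add, op_incl, hT, hdel0, add_zero, involute_one_ext]
  have hfin : ∀ w (v : V.V), LinearMap.lTensor Z.R (LinearMap.lTensor (ExteriorAlgebra ℂ 𝔥)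
      e.toLinearMap) (V.insert Z (CliffordAlgebra.involute (Q := (0 : QuadraticForm ℂ 𝔥)) w)
        ((D₀ + B₁) (1 ⊗ₜ v)) + baseMul Z e (A' - kProj A') (1 ⊗ₜ (w ⊗ₜ v))) =
      LinearMap.lTensor Z.R (TensorProduct.mk ℂ (ExteriorAlgebra ℂ 𝔥) (ExteriorAlgebra ℂ U)
        (CliffordAlgebra.involute (Q := (0 : QuadraticForm ℂ 𝔥)) w)) (contract s (e v)) +
      koszulMul A (w ⊗ₜ e v) := by
    intro w v
    rw [hT', LinearMap.add_apply, map_add, lTensor_baseMul, lTensor_baseKoszul]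
  refine ⟨{ V := V
            D := D₀ + B₁
            D_sq := fun y => ?_
            del := baseMul Z e (A' - kProj A')
            del_lower := hdel
            Dtot := totCE Z V dCE + op (baseKoszul e s + baseMul Z e A)
            Dtot_one := hgen
            Dtot_lie := hcov.lie
            Dtot_par := fun y => hcov.par_neg y
            Dtot_act := hcov.act
            Dtot_sq := hsq }, hspan, e, hlie, hact, hparV, hfin⟩
  rw [← ha ((D₀ + B₁) ((D₀ + B₁) y)), ← hzero, ← hzero, hsq, ← map_smul, ← insert_smul, ha]

end Construction

/-! ### Matrix factorizations of Koszul models -/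

section Invariant

variable {𝔥 L : Type} [LieRing 𝔥] [LieAlgebra ℂ 𝔥] [Group L] {S : Symmetry 𝔥 L}
variable {Z : EqSpace S} {V : EqModule S} {U : Type} [AddCommGroup U] [Module ℂ U]
  {e : V.V ≃ₗ[ℂ] ExteriorAlgebra ℂ U}

/-- An invariant function acts by multiplication. -/
theorem opMul_kFun {r : Z.R} (h : ∀ x, Z.der x r = 0) (y : Total Z V) :
    opMul Z e (kFun Z U r) y = r • y := by
  induction y using total_induction with
  | add x y hx hy => rw [map_add, hx, hy, smul_add]
  | smul c y hy => rw [map_smul, hy, smul_comm]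
  | lie x y hy => rw [opMul_lie, hy, totLie_smul, h, zero_smul, zero_add]
  | gen w v =>
    rw [← baseIncl_tmul, opMul_incl]
    change baseIncl Z V (baseMul Z e (r ⊗ₜ 1) (1 ⊗ₜ (w ⊗ₜ v))) = _
    rw [baseMul_scalar, map_smul]

end Invariant

namespace UnitModel

variable {n : ℕ} {L : Type} [Group L] {S : Symmetry (nilSq n) L} (M : UnitModel S)

theorem koszul_sq {A : KAlg M.Z M.U.V} (hsq : M.F A * M.F A = 0)
    (hD : M.δ * M.F A + M.F A * M.δ = M.F (kFun M.Z M.U.V M.Z.W)) :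
    (M.δ + M.F A) * (M.δ + M.F A) = M.F (kFun M.Z M.U.V M.Z.W) := by
  rw [← hD, add_mul, mul_add, mul_add, M.δ_δ, hsq]
  abel

theorem koszul_odd {A : KAlg M.Z M.U.V} (hγ : M.γ (M.F A) = -M.F A) :
    M.γ (M.δ + M.F A) = (-1 : ℂ) • (M.δ + M.F A) := by
  rw [map_add, γ_δ, hγ, neg_smul, one_smul, neg_add]

theorem koszul_act {A : KAlg M.Z M.U.V} {l : L}
    (hα : M.α l (M.F A) = (S.κ l : ℂ)⁻¹ • M.F A) :
    M.α l (M.δ + M.F A) = (S.κ l : ℂ)⁻¹ • (M.δ + M.F A) := by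
  rw [map_add, α_δ, hα, smul_add]

theorem koszul_covariant {A : KAlg M.Z M.U.V} (hγ : M.γ (M.F A) = -M.F A)
    (hα : ∀ l, M.α l (M.F A) = (S.κ l : ℂ)⁻¹ • M.F A) :
    Covariant (fun l => (S.κ l : ℂ)) (-1) (dKoszul M.Z M.e M.s + opMul M.Z M.e A) := by
  refine covariant_of_conj (fun x y => ?_) (M.koszul_odd hγ) (by norm_num)
    (fun l => Units.ne_zero _) (fun l => M.koszul_act (hα l))
  rw [LinearMap.add_apply, LinearMap.add_apply, dKoszul_lie, opMul_lie,
    map_add]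

/-- An odd element of weight `κ⁻¹` whose commutator with the Koszul differential is the potential is
the correction term of a matrix factorization. -/
theorem exists_koszul {A : KAlg M.Z M.U.V}
    (hspan : A ∈ Submodule.span M.Z.R
      {y | ∃ (a : ExteriorAlgebra ℂ (Module.Dual ℂ (nilSq n) × M.U.V)) (u : M.U.V),
        y = 1 ⊗ₜ (a * ExteriorAlgebra.ι ℂ (0, u))})
    (hγ : M.γ (M.F A) = -M.F A) (hα : ∀ l, M.α l (M.F A) = (S.κ l : ℂ)⁻¹ • M.F A)
    (hsq : M.F A * M.F A = 0)
    (hD : M.δ * M.F A + M.F A * M.δ = M.F (kFun M.Z M.U.V M.Z.W)) :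
    ∃ E : MF M.Z, IsKoszul M.Z (fun x => M.U.lie x) (fun l => M.U.act l) M.s A E := by
  have hpar : M.F (kPar M.Z M.U.V A) = M.F (-A) :=
    (M.γ_F A).symm.trans (hγ.trans (map_neg M.F A).symm)
  have hsq' := M.koszul_sq hsq hD
  refine EquivMF.exists_koszul (e := M.e) (fun _ _ => rfl) (fun _ _ => rfl) (fun _ => rfl) hspan
    (toEnd_injective hpar) (M.koszul_covariant hγ hα) fun y => ?_
  exact (LinearMap.congr_fun hsq' y).trans (opMul_kFun M.Z.der_W y)

end UnitModel

/-! ### The representations of the equations -/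

section Equations

variable {n : ℕ} {L : Type} [Group L]

theorem nil_eq_sum (P : nil n) : P = ∑ i, ∑ j, P.1 i j • nilUnit i j := by
  refine Subtype.ext (Matrix.ext fun a b => ?_)
  rw [AddSubmonoidClass.coe_finsetSum, Matrix.sum_apply, Finset.sum_eq_single a,
    AddSubmonoidClass.coe_finsetSum, Matrix.sum_apply, Finset.sum_eq_single b]
  · change _ = P.1 a b * (nilUnit a b).1 a b
    rw [nilUnit_apply]
    rcases lt_or_ge a b with h | h
    · simp [h]
    · rw [nil_apply_eq_zero _ h, zero_mul]
  · intro m _ hm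
    change P.1 a m * (nilUnit a m).1 a b = _
    rw [nilUnit_apply, if_neg (fun h => hm h.2.2), mul_zero]
  · intro h; exact absurd (Finset.mem_univ b) h
  · intro m _ hm
    rw [AddSubmonoidClass.coe_finsetSum, Matrix.sum_apply]
    refine Finset.sum_eq_zero fun m' _ => ?_
    change P.1 m m' * (nilUnit m m').1 a b = _
    rw [nilUnit_apply, if_neg (fun h => hm h.2.1), mul_zero]
  · intro h; exact absurd (Finset.mem_univ a) h

theorem eqAct_mul (c d : ℂ) (t s t' s' : Fin n → ℂˣ) (P : nil n) :
    eqAct (c * d) (t * t') (s * s') P = eqAct c t s (eqAct d t' s' P) := by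
  refine Subtype.ext ?_
  change (c * d) • (dg (t * t') * P.1 * dg (s * s')⁻¹) =
    c • (dg t * (d • (dg t' * P.1 * dg s'⁻¹)) * dg s⁻¹)
  rw [mul_inv_rev, dg_mul, dg_mul, mul_smul_comm, smul_mul_assoc, smul_smul]
  congr 1
  noncomm_ring

theorem eqAct_eqLie (c : ℂ) (t s : Fin n → ℂˣ) (x : nilSq n) (P : nil n) :
    eqAct c t s (eqLie x P) = eqLie (nilConj s x.1, nilConj t x.2) (eqAct c t s P) := by
  refine Subtype.ext ?_
  change c • (dg t * (x.2.1 * P.1 - P.1 * x.1.1) * dg s⁻¹) =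
    (dg t * x.2.1 * dg t⁻¹) * (c • (dg t * P.1 * dg s⁻¹)) -
      (c • (dg t * P.1 * dg s⁻¹)) * (dg s * x.1.1 * dg s⁻¹)
  have e1 : (dg t * x.2.1 * dg t⁻¹) * (dg t * P.1 * dg s⁻¹) =
      dg t * x.2.1 * (dg t⁻¹ * dg t) * P.1 * dg s⁻¹ := by noncomm_ring
  have e2 : (dg t * P.1 * dg s⁻¹) * (dg s * x.1.1 * dg s⁻¹) =
      dg t * P.1 * (dg s⁻¹ * dg s) * x.1.1 * dg s⁻¹ := by noncomm_ring
  rw [mul_smul_comm, smul_mul_assoc, ← smul_sub, e1, e2, dg_inv_mul, dg_inv_mul]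
  congr 1
  noncomm_ring

theorem eqLie_lie (x y : nilSq n) (P : nil n) :
    eqLie ⁅x, y⁆ P = eqLie x (eqLie y P) - eqLie y (eqLie x P) := by
  refine Subtype.ext ?_
  change (x.2.1 * y.2.1 - y.2.1 * x.2.1) * P.1 - P.1 * (x.1.1 * y.1.1 - y.1.1 * x.1.1) =
    (x.2.1 * (y.2.1 * P.1 - P.1 * y.1.1) - (y.2.1 * P.1 - P.1 * y.1.1) * x.1.1) -
    (y.2.1 * (x.2.1 * P.1 - P.1 * x.1.1) - (x.2.1 * P.1 - P.1 * x.1.1) * y.1.1)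
  noncomm_ring

/-- The even representation on the space `𝔫` of equations on which `x` acts by
`P ↦ y₂ P - P y₁`, where `(y₁, y₂) = φ x`, and `l` acts by `P ↦ c u P v⁻¹`. -/
def eqModule (S : Symmetry (nilSq n) L) (φ : nilSq n →ₗ⁅ℂ⁆ nilSq n)
    (u v : L →* (Fin n → ℂˣ)) (c : L → ℂ) (c_one : c 1 = 1) (c_mul : ∀ l m, c (l * m) = c l * c m)
    (hφ : ∀ l x, φ (S.Ad l x) = (nilConj (v l) (φ x).1, nilConj (u l) (φ x).2))
    (hc : ∀ i j, (fun l => c l * u l i * (v l j : ℂ)⁻¹) ∈ S.coord) : EqModule S where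
  V := nil n
  lie := LinearMap.mk₂ ℂ (fun x P => eqLie (φ x) P)
    (by
      intro x y P
      refine Subtype.ext ?_
      rw [map_add]
      change ((φ x).2.1 + (φ y).2.1) * P.1 - P.1 * ((φ x).1.1 + (φ y).1.1) =
        ((φ x).2.1 * P.1 - P.1 * (φ x).1.1) + ((φ y).2.1 * P.1 - P.1 * (φ y).1.1)
      noncomm_ring)
    (by
      intro d x P
      refine Subtype.ext ?_
      rw [map_smul]
      change (d • (φ x).2.1) * P.1 - P.1 * (d • (φ x).1.1) =
        d • ((φ x).2.1 * P.1 - P.1 * (φ x).1.1)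
      rw [mul_smul_comm, smul_mul_assoc, smul_sub])
    (fun x P Q => map_add _ _ _) (fun d x P => map_smul (eqLie (φ x)) d P)
  lie_lie x y P := by
    change eqLie (φ ⁅x, y⁆) P = eqLie (φ x) (eqLie (φ y) P) - eqLie (φ y) (eqLie (φ x) P)
    rw [LieHom.map_lie, eqLie_lie]
  act :=
    { toFun := fun l => eqAct (c l) (u l) (v l)
      map_one' := by
        refine LinearMap.ext fun P => Subtype.ext ?_
        change c 1 • (dg (u 1) * P.1 * dg (v 1)⁻¹) = P.1
        rw [map_one, map_one, inv_one, dg_one, c_one, one_smul, one_mul, mul_one]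
      map_mul' := by
        intro l m
        refine LinearMap.ext fun P => ?_
        rw [map_mul, map_mul, c_mul]
        exact eqAct_mul _ _ _ _ _ _ _ }
  act_lie l x P := by
    change eqAct (c l) (u l) (v l) (eqLie (φ x) P) =
      eqLie (φ (S.Ad l x)) (eqAct (c l) (u l) (v l) P)
    rw [eqAct_eqLie, hφ]
  act_coord f P := by
    have h : (fun l => f (eqAct (c l) (u l) (v l) P)) = ∑ i, ∑ j, (P.1 i j * f (nilUnit i j)) •
        fun l => c l * u l i * (v l j : ℂ)⁻¹ := by
      funext l
      conv_lhs => rw [nil_eq_sum P]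
      simp only [map_sum, map_smul, eqAct_nilUnit, Finset.sum_apply, Pi.smul_apply, smul_eq_mul]
      exact Finset.sum_congr rfl fun i _ => Finset.sum_congr rfl fun j _ => by ring
    change (fun l => f (eqAct (c l) (u l) (v l) P)) ∈ S.coord
    rw [h]
    exact sum_mem fun i _ => sum_mem fun j _ => Subalgebra.smul_mem _ (hc i j) _
  par := LinearMap.id
  par_par _ := rfl
  par_lie _ _ := rfl
  par_act _ _ := rfl

/-- The direct sum of two representations. -/
def EqModule.prod {𝔥 : Type} [LieRing 𝔥] [LieAlgebra ℂ 𝔥] {S : Symmetry 𝔥 L} (U U' : EqModule S) :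
    EqModule S where
  V := U.V × U'.V
  lie := LinearMap.mk₂ ℂ (fun x P => LinearMap.prodMap (U.lie x) (U'.lie x) P)
    (by intros; simp) (by intros; simp) (by intros; simp) (by intros; simp)
  lie_lie x y P := Prod.ext (U.lie_lie x y P.1) (U'.lie_lie x y P.2)
  act :=
    { toFun := fun l => LinearMap.prodMap (U.act l) (U'.act l)
      map_one' := by rw [map_one, map_one]; rfl
      map_mul' := by intro l m; rw [map_mul, map_mul]; rfl }
  act_lie l x P := Prod.ext (U.act_lie l x P.1) (U'.act_lie l x P.2)
  act_coord f P := by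
    have h : (fun l => f (U.act l P.1, U'.act l P.2)) =
        (fun l => (f ∘ₗ LinearMap.inl ℂ U.V U'.V) (U.act l P.1)) +
        fun l => (f ∘ₗ LinearMap.inr ℂ U.V U'.V) (U'.act l P.2) := by
      funext l
      change _ = f (_, 0) + f (0, _)
      rw [← map_add]
      simp
    exact h ▸ add_mem (U.act_coord _ _) (U'.act_coord _ _)
  par := LinearMap.prodMap U.par U'.par
  par_par P := Prod.ext (U.par_par P.1) (U'.par_par P.2)
  par_lie x P := Prod.ext (U.par_lie x P.1) (U'.par_lie x P.2)
  par_act l P := Prod.ext (U.par_act l P.1) (U'.par_act l P.2)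

theorem prod_zpow_single (t : Fin n → ℂˣ) (i : Fin n) (z : ℤ) :
    ∏ k, t k ^ (Pi.single i z : Fin n → ℤ) k = t i ^ z := by
  rw [Finset.prod_eq_single i]
  · rw [Pi.single_eq_same]
  · intro k _ hk; rw [Pi.single_eq_of_ne hk, zpow_zero]
  · intro h; exact absurd (Finset.mem_univ i) h

/-- The weight of an entry of an equation for `g`. -/
theorem weight_eq (l : Torus n) (i j : Fin n) :
    (weight (Pi.single j (-1)) (Pi.single i 1) 0 1 l : ℂ) =
      (l.2.2.2 : ℂ) * l.2.1 i * (l.1 j : ℂ)⁻¹ := by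
  change (((∏ k, l.1 k ^ (Pi.single j (-1) : Fin n → ℤ) k) *
    (∏ k, l.2.1 k ^ (Pi.single i 1 : Fin n → ℤ) k) * l.2.2.1 ^ (0 : ℤ) * l.2.2.2 ^ (1 : ℤ) : ℂˣ) : ℂ)
    = _
  rw [prod_zpow_single, prod_zpow_single, zpow_zero, zpow_one, zpow_one, zpow_neg, zpow_one, mul_one,
    Units.val_mul, Units.val_mul, Units.val_inv_eq_inv_val]
  ring

/-- The weight of an entry of an equation for `X`. -/
theorem weight_eqX (l : Torus n) (i j : Fin n) :
    (weight (Pi.single i 1 + Pi.single j (-1)) 0 (-2) 1 l : ℂ) =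
      ((l.2.2.2 : ℂ) * (l.2.2.1 : ℂ)⁻¹ ^ 2) * l.1 i * (l.1 j : ℂ)⁻¹ := by
  change (((∏ k, l.1 k ^ ((Pi.single i 1 : Fin n → ℤ) k + (Pi.single j (-1) : Fin n → ℤ) k)) *
    (∏ k, l.2.1 k ^ (0 : ℤ)) * l.2.2.1 ^ (-2 : ℤ) * l.2.2.2 ^ (1 : ℤ) : ℂˣ) : ℂ) = _
  simp only [zpow_add, Finset.prod_mul_distrib, prod_zpow_single, zpow_zero, Finset.prod_const_one,
    zpow_one, zpow_neg, mul_one, Units.val_mul, Units.val_inv_eq_inv_val]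
  rw [show (l.2.2.1 ^ (2 : ℤ) : ℂˣ) = l.2.2.1 ^ 2 from zpow_ofNat _ 2, Units.val_pow_eq_pow_val,
    inv_pow]
  ring

end Equations

/-! ### The Koszul models of the two units -/

section Evaluation

variable {E : Type} [AddCommGroup E] [Module ℂ E] {Z : Set E} {n : ℕ}

/-- The evaluation of regular functions at a point. -/
def evalAt (p : Z) : regular Z →ₐ[ℂ] ℂ := (Pi.evalAlgHom ℂ (fun _ : Z => ℂ) p).comp (regular Z).val

theorem matrix_ext_evalAt {M N : Matrix (Fin n) (Fin n) (regular Z)}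
    (h : ∀ p, M.map (evalAt p) = N.map (evalAt p)) : M = N :=
  Matrix.ext fun i j => Subtype.ext (funext fun p => congrFun (congrFun (h p) i) j)

theorem evalAt_sandwich (p : Z) (a b : Mat n) (M : Matrix (Fin n) (Fin n) (regular Z)) :
    (scalarMat (regular Z) a * M * scalarMat (regular Z) b).map (evalAt p) =
      a * M.map (evalAt p) * b := by
  have h : ∀ x : Mat n, (scalarMat (regular Z) x).map (evalAt p) = x := fun x => scalarMat_map _ x
  have hm : ∀ A B : Matrix (Fin n) (Fin n) (regular Z),
      (A * B).map (evalAt p) = A.map (evalAt p) * B.map (evalAt p) := fun A B => by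
    refine Matrix.ext fun i j => ?_
    rw [Matrix.map_apply, Matrix.mul_apply, map_sum, Matrix.mul_apply]
    exact Finset.sum_congr rfl fun k _ => map_mul _ _ _
  rw [hm, hm, h, h]

theorem evalAt_smul_sandwich (p : Z) (c : ℂ) (a b : Mat n)
    (M : Matrix (Fin n) (Fin n) (regular Z)) :
    (c • (scalarMat (regular Z) a * M * scalarMat (regular Z) b)).map (evalAt p) =
      c • (a * M.map (evalAt p) * b) := by
  rw [← evalAt_sandwich]
  exact Matrix.ext fun i j => map_smul (evalAt p) c _

theorem trace_lowerEntries {F : Z → Mat n} (hF : RegularMat F) (P : nil n) :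
    lowerEntries hF P = (scalarMat (regular Z) P.1 * hF.toMatrix).trace := by
  refine Subtype.ext (funext fun p => ?_)
  have h := congrArg Matrix.trace (evalAt_sandwich p P.1 1 hF.toMatrix)
  have h1 : scalarMat (regular Z) (1 : Mat n) = 1 := Matrix.map_one _ (map_zero _) (map_one _)
  rw [h1, mul_one, mul_one] at h
  refine h.symm.trans ?_
  exact (AddMonoidHom.map_trace (evalAt p) _).symm

end Evaluation

section Red

variable {n : ℕ}

theorem red_der_X (x : nilSq n) :
    redX_regular.toMatrix.map (lieDer (redXi n x) (redTangent x)) =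
      redX_regular.toMatrix * constMat x.1.1 - constMat x.1.1 * redX_regular.toMatrix := by
  rw [← neg_sub, ← constMat_comm x.1.1 x.1.1 redX_regular
    ((RegularMat.linear (LinearMap.fst ℂ (Mat n) (Mat n × Mat n) ∘ₗ redXi n x) :))]
  exact derMat_linear (LinearMap.fst ℂ (Mat n) (Mat n × Mat n)) (redXi n x) (redTangent x)

theorem red_der_g (x : nilSq n) :
    redg_regular.toMatrix.map (lieDer (redXi n x) (redTangent x)) =
      redg_regular.toMatrix * constMat x.2.1 - constMat x.1.1 * redg_regular.toMatrix := by
  rw [← neg_sub, ← constMat_comm x.1.1 x.2.1 redg_regular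
    ((RegularMat.linear ((LinearMap.fst ℂ (Mat n) (Mat n) ∘ₗ
      LinearMap.snd ℂ (Mat n) (Mat n × Mat n)) ∘ₗ redXi n x) :))]
  exact derMat_linear (LinearMap.fst ℂ (Mat n) (Mat n) ∘ₗ
    LinearMap.snd ℂ (Mat n) (Mat n × Mat n)) (redXi n x) (redTangent x)

theorem red_der_Y (x : nilSq n) :
    redY_regular.toMatrix.map (lieDer (redXi n x) (redTangent x)) =
      redY_regular.toMatrix * constMat x.2.1 - constMat x.2.1 * redY_regular.toMatrix := by
  rw [← neg_sub, ← constMat_comm x.2.1 x.2.1 redY_regular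
    ((RegularMat.linear ((LinearMap.snd ℂ (Mat n) (Mat n) ∘ₗ
      LinearMap.snd ℂ (Mat n) (Mat n × Mat n)) ∘ₗ redXi n x) :))]
  exact derMat_linear (LinearMap.snd ℂ (Mat n) (Mat n) ∘ₗ
    LinearMap.snd ℂ (Mat n) (Mat n × Mat n)) (redXi n x) (redTangent x)

theorem red_act_g (l : Torus n) :
    redg_regular.toMatrix.map (pullFun ((redGeom n).move l⁻¹) ((redGeom n).move_coord l⁻¹)) =
      scalarMat _ (dg l.1⁻¹) * redg_regular.toMatrix * scalarMat _ (dg l.2.1) :=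
  matrix_ext_evalAt (Z := redSet n) fun p => by
    refine Eq.trans ?_ (evalAt_sandwich p _ _ _).symm
    change (1 : ℂ) • (dg l.1⁻¹ * p.1.2.1 * dg (l.2.1⁻¹)⁻¹) = dg l.1⁻¹ * p.1.2.1 * dg l.2.1
    rw [one_smul, inv_inv]

theorem red_act_X (l : Torus n) :
    redX_regular.toMatrix.map (pullFun ((redGeom n).move l⁻¹) ((redGeom n).move_coord l⁻¹)) =
      ((l.2.2.1 : ℂ)⁻¹ ^ 2) •
        (scalarMat _ (dg l.1⁻¹) * redX_regular.toMatrix * scalarMat _ (dg l.1)) :=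
  matrix_ext_evalAt (Z := redSet n) fun p => by
    refine Eq.trans ?_ (evalAt_smul_sandwich p _ _ _ _).symm
    change (((l.2.2.1⁻¹ : ℂˣ) : ℂ) ^ 2) • (dg l.1⁻¹ * p.1.1 * dg (l.1⁻¹)⁻¹) =
      ((l.2.2.1 : ℂ)⁻¹ ^ 2) • (dg l.1⁻¹ * p.1.1 * dg l.1)
    rw [inv_inv, Units.val_inv_eq_inv_val]

theorem red_act_Y (l : Torus n) :
    redY_regular.toMatrix.map (pullFun ((redGeom n).move l⁻¹) ((redGeom n).move_coord l⁻¹)) =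
      ((l.2.2.1 : ℂ) ^ 2 * (l.2.2.2 : ℂ)⁻¹ ^ 2) •
        (scalarMat _ (dg l.2.1⁻¹) * redY_regular.toMatrix * scalarMat _ (dg l.2.1)) :=
  matrix_ext_evalAt (Z := redSet n) fun p => by
    refine Eq.trans ?_ (evalAt_smul_sandwich p _ _ _ _).symm
    change ((((l.2.2.1⁻¹ : ℂˣ) : ℂ)⁻¹) ^ 2 * ((l.2.2.2⁻¹ : ℂˣ) : ℂ) ^ 2) •
        (dg l.2.1⁻¹ * p.1.2.2 * dg (l.2.1⁻¹)⁻¹) =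
      ((l.2.2.1 : ℂ) ^ 2 * (l.2.2.2 : ℂ)⁻¹ ^ 2) • (dg l.2.1⁻¹ * p.1.2.2 * dg l.2.1)
    rw [inv_inv, Units.val_inv_eq_inv_val, Units.val_inv_eq_inv_val, inv_inv]

theorem redY_strict (i j : Fin n) (h : j ≤ i) :
    (redY_regular.toMatrix : Matrix (Fin n) (Fin n) (regular (redSet n))) i j = 0 :=
  Subtype.ext (funext fun p => p.2.2.2 i j h)

/-- There are no equations for `X` on the reduced space, as `X` is upper triangular. -/
theorem trace_redX (P : nil n) : (scalarMat (regular (redSet n)) P.1 *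
    (redX_regular.toMatrix : Matrix (Fin n) (Fin n) (regular (redSet n)))).trace = 0 := by
  rw [← trace_lowerEntries]
  refine Subtype.ext (funext fun p => ?_)
  change ∑ i, (P.1 * p.1.1) i i = 0
  exact Finset.sum_eq_zero fun i _ => nil_mul_upper P.2 p.2.1 i i le_rfl

/-- The representation of the equations of the reduced unit. -/
def redEq (n : ℕ) : EqModule (symRed n) :=
  eqModule (symRed n) LieHom.id
    ((MonoidHom.fst _ _).comp (MonoidHom.snd _ _)) (MonoidHom.fst _ _) (fun l => (l.2.2.2 : ℂ))
    rfl (fun _ _ => rfl) (fun _ _ => rfl)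
    (fun i j => by
      have h := weight_coord (n := n) (Pi.single j (-1)) (Pi.single i 1) 0 1
      rwa [funext fun l => weight_eq l i j] at h)

/-- The Koszul model of the reduced unit; there are no equations for `X`. -/
def redModel (n : ℕ) : UnitModel (symRed n) where
  Z := (redGeom n).toSpace
  U := redEq n
  tor := id
  Ad_eq _ _ := rfl
  κ_eq l := by
    refine Units.ext ?_
    simp [symRed, weight]
  g := redg_regular.toMatrix
  k := (redg_regular.inv redSet_det).toMatrix
  X := redX_regular.toMatrix
  Y := redY_regular.toMatrix
  g_k := redg_regular.toMatrix_inv redSet_det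
  Y_strict := redY_strict
  der_g := red_der_g
  der_X := red_der_X
  der_Y := red_der_Y
  act_g := red_act_g
  act_X := red_act_X
  act_Y := red_act_Y
  θ := LinearMap.id
  ξ := 0
  span u := ⟨u, 0, (add_zero u).symm⟩
  lie_θ _ _ := rfl
  lie_ξ x _ := map_zero ((redEq n).lie x)
  act_θ _ _ := rfl
  act_ξ l _ := map_zero ((redEq n).act l)
  s := lowerEntries redg_regular
  s_θ := trace_lowerEntries redg_regular
  s_ξ P := (map_zero (lowerEntries redg_regular)).trans (trace_redX P).symm

end Red

section Non

variable {n : ℕ}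

theorem nong1_inv : (nong1_regular : RegularMat fun p : nonSet n => nong1 n p).toMatrix *
    (nong1_regular.inv nonSet_det1).toMatrix = 1 := nong1_regular.toMatrix_inv nonSet_det1

theorem non_der_X (x : nilSq n) :
    nonX_regular.toMatrix.map (lieDer (nonXi n x) (nonTangent x)) = 0 := by
  refine (derMat_linear (nonX n) (nonXi n x) (nonTangent x)).trans ?_
  ext i j p
  exact neg_zero

theorem non_der_g1 (x : nilSq n) :
    nong1_regular.toMatrix.map (lieDer (nonXi n x) (nonTangent x)) =
      nong1_regular.toMatrix * constMat x.1.1 := by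
  rw [← constMat_right x.1.1 nong1_regular ((RegularMat.linear (nong1 n ∘ₗ nonXi n x) :))]
  exact derMat_linear (nong1 n) (nonXi n x) (nonTangent x)

theorem non_der_g2 (x : nilSq n) :
    nong2_regular.toMatrix.map (lieDer (nonXi n x) (nonTangent x)) =
      nong2_regular.toMatrix * constMat x.2.1 := by
  rw [← constMat_right x.2.1 nong2_regular ((RegularMat.linear (nong2 n ∘ₗ nonXi n x) :))]
  exact derMat_linear (nong2 n) (nonXi n x) (nonTangent x)

theorem non_der_Y1 (x : nilSq n) :
    nonY1_regular.toMatrix.map (lieDer (nonXi n x) (nonTangent x)) =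
      nonY1_regular.toMatrix * constMat x.1.1 - constMat x.1.1 * nonY1_regular.toMatrix := by
  rw [← neg_sub, ← constMat_comm x.1.1 x.1.1 nonY1_regular
    ((RegularMat.linear (nonY1 n ∘ₗ nonXi n x) :))]
  exact derMat_linear (nonY1 n) (nonXi n x) (nonTangent x)

theorem non_der_Y2 (x : nilSq n) :
    nonY2_regular.toMatrix.map (lieDer (nonXi n x) (nonTangent x)) =
      nonY2_regular.toMatrix * constMat x.2.1 - constMat x.2.1 * nonY2_regular.toMatrix := by
  rw [← neg_sub, ← constMat_comm x.2.1 x.2.1 nonY2_regular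
    ((RegularMat.linear (nonY2 n ∘ₗ nonXi n x) :))]
  exact derMat_linear (nonY2 n) (nonXi n x) (nonTangent x)

theorem non_der_g1_inv (x : nilSq n) :
    (nong1_regular.inv nonSet_det1).toMatrix.map (lieDer (nonXi n x) (nonTangent x)) =
      -(constMat x.1.1 * (nong1_regular.inv nonSet_det1).toMatrix) := by
  rw [derMat_inv _ _ _ nong1_inv, non_der_g1, ← mul_assoc, mul_eq_one_comm.mp nong1_inv, one_mul]

theorem non_der_g (x : nilSq n) :
    nong12_regular.toMatrix.map (lieDer (nonXi n x) (nonTangent x)) =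
      nong12_regular.toMatrix * constMat x.2.1 - constMat x.1.1 * nong12_regular.toMatrix := by
  have h : nong12_regular.toMatrix = (nong1_regular.inv nonSet_det1).toMatrix *
      (nong2_regular : RegularMat fun p : nonSet n => nong2 n p).toMatrix :=
    RegularMat.toMatrix_mul _ _
  have key : ∀ {A : Type} [Ring A] (a b g h : A), -(a * g) * h + g * (h * b) =
      g * h * b - a * (g * h) := by intros; noncomm_ring
  rw [h, derMat_mul, non_der_g1_inv, non_der_g2]
  exact key _ _ _ _

theorem non_der_AdX (x : nilSq n) :
    nonAdX_regular.toMatrix.map (lieDer (nonXi n x) (nonTangent x)) =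
      nonAdX_regular.toMatrix * constMat x.1.1 - constMat x.1.1 * nonAdX_regular.toMatrix := by
  have h : nonAdX_regular.toMatrix = (nong1_regular.inv nonSet_det1).toMatrix *
      (nonX_regular : RegularMat fun p : nonSet n => nonX n p).toMatrix *
      (nong1_regular : RegularMat fun p : nonSet n => nong1 n p).toMatrix := by
    rw [← RegularMat.toMatrix_mul, ← RegularMat.toMatrix_mul]
  have key : ∀ {A : Type} [Ring A] (a g X h : A), (-(a * g) * X + g * 0) * h + g * X * (h * a) =
      g * X * h * a - a * (g * X * h) := by intros; noncomm_ring
  rw [h, derMat_mul, derMat_mul, non_der_g1_inv, non_der_X, non_der_g1]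
  exact key _ _ _ _

/-- The group `L = GL_n × T² × T_sc` of the non-reduced space. -/
abbrev GLTorus (n : ℕ) : Type := Matrix.GeneralLinearGroup (Fin n) ℂ × Torus n

theorem non_act_g (l : GLTorus n) :
    nong12_regular.toMatrix.map (pullFun ((nonGeom n).move l⁻¹) ((nonGeom n).move_coord l⁻¹)) =
      scalarMat _ (dg l.2.1⁻¹) * nong12_regular.toMatrix * scalarMat _ (dg l.2.2.1) :=
  matrix_ext_evalAt (Z := nonSet n) fun p => by
    refine Eq.trans ?_ (evalAt_sandwich p _ _ _).symm
    change ((1 : ℂ) • ((↑(l.1⁻¹) : Mat n) * nong1 n p * dg (l.2.1⁻¹)⁻¹))⁻¹ *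
      ((1 : ℂ) • ((↑(l.1⁻¹) : Mat n) * nong2 n p * dg (l.2.2.1⁻¹)⁻¹)) =
      dg l.2.1⁻¹ * ((nong1 n p)⁻¹ * nong2 n p) * dg l.2.2.1
    rw [one_smul, one_smul, inv_inv, inv_inv, inv_sandwich _ _ _ _ _ (gl_inv_mul l.1)
      (dg_inv_mul _) (nonSet_det1 p)]
    have e : dg l.2.1⁻¹ * (nong1 n p)⁻¹ * (l.1 : Mat n) *
        ((↑(l.1⁻¹) : Mat n) * nong2 n p * dg l.2.2.1) =
      dg l.2.1⁻¹ * (nong1 n p)⁻¹ * ((l.1 : Mat n) * (↑(l.1⁻¹) : Mat n)) * nong2 n p *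
        dg l.2.2.1 := by noncomm_ring
    rw [e, gl_mul_inv]
    noncomm_ring

theorem non_act_AdX (l : GLTorus n) :
    nonAdX_regular.toMatrix.map (pullFun ((nonGeom n).move l⁻¹) ((nonGeom n).move_coord l⁻¹)) =
      ((l.2.2.2.1 : ℂ)⁻¹ ^ 2) •
        (scalarMat _ (dg l.2.1⁻¹) * nonAdX_regular.toMatrix * scalarMat _ (dg l.2.1)) :=
  matrix_ext_evalAt (Z := nonSet n) fun p => by
    refine Eq.trans ?_ (evalAt_smul_sandwich p _ _ _ _).symm
    change ((1 : ℂ) • ((↑(l.1⁻¹) : Mat n) * nong1 n p * dg (l.2.1⁻¹)⁻¹))⁻¹ *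
      ((((l.2.2.2.1⁻¹ : ℂˣ) : ℂ) ^ 2) • ((↑(l.1⁻¹) : Mat n) * nonX n p * (↑(l.1⁻¹)⁻¹ : Mat n))) *
      ((1 : ℂ) • ((↑(l.1⁻¹) : Mat n) * nong1 n p * dg (l.2.1⁻¹)⁻¹)) =
      ((l.2.2.2.1 : ℂ)⁻¹ ^ 2) • (dg l.2.1⁻¹ * ((nong1 n p)⁻¹ * nonX n p * nong1 n p) * dg l.2.1)
    rw [one_smul, inv_inv, inv_sandwich _ _ _ _ _ (gl_inv_mul l.1)
      (dg_inv_mul _) (nonSet_det1 p), Units.val_inv_eq_inv_val, mul_smul_comm, smul_mul_assoc]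
    congr 1
    have e : dg l.2.1⁻¹ * (nong1 n p)⁻¹ * (l.1 : Mat n) *
        ((↑(l.1⁻¹) : Mat n) * nonX n p * (l.1 : Mat n)) *
        ((↑(l.1⁻¹) : Mat n) * nong1 n p * dg l.2.1) =
      dg l.2.1⁻¹ * (nong1 n p)⁻¹ * ((l.1 : Mat n) * (↑(l.1⁻¹) : Mat n)) * nonX n p *
        ((l.1 : Mat n) * (↑(l.1⁻¹) : Mat n)) * nong1 n p * dg l.2.1 := by noncomm_ring
    rw [inv_inv, e, gl_mul_inv]
    noncomm_ring

theorem non_act_Y1 (l : GLTorus n) :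
    nonY1_regular.toMatrix.map (pullFun ((nonGeom n).move l⁻¹) ((nonGeom n).move_coord l⁻¹)) =
      ((l.2.2.2.1 : ℂ) ^ 2 * (l.2.2.2.2 : ℂ)⁻¹ ^ 2) •
        (scalarMat _ (dg l.2.1⁻¹) * nonY1_regular.toMatrix * scalarMat _ (dg l.2.1)) :=
  matrix_ext_evalAt (Z := nonSet n) fun p => by
    refine Eq.trans ?_ (evalAt_smul_sandwich p _ _ _ _).symm
    change ((((l.2.2.2.1⁻¹ : ℂˣ) : ℂ)⁻¹) ^ 2 * ((l.2.2.2.2⁻¹ : ℂˣ) : ℂ) ^ 2) •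
        (dg l.2.1⁻¹ * nonY1 n p * dg (l.2.1⁻¹)⁻¹) =
      ((l.2.2.2.1 : ℂ) ^ 2 * (l.2.2.2.2 : ℂ)⁻¹ ^ 2) • (dg l.2.1⁻¹ * nonY1 n p * dg l.2.1)
    rw [inv_inv, Units.val_inv_eq_inv_val, Units.val_inv_eq_inv_val, inv_inv]

theorem non_act_Y2 (l : GLTorus n) :
    nonY2_regular.toMatrix.map (pullFun ((nonGeom n).move l⁻¹) ((nonGeom n).move_coord l⁻¹)) =
      ((l.2.2.2.1 : ℂ) ^ 2 * (l.2.2.2.2 : ℂ)⁻¹ ^ 2) •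
        (scalarMat _ (dg l.2.2.1⁻¹) * nonY2_regular.toMatrix * scalarMat _ (dg l.2.2.1)) :=
  matrix_ext_evalAt (Z := nonSet n) fun p => by
    refine Eq.trans ?_ (evalAt_smul_sandwich p _ _ _ _).symm
    change ((((l.2.2.2.1⁻¹ : ℂˣ) : ℂ)⁻¹) ^ 2 * ((l.2.2.2.2⁻¹ : ℂˣ) : ℂ) ^ 2) •
        (dg l.2.2.1⁻¹ * nonY2 n p * dg (l.2.2.1⁻¹)⁻¹) =
      ((l.2.2.2.1 : ℂ) ^ 2 * (l.2.2.2.2 : ℂ)⁻¹ ^ 2) • (dg l.2.2.1⁻¹ * nonY2 n p * dg l.2.2.1)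
    rw [inv_inv, Units.val_inv_eq_inv_val, Units.val_inv_eq_inv_val, inv_inv]

theorem nonY1_strict (i j : Fin n) (h : j ≤ i) :
    (nonY1_regular.toMatrix : Matrix (Fin n) (Fin n) (regular (nonSet n))) i j = 0 :=
  Subtype.ext (funext fun p => p.2.1.2 i j h)

theorem nonY2_strict (i j : Fin n) (h : j ≤ i) :
    (nonY2_regular.toMatrix : Matrix (Fin n) (Fin n) (regular (nonSet n))) i j = 0 :=
  Subtype.ext (funext fun p => p.2.2.2 i j h)

theorem nonSet_det12 (p : nonSet n) : ((nong1 n p)⁻¹ * nong2 n p).det ≠ 0 := by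
  rw [Matrix.det_mul, Matrix.det_nonsing_inv, Ring.inverse_eq_inv']
  exact mul_ne_zero (inv_ne_zero (nonSet_det1 p)) (nonSet_det2 p)

/-- The representation of the equations of the non-reduced unit: those for `g₁⁻¹ g₂` and those for
`Ad_{g₁}⁻¹ X`. -/
def nonEq (n : ℕ) : EqModule (symNon n) :=
  EqModule.prod
    (eqModule (symNon n) LieHom.id
      ((MonoidHom.fst _ _).comp ((MonoidHom.snd _ _).comp (MonoidHom.snd _ _)))
      ((MonoidHom.fst _ _).comp (MonoidHom.snd _ _)) (fun l => (l.2.2.2.2 : ℂ))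
      rfl (fun _ _ => rfl) (fun _ _ => rfl)
      (fun i j => by
        have h := weight_coord_snd (n := n) (Pi.single j (-1)) (Pi.single i 1) 0 1
        exact (congrArg (· ∈ (symNon n).coord) (funext fun l => weight_eq l.2 i j)).mp h))
    (eqModule (symNon n)
      { toFun := fun x => (x.1, x.1)
        map_add' := fun _ _ => rfl
        map_smul' := fun _ _ => rfl
        map_lie' := rfl }
      ((MonoidHom.fst _ _).comp (MonoidHom.snd _ _))
      ((MonoidHom.fst _ _).comp (MonoidHom.snd _ _))
      (fun l => (l.2.2.2.2 : ℂ) * (l.2.2.2.1 : ℂ)⁻¹ ^ 2)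
      (by simp) (fun l m => by simp [mul_pow]; ring) (fun _ _ => rfl)
      (fun i j => by
        have h := weight_coord_snd (n := n) (Pi.single i 1 + Pi.single j (-1)) 0 (-2) 1
        exact (congrArg (· ∈ (symNon n).coord) (funext fun l => weight_eqX l.2 i j)).mp h))

/-- The Koszul model of the non-reduced unit. -/
def nonModel (n : ℕ) : UnitModel (symNon n) where
  Z := (nonGeom n).toSpace
  U := nonEq n
  tor := Prod.snd
  Ad_eq _ _ := rfl
  κ_eq l := by
    refine Units.ext ?_
    simp [symNon, weight]
  g := nong12_regular.toMatrix
  k := (nong12_regular.inv nonSet_det12).toMatrix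
  X := nonAdX_regular.toMatrix
  Y := nonY2_regular.toMatrix
  g_k := nong12_regular.toMatrix_inv nonSet_det12
  Y_strict := nonY2_strict
  der_g := non_der_g
  der_X := non_der_AdX
  der_Y := non_der_Y2
  act_g := non_act_g
  act_X := non_act_AdX
  act_Y := non_act_Y2
  θ := LinearMap.inl ℂ (nil n) (nil n)
  ξ := LinearMap.inr ℂ (nil n) (nil n)
  span u := ⟨u.1, u.2, Prod.ext (add_zero (u.1 : nil n)).symm (zero_add (u.2 : nil n)).symm⟩
  lie_θ x P := Prod.ext rfl (map_zero (eqLieX x))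
  lie_ξ x P := Prod.ext (map_zero (eqLie x)) rfl
  act_θ l P := Prod.ext rfl (map_zero (eqAct _ _ _))
  act_ξ l P := Prod.ext (map_zero (eqAct _ _ _)) rfl
  s := LinearMap.coprod (lowerEntries nong12_regular) (lowerEntries nonAdX_regular)
  s_θ P := (LinearMap.congr_fun (LinearMap.coprod_inl (lowerEntries nong12_regular)
    (lowerEntries nonAdX_regular)) P).trans (trace_lowerEntries nong12_regular P)
  s_ξ P := (LinearMap.congr_fun (LinearMap.coprod_inr (lowerEntries nong12_regular)
    (lowerEntries nonAdX_regular)) P).trans (trace_lowerEntries nonAdX_regular P)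

end Non

/-! ### Corrections for a potential of the form `Tr (X Y)` -/

namespace OpData

variable {K E : Type} [Ring K] [Algebra ℂ K] [Ring E] [Algebra ℂ E] {n : ℕ} (O : OpData K E n)

/-- The operator of an odd element supercommutes with all operators. -/
theorem odd_mul {a : K} (ha : O.γ (O.F a) = -O.F a) (b : K) :
    O.F a * O.F b = O.γ (O.F b) * O.F a := by
  obtain ⟨a₀, a₁, h, h0, h1, hc⟩ := O.super a
  have h2 : (2 : ℂ) • a₀ = 0 := by
    rw [h, map_add, h0, h1, neg_add, add_left_inj] at ha
    rw [two_smul]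
    nth_rw 1 [ha]
    exact neg_add_cancel a₀
  have h3 : a₀ = 0 := (smul_eq_zero.1 h2).resolve_left two_ne_zero
  rw [h, h3, zero_add]
  exact (hc b).2

theorem odd_sq {a : K} (ha : O.γ (O.F a) = -O.F a) : O.F a * O.F a = 0 := by
  have h1 := O.odd_mul ha a
  rw [ha, neg_mul] at h1
  have h2 : (2 : ℂ) • (O.F a * O.F a) = 0 := by
    rw [two_smul]
    nth_rw 1 [h1]
    exact neg_add_cancel _
  exact (smul_eq_zero.1 h2).resolve_left two_ne_zero

theorem F_trace_mul (M N : Matrix (Fin n) (Fin n) K) :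
    O.F (M * N).trace = ∑ i, ∑ j, O.F (M i j) * O.F (N j i) := by
  simp only [Matrix.trace, Matrix.diag_apply, Matrix.mul_apply, map_sum, map_mul]

/-- The trace of a supercommutator of odd matrices vanishes. -/
theorem F_trace_anticomm {M N : Matrix (Fin n) (Fin n) K}
    (hM : ∀ i j, O.γ (O.F (M i j)) = -O.F (M i j)) (hN : ∀ i j, O.γ (O.F (N i j)) = -O.F (N i j)) :
    O.F (M * N).trace + O.F (N * M).trace = 0 := by
  rw [F_trace_mul, F_trace_mul, Finset.sum_comm, ← Finset.sum_add_distrib]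
  refine Finset.sum_eq_zero fun i _ => ?_
  rw [← Finset.sum_add_distrib]
  refine Finset.sum_eq_zero fun j _ => ?_
  rw [O.odd_mul (hM j i), hN, neg_mul, neg_add_cancel]

variable {Y : Matrix (Fin n) (Fin n) K}

theorem trace_Ξ_odd (hY : ∀ i j, O.γ (O.F (Y i j)) = O.F (Y i j)) :
    O.γ (O.F (O.Ξ * Y).trace) = -O.F (O.Ξ * Y).trace := by
  simp only [F_trace_mul, map_sum, map_mul, O.Ξ_odd, hY, neg_mul, Finset.sum_neg_distrib]

/-- `Tr (Ξ Y)` corrects the potential `Tr (X Y)`. -/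
theorem D_trace_Ξ (hY : ∀ i j, O.γ (O.F (Y i j)) = O.F (Y i j)) (hs : SuperDG.Strict Y)
    (hD : ∀ i j, O.D * O.F (Y i j) - O.F (Y i j) * O.D = O.F ((O.η₁ * Y - Y * O.η₁) i j)) :
    O.D * O.F (O.Ξ * Y).trace + O.F (O.Ξ * Y).trace * O.D = O.F (O.X * Y).trace := by
  have h1 : ∀ i j, O.comm (O.F (O.Ξ i j) * O.F (Y j i)) =
      O.F ((O.X + (O.η₁ * O.Ξ + O.Ξ * O.η₁)) i j) * O.F (Y j i) -
        O.F (O.Ξ i j) * O.F ((O.η₁ * Y - Y * O.η₁) j i) := by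
    intro i j
    rw [comm_mul, comm_odd _ (O.Ξ_odd i j), comm_even _ (hY j i), hD, O.Ξ_odd, neg_mul,
      ← sub_eq_add_neg]
    rcases lt_or_ge j i with h | h
    · rw [O.D_Ξ i j h]
      rfl
    · rw [hs j i h, O.Ξ_eq_zero i j h]
      simp only [map_zero, mul_zero, zero_mul]
  have h2 : (O.X + (O.η₁ * O.Ξ + O.Ξ * O.η₁)) * Y - O.Ξ * (O.η₁ * Y - Y * O.η₁) =
      O.X * Y + (O.η₁ * (O.Ξ * Y) + O.Ξ * Y * O.η₁) := by noncomm_ring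
  have h3 : ∀ i j, O.γ (O.F ((O.Ξ * Y) i j)) = -O.F ((O.Ξ * Y) i j) := by
    intro i j
    simp only [Matrix.mul_apply, map_sum, map_mul, O.Ξ_odd, hY, neg_mul, Finset.sum_neg_distrib]
  rw [← comm_odd _ (O.trace_Ξ_odd hY)]
  nth_rw 1 [F_trace_mul]
  simp only [map_sum, h1, Finset.sum_sub_distrib]
  rw [← F_trace_mul, ← F_trace_mul, ← map_sub, ← Matrix.trace_sub, h2, Matrix.trace_add, map_add,
    Matrix.trace_add, map_add, O.F_trace_anticomm O.η₁_odd h3, add_zero]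

end OpData

/-! ### Elements with a factor from the space of equations -/

section EquationIdeal

variable {𝔥 L : Type} [LieRing 𝔥] [LieAlgebra ℂ 𝔥] [Group L] {S : Symmetry 𝔥 L}

/-- The left ideal of the elements of `R ⊗ Λ(𝔥* ⊕ U)` all of whose terms contain a factor
from `U`. -/
def eqIdeal (Z : EqSpace S) (U : Type) [AddCommGroup U] [Module ℂ U] : Submodule Z.R (KAlg Z U) :=
  Submodule.span Z.R {y | ∃ (a : ExteriorAlgebra ℂ (Module.Dual ℂ 𝔥 × U)) (u : U),
    y = 1 ⊗ₜ (a * ExteriorAlgebra.ι ℂ (0, u))}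

variable {Z : EqSpace S} {U : Type} [AddCommGroup U] [Module ℂ U]

theorem kGen_mem_eqIdeal (u : U) : kGen Z 0 u ∈ eqIdeal Z U :=
  Submodule.subset_span ⟨1, u, by rw [one_mul]; rfl⟩

theorem mul_mem_eqIdeal (k : KAlg Z U) {y : KAlg Z U} (hy : y ∈ eqIdeal Z U) :
    k * y ∈ eqIdeal Z U := by
  refine TensorProduct.induction_on k ?_ (fun r b => ?_) (fun k k' h h' => ?_)
  · rw [zero_mul]; exact zero_mem _
  · induction hy using Submodule.span_induction with
    | mem y h =>
      obtain ⟨a, u, rfl⟩ := h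
      have h : (r ⊗ₜ b : KAlg Z U) * 1 ⊗ₜ (a * ExteriorAlgebra.ι ℂ (0, u)) =
          r • (1 ⊗ₜ (b * a * ExteriorAlgebra.ι ℂ (0, u))) := by
        rw [Algebra.TensorProduct.tmul_mul_tmul, TensorProduct.smul_tmul', smul_eq_mul, mul_assoc]
      rw [h]
      exact Submodule.smul_mem _ _ (Submodule.subset_span ⟨_, _, rfl⟩)
    | zero => rw [mul_zero]; exact zero_mem _
    | add x y _ _ hx hy => rw [mul_add]; exact add_mem hx hy
    | smul c y _ hy => rw [mul_smul_comm]; exact Submodule.smul_mem _ _ hy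
  · rw [add_mul]; exact add_mem h h'

theorem mul_kFun_mem_eqIdeal {y : KAlg Z U} (hy : y ∈ eqIdeal Z U) (r : Z.R) :
    y * kFun Z U r ∈ eqIdeal Z U := by
  rw [← kFun_comm]
  exact mul_mem_eqIdeal _ hy

end EquationIdeal

/-! ### Simultaneous correction terms for two spaces -/

namespace OpData

variable {K E K' E' : Type} [Ring K] [Algebra ℂ K] [Ring E] [Algebra ℂ E]
  [Ring K'] [Algebra ℂ K'] [Ring E'] [Algebra ℂ E'] {n : ℕ}

theorem span_fst {O : OpData K E n} {O' : OpData K' E' n} {x : K × K'}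
    (hx : x ∈ Submodule.span (K × K')
      {y | ∃ i j, y = (O.prod O').Θ i j ∨ y = (O.prod O').Ξ i j}) :
    x.1 ∈ Submodule.span K {y | ∃ i j, y = O.Θ i j ∨ y = O.Ξ i j} := by
  induction hx using Submodule.span_induction with
  | mem y h =>
    obtain ⟨i, j, h⟩ := h
    exact Submodule.subset_span ⟨i, j, h.imp (congrArg Prod.fst) (congrArg Prod.fst)⟩
  | zero => exact zero_mem _
  | add x y _ _ hx hy => exact add_mem hx hy
  | smul c y _ hy => exact Submodule.smul_mem _ c.1 hy

theorem span_snd {O : OpData K E n} {O' : OpData K' E' n} {x : K × K'}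
    (hx : x ∈ Submodule.span (K × K')
      {y | ∃ i j, y = (O.prod O').Θ i j ∨ y = (O.prod O').Ξ i j}) :
    x.2 ∈ Submodule.span K' {y | ∃ i j, y = O'.Θ i j ∨ y = O'.Ξ i j} := by
  induction hx using Submodule.span_induction with
  | mem y h =>
    obtain ⟨i, j, h⟩ := h
    exact Submodule.subset_span ⟨i, j, h.imp (congrArg Prod.snd) (congrArg Prod.snd)⟩
  | zero => exact zero_mem _
  | add x y _ _ hx hy => exact add_mem hx hy
  | smul c y _ hy => exact Submodule.smul_mem _ c.2 hy

/-- `a` is a correction term for the potential `Tr (X g Y k)`. -/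
structure IsCorrection (O : OpData K E n) (a : K) : Prop where
  odd : O.γ (O.F a) = -O.F a
  comm : O.D * O.F a + O.F a * O.D = O.F (O.X * O.g * O.Y * O.k).trace
  mem : a ∈ Submodule.span K {y | ∃ i j, y = O.Θ i j ∨ y = O.Ξ i j}

/-- The two homomorphisms agree on the entries of corresponding matrices. -/
structure Agree (O : OpData K E n) (O' : OpData K' E' n) {T : Type} [Semiring T] [Algebra ℂ T]
    (f : K →ₐ[ℂ] T) (f' : K' →ₐ[ℂ] T) : Prop where
  g : ∀ i j, f (O.g i j) = f' (O'.g i j)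
  k : ∀ i j, f (O.k i j) = f' (O'.k i j)
  X : ∀ i j, f (O.X i j) = f' (O'.X i j)
  Y : ∀ i j, f (O.Y i j) = f' (O'.Y i j)
  Θ : ∀ i j, f (O.Θ i j) = f' (O'.Θ i j)
  Ξ : ∀ i j, f (O.Ξ i j) = f' (O'.Ξ i j)
  η₁ : ∀ i j, f (O.η₁ i j) = f' (O'.η₁ i j)
  η₂ : ∀ i j, f (O.η₂ i j) = f' (O'.η₂ i j)

theorem Agree.eq {O : OpData K E n} {O' : OpData K' E' n} {T : Type} [Semiring T] [Algebra ℂ T]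
    {f : K →ₐ[ℂ] T} {f' : K' →ₐ[ℂ] T} (h : O.Agree O' f f') {a : K × K'}
    (ha : a ∈ (O.prod O').alg) : f a.1 = f' a.2 := by
  induction ha using Algebra.adjoin_induction with
  | mem a ha =>
    obtain ⟨i, j, ha⟩ := ha
    rcases ha with rfl | rfl | rfl | rfl | rfl | rfl | rfl | rfl
    exacts [h.g i j, h.k i j, h.X i j, h.Y i j, h.Θ i j, h.Ξ i j, h.η₁ i j, h.η₂ i j]
  | algebraMap c => exact (f.commutes c).trans (f'.commutes c).symm
  | add a b _ _ ha hb => exact (map_add f _ _).trans ((congrArg₂ _ ha hb).trans (map_add f' _ _).symm)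
  | mul a b _ _ ha hb => exact (map_mul f _ _).trans ((congrArg₂ _ ha hb).trans (map_mul f' _ _).symm)

/-- Correction terms for two spaces, given by the same universal expression in the generators: they
have the same image under homomorphisms that agree on the generators. -/
theorem exists_correction_pair (O : OpData K E n) (O' : OpData K' E' n) : ∃ (a : K) (a' : K'),
    O.IsCorrection a ∧ O'.IsCorrection a' ∧
    (∀ {α : E →ₐ[ℂ] E} {α' : E' →ₐ[ℂ] E'} {κ ν : ℂ} {p q : Fin n → ℂ}, O.IsWeight α κ ν p q →
      O'.IsWeight α' κ ν p q → κ ≠ 0 → ν ≠ 0 → (∀ i, p i ≠ 0) → (∀ i, q i ≠ 0) →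
      α (O.F a) = κ⁻¹ • O.F a ∧ α' (O'.F a') = κ⁻¹ • O'.F a') ∧
    ∀ {T : Type} [Semiring T] [Algebra ℂ T] {f : K →ₐ[ℂ] T} {f' : K' →ₐ[ℂ] T},
      O.Agree O' f f' → f a = f' a' := by
  obtain ⟨⟨a, a'⟩, h1, h2, -, h3, h4, h5⟩ := (O.prod O').exists_correction
  have h6 : (O.prod O').X * (O.prod O').g * (O.prod O').Y * (O.prod O').k =
      pairMat (O.X * O.g * O.Y * O.k) (O'.X * O'.g * O'.Y * O'.k) := by
    rw [← pairMat_mul, ← pairMat_mul, ← pairMat_mul]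
    rfl
  rw [h6, pairMat_trace] at h3
  refine ⟨a, a', ⟨congrArg Prod.fst h2, congrArg Prod.fst h3, span_fst h5⟩,
    ⟨congrArg Prod.snd h2, congrArg Prod.snd h3, span_snd h5⟩, ?_, fun h => h.eq h1⟩
  intro α α' κ ν p q w w' hκ hν hp hq
  have h := h4 (w.prod w') hκ hν hp hq
  exact ⟨congrArg Prod.fst h, congrArg Prod.snd h⟩

end OpData

theorem kFun_sub {𝔥 L : Type} [LieRing 𝔥] [LieAlgebra ℂ 𝔥] [Group L] {S : Symmetry 𝔥 L}
    {Z : EqSpace S} {U : Type} [AddCommGroup U] [Module ℂ U] (r r' : Z.R) :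
    kFun Z U (r - r') = kFun Z U r - kFun Z U r' := TensorProduct.sub_tmul r r' 1

namespace UnitModel

variable {n : ℕ} {L : Type} [Group L] {S : Symmetry (nilSq n) L} (M : UnitModel S)

theorem kMat_trace (N : Matrix (Fin n) (Fin n) M.Z.R) :
    (kMat M.U.V N).trace = kFun M.Z M.U.V N.trace := (kFun_sum _ _).symm

theorem F_potential :
    (M.opData.X * M.opData.g * M.opData.Y * M.opData.k).trace =
      kFun M.Z M.U.V (M.X * M.g * M.Y * M.k).trace := by
  rw [← kMat_trace, kMat_mul, kMat_mul, kMat_mul]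
  rfl

theorem mem_eqIdeal {a : KAlg M.Z M.U.V} (ha : M.opData.IsCorrection a) :
    a ∈ eqIdeal M.Z M.U.V := by
  have h := ha.mem
  clear ha
  induction h using Submodule.span_induction with
  | mem y h =>
    obtain ⟨i, j, rfl | rfl⟩ := h
    exacts [kGen_mem_eqIdeal _, kGen_mem_eqIdeal _]
  | zero => exact zero_mem _
  | add x y _ _ hx hy => exact add_mem hx hy
  | smul c y _ hy => exact mul_mem_eqIdeal c hy

/-- The correction term for an additional summand `- Tr (X Y₁)` of the potential. -/
def correctionX (Y₁ : Matrix (Fin n) (Fin n) M.Z.R) : KAlg M.Z M.U.V :=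
  -(M.opData.Ξ * kMat M.U.V Y₁).trace

variable {M} {Y₁ : Matrix (Fin n) (Fin n) M.Z.R}

theorem correctionX_mem : M.correctionX Y₁ ∈ eqIdeal M.Z M.U.V := by
  refine neg_mem (sum_mem fun i _ => ?_)
  rw [Matrix.diag_apply, Matrix.mul_apply]
  exact sum_mem fun j _ => mul_kFun_mem_eqIdeal (kGen_mem_eqIdeal _) _

theorem correctionX_odd : M.γ (M.F (M.correctionX Y₁)) = -M.F (M.correctionX Y₁) := by
  have h := M.opData.trace_Ξ_odd (Y := kMat M.U.V Y₁) fun i j => M.F_even _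
  have h1 : M.F (M.correctionX Y₁) = -M.F (M.opData.Ξ * kMat M.U.V Y₁).trace := map_neg _ _
  rw [h1, map_neg]
  exact congrArg Neg.neg h

theorem D_correctionX (hs : ∀ i j, j ≤ i → Y₁ i j = 0)
    (hd : ∀ x, Y₁.map (M.Z.der x) = Y₁ * scalarMat M.Z.R x.1.1 - scalarMat M.Z.R x.1.1 * Y₁) :
    M.δ * M.F (M.correctionX Y₁) + M.F (M.correctionX Y₁) * M.δ =
      -M.F (kFun M.Z M.U.V (M.X * Y₁).trace) := by
  have h := M.opData.D_trace_Ξ (Y := kMat M.U.V Y₁) (fun i j => M.F_even _)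
    (fun i j hij => by
      change kFun _ _ (Y₁ i j) = 0
      rw [hs i j hij]
      exact TensorProduct.zero_tmul _ _)
    (M.D_mat (x₁ := fun x => x.1.1) (x₂ := fun x => x.1.1) (fun _ _ _ => rfl) (fun _ _ _ => rfl) hd)
  have h1 : M.F (M.correctionX Y₁) = -M.F (M.opData.Ξ * kMat M.U.V Y₁).trace := map_neg _ _
  have h2 : (M.opData.X * kMat M.U.V Y₁).trace = kFun M.Z M.U.V (M.X * Y₁).trace := by
    rw [← kMat_trace, kMat_mul]
    rfl
  rw [h2] at h
  rw [h1, mul_neg, neg_mul, ← neg_add]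
  exact congrArg Neg.neg h

theorem act_correctionX {l : L} (ha : Y₁.map (M.Z.act l) =
      (((M.tor l).2.2.1 : ℂ) ^ 2 * ((M.tor l).2.2.2 : ℂ)⁻¹ ^ 2) •
        (scalarMat M.Z.R (dg (M.tor l).1⁻¹) * Y₁ * scalarMat M.Z.R (dg (M.tor l).1))) :
    M.α l (M.F (M.correctionX Y₁)) = (S.κ l : ℂ)⁻¹ • M.F (M.correctionX Y₁) := by
  have h1 : M.F (M.correctionX Y₁) =
      -∑ i, ∑ j, M.F (M.opData.Ξ i j) * M.F (kFun M.Z M.U.V (Y₁ j i)) :=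
    (map_neg _ _).trans (congrArg Neg.neg (M.opData.F_trace_mul _ _))
  have hY : ∀ i j, M.α l (M.F (kFun M.Z M.U.V (Y₁ i j))) =
      (((M.tor l).2.2.1 : ℂ) ^ 2 * ((M.tor l).2.2.2 : ℂ)⁻¹ ^ 2 *
        (((M.tor l).1 i : ℂ)⁻¹ * (M.tor l).1 j)) • M.F (kFun M.Z M.U.V (Y₁ i j)) :=
    fun i j => M.act_kFun (by
      have h := congrFun (congrFun ha i) j
      rw [Matrix.smul_apply, scalarMat_dg, smul_smul] at h
      refine h.trans (congrArg (· • Y₁ i j) ?_)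
      rw [Pi.inv_apply, Units.val_inv_eq_inv_val])
  have hΞ : ∀ i j, M.α l (M.F (M.opData.Ξ i j)) = _ := (M.isWeight l).Ξ
  rw [h1, map_neg, smul_neg, map_sum, Finset.smul_sum]
  refine congrArg Neg.neg (Finset.sum_congr rfl fun i _ => ?_)
  rw [map_sum, Finset.smul_sum]
  refine Finset.sum_congr rfl fun j _ => ?_
  rw [map_mul, hΞ, hY]
  change (_ • M.F (M.opData.Ξ i j)) * _ = _
  rw [smul_mul_smul_comm]
  congr 1
  have e1 : ((M.tor l).1 i : ℂ) ≠ 0 := Units.ne_zero _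
  have e2 : ((M.tor l).1 j : ℂ) ≠ 0 := Units.ne_zero _
  have e3 : ((M.tor l).2.2.1 : ℂ) ≠ 0 := Units.ne_zero _
  have e4 : ((M.tor l).2.2.2 : ℂ) ≠ 0 := Units.ne_zero _
  rw [M.κ_eq]
  field_simp

/-- A correction term for `Tr (X g Y g⁻¹)` defines a Koszul matrix factorization of this potential.
-/
theorem exists_koszul_correction {a : KAlg M.Z M.U.V} (ha : M.opData.IsCorrection a)
    (hw : ∀ l, M.α l (M.F a) = (S.κ l : ℂ)⁻¹ • M.F a)
    (hW : (M.X * M.g * M.Y * M.k).trace = M.Z.W) :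
    ∃ E : MF M.Z, IsKoszul M.Z (fun x => M.U.lie x) (fun l => M.U.act l) M.s a E := by
  have hc : M.δ * M.F a + M.F a * M.δ = M.F (kFun M.Z M.U.V (M.X * M.g * M.Y * M.k).trace) :=
    ha.comm.trans (congrArg M.F M.F_potential)
  rw [hW] at hc
  exact M.exists_koszul (M.mem_eqIdeal ha) ha.odd hw (M.opData.odd_sq ha.odd) hc

/-- A correction term for `Tr (X g Y g⁻¹)` defines, together with `correctionX`, a Koszul matrix
factorization of the potential `Tr (X g Y g⁻¹) - Tr (X Y₁)`. -/
theorem exists_koszul_correctionX {a : KAlg M.Z M.U.V} (ha : M.opData.IsCorrection a)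
    (hw : ∀ l, M.α l (M.F a) = (S.κ l : ℂ)⁻¹ • M.F a) (hs : ∀ i j, j ≤ i → Y₁ i j = 0)
    (hd : ∀ x, Y₁.map (M.Z.der x) = Y₁ * scalarMat M.Z.R x.1.1 - scalarMat M.Z.R x.1.1 * Y₁)
    (hact : ∀ l, Y₁.map (M.Z.act l) = (((M.tor l).2.2.1 : ℂ) ^ 2 * ((M.tor l).2.2.2 : ℂ)⁻¹ ^ 2) •
      (scalarMat M.Z.R (dg (M.tor l).1⁻¹) * Y₁ * scalarMat M.Z.R (dg (M.tor l).1)))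
    (hW : (M.X * M.g * M.Y * M.k).trace - (M.X * Y₁).trace = M.Z.W) :
    ∃ E : MF M.Z, IsKoszul M.Z (fun x => M.U.lie x) (fun l => M.U.act l) M.s
      (a + M.correctionX Y₁) E := by
  have hc : M.δ * M.F a + M.F a * M.δ = M.F (kFun M.Z M.U.V (M.X * M.g * M.Y * M.k).trace) :=
    ha.comm.trans (congrArg M.F M.F_potential)
  have ho : M.γ (M.F a) = -M.F a := ha.odd
  have hodd : M.γ (M.F (a + M.correctionX Y₁)) = -M.F (a + M.correctionX Y₁) := by
    rw [map_add, map_add, correctionX_odd, ho, neg_add]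
  refine M.exists_koszul (add_mem (M.mem_eqIdeal ha) correctionX_mem) hodd (fun l => ?_)
    (M.opData.odd_sq hodd) ?_
  · rw [map_add, map_add, act_correctionX (hact l), hw, smul_add]
  · rw [map_add, mul_add, add_mul, add_add_add_comm, D_correctionX hs hd, hc, ← hW, kFun_sub,
      map_sub, sub_eq_add_neg]

end UnitModel

/-! ### Restriction along `j` and pull-back along `π` -/

section Pair

variable {n : ℕ}

/-- The restriction along `j` of elements of `ℂ[𝒳₂] ⊗ Λ(𝔥* ⊕ 𝔫 ⊕ 𝔫)`, with the second summand `𝔫`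
set to zero. -/
def restrictNon (n : ℕ) : KAlg (nonModel n).Z (nonModel n).U.V →ₐ[ℂ]
    regular (tildeSet n) ⊗[ℂ] ExteriorAlgebra ℂ (Module.Dual ℂ (nilSq n) × nil n) :=
  Algebra.TensorProduct.map (tildeJ n) (ExteriorAlgebra.map
    (LinearMap.prodMap (LinearMap.id : Module.Dual ℂ (nilSq n) →ₗ[ℂ] Module.Dual ℂ (nilSq n))
      (LinearMap.fst ℂ (nil n) (nil n))))

/-- The pull-back along `π` of elements of `ℂ[𝔟 × G × 𝔫] ⊗ Λ(𝔥* ⊕ 𝔫)`. -/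
def restrictRed (n : ℕ) : KAlg (redModel n).Z (redModel n).U.V →ₐ[ℂ]
    regular (tildeSet n) ⊗[ℂ] ExteriorAlgebra ℂ (Module.Dual ℂ (nilSq n) × nil n) :=
  Algebra.TensorProduct.map (tildePi n) (AlgHom.id ℂ _)

theorem restrictNon_kFun (r : regular (nonSet n)) :
    restrictNon n (kFun (nonModel n).Z (nonModel n).U.V r) = tildeJ n r ⊗ₜ 1 :=
  (Algebra.TensorProduct.map_tmul _ _ _ _).trans
    (congrArg (tildeJ n r ⊗ₜ[ℂ] ·) (map_one (ExteriorAlgebra.map _)))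

theorem restrictNon_kGen (α : Module.Dual ℂ (nilSq n)) (u : nil n × nil n) :
    restrictNon n (kGen (nonModel n).Z α u) = 1 ⊗ₜ ExteriorAlgebra.ι ℂ (α, u.1) := by
  exact (Algebra.TensorProduct.map_tmul _ _ _ _).trans
    (congrArg₂ (· ⊗ₜ[ℂ] ·) (map_one (tildeJ n)) (ExteriorAlgebra.map_apply_ι _ _))

theorem restrictRed_kGen (α : Module.Dual ℂ (nilSq n)) (u : nil n) :
    restrictRed n (kGen (redModel n).Z α u) = 1 ⊗ₜ ExteriorAlgebra.ι ℂ (α, u) := by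
  exact (Algebra.TensorProduct.map_tmul _ _ _ _).trans
    (congrArg (· ⊗ₜ[ℂ] ExteriorAlgebra.ι ℂ (α, u)) (map_one (tildePi n)))

/-- `j` pulls `Ad_{g₁}⁻¹ X` back to `X`. -/
theorem tildeJ_AdX (i j : Fin n) :
    tildeJ n (nonAdX_regular.toMatrix i j) = tildePi n (redX_regular.toMatrix i j) := by
  refine Subtype.ext (funext fun p => ?_)
  have h : (nong1 n p)⁻¹ * nong1 n p = 1 :=
    Matrix.nonsing_inv_mul _ (isUnit_iff_ne_zero.2 p.2.2.1.1)
  change ((nong1 n p)⁻¹ * (nong1 n p * nonX n p * (nong1 n p)⁻¹) * nong1 n p) i j = nonX n p i j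
  have e : (nong1 n p)⁻¹ * (nong1 n p * nonX n p * (nong1 n p)⁻¹) * nong1 n p =
      ((nong1 n p)⁻¹ * nong1 n p) * nonX n p * ((nong1 n p)⁻¹ * nong1 n p) := by noncomm_ring
  rw [e, h, one_mul, mul_one]

/-- The matrices of the two models coincide after restriction along `j` and pull-back along `π`, so
that the correction terms, as universal expressions in their entries, do so as well. -/
theorem restrict_agree (n : ℕ) :
    (nonModel n).opData.Agree (redModel n).opData (restrictNon n) (restrictRed n) where
  g _ _ := restrictNon_kFun _
  k _ _ := restrictNon_kFun _
  X i j := (restrictNon_kFun _).trans (congrArg (· ⊗ₜ[ℂ] 1) (tildeJ_AdX i j))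
  Y _ _ := restrictNon_kFun _
  Θ _ _ := (restrictNon_kGen _ _).trans (restrictRed_kGen _ _).symm
  Ξ _ _ := (restrictNon_kGen _ _).trans (restrictRed_kGen _ _).symm
  η₁ _ _ := (restrictNon_kGen _ _).trans (restrictRed_kGen _ _).symm
  η₂ _ _ := (restrictNon_kGen _ _).trans (restrictRed_kGen _ _).symm

/-- The correction of `Tr (Ad_{g₁}⁻¹ X · Y₁)` contains only generators of the second summand of `U`.
-/
theorem restrictNon_correctionX (Y₁ : Matrix (Fin n) (Fin n) (nonModel n).Z.R) :
    restrictNon n ((nonModel n).correctionX Y₁) = 0 := by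
  have h : ∀ i j, restrictNon n ((nonModel n).opData.Ξ i j) = 0 := fun i j => by
    refine (restrictNon_kGen _ _).trans ?_
    have h0 : ((0, 0) : Module.Dual ℂ (nilSq n) × nil n) = 0 := rfl
    change 1 ⊗ₜ ExteriorAlgebra.ι ℂ ((0, 0) : Module.Dual ℂ (nilSq n) × nil n) = _
    rw [h0, map_zero, TensorProduct.tmul_zero]
  rw [UnitModel.correctionX, map_neg, neg_eq_zero, Matrix.trace, map_sum]
  refine Finset.sum_eq_zero fun i _ => ?_
  rw [Matrix.diag_apply, Matrix.mul_apply, map_sum]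
  exact Finset.sum_eq_zero fun j _ => by rw [map_mul, h, zero_mul]

theorem redModel_W : ((redModel n).X * (redModel n).g * (redModel n).Y * (redModel n).k).trace =
    (redModel n).Z.W := by
  have h : (redW_regular (n := n)).toMatrix = redX_regular.toMatrix * (redg_regular.toMatrix *
      redY_regular.toMatrix * (redg_regular.inv redSet_det).toMatrix) := by
    rw [← RegularMat.toMatrix_mul, ← RegularMat.toMatrix_mul, ← RegularMat.toMatrix_mul]
  have h2 := (redW_regular (n := n)).toMatrix_trace
  rw [h, ← mul_assoc, ← mul_assoc] at h2
  exact h2.symm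

/-- The potential in terms of `Ad_{g₁}⁻¹ X` and `g₁⁻¹ g₂`. -/
theorem trace_nonW (p : nonSet n) :
    (((nong1 n p)⁻¹ * nonX n p * nong1 n p) * ((nong1 n p)⁻¹ * nong2 n p) * nonY2 n p *
      ((nong1 n p)⁻¹ * nong2 n p)⁻¹).trace -
    (((nong1 n p)⁻¹ * nonX n p * nong1 n p) * nonY1 n p).trace = (nonX n p *
    (nong2 n p * nonY2 n p * (nong2 n p)⁻¹ - nong1 n p * nonY1 n p * (nong1 n p)⁻¹)).trace := by
  have hd1 := isUnit_iff_ne_zero.2 (nonSet_det1 p)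
  have hi := inv_sandwich ((nong1 n p)⁻¹) (nong1 n p) (1 : Mat n) 1 (nong2 n p)
    (Matrix.nonsing_inv_mul _ hd1) (one_mul 1) (nonSet_det2 p)
  rw [mul_one, one_mul] at hi
  rw [hi, mul_sub, Matrix.trace_sub]
  have e1 : ((nong1 n p)⁻¹ * nonX n p * nong1 n p) * ((nong1 n p)⁻¹ * nong2 n p) * nonY2 n p *
      ((nong2 n p)⁻¹ * nong1 n p) = (nong1 n p)⁻¹ * (nonX n p * (nong1 n p * (nong1 n p)⁻¹) *
      nong2 n p * nonY2 n p * (nong2 n p)⁻¹ * nong1 n p) := by noncomm_ring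
  have e2 : ((nong1 n p)⁻¹ * nonX n p * nong1 n p) * nonY1 n p =
      (nong1 n p)⁻¹ * (nonX n p * nong1 n p * nonY1 n p) := by noncomm_ring
  rw [e1, e2, Matrix.trace_mul_comm, Matrix.trace_mul_comm (nong1 n p)⁻¹,
    Matrix.mul_nonsing_inv _ hd1, mul_one]
  have e3 : nonX n p * nong2 n p * nonY2 n p * (nong2 n p)⁻¹ * nong1 n p * (nong1 n p)⁻¹ =
      nonX n p * (nong2 n p * nonY2 n p * (nong2 n p)⁻¹) * (nong1 n p * (nong1 n p)⁻¹) := by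
    noncomm_ring
  rw [e3, Matrix.mul_nonsing_inv _ hd1, mul_one]
  congr 2
  noncomm_ring

theorem nonModel_W :
    ((nonModel n).X * (nonModel n).g * (nonModel n).Y * (nonModel n).k).trace -
      ((nonModel n).X * nonY1_regular.toMatrix).trace = (nonModel n).Z.W := by
  have h : ((((nonAdX_regular (n := n)).mul nong12_regular).mul nonY2_regular).mul
      (nong12_regular.inv nonSet_det12)).toMatrix = nonAdX_regular.toMatrix *
      nong12_regular.toMatrix * nonY2_regular.toMatrix *
      (nong12_regular.inv nonSet_det12).toMatrix := by
    rw [← RegularMat.toMatrix_mul, ← RegularMat.toMatrix_mul, ← RegularMat.toMatrix_mul]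
  have h' : ((nonAdX_regular (n := n)).mul nonY1_regular).toMatrix =
      nonAdX_regular.toMatrix * nonY1_regular.toMatrix := by
    rw [← RegularMat.toMatrix_mul]
  have h1 := (congrArg Matrix.trace h).symm.trans (RegularMat.toMatrix_trace _).symm
  have h2 := (congrArg Matrix.trace h').symm.trans (RegularMat.toMatrix_trace _).symm
  exact (congrArg₂ (· - ·) h1 h2).trans (Subtype.ext (funext fun p => trace_nonW p))

theorem exists_isUnitPair (n : ℕ) :
    ∃ (E : MF (redGeom n).toSpace) (E' : MF (nonGeom n).toSpace), IsUnitPair n E E' := by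
  obtain ⟨a', a, ha', ha, hw, hf⟩ :=
    (nonModel n).opData.exists_correction_pair (redModel n).opData
  have hw' : ∀ l : GLTorus n, _ ∧ _ := fun l =>
    hw ((nonModel n).isWeight l) ((redModel n).isWeight l.2) (Units.ne_zero _)
      (pow_ne_zero _ (inv_ne_zero (Units.ne_zero _))) (fun _ => inv_ne_zero (Units.ne_zero _))
      (fun _ => inv_ne_zero (Units.ne_zero _))
  -- the torus element `l` acts on the reduced space as `(1, l)` does on the non-reduced space
  obtain ⟨E, hE⟩ := UnitModel.exists_koszul_correction ha (fun l => (hw' (1, l)).2) redModel_W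
  obtain ⟨E', hE'⟩ := UnitModel.exists_koszul_correctionX ha' (fun l => (hw' l).1) nonY1_strict
    non_der_Y1 non_act_Y1 nonModel_W
  refine ⟨E, E', a, hE, _, hE', ?_⟩
  exact ((map_add (restrictNon n) _ _).trans (congrArg₂ (· + ·) (hf (restrict_agree n))
    (restrictNon_correctionX _))).trans (add_zero _)

end Pair

end EquivMF

end

theorem mainTheorem4 (n : ℕ) [NeZero n] :
    (∃ (E : EquivMF.MF (EquivMF.redGeom n).toSpace) (E' : EquivMF.MF (EquivMF.nonGeom n).toSpace),
      EquivMF.IsUnitPair n E E') ∧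
    ∀ (E : EquivMF.MF (EquivMF.redGeom n).toSpace) (E' : EquivMF.MF (EquivMF.nonGeom n).toSpace),
      EquivMF.IsUnitPair n E E' →
      EquivMF.MF.Isomorphic
        (EquivMF.MF.pullback (EquivMF.nonFgt n) (EquivMF.twistNon E' (EquivMF.chiLast n) 0))
        (EquivMF.MF.pullback (EquivMF.nonFgt n) E') ∧
      EquivMF.MF.Isomorphic
        (EquivMF.MF.pullback (EquivMF.redFgt n) (EquivMF.twistRed E (EquivMF.chiLast n) 0))
        (EquivMF.MF.pullback (EquivMF.redFgt n) E) :=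
  ⟨EquivMF.exists_isUnitPair n,
    fun _ E' h => ⟨EquivMF.isomorphic_twist_non E', EquivMF.isomorphic_twist_red h.choose_spec.1⟩⟩
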